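/- **Definitions.** All metrics are finite valued, and $\mathcal H^2$ is the Hausdorff $2$-measure. A *triangular metric disk* is a metric space $(T,d)$ homeomorphic to a closed disk whose boundary circle $\partial T$ is the union of three non-overlapping geodesic arcs (its *edges*, each isometric to a compact interval of positive length) that pairwise connect three distinct points; $d$ is not assumed to be a length metric. A *polyhedral surface* is a space homeomorphic to a $2$-manifold with boundary that is glued from closed planar polygonal domains, each homeomorphic to a closed disk and with boundary subdivided into finitely many non-overlapping segments, along a locally finite connected graph $\Gamma$ with edges of prescribed positive length: for each polygon $P$ the gluing map $\partial P\to\Gamma$ is injective and maps each segment of $\partial P$ by arc length onto an edge of $\Gamma$, and each point of $\Gamma$ lies in the image of at least one and only finitely many of these maps. It carries the metric $d(x,y)=\inf\sum_{k=1}^n d_{P_k}(x_k,y_k)$, the infimum over finite chains from $x=x_1$ to $y=y_n$ in which $x_k,y_k$ lie in the same polygon $P_k$ and $y_k$ is identified with $x_{k+1}$; here $d_P$ is the length metric on $P$ induced by the Euclidean metric. **Theorem 4.2.** There is an absolute constant $L>0$ such that the following holds. Let $(T,d)$ be a triangular metric disk with edges $\alpha_1,\alpha_2,\alpha_3$. Then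 there exist a polyhedral surface $(S,d_S)$ that is a triangular metric disk, with edges $\beta_1,\beta_2,\beta_3$, and a homeomorphism $\varphi\colon S\to T$ such that 1. $\operatorname{diam}_{d_S}(S)\le L\operatorname{diam}_d(T)$; 2. $\mathcal H^2_{d_S}(S)\le L\,\mathcal H^2_d(T)$ (where $\mathcal H^2_d(T)$ may be infinite); 3. $\varphi|_{\beta_j}$ maps $\beta_j$ isometrically onto $\alpha_j$ for each $j\in\{1,2,3\}$; in particular $\varphi|_{\partial S}$ is length-preserving, that is, $\ell_d(\varphi\circ\gamma)=\ell_{d_S}(\gamma)$ for every path $\gamma$ in $\partial S$; 4. $d_S(x,y)\ge d(\varphi(x),\varphi(y))$ for all $x,y\in\partial S$. -/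

import Mathlib

open MeasureTheory Set
open scoped ENNReal

noncomputable section

/-! ### Lengths, diameters, Hausdorff measure -/

/-- The length of a path `γ : [0,1] → X`: the supremum of `∑ d(γ(tₖ), γ(tₖ₊₁))`. -/
def pathLength {X : Type*} [PseudoEMetricSpace X] (γ : C(unitInterval, X)) : ℝ≥0∞ :=
  eVariationOn γ Set.univ

/-- The length (extended) distance of a metric space: the infimum of the lengths of the paths
from `x` to `y`. -/
def lengthDist {X : Type*} [PseudoEMetricSpace X] (x y : X) : ℝ≥0∞ :=
  ⨅ γ : Path x y, pathLength γ.toContinuousMap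

/-- The total Hausdorff 2-measure `H²(X)` of a metric space, normalized by the factor
`C(2) = π / 4` so that it agrees with Lebesgue measure in the Euclidean plane
(Mathlib's `μH[2]` is built from `∑ diam ^ 2`, without this factor). -/
def hausdorffTwo (X : Type*) [MetricSpace X] : ℝ≥0∞ :=
  letI : MeasurableSpace X := borel X
  haveI : BorelSpace X := ⟨rfl⟩
  ENNReal.ofReal (Real.pi / 4) * Measure.hausdorffMeasure 2 (Set.univ : Set X)

/-! ### Triangular metric disks -/

/-- `X` is homeomorphic to the closed unit disk and `B` is its boundary circle. -/
def IsDiskWithBoundary (X : Type*) [TopologicalSpace X] (B : Set X) : Prop :=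
  ∃ h : X ≃ₜ Metric.closedBall (0 : ℂ) 1, B = {x | ‖(h x : ℂ)‖ = 1}

/-- `A` is (the trace of) a geodesic from `p` to `q`, parametrized by arc length. -/
def IsGeodesicArc {X : Type*} [MetricSpace X] (A : Set X) (p q : X) : Prop :=
  ∃ γ : ℝ → X, γ 0 = p ∧ γ (dist p q) = q ∧
    (∀ s ∈ Icc 0 (dist p q), ∀ t ∈ Icc 0 (dist p q), dist (γ s) (γ t) = |s - t|) ∧
    A = γ '' Icc 0 (dist p q)

/-- `X` is a triangular metric disk with edges `α 0, α 1, α 2`: it is homeomorphic to the closed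
disk, and its boundary is the union of the three geodesic arcs `α j`, which are non-overlapping and
join pairwise three distinct points `p 0, p 1, p 2`; `α j` has the endpoints `p j`, `p (j + 1)`,
indices modulo 3. The metric of `X` need not be a length metric. -/
def IsTriangularDisk (X : Type*) [MetricSpace X] (α : Fin 3 → Set X) : Prop :=
  IsDiskWithBoundary X (⋃ j, α j) ∧
  ∃ p : Fin 3 → X, Function.Injective p ∧
    (∀ j, IsGeodesicArc (α j) (p j) (p (j + 1))) ∧
    Pairwise fun j k => Disjoint (α j \ {p j, p (j + 1)}) (α k \ {p k, p (k + 1)})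

/-! ### Polyhedral spaces -/

/-- A locally finite connected graph, with a length assigned to each edge. Loops and multiple
edges are allowed; the orientation of the edges only serves to parametrize them. -/
structure LengthGraph where
  V : Type
  E : Type
  source : E → V
  target : E → V
  len : E → ℝ
  len_pos : ∀ e, 0 < len e
  locallyFinite : ∀ v, {e | source e = v ∨ target e = v}.Finite
  connected : ∀ u v, Relation.EqvGen (fun a b => ∃ e, source e = a ∧ target e = b) u v

namespace LengthGraph

/-- The points of the 1-dimensional polyhedral space of `Γ`: the vertices and, for each edge `e`,
an open interval of length `len e`. -/
def Point (Γ : LengthGraph) : Type := Γ.V ⊕ (Σ e : Γ.E, Ioo (0 : ℝ) (Γ.len e))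

open Classical in
/-- The arc length parametrization `[0, len e] → Γ` of the closed edge `e`. -/
def edgePoint (Γ : LengthGraph) (e : Γ.E) (t : ℝ) : Γ.Point :=
  if h : t ∈ Ioo (0 : ℝ) (Γ.len e) then Sum.inr ⟨e, t, h⟩
  else if t ≤ 0 then Sum.inl (Γ.source e) else Sum.inl (Γ.target e)

end LengthGraph

/-- A planar polygonal domain homeomorphic to a closed disk, whose boundary is subdivided into
finitely many non-overlapping line segments (consecutive ones may be collinear). -/
structure PolygonalDomain where
  carrier : Set ℂ
  n : ℕ
  poly : Polygon ℂ n
  homeo_disk : Nonempty (carrier ≃ₜ Metric.closedBall (0 : ℂ) 1)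
  vertices_injective : Function.Injective poly.vertices
  frontier_eq : frontier carrier = poly.boundary ℝ
  nonoverlapping : Pairwise fun k l : Fin n =>
    Disjoint (poly.edgePath ℝ k '' Ioo 0 1) (poly.edgePath ℝ l '' Ioo 0 1)

/-- The data from which a 2-dimensional polyhedral space is glued: a graph `Γ`, polygonal
domains `P i`, and injective maps `ψ i : ∂(P i) → Γ` which map each side of `P i` by arc length
onto an edge of `Γ` (in either direction), such that each point of `Γ` lies in the image
of at least one and at most finitely many of the maps `ψ i`. -/
structure PolyhedralData where
  Γ : LengthGraph
  ι : Type
  P : ι → PolygonalDomain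
  ψ : ∀ i, frontier (P i).carrier → Γ.Point
  ψ_injective : ∀ i, Function.Injective (ψ i)
  ψ_side : ∀ i k, ∃ e : Γ.E,
    Γ.len e = dist ((P i).poly k) ((P i).poly (finRotate _ k)) ∧
    ((∀ x : frontier (P i).carrier, (x : ℂ) ∈ (P i).poly.edgeSet ℝ k →
        ψ i x = Γ.edgePoint e (dist ((P i).poly k) (x : ℂ))) ∨
      (∀ x : frontier (P i).carrier, (x : ℂ) ∈ (P i).poly.edgeSet ℝ k →
        ψ i x = Γ.edgePoint e (dist ((P i).poly (finRotate _ k)) (x : ℂ))))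
  ψ_cover : ∀ a : Γ.Point, {i | a ∈ range (ψ i)}.Nonempty ∧ {i | a ∈ range (ψ i)}.Finite

namespace PolyhedralData

variable (D : PolyhedralData)

/-- The disjoint union of all polygonal domains and the graph. -/
def PreSpace : Type := (Σ i, (D.P i).carrier) ⊕ D.Γ.Point

/-- Each boundary point `x` of a polygonal domain `P i` is to be identified with `ψ i x`. -/
def GlueRel (a b : D.PreSpace) : Prop :=
  ∃ (i : D.ι) (x : ℂ) (hc : x ∈ (D.P i).carrier) (hf : x ∈ frontier (D.P i).carrier),
    a = Sum.inl ⟨i, x, hc⟩ ∧ b = Sum.inr (D.ψ i ⟨x, hf⟩)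

/-- The glued set: the quotient by the equivalence relation generated by `GlueRel`. -/
def Space : Type := Quot D.GlueRel

/-- The point of the glued set given by a point of the polygonal domain `P i`. -/
def proj (i : D.ι) (x : (D.P i).carrier) : D.Space := Quot.mk _ (Sum.inl ⟨i, x⟩)

/-- The polyhedral (extended) distance: the infimum of `∑ₖ d_{Pₖ}(xₖ, yₖ)` over all finite chains
`x₀, y₀, …, xₙ, yₙ` from `a` to `b`, where `xₖ, yₖ` lie in the same polygonal domain `Pₖ`, where
`yₖ` is identified with `xₖ₊₁`, and where `d_{P}` is the length metric of `P`
induced by the Euclidean metric. -/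
def chainDist (a b : D.Space) : ℝ≥0∞ :=
  ⨅ (n : ℕ) (i : Fin (n + 1) → D.ι) (x : ∀ k, (D.P (i k)).carrier)
    (y : ∀ k, (D.P (i k)).carrier)
    (_ : D.proj (i 0) (x 0) = a) (_ : D.proj (i (Fin.last n)) (y (Fin.last n)) = b)
    (_ : ∀ k : Fin n, D.proj (i k.castSucc) (y k.castSucc) = D.proj (i k.succ) (x k.succ)),
    ∑ k, lengthDist (x k) (y k)

end PolyhedralData

/-- `S` is (isometric to) a 2-dimensional polyhedral space with its polyhedral metric. -/
def IsPolyhedralSpace (S : Type) [MetricSpace S] : Prop :=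
  ∃ (D : PolyhedralData) (Φ : S ≃ D.Space), ∀ x y, edist x y = D.chainDist (Φ x) (Φ y)

/-- A polyhedral surface: a 2-dimensional polyhedral space homeomorphic to a topological
2-manifold with boundary (Hausdorffness is automatic in a metric space). -/
def IsPolyhedralSurface (S : Type) [MetricSpace S] : Prop :=
  IsPolyhedralSpace S ∧ SecondCountableTopology S ∧
    Nonempty (ChartedSpace (EuclideanHalfSpace 2) S)

end

open MeasureTheory Set
open scoped ENNReal

noncomputable section

/-! ### Length distance -/

section LengthDist

variable {X : Type*} [PseudoEMetricSpace X]

/-! The surface is assembled from Euclidean triangles in such a way that its boundary copies `∂T`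
exactly, boundary distances can only grow, and the area of the triangles is paid for by area that
`T` is forced to have near its corners.

Combinatorics. Fix a small step `κ`. From corner `i`, walk along both adjacent edges in `N i` steps
of length `κ`, staying within the Gromov product `gromov l i` unless a single step is taken. The
Gromov products at the two ends of an edge add up to its length, so `N` can be chosen to leave only
a gap of at most `4 * κ` on each edge. Points at equal distance from a corner are joined by a ladder
of triangles, the hexagon left in the middle is coned from an apex, and a collar of two rings of
triangles leads from this core to an outer copy of the mesh. The complex has a shelling, so it is a
disk (`Shelling.isDiskIn`).

Domination. Outer edges are as long as the boundary pieces they copy; edges between inner points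
have length `100 * κ` plus three times the distance they represent. For `q` in `T` the function
`dist q` on the boundary extends to `distFun q` on the surface, affinely on the core and with a
correction inside the collar. Since the inner edges are so long, the extension is `1`-Lipschitz on
each triangle, hence for the chain distance (`Mesh.abs_distFun_sub_le`). Taking `q` on the boundary
gives the inequality between the two metrics (`Mesh.dist_bd_le`). A side of the surface has length
`l j` along the boundary, so domination also forces it to be a geodesic.

Area. Let `w t` be the distance of the two mesh points `t` steps from a corner (`width`). The ladder
costs about `κ * ∑ (κ + w t)`, the collar about `κ ^ 2` per mesh point, and the cone about the
square of `κ` plus the three last widths; as `w` changes by at most `2 * κ` per step, these squares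
are controlled by the same sums (`sq_width_le`). Conversely, the map whose coordinates are the
distance to a corner and the distance to an adjacent edge has `1`-Lipschitz coordinates, and a
winding number argument shows that its image contains rectangles of width `κ` and height `w t / 2 -
κ` (`TriangleParam.sum_corner_le`). The Gromov product keeps the opposite edge from interfering. The
remaining errors are of order `κ` times the perimeter. They are absorbed by taking `κ` small,
because the measure of `T` is positive (`hausdorffTwo_pos`); if it is infinite, the area bound is
void.

Homeomorphism. Which boundary points coincide depends only on the side lengths
(`TriangleParam.eq_iff`), so the two boundary circles correspond, and the correspondence extends
radially to the disks. -/

theorem edist_le_lengthDist (x y : X) : edist x y ≤ lengthDist x y := by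
  refine le_iInf fun γ => ?_
  have := eVariationOn.edist_le (f := γ.toContinuousMap) (s := univ) (mem_univ 0) (mem_univ 1)
  simpa [pathLength] using this

theorem lengthDist_comm (x y : X) : lengthDist x y = lengthDist y x := by
  have key : ∀ x y : X, lengthDist x y ≤ lengthDist y x := by
    intro x y
    refine le_iInf fun γ => (iInf_le _ γ.symm).trans (le_of_eq ?_)
    change eVariationOn (γ ∘ unitInterval.symm) univ = eVariationOn γ univ
    rw [eVariationOn.comp_eq_of_antitoneOn _ _ (unitInterval.strictAnti_symm.antitone.antitoneOn _)]
    congr 1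
    exact image_univ_of_surjective unitInterval.symm_bijective.surjective
  exact le_antisymm (key x y) (key y x)

end LengthDist

theorem eVariationOn_le_of_lipschitz_unitInterval {X : Type*} [PseudoEMetricSpace X]
    {γ : unitInterval → X} {C : ℝ} (hC : 0 ≤ C)
    (h : ∀ s t, edist (γ s) (γ t) ≤ ENNReal.ofReal (C * |(s : ℝ) - t|)) :
    eVariationOn γ univ ≤ ENNReal.ofReal C := by
  refine iSup_le fun p => ?_
  obtain ⟨n, u, hu, -⟩ := p
  calc ∑ i ∈ Finset.range n, edist (γ (u (i + 1))) (γ (u i))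
      ≤ ∑ i ∈ Finset.range n, ENNReal.ofReal (C * ((u (i + 1) : ℝ) - u i)) := by
        refine Finset.sum_le_sum fun i _ => (h _ _).trans (le_of_eq ?_)
        rw [abs_of_nonneg]
        have : u i ≤ u (i + 1) := hu (Nat.le_succ i)
        simpa using this
    _ = ENNReal.ofReal (∑ i ∈ Finset.range n, C * ((u (i + 1) : ℝ) - u i)) := by
        rw [ENNReal.ofReal_sum_of_nonneg]
        intro i _
        have : u i ≤ u (i + 1) := hu (Nat.le_succ i)
        exact mul_nonneg hC (by simpa using this)
    _ ≤ ENNReal.ofReal C := by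
        apply ENNReal.ofReal_le_ofReal
        rw [← Finset.mul_sum, Finset.sum_range_sub (fun i => (u i : ℝ))]
        have h1 := (u n).2.2
        have h2 := (u 0).2.1
        nlinarith

/-- The straight segment stays in `K` and its length is the distance of its ends. Hence the
intrinsic metric of a triangular cell is the Euclidean one. -/
theorem lengthDist_eq_edist_of_convex {E : Type*} [NormedAddCommGroup E] [NormedSpace ℝ E]
    {K : Set E} (hK : Convex ℝ K) (x y : K) : lengthDist x y = edist x y := by
  refine le_antisymm ?_ (edist_le_lengthDist x y)
  have hmem : ∀ t : unitInterval, AffineMap.lineMap (x : E) (y : E) (t : ℝ) ∈ K := fun t =>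
    hK.lineMap_mem x.2 y.2 t.2
  let γ : Path x y :=
    { toFun := fun t => ⟨AffineMap.lineMap (x : E) (y : E) (t : ℝ), hmem t⟩
      continuous_toFun := by
        refine Continuous.subtype_mk ?_ _
        exact AffineMap.lineMap_continuous.comp continuous_subtype_val
      source' := by simp
      target' := by simp }
  refine (iInf_le _ γ).trans ?_
  rw [edist_dist]
  refine eVariationOn_le_of_lipschitz_unitInterval dist_nonneg fun s t => ?_
  rw [edist_dist]
  apply ENNReal.ofReal_le_ofReal
  change dist (AffineMap.lineMap (x : E) (y : E) (s : ℝ)) (AffineMap.lineMap (x : E) (y : E) (t : ℝ))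
    ≤ _
  rw [dist_lineMap_lineMap, Real.dist_eq, mul_comm]
  rfl

/-! ### The chain distance -/

namespace PolyhedralData

variable (D : PolyhedralData)

/-- The gluing maps cover the graph, so the quotient has no points outside the cells. A polygon is
compact, hence closed, which puts its frontier inside its carrier. -/
theorem exists_proj (a : D.Space) : ∃ i x, D.proj i x = a := by
  induction a using Quot.ind with
  | mk a =>
    rcases a with ⟨i, x⟩ | a
    · exact ⟨i, x, rfl⟩
    · obtain ⟨i, ⟨x, hx⟩, hxa⟩ := (D.ψ_cover a).1
      obtain ⟨e⟩ := (D.P i).homeo_disk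
      have hc : IsClosed (D.P i).carrier := by
        have : CompactSpace (D.P i).carrier := by
          have : CompactSpace (Metric.closedBall (0 : ℂ) 1) :=
            isCompact_iff_compactSpace.1 (isCompact_closedBall _ _)
          exact e.symm.compactSpace
        exact (isCompact_iff_compactSpace.2 this).isClosed
      refine ⟨i, ⟨x, hc.frontier_subset hx⟩, ?_⟩
      rw [← hxa]
      exact Quot.sound ⟨i, x, hc.frontier_subset hx, hx, rfl, rfl⟩

variable {D}

/-- Maximality of the chain distance: an increment bound inside single cells adds up along the links
of a chain. The lower bounds for `chainDist` and its triangle inequality rest on this. -/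
theorem le_chainDist_add (F : D.Space → ℝ≥0∞)
    (hF : ∀ i (x y : (D.P i).carrier), F (D.proj i x) ≤ lengthDist x y + F (D.proj i y))
    (a b : D.Space) : F a ≤ D.chainDist a b + F b := by
  have key : ∀ (n : ℕ) (i : Fin (n + 1) → D.ι) (x y : ∀ k, (D.P (i k)).carrier),
      (∀ k : Fin n, D.proj (i k.castSucc) (y k.castSucc) = D.proj (i k.succ) (x k.succ)) →
      F (D.proj (i 0) (x 0)) ≤
        ∑ k, lengthDist (x k) (y k) + F (D.proj (i (Fin.last n)) (y (Fin.last n))) := by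
    intro n
    induction n with
    | zero => intro i x y _; simpa using hF (i 0) (x 0) (y 0)
    | succ n ih =>
      intro i x y h
      have h1 := ih (fun k => i k.succ) (fun k => x k.succ) (fun k => y k.succ)
        (fun k => h k.succ)
      have h0 := h 0
      calc F (D.proj (i 0) (x 0)) ≤ lengthDist (x 0) (y 0) + F (D.proj (i 0) (y 0)) := hF _ _ _
        _ = lengthDist (x 0) (y 0) + F (D.proj (i (Fin.succ 0)) (x (Fin.succ 0))) :=
          congrArg _ (congrArg F h0)
        _ ≤ lengthDist (x 0) (y 0) + (∑ k : Fin (n + 1), lengthDist (x k.succ) (y k.succ) +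
              F (D.proj (i (Fin.last n).succ) (y (Fin.last n).succ))) := by gcongr
        _ = _ := by
          rw [← add_assoc, Fin.sum_univ_succ (fun k => lengthDist (x k) (y k))]
          rfl
  simp only [chainDist, ENNReal.iInf_add]
  refine le_iInf fun n => le_iInf fun i => le_iInf fun x => le_iInf fun y => ?_
  refine le_iInf fun ha => le_iInf fun hb => le_iInf fun h => ?_
  have := key n i x y h
  rwa [ha, hb] at this

/-- The link from `x` to `y` is put in front of any chain that starts at `D.proj i y`. -/
theorem chainDist_le_add (i : D.ι) (x y : (D.P i).carrier) (b : D.Space) :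
    D.chainDist (D.proj i x) b ≤ lengthDist x y + D.chainDist (D.proj i y) b := by
  conv_rhs => simp only [chainDist, ENNReal.add_iInf]
  refine le_iInf fun n => le_iInf fun j => le_iInf fun u => le_iInf fun v => ?_
  refine le_iInf fun ha => le_iInf fun hb => le_iInf fun h => ?_
  let j' : Fin (n + 2) → D.ι := Fin.cons i j
  let u' : ∀ k, (D.P (j' k)).carrier := Fin.cons (α := fun k => (D.P (j' k)).carrier) x u
  let v' : ∀ k, (D.P (j' k)).carrier := Fin.cons (α := fun k => (D.P (j' k)).carrier) y v
  refine (iInf_le _ (n + 1)).trans <| (iInf_le _ j').trans <| (iInf_le _ u').trans <|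
    (iInf_le _ v').trans <| (iInf_le _ rfl).trans <| (iInf_le _ ?_).trans <|
    (iInf_le _ ?_).trans ?_
  · exact hb
  · intro k
    refine Fin.cases ?_ (fun k => ?_) k
    · exact ha.symm
    · exact h k
  · rw [Fin.sum_univ_succ]
    exact le_rfl

theorem chainDist_proj_le (i : D.ι) (x y : (D.P i).carrier) :
    D.chainDist (D.proj i x) (D.proj i y) ≤ lengthDist x y := by
  refine (iInf_le _ 0).trans <| (iInf_le _ fun _ => i).trans <| (iInf_le _ fun _ => x).trans <|
    (iInf_le _ fun _ => y).trans <| (iInf_le _ rfl).trans <| (iInf_le _ rfl).trans <|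
    (iInf_le _ fun k => k.elim0).trans ?_
  simp

theorem lengthDist_self {X : Type*} [PseudoEMetricSpace X] (x : X) : lengthDist x x = 0 := by
  refine le_antisymm ((iInf_le _ (Path.refl x)).trans ?_) bot_le
  refine (eVariationOn.constant_on ?_).le
  rintro _ ⟨_, _, rfl⟩ _ ⟨_, _, rfl⟩
  rfl

theorem chainDist_self (a : D.Space) : D.chainDist a a = 0 := by
  obtain ⟨i, x, rfl⟩ := D.exists_proj a
  exact le_antisymm ((chainDist_proj_le i x x).trans (lengthDist_self x).le) bot_le

/-- The distance to `c` is itself an admissible function in `le_chainDist_add`. -/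
theorem chainDist_triangle (a b c : D.Space) :
    D.chainDist a c ≤ D.chainDist a b + D.chainDist b c :=
  le_chainDist_add (fun x => D.chainDist x c) (fun i x y => chainDist_le_add i x y c) a b

theorem chainDist_comm (a b : D.Space) : D.chainDist a b = D.chainDist b a := by
  have key : ∀ a b : D.Space, D.chainDist b a ≤ D.chainDist a b := by
    intro a b
    have h := le_chainDist_add (D := D) (fun x => D.chainDist b x) (fun i x y => ?_) a b
    · simpa [chainDist_self] using h
    · refine (chainDist_triangle _ (D.proj i y) _).trans ?_
      rw [add_comm]
      gcongr
      exact (chainDist_proj_le i y x).trans (lengthDist_comm _ _).le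
  exact le_antisymm (key b a) (key a b)

/-- A real function on a polyhedral space that is `C`-Lipschitz on every polygonal domain is
`C`-Lipschitz with respect to the chain distance. -/
theorem ofReal_abs_sub_le_chainDist {F : D.Space → ℝ} {C : ℝ} (hC : 0 ≤ C)
    (hF : ∀ i (x y : (D.P i).carrier), |F (D.proj i x) - F (D.proj i y)| ≤ C * dist x y)
    (a b : D.Space) : ENNReal.ofReal |F a - F b| ≤ ENNReal.ofReal (C + 1) * D.chainDist a b := by
  -- The constant `C + 1` can be divided by even when `C = 0`; this is harmless, as only some
  -- Lipschitz constant is needed.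
  have hC1 : 0 < C + 1 := by linarith
  have := le_chainDist_add (D := D) (fun x => ENNReal.ofReal ((C + 1)⁻¹ * |F x - F b|))
    (fun i x y => ?_) a b
  · simp only [sub_self, abs_zero, mul_zero, ENNReal.ofReal_zero, add_zero] at this
    calc ENNReal.ofReal |F a - F b|
        = ENNReal.ofReal (C + 1) * ENNReal.ofReal ((C + 1)⁻¹ * |F a - F b|) := by
          rw [← ENNReal.ofReal_mul hC1.le, mul_inv_cancel_left₀ hC1.ne']
      _ ≤ _ := by gcongr
  · refine le_trans ?_ (add_le_add_left (edist_le_lengthDist x y) _)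
    rw [edist_dist, ← ENNReal.ofReal_add dist_nonneg (by positivity)]
    apply ENNReal.ofReal_le_ofReal
    have h1 := hF i x y
    have h2 : |F (D.proj i x) - F b| ≤ |F (D.proj i x) - F (D.proj i y)| + |F (D.proj i y) - F b| :=
      abs_sub_le _ _ _
    have h3 : (0 : ℝ) ≤ dist x y := dist_nonneg
    have h4 : (C + 1)⁻¹ * |F (D.proj i x) - F b| ≤
        (C + 1)⁻¹ * ((C + 1) * dist x y + |F (D.proj i y) - F b|) := by
      gcongr
      linarith
    rwa [mul_add, inv_mul_cancel_left₀ hC1.ne'] at h4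

/-- A real function on a polyhedral space that is `1`-Lipschitz on every polygonal domain is
`1`-Lipschitz with respect to the chain distance. -/
theorem ofReal_abs_sub_le_chainDist_of_one {F : D.Space → ℝ}
    (hF : ∀ i (x y : (D.P i).carrier), |F (D.proj i x) - F (D.proj i y)| ≤ dist x y)
    (a b : D.Space) : ENNReal.ofReal |F a - F b| ≤ D.chainDist a b := by
  have := le_chainDist_add (D := D) (fun x => ENNReal.ofReal |F x - F b|)
    (fun i x y => ?_) a b
  · simpa using this
  · refine le_trans ?_ (add_le_add_left (edist_le_lengthDist x y) _)
    rw [edist_dist, ← ENNReal.ofReal_add dist_nonneg (abs_nonneg _)]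
    apply ENNReal.ofReal_le_ofReal
    have h1 := hF i x y
    have h2 : |F (D.proj i x) - F b| ≤ |F (D.proj i x) - F (D.proj i y)| + |F (D.proj i y) - F b| :=
      abs_sub_le _ _ _
    linarith

end PolyhedralData

/-! ### Euclidean triangles as polygonal domains -/

theorem AffineBasis.eq_sum_coord (b : AffineBasis (Fin 3) ℝ ℂ) (x : ℂ) :
    x = b.coord 0 x • b 0 + b.coord 1 x • b 1 + b.coord 2 x • b 2 := by
  have h := b.linear_combination_coord_eq_self x
  rw [Fin.sum_univ_three] at h
  exact h.symm

theorem AffineBasis.sum_coord_three (b : AffineBasis (Fin 3) ℝ ℂ) (x : ℂ) :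
    b.coord 0 x + b.coord 1 x + b.coord 2 x = 1 := by
  have := b.sum_coord_apply_eq_one x
  rwa [Fin.sum_univ_three] at this

theorem AffineBasis.isCompact_convexHull (b : AffineBasis (Fin 3) ℝ ℂ) :
    IsCompact (convexHull ℝ (range b)) :=
  (finite_range b).isCompact_convexHull ℝ

theorem AffineBasis.frontier_convexHull (b : AffineBasis (Fin 3) ℝ ℂ) :
    frontier (convexHull ℝ (range b)) = {x | (∀ i, 0 ≤ b.coord i x) ∧ ∃ i, b.coord i x = 0} := by
  rw [b.isCompact_convexHull.isClosed.frontier_eq, b.interior_convexHull,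
    b.convexHull_eq_nonneg_coord]
  ext x
  simp only [mem_sdiff, mem_ofPred_eq, not_forall, not_lt]
  refine and_congr_right fun h => exists_congr fun i => ⟨fun h' => le_antisymm h' (h i), fun h' => h'.le⟩

/-- A side is the locus where the barycentric coordinate of the opposite vertex vanishes; two
rotations of `k` give the index of that vertex. -/
theorem mem_affineSegment_of_coord (b : AffineBasis (Fin 3) ℝ ℂ) (k : Fin 3) (x : ℂ) :
    x ∈ affineSegment ℝ (b k) (b (finRotate 3 k)) ↔
      (∀ i, 0 ≤ b.coord i x) ∧ b.coord (finRotate 3 (finRotate 3 k)) x = 0 := by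
  constructor
  · rintro ⟨t, ⟨h0, h1⟩, rfl⟩
    have hc : ∀ i, b.coord i (AffineMap.lineMap (b k) (b (finRotate 3 k)) t) =
        (1 - t) * b.coord i (b k) + t * b.coord i (b (finRotate 3 k)) := by
      intro i
      rw [AffineMap.apply_lineMap, AffineMap.lineMap_apply_ring]
    refine ⟨fun i => ?_, ?_⟩
    · rw [hc]
      have : ∀ j, 0 ≤ b.coord i (b j) := by
        intro j
        rw [b.coord_apply]
        split_ifs <;> norm_num
      have h2 := this k
      have h3 := this (finRotate 3 k)
      have : 0 ≤ 1 - t := by linarith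
      positivity
    · rw [hc, b.coord_apply_ne, b.coord_apply_ne]
      · ring
      · exact (by decide : ∀ k, finRotate 3 (finRotate 3 k) ≠ finRotate 3 k) k
      · exact (by decide : ∀ k, finRotate 3 (finRotate 3 k) ≠ k) k
  · rintro ⟨h, h0⟩
    refine ⟨b.coord (finRotate 3 k) x, ⟨h _, ?_⟩, ?_⟩
    · rw [← b.sum_coord_three x]
      have h0 := h 0
      have h1 := h 1
      have h2 := h 2
      fin_cases k <;> simp <;> linarith
    · have hs := b.sum_coord_three x
      have hx := b.eq_sum_coord x
      rw [AffineMap.lineMap_apply_module]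
      conv_rhs => rw [hx]
      fin_cases k <;> simp at h0 ⊢ <;> rw [h0] at hs ⊢
      · rw [show b.coord 0 x = 1 - b.coord 1 x by linarith]; simp
      · rw [show b.coord 1 x = 1 - b.coord 2 x by linarith]; simp
      · rw [show b.coord 2 x = 1 - b.coord 0 x by linarith]; simp; ring

/-- On an open side exactly one barycentric coordinate vanishes, that of the opposite vertex, so a
point determines its side. -/
theorem polygon_three_side_disjoint (b : AffineBasis (Fin 3) ℝ ℂ) {k l : Fin 3} (hkl : k ≠ l) :
    Disjoint ((⟨b⟩ : Polygon ℂ 3).edgePath ℝ k '' Ioo 0 1)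
      ((⟨b⟩ : Polygon ℂ 3).edgePath ℝ l '' Ioo 0 1) := by
  have key : ∀ k i : Fin 3, ∀ x ∈ (⟨b⟩ : Polygon ℂ 3).edgePath ℝ k '' Ioo 0 1,
      b.coord i x = 0 → i = finRotate 3 (finRotate 3 k) := by
    rintro k i _ ⟨t, ⟨h0, h1⟩, rfl⟩ h
    rw [Polygon.edgePath, AffineMap.apply_lineMap, AffineMap.lineMap_apply_ring] at h
    change (1 - t) * b.coord i (b k) + t * b.coord i (b (finRotate 3 k)) = 0 at h
    by_contra hne
    have : i = k ∨ i = finRotate 3 k :=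
      (by decide : ∀ k i, i ≠ finRotate 3 (finRotate 3 k) → i = k ∨ i = finRotate 3 k) k i hne
    have hk : k ≠ finRotate 3 k := (by decide : ∀ k, k ≠ finRotate 3 k) k
    rcases this with rfl | rfl
    · rw [b.coord_apply_eq, b.coord_apply_ne hk] at h; linarith
    · rw [b.coord_apply_eq, b.coord_apply_ne hk.symm] at h; linarith
  rw [Set.disjoint_left]
  intro x hx hx'
  have h1 : x ∈ affineSegment ℝ (b k) (b (finRotate 3 k)) :=
    image_mono Ioo_subset_Icc_self hx
  have := key l _ x hx' ((mem_affineSegment_of_coord b k x).1 h1).2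
  exact hkl ((finRotate 3).injective ((finRotate 3).injective this))

/-- A nondegenerate Euclidean triangle as a polygonal domain. -/
def trianglePolygonalDomain (b : AffineBasis (Fin 3) ℝ ℂ) : PolygonalDomain where
  carrier := convexHull ℝ (range b)
  n := 3
  poly := ⟨b⟩
  homeo_disk := by
    obtain ⟨h, -, hc, -⟩ := exists_homeomorph_image_interior_closure_frontier_eq_unitBall
      (convex_convexHull ℝ (range b)) ⟨_, b.centroid_mem_interior_convexHull⟩
      b.isCompact_convexHull.isBounded
    rw [b.isCompact_convexHull.isClosed.closure_eq] at hc
    exact ⟨(h.image _).trans (Homeomorph.setCongr hc)⟩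
  vertices_injective := b.ind.injective
  frontier_eq := by
    rw [b.frontier_convexHull]
    ext x
    simp only [Polygon.boundary, mem_iUnion, Polygon.edgeSet, mem_affineSegment_of_coord,
      mem_ofPred_eq, exists_and_left]
    refine and_congr_right fun _ => ⟨fun ⟨i, hi⟩ => ⟨finRotate 3 i, ?_⟩, fun ⟨i, hi⟩ => ⟨_, hi⟩⟩
    rwa [(by decide : ∀ i, finRotate 3 (finRotate 3 (finRotate 3 i)) = i) i]
  nonoverlapping := fun _ _ hkl => polygon_three_side_disjoint b hkl

/-- Euclidean triangles with prescribed side lengths exist. -/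
theorem exists_affineBasis_dist_eq (d : Fin 3 → Fin 3 → ℝ) (hsymm : ∀ i j, d i j = d j i)
    (hself : ∀ i, d i i = 0)
    (htri : ∀ i j k, i ≠ j → j ≠ k → i ≠ k → d i j < d i k + d k j) :
    ∃ b : AffineBasis (Fin 3) ℝ ℂ, ∀ i j, dist (b i) (b j) = d i j := by
  have t1 := htri 0 1 2 (by decide) (by decide) (by decide)
  have t2 := htri 0 2 1 (by decide) (by decide) (by decide)
  have t3 := htri 1 2 0 (by decide) (by decide) (by decide)
  have s1 := hsymm 1 0
  have s2 := hsymm 2 0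
  have s3 := hsymm 2 1
  set p := d 0 1 with hp
  set q := d 0 2 with hq
  set r := d 1 2 with hr
  rw [s3] at t1
  rw [s1] at t3
  have hp0 : 0 < p := by linarith
  -- Two vertices are placed at `0` and `p` on the real axis. The law of cosines gives the abscissa
  -- of the third; its squared height is nonnegative by Heron's factorization and the triangle
  -- inequalities.
  set x := (p ^ 2 + q ^ 2 - r ^ 2) / (2 * p) with hx
  have hx' : 2 * p * x = p ^ 2 + q ^ 2 - r ^ 2 := by rw [hx]; field_simp
  have hy : 0 ≤ q ^ 2 - x ^ 2 := by
    have h1 : 0 ≤ (2 * p) ^ 2 * (q ^ 2 - x ^ 2) := by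
      have : (2 * p) ^ 2 * (q ^ 2 - x ^ 2) = ((p + q) ^ 2 - r ^ 2) * (r ^ 2 - (p - q) ^ 2) := by
        rw [mul_sub, ← mul_pow (2 * p) x, hx']; ring
      rw [this]
      apply mul_nonneg <;> nlinarith
    exact nonneg_of_mul_nonneg_right h1 (by positivity)
  let v : Fin 3 → ℂ := ![0, p, ⟨x, √(q ^ 2 - x ^ 2)⟩]
  have hsq := Real.sq_sqrt hy
  have d01 : dist (v 0) (v 1) = p := by
    simp [v, Complex.dist_eq, abs_of_pos hp0]
  have d02 : dist (v 0) (v 2) = q := by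
    have hq0 : 0 < q := by linarith
    simp only [v, Complex.dist_eq, Complex.norm_def, Complex.normSq_apply]
    rw [Real.sqrt_eq_iff_mul_self_eq (add_nonneg (mul_self_nonneg _) (mul_self_nonneg _)) hq0.le]
    simp
    linarith
  have d12 : dist (v 1) (v 2) = r := by
    have hr0 : 0 < r := by linarith
    simp only [v, Complex.dist_eq, Complex.norm_def, Complex.normSq_apply]
    rw [Real.sqrt_eq_iff_mul_self_eq (add_nonneg (mul_self_nonneg _) (mul_self_nonneg _)) hr0.le]
    simp
    nlinarith
  have hdist : ∀ i j, dist (v i) (v j) = d i j := by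
    intro i j
    fin_cases i <;> fin_cases j <;>
      simp only [Fin.zero_eta, Fin.mk_one, Fin.reduceFinMk, hself, dist_self] <;>
      first | assumption | (rw [dist_comm]; simp only [s1, s2, s3]; assumption)
  have hind : AffineIndependent ℝ v := by
    rw [affineIndependent_iff_not_collinear]
    intro hc
    have hrange : range v = {v 0, v 1, v 2} := by
      ext z
      simp only [mem_range, mem_insert_iff, mem_singleton_iff]
      constructor
      · rintro ⟨i, rfl⟩; fin_cases i <;> simp
      · rintro (h | h | h) <;> exact ⟨_, h.symm⟩
    rw [hrange] at hc
    rcases hc.wbtw_or_wbtw_or_wbtw with h | h | h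
    · have := h.dist_add_dist; rw [d01, d12, d02] at this; linarith
    · have := h.dist_add_dist; rw [d12, dist_comm (v 2), d02, dist_comm (v 1), d01] at this; linarith
    · have := h.dist_add_dist; rw [d01, dist_comm (v 2), d02, dist_comm (v 2), d12] at this; linarith
  refine ⟨⟨v, hind, ?_⟩, hdist⟩
  rw [hind.affineSpan_eq_top_iff_card_eq_finrank_add_one]
  simp

/-! ### Metric triangle complexes -/

/-- A finite abstract simplicial complex of pure dimension two whose edges carry lengths which
satisfy the strict triangle inequality in each face. -/
structure TriangleComplex (V : Type) [LinearOrder V] where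
  faces : Finset (Finset V)
  card_face : ∀ t ∈ faces, t.card = 3
  nonempty : faces.Nonempty
  len : V → V → ℝ
  len_comm : ∀ a b, len a b = len b a
  len_lt : ∀ t ∈ faces, ∀ a ∈ t, ∀ b ∈ t, ∀ c ∈ t, a ≠ b → b ≠ c → a ≠ c →
    len a b < len a c + len c b
  -- Connectedness in the form of propagation of predicates: it is inherited along shellings and can
  -- be applied directly to relations such as finite distance.
  connected : ∀ p : V → Prop, (∀ t ∈ faces, ∀ a ∈ t, ∀ b ∈ t, p a → p b) →
    ∀ s ∈ faces, ∀ t ∈ faces, ∀ a ∈ s, ∀ b ∈ t, p a → p b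

namespace TriangleComplex

variable {V : Type} [LinearOrder V] (K : TriangleComplex V)

/-- The vertices of a face in increasing order. -/
def vert (t : K.faces) : Fin 3 ↪o V := t.1.orderEmbOfFin (K.card_face t.1 t.2)

theorem vert_mem (t : K.faces) (i : Fin 3) : K.vert t i ∈ t.1 := Finset.orderEmbOfFin_mem _ _ _

theorem exists_vert_eq (t : K.faces) {v : V} (hv : v ∈ t.1) : ∃ i, K.vert t i = v := by
  have : v ∈ Set.range (K.vert t) := by
    rw [vert, Finset.range_orderEmbOfFin]; exact hv
  exact this

theorem vert_ne (t : K.faces) {i j : Fin 3} (h : i ≠ j) : K.vert t i ≠ K.vert t j :=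
  (K.vert t).injective.ne h

theorem exists_basis (t : K.faces) : ∃ b : AffineBasis (Fin 3) ℝ ℂ, ∀ i j,
    dist (b i) (b j) = if i = j then 0 else K.len (K.vert t i) (K.vert t j) := by
  refine exists_affineBasis_dist_eq _ (fun i j => ?_) (fun i => by simp) fun i j k hij hjk hik => ?_
  · simp only [eq_comm (a := i), K.len_comm (K.vert t i)]
  · rw [if_neg hij, if_neg hik, if_neg hjk.symm]
    exact K.len_lt t.1 t.2 _ (K.vert_mem t _) _ (K.vert_mem t _) _ (K.vert_mem t _)
      (K.vert_ne t hij) (K.vert_ne t hjk) (K.vert_ne t hik)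

/-- A Euclidean triangle with the side lengths of a face. -/
def basis (t : K.faces) : AffineBasis (Fin 3) ℝ ℂ := (K.exists_basis t).choose

theorem dist_basis (t : K.faces) {i j : Fin 3} (h : i ≠ j) :
    dist (K.basis t i) (K.basis t j) = K.len (K.vert t i) (K.vert t j) := by
  rw [basis, (K.exists_basis t).choose_spec, if_neg h]

theorem len_pos (t : K.faces) {i j : Fin 3} (h : i ≠ j) : 0 < K.len (K.vert t i) (K.vert t j) := by
  rw [← K.dist_basis t h]
  exact dist_pos.2 ((K.basis t).ind.injective.ne h)

theorem len_pos_of_mem {t : Finset V} (ht : t ∈ K.faces) {a b : V} (ha : a ∈ t) (hb : b ∈ t)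
    (hab : a ≠ b) : 0 < K.len a b := by
  obtain ⟨i, rfl⟩ := K.exists_vert_eq ⟨t, ht⟩ ha
  obtain ⟨j, rfl⟩ := K.exists_vert_eq ⟨t, ht⟩ hb
  exact K.len_pos _ fun h => hab (by rw [h])

/-- Barycentric coordinates with respect to a face. -/
def bary (t : K.faces) (x : ℂ) : V → ℝ :=
  ∑ k, (K.basis t).coord k x • Pi.single (K.vert t k) (1 : ℝ)

theorem bary_vert (t : K.faces) (x : ℂ) (k : Fin 3) :
    K.bary t x (K.vert t k) = (K.basis t).coord k x := by
  simp only [bary, Finset.sum_apply, Pi.smul_apply, smul_eq_mul]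
  rw [Finset.sum_eq_single k]
  · simp
  · intro j _ hj
    rw [Pi.single_eq_of_ne (K.vert_ne t hj.symm), mul_zero]
  · simp

theorem bary_of_notMem (t : K.faces) (x : ℂ) {v : V} (hv : v ∉ t.1) : K.bary t x v = 0 := by
  simp only [bary, Finset.sum_apply, Pi.smul_apply, smul_eq_mul]
  refine Finset.sum_eq_zero fun k _ => ?_
  rw [Pi.single_eq_of_ne, mul_zero]
  rintro rfl
  exact hv (K.vert_mem t k)

theorem bary_injective (t : K.faces) : Function.Injective (K.bary t) := by
  intro x y h
  apply (K.basis t).ext_elem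
  intro i
  rw [← bary_vert, ← bary_vert, h]

theorem bary_lineMap (t : K.faces) (k l : Fin 3) (τ : ℝ) :
    K.bary t (AffineMap.lineMap (K.basis t k) (K.basis t l) τ) =
      (1 - τ) • Pi.single (K.vert t k) (1 : ℝ) + τ • Pi.single (K.vert t l) (1 : ℝ) := by
  have hb : ∀ k, ∑ j, (K.basis t).coord j (K.basis t k) • Pi.single (K.vert t j) (1 : ℝ) =
      Pi.single (K.vert t k) (1 : ℝ) := by
    intro k
    rw [Finset.sum_eq_single k]
    · simp
    · intro j _ hj
      rw [(K.basis t).coord_apply_ne hj, zero_smul]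
    · simp
  simp only [bary, AffineMap.apply_lineMap, AffineMap.lineMap_apply_ring, add_smul,
    Finset.sum_add_distrib, mul_smul, ← Finset.smul_sum, hb]

/-- The edges of the complex, oriented by the order of the vertices. -/
def Edge : Type := {e : V × V // e.1 < e.2 ∧ ∃ t ∈ K.faces, e.1 ∈ t ∧ e.2 ∈ t}

instance : Finite K.Edge := by
  have : Finite {e : V × V // e ∈ K.faces.biUnion id ×ˢ K.faces.biUnion id} := inferInstance
  refine Finite.of_injective (β := {e : V × V // e ∈ K.faces.biUnion id ×ˢ K.faces.biUnion id})
    (fun e : K.Edge => ⟨e.1, ?_⟩) fun e e' h => Subtype.ext (by simpa using h)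
  obtain ⟨t, ht, h1, h2⟩ := e.2.2
  simp only [Finset.mem_product, Finset.mem_biUnion, id_eq]
  exact ⟨⟨t, ht, h1⟩, ⟨t, ht, h2⟩⟩

/-- The `1`-skeleton of the complex. -/
def graph : LengthGraph where
  V := {v : V // ∃ t ∈ K.faces, v ∈ t}
  E := K.Edge
  source e := ⟨e.1.1, e.2.2.choose, e.2.2.choose_spec.1, e.2.2.choose_spec.2.1⟩
  target e := ⟨e.1.2, e.2.2.choose, e.2.2.choose_spec.1, e.2.2.choose_spec.2.2⟩
  len e := K.len e.1.1 e.1.2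
  len_pos e := by
    obtain ⟨t, ht, h1, h2⟩ := e.2.2
    exact K.len_pos_of_mem ht h1 h2 e.2.1.ne
  locallyFinite v := Set.toFinite _
  connected u v := by
    obtain ⟨u, s, hs, hu⟩ := u
    obtain ⟨v, t, ht, hv⟩ := v
    have := K.connected (fun w => ∀ hw : ∃ t ∈ K.faces, w ∈ t,
      Relation.EqvGen (fun a b : {v : V // ∃ t ∈ K.faces, v ∈ t} => ∃ e : K.Edge,
        (⟨e.1.1, e.2.2.choose, e.2.2.choose_spec.1, e.2.2.choose_spec.2.1⟩ :
          {v : V // ∃ t ∈ K.faces, v ∈ t}) = a ∧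
        (⟨e.1.2, e.2.2.choose, e.2.2.choose_spec.1, e.2.2.choose_spec.2.2⟩ :
          {v : V // ∃ t ∈ K.faces, v ∈ t}) = b) ⟨u, s, hs, hu⟩ ⟨w, hw⟩) ?_ s hs t ht u hu v hv
      (fun _ => .refl _) ⟨t, ht, hv⟩
    · exact this
    · intro t ht a ha b hb h hw
      refine .trans _ ⟨a, t, ht, ha⟩ _ (h ⟨t, ht, ha⟩) ?_
      rcases lt_trichotomy a b with hab | rfl | hab
      · exact .rel _ _ ⟨⟨(a, b), hab, t, ht, ha, hb⟩, rfl, rfl⟩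
      · exact .refl _
      · exact .symm _ _ (.rel _ _ ⟨⟨(b, a), hab, t, ht, hb, ha⟩, rfl, rfl⟩)

/-- Barycentric coordinates of the points of the `1`-skeleton. -/
def graphCoord : K.graph.Point → V → ℝ
  | Sum.inl v => Pi.single v.1 1
  | Sum.inr ⟨e, s⟩ => (1 - s.1 / K.graph.len e) • Pi.single e.1.1 (1 : ℝ) +
      (s.1 / K.graph.len e) • Pi.single e.1.2 (1 : ℝ)

theorem graphCoord_edgePoint (e : K.Edge) {s : ℝ} (hs : s ∈ Icc 0 (K.graph.len e)) :
    K.graphCoord (K.graph.edgePoint e s) =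
      (1 - s / K.graph.len e) • Pi.single e.1.1 (1 : ℝ) +
        (s / K.graph.len e) • Pi.single e.1.2 (1 : ℝ) := by
  have hl := K.graph.len_pos e
  by_cases h1 : s ∈ Ioo 0 (K.graph.len e)
  · have : K.graph.edgePoint e s = Sum.inr ⟨e, s, h1⟩ := dif_pos h1
    rw [this]
    rfl
  by_cases h2 : s ≤ 0
  · have : K.graph.edgePoint e s = Sum.inl (K.graph.source e) :=
      (dif_neg h1).trans (if_pos h2)
    rw [this, le_antisymm h2 hs.1]
    simp only [graphCoord, zero_div, sub_zero, one_smul, zero_smul, add_zero]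
    rfl
  · have : K.graph.edgePoint e s = Sum.inl (K.graph.target e) :=
      (dif_neg h1).trans (if_neg h2)
    rw [this, le_antisymm hs.2 (not_lt.1 fun h => h1 ⟨not_le.1 h2, h⟩), div_self hl.ne']
    simp only [graphCoord, sub_self, one_smul, zero_smul, zero_add]
    rfl

theorem graphCoord_inr_fst (e : K.Edge) (s : Ioo (0 : ℝ) (K.graph.len e)) :
    K.graphCoord (Sum.inr ⟨e, s⟩) e.1.1 = 1 - s.1 / K.graph.len e := by
  simp [graphCoord, Pi.single_eq_of_ne e.2.1.ne]

theorem graphCoord_inr_snd (e : K.Edge) (s : Ioo (0 : ℝ) (K.graph.len e)) :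
    K.graphCoord (Sum.inr ⟨e, s⟩) e.1.2 = s.1 / K.graph.len e := by
  simp [graphCoord, Pi.single_eq_of_ne e.2.1.ne']

theorem graphCoord_inr_of_ne (e : K.Edge) (s : Ioo (0 : ℝ) (K.graph.len e)) {v : V}
    (h1 : v ≠ e.1.1) (h2 : v ≠ e.1.2) : K.graphCoord (Sum.inr ⟨e, s⟩) v = 0 := by
  simp [graphCoord, Pi.single_eq_of_ne h1, Pi.single_eq_of_ne h2]

theorem div_len_mem (e : K.Edge) (s : Ioo (0 : ℝ) (K.graph.len e)) :
    s.1 / K.graph.len e ∈ Ioo (0 : ℝ) 1 :=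
  ⟨div_pos s.2.1 (K.graph.len_pos e), (div_lt_one (K.graph.len_pos e)).2 s.2.2⟩

/-- The support of the coordinates separates vertices from edges and, edges being ordered pairs,
determines the edge; the coordinate at the larger endpoint then determines the position on it. -/
theorem graphCoord_injective : Function.Injective K.graphCoord := by
  have hne : ∀ v e s, K.graphCoord (Sum.inl v) ≠ K.graphCoord (Sum.inr ⟨e, s⟩) := by
    intro v e s h
    have h1 := (congrFun h e.1.2).trans (K.graphCoord_inr_snd e s)
    have h2 := K.div_len_mem e s
    rw [← h1] at h2
    simp only [graphCoord, Pi.single_apply] at h2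
    split_ifs at h2 <;> simp at h2
  have hpos : ∀ (e : K.Edge) (s : Ioo (0 : ℝ) (K.graph.len e)) (v : V),
      K.graphCoord (Sum.inr ⟨e, s⟩) v ≠ 0 ↔ v = e.1.1 ∨ v = e.1.2 := by
    intro e s v
    have h2 := K.div_len_mem e s
    constructor
    · intro h
      by_contra! hv
      exact h (K.graphCoord_inr_of_ne e s hv.1 hv.2)
    · rintro (rfl | rfl)
      · rw [graphCoord_inr_fst]; linarith [h2.2]
      · rw [graphCoord_inr_snd]; exact h2.1.ne'
  rintro (v | ⟨e, s⟩) (w | ⟨f, r⟩) h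
  · congr 1
    apply Subtype.ext
    by_contra hvw
    have := congrFun h v.1
    simp [graphCoord, Pi.single_eq_of_ne hvw] at this
  · exact absurd h (hne v f r)
  · exact absurd h.symm (hne w e s)
  · have hef : e = f := by
      have h1 := (hpos f r e.1.1).1 (by rw [← h]; exact (hpos e s _).2 (Or.inl rfl))
      have h2 := (hpos f r e.1.2).1 (by rw [← h]; exact (hpos e s _).2 (Or.inr rfl))
      have he := e.2.1
      have hf := f.2.1
      have h3 : e.1.1 = f.1.1 ∧ e.1.2 = f.1.2 := by
        rcases h1 with h1 | h1 <;> rcases h2 with h2 | h2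
        · rw [h1, h2] at he; exact absurd he (lt_irrefl _)
        · exact ⟨h1, h2⟩
        · rw [h1, h2] at he; exact absurd he hf.not_gt
        · rw [h1, h2] at he; exact absurd he (lt_irrefl _)
      exact Subtype.ext (Prod.ext h3.1 h3.2)
    subst hef
    have := ((K.graphCoord_inr_snd e s).symm.trans (congrFun h e.1.2)).trans
      (K.graphCoord_inr_snd e r)
    rw [div_left_inj' (K.graph.len_pos e).ne'] at this
    rw [Subtype.ext this]

/-- Edges of the graph are oriented by the order of `V`, not by the face, so a side runs either
along or against its edge. These are the two alternatives that `PolyhedralData.ψ_side` admits. -/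
theorem graphCoord_edgePoint_side (t : K.faces) (k : Fin 3) : ∃ e : K.Edge,
    K.graph.len e = dist (K.basis t k) (K.basis t (finRotate 3 k)) ∧
    ((∀ x ∈ affineSegment ℝ (K.basis t k) (K.basis t (finRotate 3 k)),
        K.graphCoord (K.graph.edgePoint e (dist (K.basis t k) x)) = K.bary t x) ∨
     (∀ x ∈ affineSegment ℝ (K.basis t k) (K.basis t (finRotate 3 k)),
        K.graphCoord (K.graph.edgePoint e (dist (K.basis t (finRotate 3 k)) x)) = K.bary t x)) := by
  have hk : k ≠ finRotate 3 k := (by decide : ∀ k : Fin 3, k ≠ finRotate 3 k) k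
  have hlen := K.len_pos t hk
  rcases lt_or_gt_of_ne (K.vert_ne t hk) with h | h
  · refine ⟨⟨(K.vert t k, K.vert t (finRotate 3 k)), h, t.1, t.2, K.vert_mem t _, K.vert_mem t _⟩,
      (K.dist_basis t hk).symm, Or.inl ?_⟩
    rintro _ ⟨τ, hτ, rfl⟩
    have hd : dist (K.basis t k) (AffineMap.lineMap (K.basis t k) (K.basis t (finRotate 3 k)) τ) =
        τ * K.len (K.vert t k) (K.vert t (finRotate 3 k)) := by
      rw [dist_left_lineMap, Real.norm_of_nonneg hτ.1, K.dist_basis t hk]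
    rw [hd, bary_lineMap]
    refine (K.graphCoord_edgePoint _ ?_).trans ?_
    rotate_left
    · simp only [graph]
      rw [mul_div_cancel_right₀ _ hlen.ne']
    · exact ⟨mul_nonneg hτ.1 hlen.le, mul_le_of_le_one_left hlen.le hτ.2⟩
  · refine ⟨⟨(K.vert t (finRotate 3 k), K.vert t k), h, t.1, t.2, K.vert_mem t _, K.vert_mem t _⟩,
      ?_, Or.inr ?_⟩
    · rw [K.dist_basis t hk, K.len_comm]; rfl
    rintro _ ⟨τ, hτ, rfl⟩
    have hd : dist (K.basis t (finRotate 3 k))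
        (AffineMap.lineMap (K.basis t k) (K.basis t (finRotate 3 k)) τ) =
        (1 - τ) * K.len (K.vert t (finRotate 3 k)) (K.vert t k) := by
      rw [dist_right_lineMap, Real.norm_of_nonneg (by linarith [hτ.2]), K.dist_basis t hk,
        K.len_comm]
    rw [K.len_comm] at hlen
    rw [hd, bary_lineMap]
    refine (K.graphCoord_edgePoint _ ?_).trans ?_
    rotate_left
    · simp only [graph]
      rw [mul_div_cancel_right₀ _ hlen.ne', sub_sub_cancel, add_comm]
    · exact ⟨mul_nonneg (by linarith [hτ.2]) hlen.le,
        mul_le_of_le_one_left hlen.le (by linarith [hτ.1])⟩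

theorem exists_graphCoord_eq (t : K.faces) {x : ℂ}
    (hx : x ∈ frontier (trianglePolygonalDomain (K.basis t)).carrier) :
    ∃ a, K.graphCoord a = K.bary t x := by
  rw [(trianglePolygonalDomain (K.basis t)).frontier_eq] at hx
  obtain ⟨k, hk⟩ := mem_iUnion.1 hx
  obtain ⟨e, -, h | h⟩ := K.graphCoord_edgePoint_side t k
  · exact ⟨_, h x hk⟩
  · exact ⟨_, h x hk⟩

/-- The gluing map of a face. -/
def attach (t : K.faces) (x : frontier (trianglePolygonalDomain (K.basis t)).carrier) :
    K.graph.Point :=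
  (K.exists_graphCoord_eq t x.2).choose

theorem graphCoord_attach (t : K.faces)
    (x : frontier (trianglePolygonalDomain (K.basis t)).carrier) :
    K.graphCoord (K.attach t x) = K.bary t x :=
  (K.exists_graphCoord_eq t x.2).choose_spec

theorem lineMap_mem_frontier (t : K.faces) (i j : Fin 3) {τ : ℝ}
    (hτ : τ ∈ Icc (0 : ℝ) 1) : AffineMap.lineMap (K.basis t i) (K.basis t j) τ ∈
      frontier (trianglePolygonalDomain (K.basis t)).carrier := by
  change _ ∈ frontier (convexHull ℝ (range (K.basis t)))
  rw [AffineBasis.frontier_convexHull]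
  have hc : ∀ k, (K.basis t).coord k (AffineMap.lineMap (K.basis t i) (K.basis t j) τ) =
      (1 - τ) * (K.basis t).coord k (K.basis t i) + τ * (K.basis t).coord k (K.basis t j) := by
    intro k
    rw [AffineMap.apply_lineMap, AffineMap.lineMap_apply_ring]
  constructor
  · intro k
    rw [hc, AffineBasis.coord_apply, AffineBasis.coord_apply]
    have h1 : (0 : ℝ) ≤ if k = i then 1 else 0 := by split_ifs <;> norm_num
    have h2 : (0 : ℝ) ≤ if k = j then 1 else 0 := by split_ifs <;> norm_num
    have h3 := hτ.1
    have h4 : 0 ≤ 1 - τ := by linarith [hτ.2]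
    positivity
  · obtain ⟨k, hki, hkj⟩ := (by decide : ∀ i j : Fin 3, ∃ k, k ≠ i ∧ k ≠ j) i j
    exact ⟨k, by rw [hc, AffineBasis.coord_apply_ne _ hki, AffineBasis.coord_apply_ne _ hkj]; ring⟩

/-- The gluing data of a complex of Euclidean triangles. -/
def data : PolyhedralData where
  Γ := K.graph
  ι := K.faces
  P t := trianglePolygonalDomain (K.basis t)
  ψ t x := K.attach t x
  ψ_injective t x y h := by
    have := congrArg K.graphCoord h
    rw [graphCoord_attach, graphCoord_attach] at this
    exact Subtype.ext (K.bary_injective t this)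
  ψ_side t k := by
    obtain ⟨e, he, h | h⟩ := K.graphCoord_edgePoint_side t k
    · refine ⟨e, he, Or.inl fun x hx => K.graphCoord_injective ?_⟩
      rw [graphCoord_attach]
      exact (h x hx).symm
    · refine ⟨e, he, Or.inr fun x hx => K.graphCoord_injective ?_⟩
      rw [graphCoord_attach]
      exact (h x hx).symm
  ψ_cover a := by
    refine ⟨?_, Set.toFinite _⟩
    rcases a with ⟨v, t, ht, hv⟩ | ⟨e, s⟩
    · obtain ⟨i, rfl⟩ := K.exists_vert_eq ⟨t, ht⟩ hv
      refine ⟨⟨t, ht⟩, ⟨_, K.lineMap_mem_frontier ⟨t, ht⟩ i i (left_mem_Icc.2 zero_le_one)⟩,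
        K.graphCoord_injective ?_⟩
      rw [graphCoord_attach, bary_lineMap]
      simp [graphCoord]
    · obtain ⟨t, ht, h1, h2⟩ := e.2.2
      obtain ⟨i, hi⟩ := K.exists_vert_eq ⟨t, ht⟩ h1
      obtain ⟨j, hj⟩ := K.exists_vert_eq ⟨t, ht⟩ h2
      refine ⟨⟨t, ht⟩, ⟨_, K.lineMap_mem_frontier ⟨t, ht⟩ i j
        (Ioo_subset_Icc_self (K.div_len_mem e s))⟩, K.graphCoord_injective ?_⟩
      rw [graphCoord_attach, bary_lineMap, hi, hj]
      rfl

end TriangleComplex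

/-- The closed simplex in `V → ℝ` spanned by the unit vectors of `t`. -/
def simplexOf {V : Type*} (t : Finset V) : Set (V → ℝ) :=
  {x | (∀ v, 0 ≤ x v) ∧ (∀ v, v ∉ t → x v = 0) ∧ ∑ v ∈ t, x v = 1}

/-! ### The glued surface: barycentric coordinates, metric and area -/

namespace TriangleComplex

variable {V : Type} [LinearOrder V] (K : TriangleComplex V)

/-- The polyhedral space of a complex of Euclidean triangles. -/
def Surface : Type := K.data.Space

/-- The point of the surface given by a point of a face. -/
def toSurface (t : K.faces) (x : convexHull ℝ (range (K.basis t))) : K.Surface := K.data.proj t x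

theorem exists_toSurface (a : K.Surface) : ∃ t x, K.toSurface t x = a := K.data.exists_proj a

/-- Global barycentric coordinates on the surface. -/
def coords : K.Surface → V → ℝ :=
  Quot.lift (Sum.elim (fun p : Σ t, (K.data.P t).carrier => K.bary p.1 p.2) K.graphCoord) <| by
    rintro _ _ ⟨t, x, hc, hf, rfl, rfl⟩
    exact (K.graphCoord_attach t ⟨x, hf⟩).symm

theorem mem_convexHull_basis (t : K.faces) (x : ℂ) :
    x ∈ convexHull ℝ (range (K.basis t)) ↔ ∀ i, 0 ≤ (K.basis t).coord i x := by
  rw [(K.basis t).convexHull_eq_nonneg_coord]; rfl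

theorem toSurface_eq_of_frontier (t : K.faces) (x : convexHull ℝ (range (K.basis t)))
    (hx : (x : ℂ) ∈ frontier (convexHull ℝ (range (K.basis t)))) :
    K.toSurface t x = Quot.mk _ (Sum.inr (K.attach t ⟨x, hx⟩)) :=
  Quot.sound ⟨t, x, x.2, hx, rfl, rfl⟩

/-- A point in the interior of a face has full support, which identifies the face. For two frontier
points the comparison takes place in the graph, where `graphCoord` is injective. -/
theorem toSurface_eq_of_bary_eq {t t' : K.faces} (x : convexHull ℝ (range (K.basis t)))
    (y : convexHull ℝ (range (K.basis t'))) (h : K.bary t x = K.bary t' y) :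
    K.toSurface t x = K.toSurface t' y := by
  have key : ∀ {t t' : K.faces} (x : convexHull ℝ (range (K.basis t)))
      (y : convexHull ℝ (range (K.basis t'))), K.bary t x = K.bary t' y →
      (x : ℂ) ∉ frontier (convexHull ℝ (range (K.basis t))) →
      K.toSurface t x = K.toSurface t' y := by
    intro t t' x y h hx
    rw [AffineBasis.frontier_convexHull] at hx
    have hx' : ∀ i, (K.basis t).coord i x ≠ 0 := fun i hi =>
      hx ⟨(K.mem_convexHull_basis t x).1 x.2, i, hi⟩
    have hsub : t.1 ⊆ t'.1 := by
      intro v hv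
      by_contra hv'
      obtain ⟨i, rfl⟩ := K.exists_vert_eq t hv
      apply hx' i
      rw [← K.bary_vert, h, K.bary_of_notMem t' _ hv']
    have : t = t' := Subtype.ext (Finset.eq_of_subset_of_card_le hsub
      (by rw [K.card_face _ t.2, K.card_face _ t'.2]))
    subst this
    rw [Subtype.ext (K.bary_injective t h)]
  by_cases hx : (x : ℂ) ∈ frontier (convexHull ℝ (range (K.basis t)))
  · by_cases hy : (y : ℂ) ∈ frontier (convexHull ℝ (range (K.basis t')))
    · rw [K.toSurface_eq_of_frontier t x hx, K.toSurface_eq_of_frontier t' y hy]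
      have : K.attach t ⟨x, hx⟩ = K.attach t' ⟨y, hy⟩ := by
        apply K.graphCoord_injective
        rw [K.graphCoord_attach t ⟨x, hx⟩, K.graphCoord_attach t' ⟨y, hy⟩, h]
      rw [this]
    · exact (key y x h.symm hy).symm
  · exact key x y h hx

/-- The quotient is thereby realized inside `V → ℝ`, where its topology can be studied. -/
theorem coords_injective : Function.Injective K.coords := by
  intro a b h
  obtain ⟨t, x, rfl⟩ := K.exists_toSurface a
  obtain ⟨t', y, rfl⟩ := K.exists_toSurface b
  exact K.toSurface_eq_of_bary_eq x y h

theorem exists_coord_lipschitz : ∃ C : ℝ, 0 ≤ C ∧ ∀ (t : K.faces) (i : Fin 3) (x y : ℂ),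
    |(K.basis t).coord i x - (K.basis t).coord i y| ≤ C * dist x y := by
  have h : ∀ p : K.faces × Fin 3, ∃ C : ℝ, 0 ≤ C ∧ ∀ x y : ℂ,
      |(K.basis p.1).coord p.2 x - (K.basis p.1).coord p.2 y| ≤ C * dist x y := by
    intro p
    let f := LinearMap.toContinuousLinearMap ((K.basis p.1).coord p.2).linear
    refine ⟨‖f‖, norm_nonneg _, fun x y => ?_⟩
    rw [dist_eq_norm]
    have := f.le_opNorm (x - y)
    rw [Real.norm_eq_abs] at this
    convert this using 2
    exact (AffineMap.linearMap_vsub ((K.basis p.1).coord p.2) x y).symm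
  choose C hC0 hC using h
  refine ⟨∑ p, C p, Finset.sum_nonneg fun p _ => hC0 p, fun t i x y => (hC (t, i) x y).trans ?_⟩
  gcongr
  exact Finset.single_le_sum (fun p _ => hC0 p) (Finset.mem_univ (t, i))

theorem exists_bary_lipschitz : ∃ C : ℝ, 0 ≤ C ∧ ∀ (t : K.faces) (v : V) (x y : ℂ),
    |K.bary t x v - K.bary t y v| ≤ C * dist x y := by
  obtain ⟨C, hC0, hC⟩ := K.exists_coord_lipschitz
  refine ⟨C, hC0, fun t v x y => ?_⟩
  by_cases hv : v ∈ t.1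
  · obtain ⟨i, rfl⟩ := K.exists_vert_eq t hv
    rw [bary_vert, bary_vert]
    exact hC t i x y
  · rw [bary_of_notMem _ _ _ hv, bary_of_notMem _ _ _ hv]
    simp only [sub_self, abs_zero]
    exact mul_nonneg hC0 dist_nonneg

/-- Coordinates are continuous for the chain distance and separate points. This excludes distinct
points at distance zero. -/
theorem exists_coords_lipschitz : ∃ C : ℝ, ∀ (a b : K.Surface) (v : V),
    ENNReal.ofReal |K.coords a v - K.coords b v| ≤ ENNReal.ofReal C * K.data.chainDist a b := by
  obtain ⟨C, hC0, hC⟩ := K.exists_bary_lipschitz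
  exact ⟨C + 1, fun a b v => PolyhedralData.ofReal_abs_sub_le_chainDist (D := K.data)
    (F := fun a => K.coords a v) hC0 (fun t x y => hC t v x y) a b⟩

theorem chainDist_toSurface_le (t : K.faces) (x y : convexHull ℝ (range (K.basis t))) :
    K.data.chainDist (K.toSurface t x) (K.toSurface t y) ≤ edist x y := by
  rw [← lengthDist_eq_edist_of_convex (convex_convexHull ℝ _)]
  exact PolyhedralData.chainDist_proj_le (D := K.data) t x y

/-- Distances within a face are finite, and connectedness propagates finiteness from vertex to
vertex. -/
theorem chainDist_ne_top (a b : K.Surface) : K.data.chainDist a b ≠ ⊤ := by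
  obtain ⟨s, x, rfl⟩ := K.exists_toSurface a
  obtain ⟨t, y, rfl⟩ := K.exists_toSurface b
  have hmem : ∀ (t : K.faces) i, K.basis t i ∈ convexHull ℝ (range (K.basis t)) := fun t i =>
    subset_convexHull ℝ _ (mem_range_self i)
  have hcell : ∀ (t : K.faces) (x y : convexHull ℝ (range (K.basis t))),
      K.data.chainDist (K.toSurface t x) (K.toSurface t y) ≠ ⊤ := fun t x y =>
    ((K.chainDist_toSurface_le t x y).trans_lt (edist_lt_top x y)).ne
  have htrans : ∀ a b c : K.Surface, K.data.chainDist a b ≠ ⊤ → K.data.chainDist b c ≠ ⊤ →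
      K.data.chainDist a c ≠ ⊤ := fun a b c h1 h2 =>
    ((PolyhedralData.chainDist_triangle (D := K.data) a b c).trans_lt
      (ENNReal.add_lt_top.2 ⟨h1.lt_top, h2.lt_top⟩)).ne
  -- The predicate ranges over all faces that contain `v`: its corners in different faces represent
  -- the same point of the quotient.
  have := K.connected (fun v => ∀ (t : K.faces) (i : Fin 3), K.vert t i = v →
    K.data.chainDist (K.toSurface s x) (K.toSurface t ⟨_, hmem t i⟩) ≠ ⊤) ?_ s.1 s.2 t.1 t.2
    _ (K.vert_mem s 0) _ (K.vert_mem t 0) ?_ t 0 rfl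
  · exact htrans _ _ _ this (hcell t _ _)
  · intro u hu a ha b hb h r k hk
    obtain ⟨i, hi⟩ := K.exists_vert_eq ⟨u, hu⟩ ha
    obtain ⟨j, hj⟩ := K.exists_vert_eq ⟨u, hu⟩ hb
    have h1 := htrans _ _ _ (h ⟨u, hu⟩ i hi) (hcell ⟨u, hu⟩ _ ⟨_, hmem _ j⟩)
    have e1 := K.bary_lineMap r k k 0
    have e2 := K.bary_lineMap ⟨u, hu⟩ j j 0
    simp only [AffineMap.lineMap_apply_zero, hk, hj] at e1 e2
    have heq := K.toSurface_eq_of_bary_eq ⟨_, hmem r k⟩ ⟨_, hmem ⟨u, hu⟩ j⟩ (e1.trans e2.symm)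
    exact fun h' => h1 ((congrArg (K.data.chainDist (K.toSurface s x)) heq).symm.trans h')
  · intro r k hk
    have h1 := hcell s x ⟨_, hmem s 0⟩
    have e1 := K.bary_lineMap r k k 0
    have e2 := K.bary_lineMap s 0 0 0
    simp only [AffineMap.lineMap_apply_zero, hk] at e1 e2
    have heq := K.toSurface_eq_of_bary_eq ⟨_, hmem r k⟩ ⟨_, hmem s 0⟩ (e1.trans e2.symm)
    exact fun h' => h1 ((congrArg (K.data.chainDist (K.toSurface s x)) heq).symm.trans h')

theorem eq_of_chainDist_eq_zero {a b : K.Surface} (h : K.data.chainDist a b = 0) : a = b := by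
  obtain ⟨C, hC⟩ := K.exists_coords_lipschitz
  apply K.coords_injective
  ext v
  have := hC a b v
  rw [h, mul_zero, nonpos_iff_eq_zero, ENNReal.ofReal_eq_zero] at this
  exact sub_eq_zero.1 (abs_eq_zero.1 (le_antisymm this (abs_nonneg _)))

/-- The polyhedral distance as an extended metric. -/
@[reducible] def emetricSpace : EMetricSpace K.Surface where
  edist a b := K.data.chainDist a b
  edist_self := PolyhedralData.chainDist_self (D := K.data)
  edist_comm := PolyhedralData.chainDist_comm (D := K.data)
  edist_triangle := PolyhedralData.chainDist_triangle (D := K.data)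
  eq_of_edist_eq_zero := K.eq_of_chainDist_eq_zero

instance : MetricSpace K.Surface :=
  @EMetricSpace.toMetricSpace _ K.emetricSpace K.chainDist_ne_top

theorem isPolyhedralSpace : IsPolyhedralSpace K.Surface :=
  ⟨K.data, Equiv.refl _, fun _ _ => rfl⟩

theorem lipschitz_toSurface (t : K.faces) : LipschitzWith 1 (K.toSurface t) := by
  intro x y
  rw [ENNReal.coe_one, one_mul]
  exact K.chainDist_toSurface_le t x y

theorem continuous_coords : Continuous K.coords := by
  obtain ⟨C, hC⟩ := K.exists_coords_lipschitz
  refine continuous_pi fun v => ?_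
  have : LipschitzWith (Real.toNNReal C) (fun a => K.coords a v) := by
    intro a b
    rw [edist_dist, Real.dist_eq]
    exact hC a b v
  exact this.continuous

theorem iUnion_range_toSurface : ⋃ t, range (K.toSurface t) = univ :=
  eq_univ_of_forall fun a => by
    obtain ⟨t, x, rfl⟩ := K.exists_toSurface a
    exact mem_iUnion.2 ⟨t, x, rfl⟩

instance : CompactSpace K.Surface := by
  refine ⟨?_⟩
  rw [← K.iUnion_range_toSurface]
  refine isCompact_iUnion fun t => ?_
  have : CompactSpace (convexHull ℝ (range (K.basis t))) :=
    isCompact_iff_compactSpace.1 (K.basis t).isCompact_convexHull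
  exact isCompact_range (K.lipschitz_toSurface t).continuous

theorem map_vert (t : K.faces) : Finset.univ.map (K.vert t).toEmbedding = t.1 := by
  ext v
  constructor
  · simp only [Finset.mem_map, Finset.mem_univ, true_and]
    rintro ⟨i, rfl⟩
    exact K.vert_mem t i
  · intro hv
    obtain ⟨i, rfl⟩ := K.exists_vert_eq t hv
    simp

theorem sum_bary (t : K.faces) (x : ℂ) : ∑ v ∈ t.1, K.bary t x v = 1 := by
  rw [← K.map_vert t, Finset.sum_map]
  simp only [RelEmbedding.coe_toEmbedding, bary_vert]
  exact (K.basis t).sum_coord_apply_eq_one x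

theorem bary_mem_simplexOf (t : K.faces) (x : convexHull ℝ (range (K.basis t))) :
    K.bary t x ∈ simplexOf t.1 := by
  refine ⟨fun v => ?_, fun v hv => K.bary_of_notMem t x hv, K.sum_bary t x⟩
  by_cases hv : v ∈ t.1
  · obtain ⟨i, rfl⟩ := K.exists_vert_eq t hv
    rw [bary_vert]
    exact (K.mem_convexHull_basis t x).1 x.2 i
  · rw [K.bary_of_notMem t x hv]

theorem exists_bary_eq (t : K.faces) {y : V → ℝ} (hy : y ∈ simplexOf t.1) :
    ∃ x : convexHull ℝ (range (K.basis t)), K.bary t x = y := by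
  have hs : ∑ k, y (K.vert t k) = 1 := by
    rw [← hy.2.2, ← K.map_vert t, Finset.sum_map]
    rfl
  have hc : ∀ i, (K.basis t).coord i (∑ k, y (K.vert t k) • K.basis t k) = y (K.vert t i) := by
    intro i
    have := (K.basis t).coord_apply_combination_of_mem (Finset.mem_univ i) hs
    rwa [Finset.univ.affineCombination_eq_linear_combination _ _ hs] at this
  refine ⟨⟨∑ k, y (K.vert t k) • K.basis t k, ?_⟩, ?_⟩
  · rw [mem_convexHull_basis]
    intro i
    rw [hc]
    exact hy.1 _
  · ext v
    by_cases hv : v ∈ t.1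
    · obtain ⟨i, rfl⟩ := K.exists_vert_eq t hv
      rw [bary_vert, hc]
    · rw [K.bary_of_notMem t _ hv, hy.2.1 v hv]

theorem range_coords : range K.coords = ⋃ t ∈ K.faces, simplexOf t := by
  ext y
  simp only [mem_range, mem_iUnion, exists_prop]
  constructor
  · rintro ⟨a, rfl⟩
    obtain ⟨t, x, rfl⟩ := K.exists_toSurface a
    exact ⟨t.1, t.2, K.bary_mem_simplexOf t x⟩
  · rintro ⟨t, ht, hy⟩
    obtain ⟨x, hx⟩ := K.exists_bary_eq ⟨t, ht⟩ hy
    exact ⟨K.toSurface ⟨t, ht⟩ x, hx⟩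

/-- An injective continuous map from a compact space to a Hausdorff space is an embedding. -/
theorem isEmbedding_coords : Topology.IsEmbedding K.coords :=
  (K.continuous_coords.isClosedEmbedding K.coords_injective).isEmbedding

/-- The quadratic form which expresses squared distances in a Euclidean triangle in terms of
differences of barycentric coordinates. -/
def quadForm (a b c : V) (δ : V → ℝ) : ℝ :=
  -(δ a * δ b * K.len a b ^ 2 + δ a * δ c * K.len a c ^ 2 + δ b * δ c * K.len b c ^ 2)

/-- For weights `δ` of sum zero, the squared norm of `∑ δ i • b i` is minus the sum of `δ i * δ j *
dist (b i) (b j) ^ 2` over pairs. Thus only edge lengths enter, and the position of the triangle in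
the plane is irrelevant. -/
theorem sq_dist_eq_quadForm {t : K.faces} {a b c : V} (ht : t.1 = {a, b, c}) (hab : a ≠ b)
    (hbc : b ≠ c) (hac : a ≠ c) (x y : ℂ) :
    dist x y ^ 2 = K.quadForm a b c (K.bary t x - K.bary t y) := by
  obtain ⟨i, rfl⟩ := K.exists_vert_eq t (v := a) (by simp [ht])
  obtain ⟨j, rfl⟩ := K.exists_vert_eq t (v := b) (by simp [ht])
  obtain ⟨k, rfl⟩ := K.exists_vert_eq t (v := c) (by simp [ht])
  have hij : i ≠ j := fun h => hab (by rw [h])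
  have hjk : j ≠ k := fun h => hbc (by rw [h])
  have hik : i ≠ k := fun h => hac (by rw [h])
  simp only [quadForm, Pi.sub_apply, bary_vert, ← K.dist_basis t hij, ← K.dist_basis t hjk,
    ← K.dist_basis t hik]
  -- The pairwise distinct indices `i`, `j`, `k` are a permutation of `0`, `1`, `2`.
  have hsum : ∀ f : Fin 3 → ℝ, f 0 + f 1 + f 2 = f i + f j + f k := by
    intro f
    fin_cases i <;> fin_cases j <;> fin_cases k <;> simp at hij hjk hik ⊢ <;> ring
  have hsum' : ∀ f : Fin 3 → ℂ, f 0 + f 1 + f 2 = f i + f j + f k := by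
    intro f
    fin_cases i <;> fin_cases j <;> fin_cases k <;> simp at hij hjk hik ⊢ <;> ring
  set b := K.basis t
  have hx := (b.eq_sum_coord x).trans (hsum' fun l => b.coord l x • b l)
  have hy := (b.eq_sum_coord y).trans (hsum' fun l => b.coord l y • b l)
  have sx := (hsum fun l => b.coord l x).symm.trans (b.sum_coord_three x)
  have sy := (hsum fun l => b.coord l y).symm.trans (b.sum_coord_three y)
  have hsq : ∀ z w : ℂ, dist z w ^ 2 = (z.re - w.re) ^ 2 + (z.im - w.im) ^ 2 := by
    intro z w
    rw [Complex.dist_eq, Complex.sq_norm, Complex.normSq_apply, Complex.sub_re, Complex.sub_im]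
    ring
  have hre := congrArg Complex.re hx
  have him := congrArg Complex.im hx
  have hre' := congrArg Complex.re hy
  have him' := congrArg Complex.im hy
  simp only [Complex.add_re, Complex.add_im, Complex.real_smul, Complex.mul_re, Complex.mul_im,
    Complex.ofReal_re, Complex.ofReal_im, zero_mul, sub_zero, add_zero] at hre him hre' him'
  simp only [hsq]
  rw [hre, him, hre', him']
  have e1 : b.coord k x = 1 - b.coord i x - b.coord j x := by linarith
  have e2 : b.coord k y = 1 - b.coord i y - b.coord j y := by linarith
  rw [e1, e2]
  ring

/-- Upper bound for the distance of two points in a common face. -/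
theorem sq_dist_le_quadForm {a b c : V} (ht : {a, b, c} ∈ K.faces) (hab : a ≠ b)
    (hbc : b ≠ c) (hac : a ≠ c) {p q : K.Surface} (hp : K.coords p ∈ simplexOf {a, b, c})
    (hq : K.coords q ∈ simplexOf {a, b, c}) :
    dist p q ^ 2 ≤ K.quadForm a b c (K.coords p - K.coords q) := by
  obtain ⟨x, hx⟩ := K.exists_bary_eq ⟨_, ht⟩ hp
  obtain ⟨y, hy⟩ := K.exists_bary_eq ⟨_, ht⟩ hq
  have hpx : K.toSurface ⟨_, ht⟩ x = p := K.coords_injective hx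
  have hqy : K.toSurface ⟨_, ht⟩ y = q := K.coords_injective hy
  have h1 := K.sq_dist_eq_quadForm (t := ⟨_, ht⟩) rfl hab hbc hac x y
  rw [hx, hy] at h1
  rw [← h1, ← hpx, ← hqy]
  have := (K.lipschitz_toSurface ⟨_, ht⟩).dist_le_mul x y
  rw [NNReal.coe_one, one_mul] at this
  exact pow_le_pow_left₀ dist_nonneg this 2

/-- A function of the barycentric coordinates which is `1`-Lipschitz on each face is `1`-Lipschitz
on the surface. -/
theorem abs_sub_le_dist (U : (V → ℝ) → ℝ)
    (hU : ∀ t ∈ K.faces, ∃ a b c, t = {a, b, c} ∧ a ≠ b ∧ b ≠ c ∧ a ≠ c ∧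
      ∀ x ∈ simplexOf t, ∀ y ∈ simplexOf t, (U x - U y) ^ 2 ≤ K.quadForm a b c (x - y))
    (p q : K.Surface) : |U (K.coords p) - U (K.coords q)| ≤ dist p q := by
  have := PolyhedralData.ofReal_abs_sub_le_chainDist_of_one (D := K.data)
    (F := fun a => U (K.coords a)) (fun t x y => ?_) p q
  · change _ ≤ edist p q at this
    rw [edist_dist] at this
    exact (ENNReal.ofReal_le_ofReal_iff dist_nonneg).1 this
  · change |U (K.bary t x) - U (K.bary t y)| ≤ _
    obtain ⟨a, b, c, ht, hab, hbc, hac, h⟩ := hU t.1 t.2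
    refine abs_le_of_sq_le_sq ?_ dist_nonneg
    refine (h _ (K.bary_mem_simplexOf t x) _ (K.bary_mem_simplexOf t y)).trans (le_of_eq ?_)
    exact (K.sq_dist_eq_quadForm ht hab hbc hac x y).symm

/-- The triangle lies in the parallelogram spanned by two of its sides, a `2`-Lipschitz image of a
rectangle in the sup metric. There `μH[2]` is Lebesgue measure, so the loss is `2 ^ 2 = 4`. -/
theorem hausdorffMeasure_triangle_le (b : AffineBasis (Fin 3) ℝ ℂ) {i j k : Fin 3} (hij : i ≠ j)
    (hjk : j ≠ k) (hik : i ≠ k) : μH[2] (convexHull ℝ (range b)) ≤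
      ENNReal.ofReal (4 * (dist (b i) (b j) * dist (b i) (b k))) := by
  set u := b j - b i with hu
  set v := b k - b i with hv
  have hu0 : 0 < ‖u‖ := norm_pos_iff.2 (sub_ne_zero.2 (b.ind.injective.ne hij.symm))
  have hv0 : 0 < ‖v‖ := norm_pos_iff.2 (sub_ne_zero.2 (b.ind.injective.ne hik.symm))
  let f : (Fin 2 → ℝ) → ℂ := fun p => b i + (p 0 / ‖u‖) • u + (p 1 / ‖v‖) • v
  have hf : LipschitzWith 2 f := by
    refine LipschitzWith.of_dist_le_mul fun p q => ?_
    have h1 : f p - f q = ((p 0 - q 0) / ‖u‖) • u + ((p 1 - q 1) / ‖v‖) • v := by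
      simp only [f, sub_div, sub_smul]
      abel
    have h0 := dist_le_pi_dist p q 0
    have h2 := dist_le_pi_dist p q 1
    rw [Real.dist_eq] at h0 h2
    calc dist (f p) (f q) ≤ ‖((p 0 - q 0) / ‖u‖) • u‖ + ‖((p 1 - q 1) / ‖v‖) • v‖ := by
          rw [dist_eq_norm, h1]; exact norm_add_le _ _
      _ = |p 0 - q 0| + |p 1 - q 1| := by
          rw [norm_smul, norm_smul, norm_div, norm_div, norm_norm, norm_norm,
            div_mul_cancel₀ _ hu0.ne', div_mul_cancel₀ _ hv0.ne', Real.norm_eq_abs,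
            Real.norm_eq_abs]
      _ ≤ _ := by push_cast; linarith
  have hsub : convexHull ℝ (range b) ⊆ f '' (Icc 0 ![‖u‖, ‖v‖]) := by
    intro x hx
    rw [b.convexHull_eq_nonneg_coord] at hx
    have hx' : ∀ i, 0 ≤ b.coord i x := hx
    have hsum : ∀ f : Fin 3 → ℝ, f 0 + f 1 + f 2 = f i + f j + f k := by
      intro f
      fin_cases i <;> fin_cases j <;> fin_cases k <;> simp at hij hjk hik ⊢ <;> ring
    have hsum' : ∀ f : Fin 3 → ℂ, f 0 + f 1 + f 2 = f i + f j + f k := by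
      intro f
      fin_cases i <;> fin_cases j <;> fin_cases k <;> simp at hij hjk hik ⊢ <;> ring
    have h1 := (hsum fun l => b.coord l x).symm.trans (b.sum_coord_three x)
    have h2 := (b.eq_sum_coord x).trans (hsum' fun l => b.coord l x • b l)
    have hi := hx' i
    have hj := hx' j
    have hk := hx' k
    refine ⟨![b.coord j x * ‖u‖, b.coord k x * ‖v‖], ⟨?_, ?_⟩, ?_⟩
    · intro l
      fin_cases l
      · exact mul_nonneg hj hu0.le
      · exact mul_nonneg hk hv0.le
    · intro l
      fin_cases l
      · exact mul_le_of_le_one_left hu0.le (by linarith)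
      · exact mul_le_of_le_one_left hv0.le (by linarith)
    · simp only [f, Matrix.cons_val_zero, Matrix.cons_val_one]
      rw [mul_div_cancel_right₀ _ hu0.ne', mul_div_cancel_right₀ _ hv0.ne']
      conv_rhs => rw [h2, show b.coord i x = 1 - b.coord j x - b.coord k x by linarith]
      simp only [hu, hv, Complex.real_smul]
      push_cast
      ring
  have hvol : μH[2] (Icc 0 ![‖u‖, ‖v‖] : Set (Fin 2 → ℝ)) = ENNReal.ofReal (‖u‖ * ‖v‖) := by
    have : (μH[2] : Measure (Fin 2 → ℝ)) = volume := by
      simpa using hausdorffMeasure_pi_real (ι := Fin 2)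
    rw [this, Real.volume_Icc_pi, Fin.prod_univ_two, ENNReal.ofReal_mul hu0.le]
    simp
  calc μH[2] (convexHull ℝ (range b)) ≤ μH[2] (f '' (Icc 0 ![‖u‖, ‖v‖])) := measure_mono hsub
    _ ≤ (2 : NNReal) ^ (2 : ℝ) * μH[2] (Icc 0 ![‖u‖, ‖v‖] : Set (Fin 2 → ℝ)) :=
      hf.lipschitzOnWith.hausdorffMeasure_image_le (by norm_num)
    _ = ENNReal.ofReal (4 * (dist (b i) (b j) * dist (b i) (b k))) := by
      rw [hvol, dist_comm, dist_eq_norm, dist_comm (b i), dist_eq_norm, ENNReal.ofReal_mul (p := 4)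
        (by norm_num)]
      congr 1
      norm_num

/-- Upper bound for the area of the surface by the products of two side lengths. -/
theorem hausdorffTwo_le (A : Finset V → ℝ)
    (hA : ∀ t ∈ K.faces, ∃ a b c, t = {a, b, c} ∧ a ≠ b ∧ b ≠ c ∧ a ≠ c ∧
      K.len a b * K.len a c ≤ A t) :
    hausdorffTwo K.Surface ≤ ENNReal.ofReal (4 * ∑ t ∈ K.faces, A t) := by
  let _ : MeasurableSpace K.Surface := borel K.Surface
  have : BorelSpace K.Surface := ⟨rfl⟩
  have hcell : ∀ t : K.faces, μH[2] (range (K.toSurface t)) ≤ ENNReal.ofReal (4 * A t.1) := by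
    intro t
    obtain ⟨a, b, c, ht, hab, hbc, hac, h⟩ := hA t.1 t.2
    obtain ⟨i, rfl⟩ := K.exists_vert_eq t (v := a) (by simp [ht])
    obtain ⟨j, rfl⟩ := K.exists_vert_eq t (v := b) (by simp [ht])
    obtain ⟨k, rfl⟩ := K.exists_vert_eq t (v := c) (by simp [ht])
    have hij : i ≠ j := fun h => hab (by rw [h])
    have hjk : j ≠ k := fun h => hbc (by rw [h])
    have hik : i ≠ k := fun h => hac (by rw [h])
    rw [← image_univ]
    have h1 := (K.lipschitz_toSurface t).lipschitzOnWith (s := univ) |>.hausdorffMeasure_image_le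
      (d := 2) (by norm_num)
    refine h1.trans ?_
    have h2 : μH[2] (univ : Set (convexHull ℝ (range (K.basis t)))) =
        μH[2] (convexHull ℝ (range (K.basis t))) := by
      have := isometry_subtype_coe (s := convexHull ℝ (range (K.basis t)))
        |>.hausdorffMeasure_image (d := 2) (Or.inl (by norm_num)) univ
      rw [← this, image_univ, Subtype.range_coe]
    rw [h2]
    simp only [ENNReal.coe_one, ENNReal.one_rpow, one_mul]
    refine (hausdorffMeasure_triangle_le (K.basis t) hij hjk hik).trans ?_
    apply ENNReal.ofReal_le_ofReal
    rw [K.dist_basis t hij, K.dist_basis t hik]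
    linarith
  have hA0 : ∀ t ∈ K.faces, 0 ≤ A t := by
    intro t ht
    obtain ⟨a, b, c, rfl, hab, hbc, hac, h⟩ := hA t ht
    refine le_trans (mul_nonneg ?_ ?_) h
    · exact (K.len_pos_of_mem ht (by simp) (by simp) hab).le
    · exact (K.len_pos_of_mem ht (by simp) (by simp) hac).le
  unfold hausdorffTwo
  calc ENNReal.ofReal (Real.pi / 4) * μH[2] (univ : Set K.Surface)
      ≤ 1 * ∑ t : K.faces, ENNReal.ofReal (4 * A t.1) := by
        gcongr
        · rw [ENNReal.ofReal_le_one]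
          linarith [Real.pi_le_four]
        · rw [← K.iUnion_range_toSurface]
          exact (measure_iUnion_fintype_le _ _).trans (Finset.sum_le_sum fun t _ => hcell t)
    _ = ENNReal.ofReal (4 * ∑ t ∈ K.faces, A t) := by
        rw [one_mul, ← ENNReal.ofReal_sum_of_nonneg (fun t _ => by
          have := hA0 t.1 t.2
          positivity), ← Finset.mul_sum, Finset.sum_coe_sort K.faces A]

end TriangleComplex

/-! ### Topological disks and arcs -/

section Disk

variable {E : Type*} [TopologicalSpace E]

/-- `A` is an embedded closed disk with boundary circle `B`. -/
def IsDiskIn (A B : Set E) : Prop :=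
  ∃ e : ℂ → E, ContinuousOn e (Metric.closedBall 0 1) ∧ InjOn e (Metric.closedBall 0 1) ∧
    e '' Metric.closedBall 0 1 = A ∧ e '' Metric.sphere 0 1 = B

/-- `c` is an embedded arc from `p` to `q`. -/
def IsArcIn (c : Set E) (p q : E) : Prop :=
  ∃ γ : ℝ → E, ContinuousOn γ (Icc 0 1) ∧ InjOn γ (Icc 0 1) ∧ γ 0 = p ∧ γ 1 = q ∧
    γ '' Icc 0 1 = c

theorem IsArcIn.symm {c : Set E} {p q : E} (h : IsArcIn c p q) : IsArcIn c q p := by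
  obtain ⟨γ, hc, hi, h0, h1, him⟩ := h
  have hm : MapsTo (fun t : ℝ => 1 - t) (Icc 0 1) (Icc 0 1) := fun t ht =>
    ⟨by linarith [ht.2], by linarith [ht.1]⟩
  refine ⟨fun t => γ (1 - t), hc.comp (by fun_prop) hm, ?_, by simpa, by simpa, ?_⟩
  · intro s hs t ht h
    have := hi (hm hs) (hm ht) h
    linarith
  · rw [← him]
    apply Subset.antisymm
    · rintro _ ⟨t, ht, rfl⟩
      exact ⟨_, hm ht, rfl⟩
    · rintro _ ⟨t, ht, rfl⟩
      exact ⟨_, hm ht, by simp⟩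

theorem IsArcIn.trans {c d : Set E} {p q r : E} (hc : IsArcIn c p q) (hd : IsArcIn d q r)
    (hcd : c ∩ d ⊆ {q}) : IsArcIn (c ∪ d) p r := by
  obtain ⟨γ, hγ, hγi, hγ0, hγ1, rfl⟩ := hc
  obtain ⟨δ, hδ, hδi, hδ0, hδ1, rfl⟩ := hd
  let f : ℝ → E := fun t => if t ≤ 1 / 2 then γ (2 * t) else δ (2 * t - 1)
  have f1 : ∀ t ≤ (1 / 2 : ℝ), f t = γ (2 * t) := fun t ht => if_pos ht
  have f2 : ∀ t : ℝ, 1 / 2 ≤ t → f t = δ (2 * t - 1) := by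
    intro t ht
    rcases ht.eq_or_lt with rfl | h
    · rw [f1 _ le_rfl]
      norm_num [hγ1, hδ0]
    · exact if_neg (not_le.2 h)
  have m1 : MapsTo (fun t : ℝ => 2 * t) (Icc 0 (1 / 2)) (Icc 0 1) := fun t ht =>
    ⟨by linarith [ht.1], by linarith [ht.2]⟩
  have m2 : MapsTo (fun t : ℝ => 2 * t - 1) (Icc (1 / 2) 1) (Icc 0 1) := fun t ht =>
    ⟨by linarith [ht.1], by linarith [ht.2]⟩
  have hI : Icc (0 : ℝ) 1 = Icc 0 (1 / 2) ∪ Icc (1 / 2) 1 :=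
    (Icc_union_Icc_eq_Icc (by norm_num) (by norm_num)).symm
  have hcross : ∀ s ∈ Icc (0 : ℝ) (1 / 2), ∀ t ∈ Icc (1 / 2 : ℝ) 1, f s = f t → s = t := by
    intro s hs t ht h
    have hfs := f1 s hs.2
    have hft := f2 t ht.1
    have hq : f s = q := hcd ⟨⟨_, m1 hs, hfs.symm⟩, ⟨_, m2 ht, by rw [← hft, h]⟩⟩
    have h1 := hγi (m1 hs) (right_mem_Icc.2 zero_le_one) (by rw [← hfs, hq, hγ1])
    have h2 := hδi (m2 ht) (left_mem_Icc.2 zero_le_one) (by rw [← hft, ← h, hq, hδ0])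
    linarith
  refine ⟨f, ?_, ?_, ?_, ?_, ?_⟩
  · rw [hI]
    refine ContinuousOn.union_of_isClosed ?_ ?_ isClosed_Icc isClosed_Icc
    · exact (hγ.comp (by fun_prop) m1).congr fun t ht => f1 t ht.2
    · exact (hδ.comp (by fun_prop) m2).congr fun t ht => f2 t ht.1
  · rw [hI]
    rintro s (hs | hs) t (ht | ht) h
    · rw [f1 s hs.2, f1 t ht.2] at h
      linarith [hγi (m1 hs) (m1 ht) h]
    · exact hcross s hs t ht h
    · exact (hcross t ht s hs h.symm).symm
    · rw [f2 s hs.1, f2 t ht.1] at h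
      linarith [hδi (m2 hs) (m2 ht) h]
  · rw [f1 0 (by norm_num)]; simpa
  · rw [f2 1 (by norm_num)]; norm_num [hδ1]
  · have him : f '' Icc 0 1 = f '' Icc 0 (1 / 2) ∪ f '' Icc (1 / 2) 1 := by
      rw [← image_union, ← hI]
    rw [him]
    congr 1
    · apply Subset.antisymm
      · rintro _ ⟨t, ht, rfl⟩
        exact ⟨_, m1 ht, (f1 t ht.2).symm⟩
      · rintro _ ⟨t, ht, rfl⟩
        refine ⟨t / 2, ⟨by linarith [ht.1], by linarith [ht.2]⟩, ?_⟩
        rw [f1 _ (by linarith [ht.2])]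
        congr 1
        ring
    · apply Subset.antisymm
      · rintro _ ⟨t, ht, rfl⟩
        exact ⟨_, m2 ht, (f2 t ht.1).symm⟩
      · rintro _ ⟨t, ht, rfl⟩
        refine ⟨(t + 1) / 2, ⟨by linarith [ht.1], by linarith [ht.2]⟩, ?_⟩
        rw [f2 _ (by linarith [ht.1])]
        congr 1
        ring

/-- The radial extension of a self-map of the circle. -/
theorem exists_radial_extension {τ : ℂ → ℂ} (hτ : ContinuousOn τ (Metric.sphere 0 1))
    (hb : BijOn τ (Metric.sphere 0 1) (Metric.sphere 0 1)) :
    ∃ Θ : ℂ → ℂ, ContinuousOn Θ (Metric.closedBall 0 1) ∧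
      BijOn Θ (Metric.closedBall 0 1) (Metric.closedBall 0 1) ∧
      EqOn Θ τ (Metric.sphere 0 1) := by
  have hn : ∀ z : ℂ, z ≠ 0 → (‖z‖⁻¹ • z) ∈ Metric.sphere (0 : ℂ) 1 := by
    intro z hz
    simp [inv_mul_cancel₀ (norm_ne_zero_iff.2 hz)]
  -- The cone over `τ`. It preserves norms, which gives continuity at the origin, where the
  -- direction of `z` is undefined.
  let Θ : ℂ → ℂ := fun z => ‖z‖ • τ (‖z‖⁻¹ • z)
  have hnorm : ∀ z, ‖Θ z‖ = ‖z‖ := by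
    intro z
    by_cases hz : z = 0
    · simp [Θ, hz]
    · have := hb.mapsTo (hn z hz)
      rw [mem_sphere_zero_iff_norm] at this
      simp only [Θ]
      rw [norm_smul, this, norm_norm, mul_one]
  refine ⟨Θ, ?_, ⟨?_, ?_, ?_⟩, ?_⟩
  · refine Continuous.continuousOn (continuous_iff_continuousAt.2 fun z => ?_)
    by_cases hz : z = 0
    · subst hz
      have h0 : Θ 0 = 0 := by simp [Θ]
      rw [ContinuousAt, h0]
      rw [tendsto_zero_iff_norm_tendsto_zero]
      simp only [hnorm]
      exact continuous_norm.tendsto' 0 0 norm_zero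
    · have hU : {w : ℂ | w ≠ 0} ∈ nhds z := isOpen_ne.mem_nhds hz
      refine ContinuousOn.continuousAt (s := {w : ℂ | w ≠ 0}) ?_ hU
      refine continuous_norm.continuousOn.smul (hτ.comp ?_ fun w hw => hn w hw)
      exact (continuousOn_id.norm.inv₀ fun w hw => norm_ne_zero_iff.2 hw).smul continuousOn_id
  · intro z hz
    rw [mem_closedBall_zero_iff] at hz ⊢
    rwa [hnorm]
  · intro z _ w _ h
    have hzw : ‖z‖ = ‖w‖ := by rw [← hnorm z, h, hnorm]
    by_cases hz : z = 0
    · rw [hz, norm_zero] at hzw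
      rw [hz, eq_comm, ← norm_eq_zero, ← hzw]
    · have hw : w ≠ 0 := by rwa [← norm_ne_zero_iff, ← hzw, norm_ne_zero_iff]
      have h1 : τ (‖z‖⁻¹ • z) = τ (‖w‖⁻¹ • w) := by
        simp only [Θ] at h
        rw [hzw] at h ⊢
        exact smul_right_injective ℂ (norm_ne_zero_iff.2 hw) h
      have h2 := hb.injOn (hn z hz) (hn w hw) h1
      rw [hzw] at h2
      exact smul_right_injective ℂ (inv_ne_zero (norm_ne_zero_iff.2 hw)) h2
  · intro w hw
    by_cases hw0 : w = 0
    · exact ⟨0, by simp, by simp [Θ, hw0]⟩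
    · obtain ⟨u, hu, huw⟩ := hb.surjOn (hn w hw0)
      rw [mem_sphere_zero_iff_norm] at hu
      have hwn := norm_ne_zero_iff.2 hw0
      refine ⟨‖w‖ • u, ?_, ?_⟩
      · rw [mem_closedBall_zero_iff] at hw ⊢
        rwa [norm_smul, hu, norm_norm, mul_one]
      · simp only [Θ]
        rw [norm_smul, hu, norm_norm, mul_one, smul_smul, inv_mul_cancel₀ hwn, one_smul, huw,
          smul_smul, mul_inv_cancel₀ hwn, one_smul]
  · intro z hz
    rw [mem_sphere_zero_iff_norm] at hz
    simp [Θ, hz]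

/-- An embedded disk has a parametrization by any planar convex body which extends a given
parametrization of its boundary. -/
theorem IsDiskIn.exists_param [T2Space E] {A B : Set E} (h : IsDiskIn A B) {K : Set ℂ}
    (hK : Convex ℝ K) (hKc : IsCompact K) (hne : (interior K).Nonempty) {b : ℂ → E}
    (hb : ContinuousOn b (frontier K)) (hbi : InjOn b (frontier K)) (hbB : b '' frontier K = B) :
    ∃ e : ℂ → E, ContinuousOn e K ∧ InjOn e K ∧ e '' K = A ∧ EqOn e b (frontier K) := by
  obtain ⟨e, hec, hei, heA, heB⟩ := h
  obtain ⟨k, -, hkK, hkf⟩ :=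
    exists_homeomorph_image_interior_closure_frontier_eq_unitBall hK hne hKc.isBounded
  rw [hKc.isClosed.closure_eq] at hkK
  have hsub : Metric.sphere (0 : ℂ) 1 ⊆ Metric.closedBall 0 1 := Metric.sphere_subset_closedBall
  have hsymm : ∀ z ∈ Metric.sphere (0 : ℂ) 1, k.symm z ∈ frontier K := by
    intro z hz
    rw [← hkf] at hz
    obtain ⟨w, hw, rfl⟩ := hz
    simpa
  have hex : ∀ z : ℂ, z ∈ Metric.sphere (0 : ℂ) 1 →
      ∃ w ∈ Metric.sphere (0 : ℂ) 1, e w = b (k.symm z) := by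
    intro z hz
    have : b (k.symm z) ∈ B := hbB ▸ mem_image_of_mem b (hsymm z hz)
    rwa [← heB] at this
  -- `τ` is the change of boundary parametrization from `b` to `e`, read on the unit circle. It is
  -- continuous because `e` is an embedding of the compact disk and `e ∘ τ` is continuous.
  choose! τ hτS hτ using hex
  have hτc : ContinuousOn τ (Metric.sphere 0 1) := by
    have hemb : Topology.IsEmbedding ((Metric.closedBall (0 : ℂ) 1).domRestrict e) := by
      have : CompactSpace (Metric.closedBall (0 : ℂ) 1) :=
        isCompact_iff_compactSpace.1 (isCompact_closedBall _ _)
      exact ((continuousOn_iff_continuous_domRestrict.1 hec).isClosedEmbedding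
        (injOn_iff_injective.1 hei)).isEmbedding
    rw [continuousOn_iff_continuous_domRestrict]
    let g : Metric.sphere (0 : ℂ) 1 → Metric.closedBall (0 : ℂ) 1 := fun z =>
      ⟨τ z, hsub (hτS z z.2)⟩
    have hg : Continuous g := by
      rw [hemb.continuous_iff]
      have : (Metric.closedBall (0 : ℂ) 1).domRestrict e ∘ g =
          (Metric.sphere (0 : ℂ) 1).domRestrict (b ∘ k.symm) := by
        ext z
        exact hτ z z.2
      rw [this, ← continuousOn_iff_continuous_domRestrict]
      exact hb.comp k.symm.continuous.continuousOn hsymm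
    exact continuous_subtype_val.comp hg
  have hτb : BijOn τ (Metric.sphere 0 1) (Metric.sphere 0 1) := by
    refine ⟨hτS, fun z hz w hw hzw => ?_, fun w hw => ?_⟩
    · have := hτ z hz
      rw [hzw, hτ w hw] at this
      exact k.symm.injective (hbi (hsymm w hw) (hsymm z hz) this).symm
    · have : e w ∈ B := heB ▸ mem_image_of_mem e hw
      rw [← hbB] at this
      obtain ⟨x, hx, hxw⟩ := this
      have hkx : k x ∈ Metric.sphere (0 : ℂ) 1 := hkf ▸ mem_image_of_mem k hx
      refine ⟨k x, hkx, hei (hsub (hτS _ hkx)) (hsub hw) ?_⟩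
      rw [hτ _ hkx, k.symm_apply_apply, hxw]
  obtain ⟨Θ, hΘc, hΘb, hΘτ⟩ := exists_radial_extension hτc hτb
  have hkm : MapsTo k K (Metric.closedBall 0 1) := fun z hz => hkK ▸ mem_image_of_mem k hz
  refine ⟨fun z => e (Θ (k z)), ?_, ?_, ?_, ?_⟩
  · exact hec.comp (hΘc.comp k.continuous.continuousOn hkm) fun z hz => hΘb.mapsTo (hkm hz)
  · intro z hz w hw h
    exact k.injective (hΘb.injOn (hkm hz) (hkm hw)
      (hei (hΘb.mapsTo (hkm hz)) (hΘb.mapsTo (hkm hw)) h))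
  · rw [← heA, ← hΘb.image_eq, ← hkK, image_image, image_image]
  · intro z hz
    have hkz : k z ∈ Metric.sphere (0 : ℂ) 1 := hkf ▸ mem_image_of_mem k hz
    change e (Θ (k z)) = b z
    rw [hΘτ hkz, hτ _ hkz, k.symm_apply_apply]

theorem IsDiskIn.of_convex {K : Set ℂ} (hK : Convex ℝ K) (hKc : IsCompact K)
    (hne : (interior K).Nonempty) {e : ℂ → E} (he : ContinuousOn e K) (hei : InjOn e K) :
    IsDiskIn (e '' K) (e '' frontier K) := by
  obtain ⟨k, -, hkK, hkf⟩ :=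
    exists_homeomorph_image_interior_closure_frontier_eq_unitBall hK hne hKc.isBounded
  rw [hKc.isClosed.closure_eq] at hkK
  have hm : MapsTo k.symm (Metric.closedBall 0 1) K := by
    rintro z hz
    rw [← hkK] at hz
    obtain ⟨w, hw, rfl⟩ := hz
    simpa
  refine ⟨e ∘ k.symm, he.comp k.symm.continuous.continuousOn hm, ?_, ?_, ?_⟩
  · exact hei.comp k.symm.injective.injOn hm
  · rw [← hkK, image_comp, ← image_comp k.symm, k.symm_comp_self, image_id]
  · rw [← hkf, image_comp, ← image_comp k.symm, k.symm_comp_self, image_id]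

/-- The closed upper half of the unit disk. -/
def upperHalfDisk : Set ℂ := Metric.closedBall 0 1 ∩ {z | 0 ≤ z.im}

theorem frontier_upperHalfDisk : frontier upperHalfDisk =
    {z | ‖z‖ ≤ 1 ∧ z.im = 0} ∪ {z | ‖z‖ = 1 ∧ 0 ≤ z.im} := by
  have hcl : IsClosed upperHalfDisk :=
    Metric.isClosed_closedBall.inter (isClosed_le continuous_const Complex.continuous_im)
  rw [hcl.frontier_eq, upperHalfDisk, interior_inter, interior_closedBall _ one_ne_zero,
    Complex.interior_setOfPred_le_im]
  ext z
  simp only [mem_sdiff, mem_inter_iff, mem_closedBall_zero_iff, mem_ofPred_eq, mem_ball_zero_iff,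
    not_and, not_lt, mem_union]
  constructor
  · rintro ⟨⟨h1, h2⟩, h3⟩
    rcases h1.eq_or_lt with h | h
    · exact Or.inr ⟨h, h2⟩
    · exact Or.inl ⟨h1, le_antisymm (h3 h) h2⟩
  · rintro (⟨h1, h2⟩ | ⟨h1, h2⟩)
    · exact ⟨⟨h1, h2.ge⟩, fun _ => h2.le⟩
    · exact ⟨⟨h1.le, h2⟩, fun h => absurd h1 h.ne⟩

theorem convex_upperHalfDisk : Convex ℝ upperHalfDisk :=
  (convex_closedBall _ _).inter (convex_halfSpace_ge Complex.imLm.isLinear 0)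

theorem isCompact_upperHalfDisk : IsCompact upperHalfDisk :=
  (isCompact_closedBall _ _).inter_right (isClosed_le continuous_const Complex.continuous_im)

theorem interior_upperHalfDisk_nonempty : (interior upperHalfDisk).Nonempty := by
  rw [upperHalfDisk, interior_inter, interior_closedBall _ one_ne_zero,
    Complex.interior_setOfPred_le_im]
  refine ⟨⟨0, 1 / 2⟩, ?_, ?_⟩
  · rw [mem_ball_zero_iff]
    have : (⟨0, 1 / 2⟩ : ℂ) = ((1 / 2 : ℝ) : ℂ) * Complex.I := by
      apply Complex.ext <;> simp
    rw [this, norm_mul, Complex.norm_I, Complex.norm_real]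
    norm_num
  · change (0 : ℝ) < 1 / 2
    norm_num

/-- Prepares the gluing of two disks along `c`: the arc `c` goes to the diameter with a prescribed
parametrization and `a` goes to the semicircle. Both are parametrized by the real part, so they
match at the points `-1` and `1`. -/
theorem IsDiskIn.exists_halfDisk_param [T2Space E] {A c a : Set E} {p q : E}
    (hA : IsDiskIn A (c ∪ a)) {γ : ℝ → E} (hγ : ContinuousOn γ (Icc 0 1))
    (hγi : InjOn γ (Icc 0 1)) (hγ0 : γ 0 = p) (hγ1 : γ 1 = q) (hγc : γ '' Icc 0 1 = c)
    (ha : IsArcIn a p q) (hca : c ∩ a ⊆ {p, q}) :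
    ∃ e : ℂ → E, ContinuousOn e upperHalfDisk ∧ InjOn e upperHalfDisk ∧ e '' upperHalfDisk = A ∧
      (∀ z : ℂ, ‖z‖ ≤ 1 → z.im = 0 → e z = γ ((z.re + 1) / 2)) ∧
      e '' {z | ‖z‖ = 1 ∧ 0 ≤ z.im} = a := by
  obtain ⟨δ, hδ, hδi, hδ0, hδ1, rfl⟩ := ha
  subst hγc
  let b : ℂ → E := fun z => if z.im = 0 then γ ((z.re + 1) / 2) else δ ((z.re + 1) / 2)
  have hre : ∀ z : ℂ, ‖z‖ ≤ 1 → (z.re + 1) / 2 ∈ Icc (0 : ℝ) 1 := by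
    intro z hz
    have := abs_le.1 ((Complex.abs_re_le_norm z).trans hz)
    exact ⟨by linarith, by linarith⟩
  have hsq : ∀ z : ℂ, ‖z‖ = 1 → z.re ^ 2 + z.im ^ 2 = 1 := by
    intro z hz
    have := Complex.sq_norm z
    rw [hz, Complex.normSq_apply] at this
    linarith
  have b1 : ∀ z : ℂ, z.im = 0 → b z = γ ((z.re + 1) / 2) := fun z hz => if_pos hz
  have b2 : ∀ z : ℂ, ‖z‖ = 1 → b z = δ ((z.re + 1) / 2) := by
    intro z hz
    by_cases h : z.im = 0
    · rw [b1 z h]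
      have := hsq z hz
      rw [h] at this
      have h2 : (z.re - 1) * (z.re + 1) = 0 := by linarith
      rcases mul_eq_zero.1 h2 with h2 | h2
      · rw [show z.re = 1 by linarith]; norm_num [hγ1, hδ1]
      · rw [h2]; norm_num [hγ0, hδ0]
    · exact if_neg h
  have hfr := frontier_upperHalfDisk
  have hbc : ContinuousOn b (frontier upperHalfDisk) := by
    rw [hfr]
    refine ContinuousOn.union_of_isClosed ?_ ?_ ?_ ?_
    · exact (hγ.comp (Continuous.continuousOn (by fun_prop)) fun z hz => hre z hz.1).congr
        fun z hz => b1 z hz.2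
    · exact (hδ.comp (Continuous.continuousOn (by fun_prop)) fun z hz => hre z hz.1.le).congr
        fun z hz => b2 z hz.1
    · exact (isClosed_le continuous_norm continuous_const).inter
        (isClosed_eq Complex.continuous_im continuous_const)
    · exact (isClosed_eq continuous_norm continuous_const).inter
        (isClosed_le continuous_const Complex.continuous_im)
  have hcross : ∀ z w : ℂ, ‖z‖ ≤ 1 → z.im = 0 → ‖w‖ = 1 → 0 ≤ w.im → b z = b w → z = w := by
    intro z w hz hz0 hw hw0 h
    have hmem := hca ⟨⟨_, hre z hz, (b1 z hz0).symm⟩, ⟨_, hre w hw.le, by rw [h, b2 w hw]⟩⟩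
    have hb1 := b1 z hz0
    have hb2 := b2 w hw
    have hw' := hsq w hw
    rcases hmem with h' | h'
    · have e1 := hγi (hre z hz) (left_mem_Icc.2 zero_le_one) (by rw [← hb1, h', hγ0])
      have e2 := hδi (hre w hw.le) (left_mem_Icc.2 zero_le_one) (by rw [← hb2, ← h, h', hδ0])
      have e3 : w.re = -1 := by linarith
      rw [e3] at hw'
      apply Complex.ext
      · linarith
      · rw [hz0, eq_comm]; exact pow_eq_zero_iff two_ne_zero |>.1 (by linarith)
    · have e1 := hγi (hre z hz) (right_mem_Icc.2 zero_le_one) (by rw [← hb1, h', hγ1])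
      have e2 := hδi (hre w hw.le) (right_mem_Icc.2 zero_le_one) (by rw [← hb2, ← h, h', hδ1])
      have e3 : w.re = 1 := by linarith
      rw [e3] at hw'
      apply Complex.ext
      · linarith
      · rw [hz0, eq_comm]; exact pow_eq_zero_iff two_ne_zero |>.1 (by linarith)
  have hbi : InjOn b (frontier upperHalfDisk) := by
    rw [hfr]
    rintro z (⟨hz, hz0⟩ | ⟨hz, hz0⟩) w (⟨hw, hw0⟩ | ⟨hw, hw0⟩) h
    · rw [b1 z hz0, b1 w hw0] at h
      have := hγi (hre z hz) (hre w hw) h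
      exact Complex.ext (by linarith) (hz0.trans hw0.symm)
    · exact hcross z w hz hz0 hw hw0 h
    · exact (hcross w z hw hw0 hz hz0 h.symm).symm
    · rw [b2 z hz, b2 w hw] at h
      have := hδi (hre z hz.le) (hre w hw.le) h
      have hre : z.re = w.re := by linarith
      have h1 := hsq z hz
      have h2 := hsq w hw
      rw [hre] at h1
      refine Complex.ext hre ?_
      exact (pow_left_inj₀ hz0 hw0 two_ne_zero).1 (by linarith)
  have him1 : b '' {z | ‖z‖ ≤ 1 ∧ z.im = 0} = γ '' Icc 0 1 := by
    apply Subset.antisymm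
    · rintro _ ⟨z, hz, rfl⟩
      exact ⟨_, hre z hz.1, (b1 z hz.2).symm⟩
    · rintro _ ⟨t, ht, rfl⟩
      refine ⟨((2 * t - 1 : ℝ) : ℂ), ⟨?_, Complex.ofReal_im _⟩, ?_⟩
      · rw [Complex.norm_real, Real.norm_eq_abs, abs_le]
        exact ⟨by linarith [ht.1], by linarith [ht.2]⟩
      · rw [b1 _ (Complex.ofReal_im _), Complex.ofReal_re]
        congr 1
        ring
  have him2 : b '' {z | ‖z‖ = 1 ∧ 0 ≤ z.im} = δ '' Icc 0 1 := by
    apply Subset.antisymm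
    · rintro _ ⟨z, hz, rfl⟩
      exact ⟨_, hre z hz.1.le, (b2 z hz.1).symm⟩
    · rintro _ ⟨t, ht, rfl⟩
      have h0 : 0 ≤ 1 - (2 * t - 1) ^ 2 := by nlinarith [ht.1, ht.2]
      have hnorm : ‖(⟨2 * t - 1, √(1 - (2 * t - 1) ^ 2)⟩ : ℂ)‖ = 1 := by
        rw [← sq_eq_sq₀ (norm_nonneg _) zero_le_one, Complex.sq_norm, Complex.normSq_apply]
        simp only
        rw [Real.mul_self_sqrt h0]
        ring
      refine ⟨⟨2 * t - 1, √(1 - (2 * t - 1) ^ 2)⟩, ⟨hnorm, Real.sqrt_nonneg _⟩, ?_⟩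
      rw [b2 _ hnorm]
      congr 1
      ring
  obtain ⟨e, hec, hei, heA, heb⟩ := hA.exists_param convex_upperHalfDisk isCompact_upperHalfDisk
    interior_upperHalfDisk_nonempty hbc hbi (by rw [hfr, image_union, him1, him2])
  refine ⟨e, hec, hei, heA, fun z hz hz0 => ?_, ?_⟩
  · rw [heb (by rw [hfr]; exact Or.inl ⟨hz, hz0⟩), b1 z hz0]
  · rw [← him2]
    exact image_congr fun z hz => heb (by rw [hfr]; exact Or.inr hz)

/-- Two disks which meet in a common boundary arc form a disk. -/
theorem IsDiskIn.union [T2Space E] {A B c a b : Set E} {p q : E} (hA : IsDiskIn A (c ∪ a))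
    (hB : IsDiskIn B (c ∪ b)) (hc : IsArcIn c p q) (ha : IsArcIn a p q) (hb : IsArcIn b p q)
    (hca : c ∩ a ⊆ {p, q}) (hcb : c ∩ b ⊆ {p, q}) (hAB : A ∩ B ⊆ c) :
    IsDiskIn (A ∪ B) (a ∪ b) := by
  obtain ⟨γ, hγ, hγi, hγ0, hγ1, hγc⟩ := hc
  obtain ⟨e, hec, hei, heA, heγ, hea⟩ := hA.exists_halfDisk_param hγ hγi hγ0 hγ1 hγc ha hca
  obtain ⟨f, hfc, hfi, hfB, hfγ, hfb⟩ := hB.exists_halfDisk_param hγ hγi hγ0 hγ1 hγc hb hcb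
  let conj : ℂ → ℂ := fun z => starRingEnd ℂ z
  have hconj : Continuous conj := Complex.continuous_conj
  have hcim : ∀ z, (conj z).im = -z.im := Complex.conj_im
  have hcre : ∀ z, (conj z).re = z.re := Complex.conj_re
  have hcn : ∀ z, ‖conj z‖ = ‖z‖ := Complex.norm_conj
  have hcc : ∀ z, conj (conj z) = z := Complex.conj_conj
  let L : Set ℂ := Metric.closedBall 0 1 ∩ {z | z.im ≤ 0}
  have hL : MapsTo conj L upperHalfDisk := by
    rintro z ⟨h1, h2⟩
    refine ⟨by rw [mem_closedBall_zero_iff] at h1 ⊢; rwa [hcn], ?_⟩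
    change 0 ≤ (conj z).im
    rw [hcim]
    simpa using h2
  have hUL : Metric.closedBall (0 : ℂ) 1 = upperHalfDisk ∪ L := by
    rw [upperHalfDisk, ← inter_union_distrib_left]
    symm
    rw [inter_eq_left]
    intro z _
    exact le_total 0 z.im
  -- One disk fills the upper half, the other the reflected lower half; on the diameter both are
  -- given by the same `γ`.
  let g : ℂ → E := fun z => if 0 ≤ z.im then e z else f (conj z)
  have g1 : ∀ z ∈ upperHalfDisk, g z = e z := fun z hz => if_pos hz.2
  have g2 : ∀ z ∈ L, g z = f (conj z) := by
    intro z hz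
    have hz1 := mem_closedBall_zero_iff.1 hz.1
    by_cases h : 0 ≤ z.im
    · have h0 : z.im = 0 := le_antisymm hz.2 h
      rw [g1 z ⟨hz.1, h⟩, heγ z hz1 h0, hfγ (conj z) (by rwa [hcn]) (by rw [hcim, h0, neg_zero]),
        hcre]
    · exact if_neg h
  have hcpt : ∀ (h : ℂ → E), InjOn h upperHalfDisk →
      (∀ z : ℂ, ‖z‖ ≤ 1 → z.im = 0 → h z = γ ((z.re + 1) / 2)) →
      ∀ z ∈ upperHalfDisk, h z ∈ c → z.im = 0 := by
    intro h hi hh z hz hzc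
    rw [← hγc] at hzc
    obtain ⟨t, ht, htz⟩ := hzc
    have hn : ‖((2 * t - 1 : ℝ) : ℂ)‖ ≤ 1 := by
      rw [Complex.norm_real, Real.norm_eq_abs, abs_le]
      exact ⟨by linarith [ht.1], by linarith [ht.2]⟩
    have h1 := hh ((2 * t - 1 : ℝ) : ℂ) hn (Complex.ofReal_im _)
    rw [Complex.ofReal_re, show (2 * t - 1 + 1) / 2 = t by ring, htz] at h1
    have h2 := hi ⟨mem_closedBall_zero_iff.2 hn, (Complex.ofReal_im _).ge⟩ hz h1
    rw [← h2, Complex.ofReal_im]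
  have hcross : ∀ z ∈ upperHalfDisk, ∀ w ∈ L, g z = g w → z = w := by
    intro z hz w hw h
    rw [g1 z hz, g2 w hw] at h
    have hmem : e z ∈ c := hAB ⟨heA ▸ mem_image_of_mem e hz, h ▸ hfB ▸ mem_image_of_mem f (hL hw)⟩
    have hz0 := hcpt e hei heγ z hz hmem
    have hw0 := hcpt f hfi hfγ (conj w) (hL hw) (h ▸ hmem)
    rw [hcim, neg_eq_zero] at hw0
    have hwU : w ∈ upperHalfDisk := ⟨hw.1, hw0.ge⟩
    refine hei hz hwU ?_
    rw [h, ← g2 w hw, g1 w hwU]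
  refine ⟨g, ?_, ?_, ?_, ?_⟩
  · rw [hUL]
    refine ContinuousOn.union_of_isClosed (hec.congr g1)
      ((hfc.comp hconj.continuousOn hL).congr g2) isCompact_upperHalfDisk.isClosed
      (Metric.isClosed_closedBall.inter (isClosed_le Complex.continuous_im continuous_const))
  · rw [hUL]
    rintro z (hz | hz) w (hw | hw) h
    · rw [g1 z hz, g1 w hw] at h
      exact hei hz hw h
    · exact hcross z hz w hw h
    · exact (hcross w hw z hz h.symm).symm
    · rw [g2 z hz, g2 w hw] at h
      rw [← hcc z, hfi (hL hz) (hL hw) h, hcc]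
  · rw [hUL, image_union]
    congr 1
    · rw [← heA]; exact image_congr g1
    · rw [← hfB]
      apply Subset.antisymm
      · rintro _ ⟨z, hz, rfl⟩
        exact ⟨_, hL hz, (g2 z hz).symm⟩
      · rintro _ ⟨z, hz, rfl⟩
        have : conj z ∈ L := by
          refine ⟨?_, ?_⟩
          · have := hz.1
            rw [mem_closedBall_zero_iff] at this ⊢
            rwa [hcn]
          · change (conj z).im ≤ 0
            rw [hcim]
            simpa using hz.2
        exact ⟨_, this, by rw [g2 _ this, hcc]⟩
  · have hS : Metric.sphere (0 : ℂ) 1 = {z | ‖z‖ = 1 ∧ 0 ≤ z.im} ∪ {z | ‖z‖ = 1 ∧ z.im ≤ 0} := by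
      ext z
      simp only [mem_sphere_zero_iff_norm, mem_union, mem_ofPred_eq]
      have := le_total 0 z.im
      tauto
    rw [hS, image_union]
    congr 1
    · rw [← hea]
      exact image_congr fun z hz => g1 z ⟨mem_closedBall_zero_iff.2 hz.1.le, hz.2⟩
    · rw [← hfb]
      have hl : ∀ z : ℂ, ‖z‖ = 1 ∧ z.im ≤ 0 → z ∈ L := fun z hz =>
        ⟨mem_closedBall_zero_iff.2 hz.1.le, hz.2⟩
      apply Subset.antisymm
      · rintro _ ⟨z, hz, rfl⟩
        exact ⟨conj z, ⟨(hcn z).trans hz.1, (hL (hl z hz)).2⟩, (g2 z (hl z hz)).symm⟩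
      · rintro _ ⟨z, hz, rfl⟩
        have h1 : ‖conj z‖ = 1 ∧ (conj z).im ≤ 0 := ⟨(hcn z).trans hz.1, by
          rw [hcim]; simpa using hz.2⟩
        exact ⟨conj z, h1, by rw [g2 _ (hl _ h1), hcc]⟩

end Disk

/-! ### Simplices and polygonal paths in `V → ℝ` -/

section Simplex

variable {V : Type*}

theorem simplexOf_mono {s t : Finset V} (h : s ⊆ t) : simplexOf s ⊆ simplexOf t := by
  rintro x ⟨h0, h1, h2⟩
  refine ⟨h0, fun v hv => h1 v fun hs => hv (h hs), ?_⟩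
  rw [← h2]
  exact (Finset.sum_subset h fun v _ hv => h1 v hv).symm

variable [DecidableEq V]

/-- Simplices spanned by unit vectors meet exactly in their common face. Intersections in the
realization are thus computed on vertex sets. -/
theorem simplexOf_inter (s t : Finset V) : simplexOf s ∩ simplexOf t = simplexOf (s ∩ t) := by
  apply Subset.antisymm
  · rintro x ⟨⟨h0, h1, h2⟩, ⟨-, h3, -⟩⟩
    refine ⟨h0, fun v hv => ?_, ?_⟩
    · rw [Finset.mem_inter, not_and_or] at hv
      exact hv.elim (h1 v) (h3 v)
    · rw [← h2]
      exact Finset.sum_subset Finset.inter_subset_left fun v hv hv' =>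
        h3 v fun hvt => hv' (Finset.mem_inter.2 ⟨hv, hvt⟩)
  · exact subset_inter (simplexOf_mono Finset.inter_subset_left)
      (simplexOf_mono Finset.inter_subset_right)

theorem simplexOf_singleton (v : V) : simplexOf {v} = {Pi.single v (1 : ℝ)} := by
  ext x
  constructor
  · rintro ⟨-, h1, h2⟩
    rw [Finset.sum_singleton] at h2
    refine mem_singleton_iff.2 (funext fun w => ?_)
    by_cases hw : w = v
    · subst hw; simpa using h2
    · rw [h1 w (by simpa using hw), Pi.single_eq_of_ne hw]
  · rintro rfl
    refine ⟨fun w => ?_, fun w hw => ?_, by simp⟩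
    · by_cases hw : w = v
      · subst hw; simp
      · simp [Pi.single_eq_of_ne hw]
    · rw [Pi.single_eq_of_ne (by simpa using hw)]

/-- A point of a simplex whose coordinate at `v` vanishes lies in the opposite face. -/
theorem mem_simplexOf_erase {t : Finset V} {x : V → ℝ} (hx : x ∈ simplexOf t) {v : V}
    (hv : x v = 0) : x ∈ simplexOf (t.erase v) := by
  refine ⟨hx.1, fun w hw => ?_, ?_⟩
  · by_cases hwv : w = v
    · rw [hwv, hv]
    · exact hx.2.1 w fun h => hw (Finset.mem_erase.2 ⟨hwv, h⟩)
  · rw [← hx.2.2]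
    exact Finset.sum_erase t hv

theorem eq_single_of_mem_simplexOf_pair {u v : V} (huv : u ≠ v) {x : V → ℝ}
    (hx : x ∈ simplexOf {u, v}) (hv : x v = 0) : x = Pi.single u 1 := by
  have := mem_simplexOf_erase hx hv
  rw [show ({u, v} : Finset V).erase v = {u} by
    ext w
    simp only [Finset.mem_erase, Finset.mem_insert, Finset.mem_singleton]
    constructor
    · tauto
    · rintro rfl; exact ⟨huv, Or.inl rfl⟩, simplexOf_singleton] at this
  exact this

theorem isArcIn_simplexOf_pair {u v : V} (huv : u ≠ v) :
    IsArcIn (simplexOf {u, v}) (Pi.single u (1 : ℝ)) (Pi.single v (1 : ℝ)) := by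
  let γ : ℝ → V → ℝ := fun t => (1 - t) • Pi.single u (1 : ℝ) + t • Pi.single v (1 : ℝ)
  have hu : ∀ t, γ t u = 1 - t := fun t => by simp [γ, Pi.single_eq_of_ne huv]
  have hv : ∀ t, γ t v = t := fun t => by simp [γ, Pi.single_eq_of_ne huv.symm]
  have hw : ∀ t w, w ≠ u → w ≠ v → γ t w = 0 := fun t w h1 h2 => by
    simp [γ, Pi.single_eq_of_ne h1, Pi.single_eq_of_ne h2]
  refine ⟨γ, ?_, ?_, by simp [γ], by simp [γ], ?_⟩
  · exact Continuous.continuousOn (by fun_prop)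
  · intro s _ t _ h
    rw [← hv s, h, hv]
  · apply Subset.antisymm
    · rintro _ ⟨t, ht, rfl⟩
      refine ⟨fun w => ?_, fun w hw' => ?_, ?_⟩
      · by_cases h1 : w = u
        · rw [h1, hu]; linarith [ht.2]
        by_cases h2 : w = v
        · rw [h2, hv]; exact ht.1
        rw [hw t w h1 h2]
      · simp only [Finset.mem_insert, Finset.mem_singleton, not_or] at hw'
        exact hw t w hw'.1 hw'.2
      · rw [Finset.sum_pair huv, hu, hv]; ring
    · rintro x ⟨h0, h1, h2⟩
      rw [Finset.sum_pair huv] at h2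
      refine ⟨x v, ⟨h0 v, by linarith [h0 u]⟩, funext fun w => ?_⟩
      by_cases hwu : w = u
      · rw [hwu, hu]; linarith
      by_cases hwv : w = v
      · rw [hwv, hv]
      rw [hw _ w hwu hwv, h1 w (by simp [hwu, hwv])]

/-- The polygonal path through the unit vectors of a list. -/
def pathSet : List V → Set (V → ℝ)
  | [] => ∅
  | [x] => simplexOf {x}
  | x :: y :: l => simplexOf {x, y} ∪ pathSet (y :: l)

theorem pathSet_cons_cons (x y : V) (l : List V) :
    pathSet (x :: y :: l) = simplexOf {x, y} ∪ pathSet (y :: l) := rfl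

theorem eq_zero_of_mem_pathSet {l : List V} {v : V} (hv : v ∉ l) {x : V → ℝ}
    (hx : x ∈ pathSet l) : x v = 0 := by
  induction l with
  | nil => exact absurd hx (notMem_empty x)
  | cons y l ih =>
    cases l with
    | nil => exact hx.2.1 v (by simpa using hv)
    | cons z l =>
      rcases hx with hx | hx
      · exact hx.2.1 v (by simp at hv ⊢; tauto)
      · exact ih (fun h => hv (List.mem_cons_of_mem _ h)) hx

theorem pathSet_append (l : List V) (x : V) (l' : List V) :
    pathSet (l ++ x :: l') = pathSet (l ++ [x]) ∪ pathSet (x :: l') := by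
  induction l with
  | nil =>
    have : pathSet [x] ⊆ pathSet (x :: l') := by
      cases l' with
      | nil => exact Subset.rfl
      | cons y l' => exact (simplexOf_mono (by simp)).trans subset_union_left
    exact (union_eq_right.2 this).symm
  | cons y l ih =>
    cases l with
    | nil =>
      simp only [List.cons_append, List.nil_append, pathSet_cons_cons]
      rw [union_assoc]
      congr 1
    | cons z l =>
      simp only [List.cons_append, pathSet_cons_cons] at ih ⊢
      rw [ih, union_assoc]

/-- The coordinate at `x` vanishes on the rest of the path, so the first edge meets the rest only in
the vertex `y`. -/
theorem isArcIn_pathSet {x y : V} {l : List V} (h : (x :: y :: l).Nodup) :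
    IsArcIn (pathSet (x :: y :: l)) (Pi.single x (1 : ℝ))
      (Pi.single ((y :: l).getLast (List.cons_ne_nil _ _)) (1 : ℝ)) := by
  induction l generalizing x y with
  | nil =>
    have hxy : x ≠ y := by simpa using h
    have : pathSet [x, y] = simplexOf {x, y} := by
      rw [pathSet_cons_cons, union_eq_left]
      exact simplexOf_mono (by simp)
    rw [this]
    exact isArcIn_simplexOf_pair hxy
  | cons z l ih =>
    have hxy : x ≠ y := by
      rintro rfl
      simp at h
    rw [pathSet_cons_cons]
    refine (isArcIn_simplexOf_pair hxy).trans (ih (List.nodup_cons.1 h).2) ?_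
    rintro p ⟨hp, hp'⟩
    have h0 : p x = 0 := eq_zero_of_mem_pathSet (List.nodup_cons.1 h).1 hp'
    rw [Finset.pair_comm] at hp
    exact eq_single_of_mem_simplexOf_pair hxy.symm hp h0

/-- The closed polygon through the unit vectors of a list. -/
def cycleSet : List V → Set (V → ℝ)
  | [] => ∅
  | x :: l => pathSet (x :: l ++ [x])

/-- The two starting vertices cut the closed polygon into the same two paths. -/
theorem cycleSet_append_comm (l l' : List V) : cycleSet (l ++ l') = cycleSet (l' ++ l) := by
  cases l with
  | nil => simp
  | cons x a =>
    cases l' with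
    | nil => simp
    | cons y b =>
      have h1 : cycleSet (x :: a ++ y :: b) = pathSet (x :: a ++ y :: (b ++ [x])) := by
        simp [cycleSet]
      have h2 : cycleSet (y :: b ++ x :: a) = pathSet (y :: b ++ x :: (a ++ [y])) := by
        simp [cycleSet]
      rw [h1, h2, pathSet_append (x :: a) y (b ++ [x]), pathSet_append (y :: b) x (a ++ [y]),
        union_comm]
      rfl

theorem isDiskIn_simplexOf {u v w : V} (huv : u ≠ v) (hvw : v ≠ w) (huw : u ≠ w) :
    IsDiskIn (simplexOf {u, v, w})
      (simplexOf {u, v} ∪ simplexOf {v, w} ∪ simplexOf {u, w}) := by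
  -- An equilateral triangle serves as planar model; only its barycentric coordinates are used.
  obtain ⟨b, -⟩ := exists_affineBasis_dist_eq (fun i j => if i = j then 0 else 1)
    (fun i j => by simp [eq_comm]) (fun i => by simp) (fun i j k h1 h2 h3 => by
      simp only [if_neg h1, if_neg h2.symm, if_neg h3]; norm_num)
  let e : ℂ → V → ℝ := fun x => b.coord 0 x • Pi.single u (1 : ℝ) +
    b.coord 1 x • Pi.single v (1 : ℝ) + b.coord 2 x • Pi.single w (1 : ℝ)
  have eu : ∀ x, e x u = b.coord 0 x := fun x => by
    simp [e, Pi.single_eq_of_ne huv, Pi.single_eq_of_ne huw]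
  have ev : ∀ x, e x v = b.coord 1 x := fun x => by
    simp [e, Pi.single_eq_of_ne huv.symm, Pi.single_eq_of_ne hvw]
  have ew : ∀ x, e x w = b.coord 2 x := fun x => by
    simp [e, Pi.single_eq_of_ne huw.symm, Pi.single_eq_of_ne hvw.symm]
  have e0 : ∀ x z, z ≠ u → z ≠ v → z ≠ w → e x z = 0 := fun x z h1 h2 h3 => by
    simp [e, Pi.single_eq_of_ne h1, Pi.single_eq_of_ne h2, Pi.single_eq_of_ne h3]
  have hcont : ∀ i, Continuous (b.coord i) := fun i => (b.coord i).continuous_of_finiteDimensional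
  have h1 := IsDiskIn.of_convex (e := e) (convex_convexHull ℝ (range b)) b.isCompact_convexHull
    ⟨_, b.centroid_mem_interior_convexHull⟩
    (Continuous.continuousOn (by
      have := hcont 0; have := hcont 1; have := hcont 2
      fun_prop)) (fun x _ y _ h => b.ext_elem fun i => by
        fin_cases i
        · simpa [eu] using congrFun h u
        · simpa [ev] using congrFun h v
        · simpa [ew] using congrFun h w)
  have hsum : ∀ x : V → ℝ, ∑ z ∈ {u, v, w}, x z = x u + x v + x w := by
    intro x
    rw [Finset.sum_insert (by simp [huv, huw]), Finset.sum_pair hvw]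
    ring
  have hmemc : ∀ y ∈ simplexOf {u, v, w}, ∃ x, e x = y ∧ (∀ i, 0 ≤ b.coord i x) := by
    rintro y ⟨y0, y1, y2⟩
    rw [hsum] at y2
    let c : Fin 3 → ℝ := ![y u, y v, y w]
    have hs : ∑ i, c i = 1 := by rw [Fin.sum_univ_three]; exact y2
    have hc : ∀ i, b.coord i (∑ k, c k • b k) = c i := by
      intro i
      have := b.coord_apply_combination_of_mem (Finset.mem_univ i) hs
      rwa [Finset.univ.affineCombination_eq_linear_combination _ _ hs] at this
    refine ⟨∑ k, c k • b k, funext fun z => ?_, fun i => ?_⟩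
    · by_cases hzu : z = u
      · rw [hzu, eu, hc]; rfl
      by_cases hzv : z = v
      · rw [hzv, ev, hc]; rfl
      by_cases hzw : z = w
      · rw [hzw, ew, hc]; rfl
      rw [e0 _ z hzu hzv hzw, y1 z (by simp [hzu, hzv, hzw])]
    · rw [hc]
      fin_cases i
      exacts [y0 u, y0 v, y0 w]
  have hmem : ∀ x, (∀ i, 0 ≤ b.coord i x) → e x ∈ simplexOf {u, v, w} := by
    intro x hx
    refine ⟨fun z => ?_, fun z hz => ?_, ?_⟩
    · by_cases hzu : z = u
      · rw [hzu, eu]; exact hx 0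
      by_cases hzv : z = v
      · rw [hzv, ev]; exact hx 1
      by_cases hzw : z = w
      · rw [hzw, ew]; exact hx 2
      rw [e0 _ z hzu hzv hzw]
    · simp only [Finset.mem_insert, Finset.mem_singleton, not_or] at hz
      exact e0 x z hz.1 hz.2.1 hz.2.2
    · rw [hsum, eu, ev, ew, b.sum_coord_three]
  have hA : e '' convexHull ℝ (range b) = simplexOf {u, v, w} := by
    rw [b.convexHull_eq_nonneg_coord]
    apply Subset.antisymm
    · rintro _ ⟨x, hx, rfl⟩
      exact hmem x hx
    · intro y hy
      obtain ⟨x, rfl, hx⟩ := hmemc y hy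
      exact ⟨x, hx, rfl⟩
  have er0 : ({u, v, w} : Finset V).erase u = {v, w} :=
    Finset.erase_insert (by simp [huv, huw])
  have er1 : ({u, v, w} : Finset V).erase v = {u, w} := by
    rw [Finset.insert_comm]; exact Finset.erase_insert (by simp [huv.symm, hvw])
  have er2 : ({u, v, w} : Finset V).erase w = {u, v} := by
    rw [Finset.pair_comm v w, Finset.insert_comm]
    exact Finset.erase_insert (by simp [huw.symm, hvw.symm])
  have hB : e '' frontier (convexHull ℝ (range b)) =
      simplexOf {u, v} ∪ simplexOf {v, w} ∪ simplexOf {u, w} := by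
    rw [b.frontier_convexHull]
    apply Subset.antisymm
    · rintro _ ⟨x, ⟨hx, i, hi⟩, rfl⟩
      fin_cases i
      · exact Or.inl (Or.inr (er0 ▸ mem_simplexOf_erase (hmem x hx) ((eu x).trans hi)))
      · exact Or.inr (er1 ▸ mem_simplexOf_erase (hmem x hx) ((ev x).trans hi))
      · exact Or.inl (Or.inl (er2 ▸ mem_simplexOf_erase (hmem x hx) ((ew x).trans hi)))
    · rintro y ((hy | hy) | hy)
      · obtain ⟨x, rfl, hx⟩ := hmemc y (simplexOf_mono (by
          intro z; simp only [Finset.mem_insert, Finset.mem_singleton]; tauto) hy)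
        exact ⟨x, ⟨hx, 2, by rw [← ew]; exact hy.2.1 w (by simp [huw.symm, hvw.symm])⟩, rfl⟩
      · obtain ⟨x, rfl, hx⟩ := hmemc y (simplexOf_mono (by
          intro z; simp only [Finset.mem_insert, Finset.mem_singleton]; tauto) hy)
        exact ⟨x, ⟨hx, 0, by rw [← eu]; exact hy.2.1 u (by simp [huv, huw])⟩, rfl⟩
      · obtain ⟨x, rfl, hx⟩ := hmemc y (simplexOf_mono (by
          intro z; simp only [Finset.mem_insert, Finset.mem_singleton]; tauto) hy)
        exact ⟨x, ⟨hx, 1, by rw [← ev]; exact hy.2.1 v (by simp [huv.symm, hvw])⟩, rfl⟩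
  rwa [hA, hB] at h1

/-! ### Shellings -/

/-- `Shelling T l` means that the faces `T` are obtained from a single triangle by successively
adding triangles along one or two consecutive boundary edges, and that `l` is the cyclic list of
boundary vertices. -/
inductive Shelling : Finset (Finset V) → List V → Prop
  | base {u v w : V} : u ≠ v → v ≠ w → u ≠ w → Shelling {{u, v, w}} [u, v, w]
  | rot {T : Finset (Finset V)} (l l' : List V) : Shelling T (l ++ l') → Shelling T (l' ++ l)
  | ear {T : Finset (Finset V)} {u v : V} {l : List V} (z : V) : Shelling T (u :: v :: l) →
      (∀ t ∈ T, z ∉ t) → Shelling (insert {u, v, z} T) (u :: z :: v :: l)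
  -- The new edge from `u` to `w` must not be present already, or the triangle would meet the old
  -- disk outside the two edges at `v`. The case `l = []` would cap off a boundary triangle and
  -- leave no disk.
  | fill {T : Finset (Finset V)} {u v w : V} {l : List V} : Shelling T (u :: v :: w :: l) →
      l ≠ [] → (∀ t ∈ T, u ∈ t → w ∉ t) → Shelling (insert {u, v, w} T) (u :: w :: l)

namespace Shelling

variable {T : Finset (Finset V)} {l : List V}

theorem nodup_and_mem (h : Shelling T l) :
    l.Nodup ∧ 3 ≤ l.length ∧ ∀ v ∈ l, ∃ t ∈ T, v ∈ t := by
  induction h with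
  | base huv hvw huw => simp [huv, hvw, huw]
  | rot l l' h ih =>
    refine ⟨(List.perm_append_comm.nodup_iff).1 ih.1, ?_, fun v hv => ih.2.2 v ?_⟩
    · have := ih.2.1
      simp only [List.length_append] at this ⊢
      omega
    · simp only [List.mem_append] at hv ⊢
      tauto
  | @ear T u v l z h hz ih =>
    obtain ⟨h1, h2, h3⟩ := ih
    refine ⟨?_, by simp at h2 ⊢, fun x hx => ?_⟩
    · have hz' : z ∉ u :: v :: l := fun hzl => by
        obtain ⟨t, ht, hzt⟩ := h3 z hzl
        exact hz t ht hzt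
      simp only [List.nodup_cons, List.mem_cons, not_or] at h1 hz' ⊢
      exact ⟨⟨fun h => hz'.1 h.symm, h1.1.1, h1.1.2⟩, ⟨hz'.2.1, hz'.2.2⟩, h1.2⟩
    · by_cases hxz : x = z
      · exact ⟨_, Finset.mem_insert_self _ _, by simp [hxz]⟩
      · obtain ⟨t, ht, hxt⟩ := h3 x (by simp at hx ⊢; tauto)
        exact ⟨t, Finset.mem_insert_of_mem ht, hxt⟩
  | @fill T u v w l h hl hT ih =>
    obtain ⟨h1, h2, h3⟩ := ih
    refine ⟨?_, ?_, fun x hx => ?_⟩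
    · simp only [List.nodup_cons, List.mem_cons, not_or] at h1 ⊢
      exact ⟨⟨h1.1.2.1, h1.1.2.2⟩, h1.2.2⟩
    · cases l with
      | nil => exact absurd rfl hl
      | cons => simp
    · obtain ⟨t, ht, hxt⟩ := h3 x (by simp at hx ⊢; tauto)
      exact ⟨t, Finset.mem_insert_of_mem ht, hxt⟩

theorem card_eq_three (h : Shelling T l) : ∀ t ∈ T, t.card = 3 := by
  induction h with
  | base huv hvw huw => simp [Finset.card_eq_three.2 ⟨_, _, _, huv, huw, hvw, rfl⟩]
  | rot l l' h ih => exact ih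
  | @ear T u v l z h hz ih =>
    have hz' : ∀ x ∈ u :: v :: l, x ≠ z := by
      rintro x hx rfl
      obtain ⟨t, ht, hxt⟩ := h.nodup_and_mem.2.2 x hx
      exact hz t ht hxt
    have huv : u ≠ v := fun huv => by
      have := h.nodup_and_mem.1
      simp [huv] at this
    intro t ht
    rcases Finset.mem_insert.1 ht with rfl | ht
    · exact Finset.card_eq_three.2 ⟨u, v, z, huv, hz' u (by simp), hz' v (by simp), rfl⟩
    · exact ih t ht
  | @fill T u v w l h hl hT ih =>
    have := h.nodup_and_mem.1
    simp only [List.nodup_cons, List.mem_cons, not_or] at this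
    intro t ht
    rcases Finset.mem_insert.1 ht with rfl | ht
    · exact Finset.card_eq_three.2 ⟨u, v, w, this.1.1, this.1.2.1, this.2.1.1, rfl⟩
    · exact ih t ht

theorem nonempty (h : Shelling T l) : T.Nonempty := by
  obtain ⟨-, h2, h3⟩ := h.nodup_and_mem
  obtain ⟨v, hv⟩ := List.exists_mem_of_length_pos (l := l) (by omega)
  obtain ⟨t, ht, -⟩ := h3 v hv
  exact ⟨t, ht⟩

theorem connected (h : Shelling T l) (p : V → Prop)
    (hp : ∀ t ∈ T, ∀ a ∈ t, ∀ b ∈ t, p a → p b) :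
    ∀ s ∈ T, ∀ t ∈ T, ∀ a ∈ s, ∀ b ∈ t, p a → p b := by
  suffices H : (∀ t ∈ T, ∀ a ∈ t, p a) ∨ (∀ t ∈ T, ∀ a ∈ t, ¬ p a) by
    intro s hs t ht a ha b hb hpa
    rcases H with H | H
    · exact H t ht b hb
    · exact absurd hpa (H s hs a ha)
  have step : ∀ (T : Finset (Finset V)) (t : Finset V) (u : V), u ∈ t → (∃ s ∈ T, u ∈ s) →
      (∀ s ∈ insert t T, ∀ a ∈ s, ∀ b ∈ s, p a → p b) →
      ((∀ t ∈ T, ∀ a ∈ t, p a) ∨ (∀ t ∈ T, ∀ a ∈ t, ¬ p a)) →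
      ((∀ s ∈ insert t T, ∀ a ∈ s, p a) ∨ (∀ s ∈ insert t T, ∀ a ∈ s, ¬ p a)) := by
    rintro T t u hut ⟨s, hs, hus⟩ hp (H | H)
    · left
      intro r hr a ha
      rcases Finset.mem_insert.1 hr with rfl | hr
      · exact hp _ (Finset.mem_insert_self _ _) u hut a ha (H s hs u hus)
      · exact H r hr a ha
    · right
      intro r hr a ha
      rcases Finset.mem_insert.1 hr with rfl | hr
      · exact fun hpa => H s hs u hus (hp _ (Finset.mem_insert_self _ _) a ha u hut hpa)
      · exact H r hr a ha
  induction h with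
  | @base u v w huv hvw huw =>
    by_cases hu : p u
    · left
      intro t ht a ha
      exact hp t ht u (by simp at ht; simp [ht]) a ha hu
    · right
      intro t ht a ha hpa
      exact hu (hp t ht a ha u (by simp at ht; simp [ht]) hpa)
  | rot l l' h ih => exact ih hp
  | @ear T u v l z h hz ih =>
    exact step T _ u (by simp) (h.nodup_and_mem.2.2 u (by simp)) hp
      (ih fun t ht => hp t (Finset.mem_insert_of_mem ht))
  | @fill T u v w l h hl hT ih =>
    exact step T _ u (by simp) (h.nodup_and_mem.2.2 u (by simp)) hp
      (ih fun t ht => hp t (Finset.mem_insert_of_mem ht))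

/-- The realization of a shelled complex is a disk bounded by the polygon of its boundary
vertices. -/
theorem isDiskIn (h : Shelling T l) : IsDiskIn (⋃ t ∈ T, simplexOf t) (cycleSet l) := by
  have hcov : ∀ {A B : Set (V → ℝ)}, IsDiskIn A B → B ⊆ A := by
    rintro A B ⟨e, -, -, rfl, rfl⟩
    exact image_mono Metric.sphere_subset_closedBall
  induction h with
  | @base u v w huv hvw huw =>
    have := isDiskIn_simplexOf huv hvw huw
    have hc : cycleSet [u, v, w] = simplexOf {u, v} ∪ simplexOf {v, w} ∪ simplexOf {u, w} := by
      simp only [cycleSet, List.cons_append, List.nil_append, pathSet_cons_cons]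
      rw [Finset.pair_comm w u, union_eq_left.2 (show pathSet [u] ⊆ simplexOf {u, w} from
        simplexOf_mono (by simp)), union_assoc]
    rw [hc]
    simpa using this
  | rot l l' h ih => rwa [cycleSet_append_comm]
  | @ear T u v l z h hz ih =>
    obtain ⟨hnd, hlen, hmem⟩ := h.nodup_and_mem
    have hzl : z ∉ u :: v :: l := fun hzl => by
      obtain ⟨t, ht, hzt⟩ := hmem z hzl
      exact hz t ht hzt
    simp only [List.mem_cons, not_or] at hzl
    have hnd' := hnd
    simp only [List.nodup_cons, List.mem_cons, not_or] at hnd'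
    obtain ⟨⟨huv, hul⟩, hvl, hl⟩ := hnd'
    replace huv : u ≠ v := huv
    have hzu : z ≠ u := hzl.1
    have hzv : z ≠ v := hzl.2.1
    have hcyc : cycleSet (u :: v :: l) = simplexOf {u, v} ∪ pathSet (v :: l ++ [u]) := rfl
    rw [hcyc] at ih
    have ha : IsArcIn (pathSet (v :: l ++ [u])) (Pi.single u (1 : ℝ)) (Pi.single v (1 : ℝ)) := by
      cases l with
      | nil => simp at hlen
      | cons y l =>
        have hn : (v :: y :: (l ++ [u])).Nodup := by
          have : List.Perm (v :: y :: (l ++ [u])) (u :: v :: y :: l) := by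
            rw [← List.singleton_append (x := u)]
            exact List.perm_append_comm (l₁ := v :: y :: l) (l₂ := [u])
          exact this.nodup_iff.2 hnd
        have := isArcIn_pathSet hn
        rw [show (y :: (l ++ [u])).getLast (List.cons_ne_nil _ _) = u by
          rw [List.getLast_cons (by simp)]; simp] at this
        exact this.symm
    have hb : IsArcIn (simplexOf {u, z} ∪ simplexOf {z, v}) (Pi.single u (1 : ℝ))
        (Pi.single v (1 : ℝ)) := by
      refine (isArcIn_simplexOf_pair hzu.symm).trans
        (isArcIn_simplexOf_pair hzv) ?_
      rw [simplexOf_inter, ← simplexOf_singleton]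
      apply simplexOf_mono
      intro x
      simp only [Finset.mem_inter, Finset.mem_insert, Finset.mem_singleton]
      rintro ⟨rfl | rfl, h | h⟩
      · exact absurd h.symm hzl.1
      · exact absurd h huv
      · rfl
      · rfl
    have hca : simplexOf {u, v} ∩ pathSet (v :: l ++ [u]) ⊆
        {Pi.single u (1 : ℝ), Pi.single v (1 : ℝ)} := by
      cases l with
      | nil => simp at hlen
      | cons y l =>
        rintro x ⟨hx, hx' | hx'⟩
        · right
          rw [mem_singleton_iff]
          rw [Finset.pair_comm] at hx
          refine eq_single_of_mem_simplexOf_pair huv.symm hx ?_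
          simp only [List.mem_cons, not_or] at hul
          exact hx'.2.1 u (by simp [huv, hul.1])
        · left
          refine eq_single_of_mem_simplexOf_pair huv hx ?_
          refine eq_zero_of_mem_pathSet ?_ hx'
          simp only [List.mem_cons, not_or] at hvl
          change v ∉ y :: (l ++ [u])
          simp only [List.mem_cons, List.mem_append, List.not_mem_nil, or_false, not_or]
          exact ⟨hvl.1, hvl.2, huv.symm⟩
    have hB : IsDiskIn (simplexOf {u, v, z})
        (simplexOf {u, v} ∪ (simplexOf {u, z} ∪ simplexOf {z, v})) := by
      rw [union_comm (simplexOf {u, z}), ← union_assoc, Finset.pair_comm z v]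
      exact isDiskIn_simplexOf huv hzv.symm hzu.symm
    have hcb : simplexOf {u, v} ∩ (simplexOf {u, z} ∪ simplexOf {z, v}) ⊆
        {Pi.single u (1 : ℝ), Pi.single v (1 : ℝ)} := by
      rintro x ⟨hx, hx' | hx'⟩
      · left
        exact eq_single_of_mem_simplexOf_pair huv hx (hx'.2.1 v (by
          simp [huv.symm, hzv.symm]))
      · right
        rw [Finset.pair_comm] at hx
        exact eq_single_of_mem_simplexOf_pair huv.symm hx (hx'.2.1 u (by
          simp [huv, hzu.symm]))
    -- Since `z` is new, an old face shares only vertices among `u` and `v` with the added triangle.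
    have hAB : (⋃ t ∈ T, simplexOf t) ∩ simplexOf {u, v, z} ⊆ simplexOf {u, v} := by
      rintro x ⟨hx, hx'⟩
      obtain ⟨t, ht, hxt⟩ := mem_iUnion₂.1 hx
      have : x ∈ simplexOf (t ∩ {u, v, z}) := by
        rw [← simplexOf_inter]; exact ⟨hxt, hx'⟩
      refine simplexOf_mono ?_ this
      intro y
      simp only [Finset.mem_inter, Finset.mem_insert, Finset.mem_singleton]
      rintro ⟨hy, rfl | rfl | rfl⟩
      · exact Or.inl rfl
      · exact Or.inr rfl
      · exact absurd hy (hz t ht)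
    have := ih.union hB (isArcIn_simplexOf_pair huv) ha hb hca hcb hAB
    rw [Finset.set_biUnion_insert, union_comm]
    have hcyc' : cycleSet (u :: z :: v :: l) =
        simplexOf {u, z} ∪ (simplexOf {z, v} ∪ pathSet (v :: l ++ [u])) := rfl
    rwa [hcyc', ← union_assoc, union_comm (simplexOf {u, z} ∪ _)]
  | @fill T u v w l h hl hT ih =>
    obtain ⟨hnd, hlen, hmem⟩ := h.nodup_and_mem
    have hnd' := hnd
    simp only [List.nodup_cons, List.mem_cons, not_or] at hnd'
    obtain ⟨⟨huv, huw, hul⟩, ⟨hvw, hvl⟩, hwl, hl'⟩ := hnd'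
    replace huv : u ≠ v := huv
    replace huw : u ≠ w := huw
    replace hvw : v ≠ w := hvw
    have hcyc : cycleSet (u :: v :: w :: l) =
      simplexOf {u, v} ∪ (simplexOf {v, w} ∪ pathSet (w :: l ++ [u])) := rfl
    rw [hcyc, ← union_assoc] at ih
    have ha : IsArcIn (pathSet (w :: l ++ [u])) (Pi.single u (1 : ℝ)) (Pi.single w (1 : ℝ)) := by
      cases l with
      | nil => exact absurd rfl hl
      | cons y l =>
        have hn : (w :: y :: (l ++ [u])).Nodup := by
          have : List.Perm (w :: y :: (l ++ [u])) (u :: w :: y :: l) := by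
            rw [← List.singleton_append (x := u)]
            exact List.perm_append_comm (l₁ := w :: y :: l) (l₂ := [u])
          refine this.nodup_iff.2 ?_
          exact hnd.sublist (by simp)
        have := isArcIn_pathSet hn
        rw [show (y :: (l ++ [u])).getLast (List.cons_ne_nil _ _) = u by
          rw [List.getLast_cons (by simp)]; simp] at this
        exact this.symm
    have hc : IsArcIn (simplexOf {u, v} ∪ simplexOf {v, w}) (Pi.single u (1 : ℝ))
        (Pi.single w (1 : ℝ)) := by
      refine (isArcIn_simplexOf_pair huv).trans (isArcIn_simplexOf_pair hvw) ?_
      rw [simplexOf_inter, ← simplexOf_singleton]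
      apply simplexOf_mono
      intro x
      simp only [Finset.mem_inter, Finset.mem_insert, Finset.mem_singleton]
      rintro ⟨rfl | rfl, h | h⟩
      · exact absurd h huv
      · exact absurd h huw
      · rfl
      · rfl
    have key : ∀ s : Set (V → ℝ), (∀ x ∈ s, x v = 0) →
        (simplexOf {u, v} ∪ simplexOf {v, w}) ∩ s ⊆
        {Pi.single u (1 : ℝ), Pi.single w (1 : ℝ)} := by
      rintro s hs x ⟨hx | hx, hxs⟩
      · left
        exact eq_single_of_mem_simplexOf_pair huv hx (hs x hxs)
      · right
        rw [Finset.pair_comm] at hx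
        exact eq_single_of_mem_simplexOf_pair hvw.symm hx (hs x hxs)
    have hca := key (pathSet (w :: l ++ [u])) fun x hx => eq_zero_of_mem_pathSet (by
      simp only [List.cons_append, List.mem_cons, List.mem_append, List.not_mem_nil, or_false,
        not_or]
      exact ⟨hvw, hvl, huv.symm⟩) hx
    have hcb := key (simplexOf {u, w}) fun x hx => hx.2.1 v (by simp [huv.symm, hvw])
    -- No old face contains both `u` and `w`, so each meets the new triangle inside one of the two
    -- edges at `v`.
    have hAB : (⋃ t ∈ T, simplexOf t) ∩ simplexOf {u, v, w} ⊆
        simplexOf {u, v} ∪ simplexOf {v, w} := by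
      rintro x ⟨hx, hx'⟩
      obtain ⟨t, ht, hxt⟩ := mem_iUnion₂.1 hx
      have hm : x ∈ simplexOf (t ∩ {u, v, w}) := by
        rw [← simplexOf_inter]; exact ⟨hxt, hx'⟩
      by_cases hut : u ∈ t
      · left
        refine simplexOf_mono ?_ hm
        intro y
        simp only [Finset.mem_inter, Finset.mem_insert, Finset.mem_singleton]
        rintro ⟨hy, rfl | rfl | rfl⟩
        · exact Or.inl rfl
        · exact Or.inr rfl
        · exact absurd hy (hT t ht hut)
      · right
        refine simplexOf_mono ?_ hm
        intro y
        simp only [Finset.mem_inter, Finset.mem_insert, Finset.mem_singleton]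
        rintro ⟨hy, rfl | rfl | rfl⟩
        · exact absurd hy hut
        · exact Or.inl rfl
        · exact Or.inr rfl
    have := ih.union (isDiskIn_simplexOf huv hvw huw) hc ha (isArcIn_simplexOf_pair huw) hca hcb
      hAB
    rw [Finset.set_biUnion_insert, union_comm]
    have hcyc' : cycleSet (u :: w :: l) = simplexOf {u, w} ∪ pathSet (w :: l ++ [u]) := rfl
    rwa [hcyc', union_comm (simplexOf {u, w})]

end Shelling

end Simplex

/-! ### Charts of the closed disk -/

section Charts

/-- The point of the half plane with given coordinates `Re w ≥ 0` and `Im w`. -/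
def halfPlanePoint (w : ℂ) (hw : 0 ≤ w.re) : EuclideanHalfSpace 2 :=
  ⟨!₂[w.re, w.im], by simpa using hw⟩

/-- The real part of `(1 + u) / (1 - u)` is `1 - ‖u‖ ^ 2` over `‖1 - u‖ ^ 2`. At the pole the
quotient is `0` by convention, so no point has to be excluded. -/
theorem re_cayley_nonneg (c : ℂ) (hc : ‖c‖ = 1) (z : Metric.closedBall (0 : ℂ) 1) :
    0 ≤ ((1 + c * z) / (1 - c * z)).re := by
  have hz : ‖c * z‖ ≤ 1 := by
    rw [norm_mul, hc, one_mul]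
    exact mem_closedBall_zero_iff.1 z.2
  generalize c * (z : ℂ) = u at hz
  have h1 : Complex.normSq u ≤ 1 := by
    rw [Complex.normSq_eq_norm_sq]
    exact pow_le_one₀ (norm_nonneg _) hz
  rw [Complex.div_re, ← add_div]
  refine div_nonneg ?_ (Complex.normSq_nonneg _)
  rw [Complex.normSq_apply] at h1
  simp only [Complex.add_re, Complex.one_re, Complex.sub_re, Complex.add_im, Complex.one_im,
    Complex.sub_im]
  nlinarith

theorem norm_cayley_symm_le (c : ℂ) (hc : ‖c‖ = 1) (w : EuclideanHalfSpace 2) :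
    ‖c * (((⟨w.1 0, w.1 1⟩ : ℂ) - 1) / (⟨w.1 0, w.1 1⟩ + 1))‖ ≤ 1 := by
  have hw : (0 : ℝ) ≤ w.1 0 := w.2
  rw [norm_mul, hc, one_mul, norm_div]
  refine div_le_one_of_le₀ ?_ (norm_nonneg _)
  refine (sq_le_sq₀ (norm_nonneg _) (norm_nonneg _)).1 ?_
  rw [← Complex.normSq_eq_norm_sq, ← Complex.normSq_eq_norm_sq, Complex.normSq_apply,
    Complex.normSq_apply]
  simp only [Complex.add_re, Complex.one_re, Complex.sub_re, Complex.add_im, Complex.one_im,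
    Complex.sub_im]
  nlinarith

/-- The Cayley transform as a chart of the closed disk whose domain omits the boundary point
`1 / c`. -/
def cayleyChart (c : ℂ) (hc : ‖c‖ = 1) :
    OpenPartialHomeomorph (Metric.closedBall (0 : ℂ) 1) (EuclideanHalfSpace 2) where
  toFun z := halfPlanePoint _ (re_cayley_nonneg c hc z)
  invFun w := ⟨c⁻¹ * (((⟨w.1 0, w.1 1⟩ : ℂ) - 1) / (⟨w.1 0, w.1 1⟩ + 1)), by
    simpa using norm_cayley_symm_le c⁻¹ (by simp [hc]) w⟩
  source := {z | c * z ≠ 1}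
  target := univ
  map_source' _ _ := mem_univ _
  map_target' w _ := by
    have hc0 : c ≠ 0 := by rintro rfl; simp at hc
    have hw : (0 : ℝ) ≤ w.1 0 := w.2
    intro h
    rw [mul_inv_cancel_left₀ hc0, div_eq_one_iff_eq] at h
    · have := congrArg Complex.re h
      simp at this
      linarith
    · intro h0
      have := congrArg Complex.re h0
      simp at this
      linarith
  left_inv' z hz := by
    have hc0 : c ≠ 0 := by rintro rfl; simp at hc
    have hz' : 1 - c * (z : ℂ) ≠ 0 := fun h => hz (sub_eq_zero.1 h).symm
    apply Subtype.ext
    have hre : ∀ u : ℂ, (⟨u.re, u.im⟩ : ℂ) = u := fun u => rfl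
    simp only [halfPlanePoint, PiLp.toLp_apply, Matrix.cons_val_zero, Matrix.cons_val_one, hre]
    have h1 : (1 + c * (z : ℂ)) / (1 - c * z) - 1 = 2 * (c * z) / (1 - c * z) := by
      field_simp; ring
    have h2 : (1 + c * (z : ℂ)) / (1 - c * z) + 1 = 2 / (1 - c * z) := by
      field_simp; ring
    rw [h1, h2]
    field_simp
  right_inv' w _ := by
    have hc0 : c ≠ 0 := by rintro rfl; simp at hc
    have hw : (0 : ℝ) ≤ w.1 0 := w.2
    have key : ∀ u : ℂ, u + 1 ≠ 0 →
        (1 + c * (c⁻¹ * ((u - 1) / (u + 1)))) / (1 - c * (c⁻¹ * ((u - 1) / (u + 1)))) = u := by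
      intro u hu
      rw [mul_inv_cancel_left₀ hc0]
      have h1 : 1 + (u - 1) / (u + 1) = 2 * u / (u + 1) := by field_simp; ring
      have h2 : 1 - (u - 1) / (u + 1) = 2 / (u + 1) := by field_simp; ring
      rw [h1, h2]
      field_simp
    have hne : (⟨w.1 0, w.1 1⟩ : ℂ) + 1 ≠ 0 := by
      intro h0
      have := congrArg Complex.re h0
      simp at this
      linarith
    apply Subtype.ext
    ext i
    simp only [halfPlanePoint]
    rw [key _ hne]
    fin_cases i <;> rfl
  open_source := by
    exact isOpen_ne_fun (by fun_prop) continuous_const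
  open_target := isOpen_univ
  continuousOn_toFun := by
    have h : ContinuousOn (fun z : Metric.closedBall (0 : ℂ) 1 =>
        (1 + c * (z : ℂ)) / (1 - c * z)) {z | c * z ≠ 1} :=
      ContinuousOn.div (by fun_prop) (by fun_prop) fun z hz h => hz (sub_eq_zero.1 h).symm
    refine Topology.IsInducing.subtypeVal.continuousOn_iff.2 ?_
    refine (PiLp.continuous_toLp 2 _).comp_continuousOn (continuousOn_pi.2 fun i => ?_)
    fin_cases i
    · exact Complex.continuous_re.comp_continuousOn h
    · exact Complex.continuous_im.comp_continuousOn h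
  continuousOn_invFun := by
    refine Continuous.continuousOn (Continuous.subtype_mk (continuous_const.mul ?_) _)
    have h : Continuous fun w : EuclideanHalfSpace 2 => (⟨w.1 0, w.1 1⟩ : ℂ) := by
      have : Continuous fun w : EuclideanHalfSpace 2 => ((w.1 0 : ℝ) : ℂ) + (w.1 1 : ℝ) * Complex.I :=
        by fun_prop
      refine this.congr fun w => ?_
      apply Complex.ext <;> simp
    refine (h.sub continuous_const).div (h.add continuous_const) fun w h0 => ?_
    have hw : (0 : ℝ) ≤ w.1 0 := w.2
    have := congrArg Complex.re h0
    simp at this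
    linarith

/-- Two Cayley charts, omitting `1` and `-1` respectively, cover the disk. -/
theorem nonempty_chartedSpace_of_homeomorph {S : Type*} [TopologicalSpace S]
    (h : S ≃ₜ Metric.closedBall (0 : ℂ) 1) :
    Nonempty (ChartedSpace (EuclideanHalfSpace 2) S) := by
  classical
  let e (c : ℂ) (hc : ‖c‖ = 1) := h.toOpenPartialHomeomorph.trans (cayleyChart c hc)
  refine ⟨{ atlas := {e 1 (by simp), e (-1) (by simp)}
            chartAt := fun x => if (h x : ℂ) = 1 then e (-1) (by simp) else e 1 (by simp)
            mem_chart_source := fun x => ?_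
            chart_mem_atlas := fun x => ?_ }⟩
  · split_ifs with hx
    · simp [e, cayleyChart, hx]
      norm_num
    · simpa [e, cayleyChart] using hx
  · split_ifs
    · exact Or.inr rfl
    · exact Or.inl rfl

end Charts

/-! ### A winding number criterion -/

section Winding

/-- The values lie in the discrete set of multiples of `2πi`. Applied to differences of logarithms,
this says that two branches differ by a constant on a connected set. -/
theorem IsPreconnected.eq_of_exp_eq_one {X : Type*} [TopologicalSpace X] {s : Set X}
    (hs : IsPreconnected s) {f : X → ℂ} (hf : ContinuousOn f s)
    (h1 : ∀ x ∈ s, Complex.exp (f x) = 1) {x y : X} (hx : x ∈ s) (hy : y ∈ s) : f x = f y := by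
  have hpi : (2 * Real.pi * Complex.I : ℂ) ≠ 0 := Complex.two_pi_I_ne_zero
  have hd : DiscreteTopology (range ((↑) : ℤ → ℝ)) :=
    (Int.isClosedEmbedding_coe_real.isEmbedding.toHomeomorph.symm.isEmbedding.discreteTopology)
  have key : ∀ z ∈ s, ∃ n : ℤ, f z = n * (2 * Real.pi * Complex.I) := fun z hz =>
    Complex.exp_eq_one_iff.1 (h1 z hz)
  have := hs.constant_of_mapsTo ⟨hd⟩ (f := fun z => (f z / (2 * Real.pi * Complex.I)).re)
    (T := range ((↑) : ℤ → ℝ)) (Complex.continuous_re.comp_continuousOn (hf.div_const _))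
    (fun z hz => by
      obtain ⟨n, hn⟩ := key z hz
      exact ⟨n, by simp only [hn, mul_div_cancel_right₀ _ hpi, Complex.intCast_re]⟩) hx hy
  obtain ⟨n, hn⟩ := key x hx
  obtain ⟨m, hm⟩ := key y hy
  simp only [hn, hm, mul_div_cancel_right₀ _ hpi, Complex.intCast_re] at this
  rw [hn, hm, Int.cast_injective this]

/-- Precomposing with the retraction `z / max 1 ‖z‖` of the plane onto the disk gives a nonvanishing
function on a simply connected open set, where a logarithm exists. -/
theorem exists_continuous_log_of_disk {X : Type*} [TopologicalSpace X]
    (h : X ≃ₜ Metric.closedBall (0 : ℂ) 1) {G : X → ℂ} (hG : Continuous G) (h0 : ∀ x, G x ≠ 0) :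
    ∃ L : X → ℂ, Continuous L ∧ ∀ x, Complex.exp (L x) = G x := by
  let r : ℂ → Metric.closedBall (0 : ℂ) 1 := fun z => ⟨((max 1 ‖z‖ : ℝ) : ℂ)⁻¹ * z, by
    have h1 : (0 : ℝ) < max 1 ‖z‖ := lt_of_lt_of_le one_pos (le_max_left _ _)
    rw [mem_closedBall_zero_iff, norm_mul, norm_inv, Complex.norm_real, Real.norm_of_nonneg h1.le,
      inv_mul_le_iff₀ h1, mul_one]
    exact le_max_right _ _⟩
  have hr : Continuous r := by
    refine Continuous.subtype_mk (Continuous.mul (Continuous.inv₀ (by fun_prop) fun z => ?_)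
      continuous_id) _
    exact Complex.ofReal_ne_zero.2 (lt_of_lt_of_le one_pos (le_max_left _ _)).ne'
  have hrz : ∀ z : Metric.closedBall (0 : ℂ) 1, r z = z := fun z => Subtype.ext (by
    simp [r, max_eq_left (mem_closedBall_zero_iff.1 z.2)])
  obtain ⟨f, hf, hfe⟩ := Complex.exists_continuousOn_eqOn_exp_comp (U := univ) (X := ℂ)
    (g := fun z => G (h.symm (r z)))
    (Homeomorph.Set.univ ℂ).toHomotopyEquiv.simplyConnectedSpace isOpen_univ
    (by fun_prop) (by rintro ⟨z, -, hz⟩; exact h0 _ hz)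
  refine ⟨fun x => f (h x), (continuousOn_univ.1 hf).comp (by fun_prop), fun x => ?_⟩
  have := hfe (mem_univ (h x : ℂ))
  simpa [hrz] using this

/-- If a map of the disk into the plane sends three arcs that close up to a curve winding around
`w`, then `w` is in the range. -/
theorem mem_range_of_winding {X : Type*} [TopologicalSpace X]
    (h : X ≃ₜ Metric.closedBall (0 : ℂ) 1) {F : X → ℂ} (hF : Continuous F) (w : ℂ)
    {A B C : Set X} (hA : IsPreconnected A) (hB : IsPreconnected B) (hC : IsPreconnected C)
    {p q r : X} (hpA : p ∈ A) (hpB : p ∈ B) (hqB : q ∈ B) (hqC : q ∈ C) (hrA : r ∈ A)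
    (hrC : r ∈ C) (hFA : ∀ x ∈ A, (F x).im < w.im) (hFC : ∀ x ∈ C, w.re < (F x).re)
    (hFB : ∀ x ∈ B, (F x).re = w.re → w.im < (F x).im) (hFp : (F p).re < w.re) :
    w ∈ range F := by
  by_contra hw
  -- If `w` is missed, `F - w` has a logarithm `L` on the whole disk. Along `A ∪ C` it differs by a
  -- constant from the principal branch, and along `B` from a branch cut along the downward ray.
  -- Comparison at the common points `p` and `q` will give a mismatch of `2π`.
  obtain ⟨L, hL, hLe⟩ := exists_continuous_log_of_disk h (G := fun x => F x - w) (by fun_prop)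
    (fun x hx => hw ⟨x, sub_eq_zero.1 hx⟩)
  have hAC : IsPreconnected (A ∪ C) := hA.union r hrA hrC hC
  have hslit : ∀ x ∈ A ∪ C, F x - w ∈ Complex.slitPlane := by
    rintro x (hx | hx)
    · exact Or.inr (by simpa using (sub_neg.2 (hFA x hx)).ne)
    · exact Or.inl (by simpa using hFC x hx)
  have hslitB : ∀ x ∈ B, -Complex.I * (F x - w) ∈ Complex.slitPlane := by
    intro x hx
    by_cases hre : (F x).re = w.re
    · left
      simpa using hFB x hx hre
    · right
      simpa [sub_eq_zero, neg_eq_zero, eq_comm] using hre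
  have e1 := hAC.eq_of_exp_eq_one (f := fun x => L x - Complex.log (F x - w))
    (hL.continuousOn.sub (ContinuousOn.clog (by fun_prop) hslit))
    (fun x hx => by
      rw [Complex.exp_sub, hLe, Complex.exp_log (Complex.slitPlane_ne_zero (hslit x hx))]
      exact div_self (Complex.slitPlane_ne_zero (hslit x hx)))
    (Or.inl hpA : p ∈ A ∪ C) (Or.inr hqC : q ∈ A ∪ C)
  have e2 := hB.eq_of_exp_eq_one
    (f := fun x => L x - (Complex.log (-Complex.I * (F x - w)) + Real.pi / 2 * Complex.I))
    (hL.continuousOn.sub ((ContinuousOn.clog (by fun_prop) hslitB).add continuousOn_const))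
    (fun x hx => by
      have hne := Complex.slitPlane_ne_zero (hslitB x hx)
      rw [Complex.exp_sub, hLe, Complex.exp_add, Complex.exp_log hne, Complex.exp_pi_div_two_mul_I]
      have h3 : -Complex.I * (F x - w) * Complex.I = F x - w := by
        linear_combination -(F x - w) * Complex.I_mul_I
      rw [h3]
      exact div_self fun h0 => hne (by rw [h0, mul_zero])) hpB hqB
  have e3 : Complex.log (F p - w) - Complex.log (-Complex.I * (F p - w)) =
      Complex.log (F q - w) - Complex.log (-Complex.I * (F q - w)) := by
    linear_combination e2 - e1
  have hq : 0 < (F q - w).re := by simpa using hFC q hqC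
  have hp1 : (F p - w).re < 0 := by simpa using hFp
  have hp2 : (F p - w).im < 0 := by simpa using hFA p hpA
  have e4 := congrArg Complex.im e3
  simp only [Complex.sub_im, Complex.log_im] at e4
  have hargq := Complex.abs_arg_lt_pi_div_two_iff.2 (Or.inl hq)
  rw [abs_lt] at hargq
  have hqn : F q - w ≠ 0 := fun h0 => by simp [h0] at hq
  have hpn : F p - w ≠ 0 := fun h0 => by simp [h0] at hp1
  have hargp1 : (F p - w).arg < -(Real.pi / 2) := by
    rcases lt_or_ge (F p - w).arg (-(Real.pi / 2)) with hlt | hge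
    · exact hlt
    · exact absurd ((Complex.neg_pi_div_two_le_arg_iff).1 hge) (by
        rintro (h5 | h5) <;> linarith)
  have hargp0 := Complex.neg_pi_lt_arg (F p - w)
  have hI : (-Complex.I).arg = -(Real.pi / 2) := Complex.arg_neg_I
  have hIn : -Complex.I ≠ 0 := neg_ne_zero.2 Complex.I_ne_zero
  -- Multiplication by `-I` lowers the argument by `π / 2` at `q`, in the right half plane. At `p`,
  -- in the open third quadrant, it crosses the cut and raises the principal argument by `3π / 2`.
  have f1 : (-Complex.I * (F q - w)).arg = -(Real.pi / 2) + (F q - w).arg := by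
    rw [← hI]
    refine Complex.arg_mul hIn hqn ?_
    rw [hI]
    constructor <;> linarith
  have f2 : (-Complex.I * (F p - w)).arg = Real.pi / 2 + ((F p - w).arg + Real.pi) := by
    have h6 : -Complex.I * (F p - w) = Complex.I * (-(F p - w)) := by ring
    have h7 : (-(F p - w)).arg = (F p - w).arg + Real.pi := Complex.arg_neg_eq_arg_add_pi_of_im_neg hp2
    rw [h6, Complex.arg_mul Complex.I_ne_zero (neg_ne_zero.2 hpn), Complex.arg_I, h7]
    rw [Complex.arg_I, h7]
    have := Real.pi_pos
    constructor <;> linarith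
  rw [f1, f2] at e4
  have := Real.pi_pos
  linarith

end Winding

/-! ### Area under the graph of a distance function -/

/-- A metric space that is mapped by a map with `1`-Lipschitz coordinates onto a set containing
given disjoint rectangles has large Hausdorff measure. -/
theorem sum_le_hausdorffMeasure_of_rectangles {X : Type*} [MetricSpace X] [MeasurableSpace X]
    [BorelSpace X] (F : X → ℂ) (h1 : ∀ x y, |(F x).re - (F y).re| ≤ dist x y)
    (h2 : ∀ x y, |(F x).im - (F y).im| ≤ dist x y) {κ : ℝ} (hκ : 0 < κ) (n : ℕ) (f : ℕ → ℝ)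
    (hf : ∀ t < n, ∀ w : ℂ, t * κ < w.re → w.re < (t + 1) * κ → 0 < w.im → w.im < f t →
      w ∈ range F) :
    ∑ t ∈ Finset.range n, ENNReal.ofReal (κ * f t) ≤ Measure.hausdorffMeasure 2 (univ : Set X) := by
  -- With values in the sup metric, `1`-Lipschitz coordinates make the map `1`-Lipschitz, and
  -- Hausdorff `2`-measure is exactly Lebesgue measure. No constant is lost.
  let Φ : X → Fin 2 → ℝ := fun x => ![(F x).re, (F x).im]
  have hΦ : LipschitzWith 1 Φ := by
    refine LipschitzWith.of_dist_le_mul fun x y => ?_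
    rw [NNReal.coe_one, one_mul, dist_pi_le_iff dist_nonneg]
    intro i
    fin_cases i
    · exact h1 x y
    · exact h2 x y
  let R : ℕ → Set (Fin 2 → ℝ) := fun t =>
    Ioo ![t * κ, 0] ![(t + 1) * κ, f t]
  let R' : ℕ → Set (Fin 2 → ℝ) := fun t =>
    Set.pi univ fun i => Ioo ((![t * κ, 0] : Fin 2 → ℝ) i) ((![(t + 1) * κ, f t] : Fin 2 → ℝ) i)
  have hvol : ∀ t, volume (R' t) = ENNReal.ofReal (κ * f t) := by
    intro t
    rw [Real.volume_pi_Ioo, Fin.prod_univ_two]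
    simp only [Matrix.cons_val_zero, Matrix.cons_val_one, sub_zero]
    rw [ENNReal.ofReal_mul hκ.le]
    congr 2
    ring
  have hdisj : ∀ s t : ℕ, s < t → Disjoint (R' s) (R' t) := by
    intro s t hst
    rw [Set.disjoint_left]
    intro x hx hy
    have hx0 := (hx 0 (mem_univ _)).2
    have hy0 := (hy 0 (mem_univ _)).1
    simp only [Matrix.cons_val_zero] at hx0 hy0
    have : ((s : ℝ) + 1) ≤ t := by exact_mod_cast hst
    nlinarith
  have hsub : ⋃ t ∈ Finset.range n, R' t ⊆ Φ '' univ := by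
    intro x hx
    obtain ⟨t, ht, hxt⟩ := mem_iUnion₂.1 hx
    have hx0 := hxt 0 (mem_univ _)
    have hx1 := hxt 1 (mem_univ _)
    simp only [Matrix.cons_val_zero, Matrix.cons_val_one] at hx0 hx1
    obtain ⟨y, hy⟩ := hf t (Finset.mem_range.1 ht) ⟨x 0, x 1⟩ hx0.1 hx0.2 hx1.1 hx1.2
    refine ⟨y, mem_univ _, ?_⟩
    ext i
    fin_cases i
    · simp [Φ, hy]
    · simp [Φ, hy]
  calc ∑ t ∈ Finset.range n, ENNReal.ofReal (κ * f t) = ∑ t ∈ Finset.range n, volume (R' t) :=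
        Finset.sum_congr rfl fun t _ => (hvol t).symm
    _ = volume (⋃ t ∈ Finset.range n, R' t) := by
        refine (measure_biUnion_finset (fun s _ t _ hst => ?_) fun t _ =>
          MeasurableSet.univ_pi fun i => measurableSet_Ioo).symm
        rcases lt_or_gt_of_ne hst with h | h
        · exact hdisj s t h
        · exact (hdisj t s h).symm
    _ ≤ volume (Φ '' univ) := measure_mono hsub
    _ = Measure.hausdorffMeasure 2 (Φ '' univ) := by
        have := hausdorffMeasure_pi_real (ι := Fin 2)
        rw [Fintype.card_fin, Nat.cast_ofNat] at this
        rw [this]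
    _ ≤ (1 : NNReal) ^ (2 : ℝ) * Measure.hausdorffMeasure 2 (univ : Set X) := by
        exact hΦ.hausdorffMeasure_image_le zero_le_two univ
    _ = _ := by simp

/-! ### Parametrized triangular disks -/

/-- The space `X` is a disk whose boundary is parametrized by three geodesics `γ j`
of length `l j`. -/
structure TriangleParam (X : Type*) [MetricSpace X] (l : Fin 3 → ℝ) (γ : Fin 3 → ℝ → X) :
    Prop where
  disk : IsDiskWithBoundary X (⋃ j, γ j '' Icc 0 (l j))
  pos : ∀ j, 0 < l j
  dist_eq : ∀ j, ∀ s ∈ Icc 0 (l j), ∀ t ∈ Icc 0 (l j), dist (γ j s) (γ j t) = |s - t|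
  glue : ∀ j, γ j (l j) = γ (j + 1) 0
  disjoint : ∀ j k, j ≠ k → ∀ s ∈ Ioo 0 (l j), ∀ t ∈ Ioo 0 (l k), γ j s ≠ γ k t

theorem IsTriangularDisk.exists_param {X : Type*} [MetricSpace X] {α : Fin 3 → Set X}
    (h : IsTriangularDisk X α) :
    ∃ l γ, TriangleParam X l γ ∧ ∀ j, α j = γ j '' Icc 0 (l j) := by
  obtain ⟨hd, p, hp, hg, hdis⟩ := h
  choose γ h0 h1 h2 h3 using hg
  have hpos : ∀ j, 0 < dist (p j) (p (j + 1)) := fun j => dist_pos.2 fun h =>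
    (by decide : ∀ j : Fin 3, j ≠ j + 1) j (hp h)
  have hend : ∀ j, ∀ s ∈ Ioo 0 (dist (p j) (p (j + 1))),
      γ j s ∈ α j \ {p j, p (j + 1)} := by
    intro j s hs
    have hs' := Ioo_subset_Icc_self hs
    refine ⟨by rw [h3 j]; exact mem_image_of_mem _ hs', ?_⟩
    rintro (h | h)
    · rw [← h0 j] at h
      have := h2 j s hs' 0 ⟨le_rfl, (hpos j).le⟩
      rw [h, dist_self, sub_zero, abs_of_pos hs.1] at this
      exact hs.1.ne this
    · rw [mem_singleton_iff, ← h1 j] at h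
      have := h2 j s hs' _ ⟨(hpos j).le, le_rfl⟩
      rw [h, dist_self] at this
      have := abs_eq_zero.1 this.symm
      linarith [hs.2]
  refine ⟨fun j => dist (p j) (p (j + 1)), γ, ⟨?_, hpos, h2, fun j => by rw [h1, h0], ?_⟩, h3⟩
  · simpa only [← h3] using hd
  · intro j k hjk s hs t ht heq
    exact Set.disjoint_left.1 (hdis hjk) (hend j s hs) (heq ▸ hend k t ht)

namespace TriangleParam

variable {X : Type*} [MetricSpace X] {l : Fin 3 → ℝ} {γ : Fin 3 → ℝ → X}

theorem zero_mem (h : TriangleParam X l γ) (j : Fin 3) : (0 : ℝ) ∈ Icc 0 (l j) :=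
  ⟨le_rfl, (h.pos j).le⟩

theorem len_mem (h : TriangleParam X l γ) (j : Fin 3) : l j ∈ Icc 0 (l j) :=
  ⟨(h.pos j).le, le_rfl⟩

theorem injOn (h : TriangleParam X l γ) (j : Fin 3) : InjOn (γ j) (Icc 0 (l j)) := by
  intro s hs t ht hst
  have := h.dist_eq j s hs t ht
  rw [hst, dist_self] at this
  exact sub_eq_zero.1 (abs_eq_zero.1 this.symm)

theorem continuousOn (h : TriangleParam X l γ) (j : Fin 3) :
    ContinuousOn (γ j) (Icc 0 (l j)) := by
  refine (LipschitzOnWith.of_dist_le_mul (K := 1) fun s hs t ht => ?_).continuousOn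
  rw [NNReal.coe_one, one_mul, h.dist_eq j s hs t ht, Real.dist_eq]

theorem dist_corner (h : TriangleParam X l γ) (j : Fin 3) :
    dist (γ j 0) (γ (j + 1) 0) = l j := by
  rw [← h.glue, h.dist_eq j _ (h.zero_mem j) _ (h.len_mem j), zero_sub, abs_neg,
    abs_of_pos (h.pos j)]

theorem corner_ne (h : TriangleParam X l γ) {j k : Fin 3} (hjk : j ≠ k) : γ j 0 ≠ γ k 0 := by
  have key : ∀ j, γ j 0 ≠ γ (j + 1) 0 := fun j heq => by
    have := h.dist_corner j
    rw [heq, dist_self] at this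
    exact (h.pos j).ne this
  rcases (by decide : ∀ j k : Fin 3, j ≠ k → k = j + 1 ∨ j = k + 1) j k hjk with rfl | rfl
  · exact key j
  · exact (key k).symm

theorem glue' (h : TriangleParam X l γ) (j : Fin 3) : γ (j + 2) (l (j + 2)) = γ j 0 := by
  rw [h.glue, (by decide : ∀ j : Fin 3, j + 2 + 1 = j) j]

theorem isTriangularDisk (h : TriangleParam X l γ) :
    IsTriangularDisk X fun j => γ j '' Icc 0 (l j) := by
  refine ⟨h.disk, fun j => γ j 0, fun j k hjk => by_contra fun hne => h.corner_ne hne hjk,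
    fun j => ⟨γ j, rfl, ?_, ?_, ?_⟩, fun j k hjk => ?_⟩
  · rw [h.dist_corner, h.glue]
  · rw [h.dist_corner]; exact h.dist_eq j
  · rw [h.dist_corner]
  · have key : ∀ j, ∀ x ∈ γ j '' Icc 0 (l j) \ {γ j 0, γ (j + 1) 0},
        ∃ s ∈ Ioo 0 (l j), γ j s = x := by
      rintro j _ ⟨⟨s, hs, rfl⟩, hs'⟩
      simp only [mem_insert_iff, mem_singleton_iff, not_or] at hs'
      refine ⟨s, ⟨lt_of_le_of_ne hs.1 fun h0 => hs'.1 (by rw [h0]),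
        lt_of_le_of_ne hs.2 fun h0 => hs'.2 (by rw [h0, h.glue])⟩, rfl⟩
    refine Set.disjoint_left.2 fun x hx hy => ?_
    obtain ⟨s, hs, rfl⟩ := key j x hx
    obtain ⟨t, ht, hst⟩ := key k _ hy
    exact h.disjoint j k hjk s hs t ht hst.symm

theorem triangle_le (h : TriangleParam X l γ) (i : Fin 3) : l i ≤ l (i + 1) + l (i + 2) := by
  have h1 := h.dist_corner i
  have h2 := h.dist_corner (i + 1)
  have h3 := h.dist_corner (i + 2)
  rw [(by decide : ∀ j : Fin 3, j + 1 + 1 = j + 2) i] at h2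
  rw [(by decide : ∀ j : Fin 3, j + 2 + 1 = j) i] at h3
  rw [← h1, ← h2, ← h3]
  have := dist_triangle (γ i 0) (γ (i + 2) 0) (γ (i + 1) 0)
  rw [dist_comm (γ i 0) (γ (i + 2) 0), dist_comm (γ (i + 2) 0) (γ (i + 1) 0)] at this
  linarith

/-- The Gromov product at a corner. -/
def _root_.gromov (l : Fin 3 → ℝ) (i : Fin 3) : ℝ := (l i + l (i + 2) - l (i + 1)) / 2

theorem gromov_nonneg (h : TriangleParam X l γ) (i : Fin 3) : 0 ≤ gromov l i := by
  have := h.triangle_le (i + 1)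
  rw [(by decide : ∀ j : Fin 3, j + 1 + 1 = j + 2) i,
    (by decide : ∀ j : Fin 3, j + 1 + 2 = j) i] at this
  unfold gromov; linarith

theorem _root_.gromov_add (l : Fin 3 → ℝ) (i : Fin 3) : gromov l i + gromov l (i + 1) = l i := by
  unfold gromov
  rw [(by decide : ∀ j : Fin 3, j + 1 + 1 = j + 2) i,
    (by decide : ∀ j : Fin 3, j + 1 + 2 = j) i]
  ring

theorem gromov_le (h : TriangleParam X l γ) (i : Fin 3) : gromov l i ≤ l i := by
  linarith [gromov_add l i, h.gromov_nonneg (i + 1)]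

theorem gromov_le' (h : TriangleParam X l γ) (i : Fin 3) : gromov l i ≤ l (i + 2) := by
  have := gromov_add l (i + 2)
  rw [(by decide : ∀ j : Fin 3, j + 2 + 1 = j) i] at this
  linarith [h.gromov_nonneg (i + 2)]

/-- Average the two triangle inequalities from the corner, through the point of the opposite edge,
to the ends of that edge. In the planar picture this keeps the opposite edge to the right of all
rectangles at the corner. -/
theorem gromov_le_dist (h : TriangleParam X l γ) (i : Fin 3) {s : ℝ}
    (hs : s ∈ Icc 0 (l (i + 1))) : gromov l i ≤ dist (γ (i + 1) s) (γ i 0) := by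
  have h1 := h.dist_corner i
  have h3 := h.dist_corner (i + 2)
  rw [(by decide : ∀ j : Fin 3, j + 2 + 1 = j) i] at h3
  have e1 := h.dist_eq (i + 1) s hs 0 (h.zero_mem _)
  have e2 := h.dist_eq (i + 1) s hs _ (h.len_mem _)
  rw [h.glue, (by decide : ∀ j : Fin 3, j + 1 + 1 = j + 2) i, abs_of_nonpos (by linarith [hs.2])]
    at e2
  rw [sub_zero, abs_of_nonneg hs.1] at e1
  have t1 := dist_triangle (γ i 0) (γ (i + 1) s) (γ (i + 1) 0)
  have t2 := dist_triangle (γ (i + 2) 0) (γ (i + 1) s) (γ i 0)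
  rw [h1, dist_comm (γ i 0) (γ (i + 1) s)] at t1
  rw [dist_comm (γ (i + 2) 0) (γ (i + 1) s)] at t2
  unfold gromov
  linarith

theorem dist_corner_left (h : TriangleParam X l γ) (i : Fin 3) {s : ℝ} (hs : s ∈ Icc 0 (l i)) :
    dist (γ i s) (γ i 0) = s := by
  rw [h.dist_eq i s hs 0 (h.zero_mem i), sub_zero, abs_of_nonneg hs.1]

theorem dist_corner_right (h : TriangleParam X l γ) (i : Fin 3) {s : ℝ}
    (hs : s ∈ Icc 0 (l (i + 2))) : dist (γ (i + 2) s) (γ i 0) = l (i + 2) - s := by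
  rw [← h.glue', h.dist_eq (i + 2) s hs _ (h.len_mem _), abs_of_nonpos (by linarith [hs.2])]
  ring

/-- The Hausdorff measure of a triangular disk is bounded below by the width of a corner. -/
theorem sum_corner_le (h : TriangleParam X l γ) [MeasurableSpace X] [BorelSpace X] (i : Fin 3)
    {κ : ℝ} (hκ : 0 < κ) (n : ℕ) (hn : n * κ ≤ gromov l i) :
    ∑ t ∈ Finset.range n, ENNReal.ofReal
      (κ * (dist (γ i (t * κ)) (γ (i + 2) (l (i + 2) - t * κ)) / 2 - κ)) ≤
      Measure.hausdorffMeasure 2 (univ : Set X) := by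
  obtain ⟨e, he⟩ := h.disk
  -- Edge `i` goes to the real axis and the opposite edge to the right of `gromov l i`. Edge `i + 2`
  -- is parametrized by its distance to the corner and becomes a graph, whose height at `t * κ` will
  -- be at least half of the width there.
  let F : X → ℂ := fun x => ⟨dist x (γ i 0), Metric.infDist x (γ i '' Icc 0 (l i))⟩
  have hF1 : ∀ x y, |(F x).re - (F y).re| ≤ dist x y := fun x y =>
    abs_dist_sub_le x y (γ i 0)
  have hF2 : ∀ x y, |(F x).im - (F y).im| ≤ dist x y := by
    intro x y
    have h1 := Metric.infDist_le_infDist_add_dist (s := γ i '' Icc 0 (l i)) (x := x) (y := y)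
    have h2 := Metric.infDist_le_infDist_add_dist (s := γ i '' Icc 0 (l i)) (x := y) (y := x)
    rw [dist_comm y x] at h2
    exact abs_sub_le_iff.2 ⟨by simp only [F]; linarith, by simp only [F]; linarith⟩
  have hFc : Continuous F := by
    have : Continuous fun x => ((dist x (γ i 0) : ℝ) : ℂ) +
        (Metric.infDist x (γ i '' Icc 0 (l i)) : ℝ) * Complex.I := by
      have := Metric.continuous_infDist_pt (γ i '' Icc 0 (l i))
      fun_prop
    refine this.congr fun x => ?_
    apply Complex.ext <;> simp [F]
  have hg1 := h.gromov_le i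
  have hg2 := h.gromov_le' i
  have hpre : ∀ j, IsPreconnected (γ j '' Icc 0 (l j)) := fun j =>
    isPreconnected_Icc.image _ (h.continuousOn j)
  refine sum_le_hausdorffMeasure_of_rectangles F hF1 hF2 hκ n _ fun t ht w hw1 hw2 hw3 hw4 => ?_
  have htn : ((t : ℝ) + 1) * κ ≤ n * κ :=
    mul_le_mul_of_nonneg_right (by exact_mod_cast ht) hκ.le
  have ht0 : 0 ≤ (t : ℝ) * κ := by positivity
  have hwr : w.re < gromov l i := by linarith
  refine mem_range_of_winding e hFc w (hpre i) (hpre (i + 2)) (hpre (i + 1))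
    (p := γ i 0) (q := γ (i + 2) 0) (r := γ (i + 1) 0) (mem_image_of_mem _ (h.zero_mem i))
    ⟨_, h.len_mem _, h.glue' i⟩ (mem_image_of_mem _ (h.zero_mem _))
    ⟨_, h.len_mem _, by rw [h.glue, (by decide : ∀ j : Fin 3, j + 1 + 1 = j + 2) i]⟩
    ⟨_, h.len_mem _, h.glue i⟩ (mem_image_of_mem _ (h.zero_mem _)) ?_ ?_ ?_ ?_
  · intro x hx
    simp only [F, Metric.infDist_zero_of_mem hx]
    exact hw3
  · rintro _ ⟨s, hs, rfl⟩
    exact hwr.trans_le (h.gromov_le_dist i hs)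
  · rintro _ ⟨s, hs, rfl⟩ hre
    change dist (γ (i + 2) s) (γ i 0) = w.re at hre
    change w.im < Metric.infDist (γ (i + 2) s) (γ i '' Icc 0 (l i))
    rw [h.dist_corner_right i hs] at hre
    have hY : l (i + 2) - t * κ ∈ Icc 0 (l (i + 2)) := ⟨by nlinarith, by linarith⟩
    have hXm : t * κ ∈ Icc 0 (l i) := ⟨ht0, by nlinarith⟩
    -- For a point `u` of edge `i`, the width is at most `|t * κ - u|` plus the distance `d` to that
    -- point, and `|t * κ - u| ≤ d` by comparing distances to the corner. Hence the factor `1 / 2`.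
    have h1 : dist (γ i (t * κ)) (γ (i + 2) (l (i + 2) - t * κ)) / 2 ≤
        Metric.infDist (γ (i + 2) (l (i + 2) - t * κ)) (γ i '' Icc 0 (l i)) := by
      refine (Metric.le_infDist ⟨_, mem_image_of_mem _ (h.zero_mem i)⟩).2 ?_
      rintro _ ⟨u, hu, rfl⟩
      have h2 := dist_triangle (γ i (t * κ)) (γ i u) (γ (i + 2) (l (i + 2) - t * κ))
      rw [h.dist_eq i _ hXm u hu, dist_comm (γ i u)] at h2
      have h3 := abs_dist_sub_le (γ (i + 2) (l (i + 2) - t * κ)) (γ i u) (γ i 0)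
      rw [h.dist_corner_right i hY, h.dist_corner_left i hu, sub_sub_cancel] at h3
      linarith
    -- Moving by less than one step from the mesh point costs at most `κ`, which is the height
    -- subtracted from the rectangle.
    have h2 := Metric.infDist_le_infDist_add_dist (s := γ i '' Icc 0 (l i))
      (x := γ (i + 2) (l (i + 2) - t * κ)) (y := γ (i + 2) s)
    rw [h.dist_eq (i + 2) _ hY s hs, abs_of_nonneg (by linarith)] at h2
    linarith
  · simp only [F, dist_self]
    linarith

/-- Some Gromov product is positive, because adjacent ones sum to an edge length. Halfway to it the
width is positive, as open edges are disjoint, so for a fine enough step one rectangle has positive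
area. This is what allows errors proportional to `κ` to be absorbed. -/
theorem hausdorffTwo_pos (h : TriangleParam X l γ) : 0 < hausdorffTwo X := by
  obtain ⟨i, hi⟩ : ∃ i, 0 < gromov l i := by
    have := gromov_add l 0
    have := h.pos 0
    by_contra! hc
    linarith [hc 0, hc (0 + 1)]
  let _ : MeasurableSpace X := borel X
  have : BorelSpace X := ⟨rfl⟩
  have hg1 := h.gromov_le i
  have hg2 := h.gromov_le' i
  set s := gromov l i / 2 with hs
  have hs0 : 0 < s := by positivity
  have hg : 0 < dist (γ i s) (γ (i + 2) (l (i + 2) - s)) := by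
    refine dist_pos.2 (h.disjoint i (i + 2) ((by decide : ∀ j : Fin 3, j ≠ j + 2) i) s
      ⟨hs0, by linarith⟩ _ ⟨by linarith, by linarith⟩)
  obtain ⟨m, hm⟩ := exists_nat_gt (s / (dist (γ i s) (γ (i + 2) (l (i + 2) - s)) / 2))
  rw [div_lt_iff₀ (by positivity)] at hm
  have hm0 : 0 < (m : ℝ) := by
    rcases Nat.eq_zero_or_pos m with rfl | h0
    · simp at hm; linarith
    · exact_mod_cast h0
  have hm1 : (1 : ℝ) ≤ m := by exact_mod_cast (Nat.cast_pos.1 hm0)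
  have hκ : 0 < s / m := by positivity
  have hmκ : m * (s / m) = s := by field_simp
  have h1 := h.sum_corner_le i hκ (m + 1) (by
    push_cast
    have : s / m ≤ s := div_le_self hs0.le hm1
    rw [add_mul, hmκ]
    linarith)
  have h2 := (Finset.single_le_sum (fun t _ => zero_le) (Finset.self_mem_range_succ m)).trans h1
  rw [hmκ] at h2
  refine ENNReal.mul_pos (ENNReal.ofReal_pos.2 (by positivity)).ne' (lt_of_lt_of_le ?_ h2).ne'
  refine ENNReal.ofReal_pos.2 (mul_pos hκ (sub_pos.2 ?_))
  rw [div_lt_iff₀ hm0]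
  linarith

/-- A corner does not lie on the opposite edge. -/
theorem ne_corner (h : TriangleParam X l γ) (j : Fin 3) {s : ℝ} (hs : s ∈ Icc 0 (l (j + 1))) :
    γ (j + 1) s ≠ γ j 0 := by
  intro hsj
  obtain ⟨e, he⟩ := h.disk
  have hnorm : ∀ k, ∀ s ∈ Icc 0 (l k), ‖(e (γ k s) : ℂ)‖ = 1 := by
    intro k s hs
    have : γ k s ∈ ⋃ j, γ j '' Icc 0 (l j) := mem_iUnion.2 ⟨k, mem_image_of_mem _ hs⟩
    rw [he] at this
    exact this
  have hs0 : s ≠ 0 := by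
    rintro rfl
    exact h.corner_ne ((by decide : ∀ j : Fin 3, j + 1 ≠ j) j) hsj
  have hsl : s ≠ l (j + 1) := by
    rintro rfl
    rw [h.glue] at hsj
    exact h.corner_ne ((by decide : ∀ j : Fin 3, j + 1 + 1 ≠ j) j) hsj
  have hl2 := h.pos (j + 2)
  -- If edge `j + 1` returned to corner `j`, edges `j` and `j + 1` would contain two paths joining
  -- the same two corners and avoiding a point `a` of edge `j + 2`. That `a` is not corner `j + 1`
  -- has to be arranged, since a corner inside an edge is not yet excluded.
  obtain ⟨a, ha, hane⟩ : ∃ a ∈ Ioo 0 (l (j + 2)), γ (j + 2) a ≠ γ (j + 1) 0 := by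
    by_contra! hc
    have h1 := hc (l (j + 2) / 2) ⟨by linarith, by linarith⟩
    have h2 := hc (l (j + 2) / 3) ⟨by linarith, by linarith⟩
    have := h.injOn (j + 2) ⟨by linarith, by linarith⟩ ⟨by linarith, by linarith⟩ (h1.trans h2.symm)
    linarith
  have ha' := Ioo_subset_Icc_self ha
  have hne0 : ∀ t ∈ Icc 0 (l j), γ j t ≠ γ (j + 2) a := by
    intro t ht heq
    rcases eq_or_lt_of_le ht.1 with rfl | ht0
    · rw [← h.glue' j] at heq
      exact ha.2.ne (h.injOn _ (h.len_mem _) ha' heq).symm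
    rcases eq_or_lt_of_le ht.2 with rfl | htl
    · rw [h.glue] at heq
      exact hane heq.symm
    exact h.disjoint _ _ ((by decide : ∀ j : Fin 3, j ≠ j + 2) j) t ⟨ht0, htl⟩ a ha heq
  have hne1 : ∀ t ∈ Icc 0 (l (j + 1)), γ (j + 1) t ≠ γ (j + 2) a := by
    intro t ht heq
    rcases eq_or_lt_of_le ht.1 with rfl | ht0
    · exact hane heq.symm
    rcases eq_or_lt_of_le ht.2 with rfl | htl
    · rw [h.glue, (by decide : ∀ j : Fin 3, j + 1 + 1 = j + 2) j] at heq
      exact ha.1.ne (h.injOn _ (h.zero_mem _) ha' heq)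
    exact h.disjoint _ _ ((by decide : ∀ j : Fin 3, j + 1 ≠ j + 2) j) t ⟨ht0, htl⟩ a ha heq
  set z₀ : ℂ := (e (γ (j + 2) a) : ℂ) with hz₀
  have hz₀n : ‖z₀‖ = 1 := hnorm _ a ha'
  have hz₀0 : z₀ ≠ 0 := fun h0 => by simp [h0] at hz₀n
  -- The angle on the circle cut at `z₀`, injective on the boundary and continuous off the point
  -- `a`. It turns both paths into paths in an interval.
  let ψ : X → ℝ := fun x => Complex.arg (-(e x / z₀))
  have hslit : ∀ x, ‖(e x : ℂ)‖ = 1 → x ≠ γ (j + 2) a → -((e x : ℂ) / z₀) ∈ Complex.slitPlane := by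
    intro x hx hxa
    by_contra hns
    simp only [Complex.mem_slitPlane_iff, not_or, Complex.neg_re, Complex.neg_im, not_lt,
      ne_eq, neg_eq_zero, not_not, neg_nonpos] at hns
    have hn : ‖(e x : ℂ) / z₀‖ = 1 := by rw [norm_div, hx, hz₀n, div_one]
    have hre : (e x : ℂ) / z₀ = (((e x : ℂ) / z₀).re : ℂ) := Complex.ext rfl (by simpa using hns.2)
    rw [hre, Complex.norm_real, Real.norm_of_nonneg hns.1] at hn
    rw [hn, Complex.ofReal_one, div_eq_one_iff_eq hz₀0] at hre
    exact hxa (e.injective (Subtype.ext hre))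
  have hψc : ∀ x, ‖(e x : ℂ)‖ = 1 → x ≠ γ (j + 2) a → ContinuousAt ψ x := by
    intro x hx hxa
    exact ContinuousAt.comp (f := fun x => -((e x : ℂ) / z₀)) (Complex.continuousAt_arg (hslit x hx hxa))
      (by fun_prop)
  have hψi : ∀ x y, ‖(e x : ℂ)‖ = 1 → ‖(e y : ℂ)‖ = 1 → ψ x = ψ y → x = y := by
    intro x y hx hy hxy
    have := Complex.ext_norm_arg (by rw [norm_neg, norm_neg, norm_div, norm_div, hx, hy]) hxy
    rw [neg_inj, div_left_inj' hz₀0] at this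
    exact e.injective (Subtype.ext this)
  have hu : ContinuousOn (fun t => ψ (γ j t)) (Icc 0 (l j)) := fun t ht =>
    (hψc _ (hnorm j t ht) (hne0 t ht)).comp_continuousWithinAt (h.continuousOn j t ht)
  have hsub : Icc 0 s ⊆ Icc 0 (l (j + 1)) := Icc_subset_Icc_right hs.2
  have hv : ContinuousOn (fun t => ψ (γ (j + 1) t)) (Icc 0 s) := fun t ht =>
    (hψc _ (hnorm _ t (hsub ht)) (hne1 t (hsub ht))).comp_continuousWithinAt
      ((h.continuousOn (j + 1)).mono hsub t ht)
  set P := ψ (γ j 0) with hP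
  set Q := ψ (γ (j + 1) 0) with hQ
  have hPQ : P ≠ Q := fun hPQ => h.corner_ne ((by decide : ∀ j : Fin 3, j ≠ j + 1) j)
    (hψi _ _ (hnorm _ _ (h.zero_mem _)) (hnorm _ _ (h.zero_mem _)) hPQ)
  have hmid : (P + Q) / 2 ∈ uIcc P Q := by
    rcases le_total P Q with hle | hle
    · rw [uIcc_of_le hle]; constructor <;> linarith
    · rw [uIcc_of_ge hle]; constructor <;> linarith
  -- Both paths take the mean of the two corner angles, and they do so at interior parameters. This
  -- gives a common point of two open edges.
  have i1 := intermediate_value_uIcc (f := fun t => ψ (γ j t)) (a := 0) (b := l j) (by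
    rwa [uIcc_of_le (h.pos j).le])
  have i2 := intermediate_value_uIcc (f := fun t => ψ (γ (j + 1) t)) (a := 0) (b := s) (by
    rwa [uIcc_of_le hs.1])
  simp only [h.glue, hsj] at i1 i2
  obtain ⟨t₁, ht₁, hm₁⟩ := i1 hmid
  obtain ⟨t₂, ht₂, hm₂⟩ := i2 (uIcc_comm P Q ▸ hmid)
  rw [uIcc_of_le (h.pos j).le] at ht₁
  rw [uIcc_of_le hs.1] at ht₂
  simp only at hm₁ hm₂
  have a1 : t₁ ≠ 0 := by
    rintro rfl
    exact hPQ (by rw [← hP] at hm₁; linarith)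
  have a2 : t₁ ≠ l j := by
    rintro rfl
    rw [h.glue, ← hQ] at hm₁
    exact hPQ (by linarith)
  have a3 : t₂ ≠ 0 := by
    rintro rfl
    exact hPQ (by rw [← hQ] at hm₂; linarith)
  have hs' : s < l (j + 1) := lt_of_le_of_ne hs.2 hsl
  exact h.disjoint _ _ ((by decide : ∀ j : Fin 3, j ≠ j + 1) j) t₁
    ⟨lt_of_le_of_ne ht₁.1 a1.symm, lt_of_le_of_ne ht₁.2 a2⟩ t₂
    ⟨lt_of_le_of_ne ht₂.1 a3.symm, ht₂.2.trans_lt hs'⟩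
    (hψi _ _ (hnorm _ _ ht₁) (hnorm _ _ (hsub ht₂)) (hm₁.trans hm₂.symm))

/-- The right-hand side mentions only `l`: two disks with the same side lengths have the same
boundary identifications. -/
theorem eq_iff (h : TriangleParam X l γ) {j k : Fin 3} {s t : ℝ} (hs : s ∈ Icc 0 (l j))
    (ht : t ∈ Icc 0 (l k)) :
    γ j s = γ k t ↔ (j = k ∧ s = t) ∨ (k = j + 1 ∧ s = l j ∧ t = 0) ∨
      (j = k + 1 ∧ t = l k ∧ s = 0) := by
  constructor
  · have key : ∀ j, ∀ s ∈ Icc 0 (l j), ∀ t ∈ Icc 0 (l (j + 1)), γ j s = γ (j + 1) t →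
        s = l j ∧ t = 0 := by
      intro j s hs t ht heq
      rcases eq_or_lt_of_le hs.1 with rfl | hs0
      · exact absurd heq.symm (h.ne_corner j ht)
      rcases eq_or_lt_of_le hs.2 with rfl | hsl
      · rw [h.glue] at heq
        exact ⟨rfl, (h.injOn _ (h.zero_mem _) ht heq).symm⟩
      rcases eq_or_lt_of_le ht.1 with rfl | ht0
      · rw [← h.glue] at heq
        exact ⟨h.injOn _ hs (h.len_mem _) heq, rfl⟩
      rcases eq_or_lt_of_le ht.2 with rfl | htl
      · have := h.ne_corner (j + 2) (s := s)
        rw [(by decide : ∀ j : Fin 3, j + 2 + 1 = j) j] at this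
        rw [h.glue, (by decide : ∀ j : Fin 3, j + 1 + 1 = j + 2) j] at heq
        exact absurd heq (this hs)
      exact absurd heq (h.disjoint _ _ ((by decide : ∀ j : Fin 3, j ≠ j + 1) j) s ⟨hs0, hsl⟩ t
        ⟨ht0, htl⟩)
    intro heq
    rcases (by decide : ∀ j k : Fin 3, j = k ∨ k = j + 1 ∨ j = k + 1) j k with rfl | rfl | rfl
    · exact Or.inl ⟨rfl, h.injOn _ hs ht heq⟩
    · exact Or.inr (Or.inl ⟨rfl, key _ s hs t ht heq⟩)
    · exact Or.inr (Or.inr ⟨rfl, key _ t ht s hs heq.symm⟩)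
  · rintro (⟨rfl, rfl⟩ | ⟨rfl, rfl, rfl⟩ | ⟨rfl, rfl, rfl⟩)
    · rfl
    · exact h.glue j
    · exact (h.glue k).symm

end TriangleParam

/-! ### Comparing triangular disks with the same side lengths -/

namespace TriangleParam

variable {S T : Type*} [MetricSpace S] [MetricSpace T] {l : Fin 3 → ℝ} {β : Fin 3 → ℝ → S}
  {γ : Fin 3 → ℝ → T}

/-- Presents the circle as the image of three disjoint closed intervals, compact and hence by a
quotient map. -/
theorem exists_sphere_param (h : TriangleParam T l γ) :
    ∃ (e : T ≃ₜ Metric.closedBall (0 : ℂ) 1)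
      (f : (Σ j : Fin 3, Icc (0 : ℝ) (l j)) → Metric.sphere (0 : ℂ) 1),
      Continuous f ∧ Function.Surjective f ∧ (∀ a, (f a : ℂ) = e (γ a.1 a.2)) := by
  obtain ⟨e, he⟩ := h.disk
  have hm : ∀ a : Σ j : Fin 3, Icc (0 : ℝ) (l j), (e (γ a.1 a.2) : ℂ) ∈ Metric.sphere (0 : ℂ) 1 := by
    rintro ⟨j, s, hs⟩
    have : γ j s ∈ ⋃ j, γ j '' Icc 0 (l j) := mem_iUnion.2 ⟨j, mem_image_of_mem _ hs⟩
    rw [he] at this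
    simpa using this
  refine ⟨e, fun a => ⟨_, hm a⟩, ?_, ?_, fun a => rfl⟩
  · refine Continuous.subtype_mk (continuous_sigma fun j => ?_) _
    exact continuous_subtype_val.comp (e.continuous.comp
      (continuousOn_iff_continuous_domRestrict.1 (h.continuousOn j)))
  · rintro ⟨z, hz⟩
    have hz1 : ‖z‖ = 1 := by simpa using hz
    have : e.symm ⟨z, Metric.sphere_subset_closedBall hz⟩ ∈ ⋃ j, γ j '' Icc 0 (l j) := by
      rw [he]
      simpa using hz1
    obtain ⟨j, s, hs, hjs⟩ := mem_iUnion.1 this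
    refine ⟨⟨j, s, hs⟩, Subtype.ext ?_⟩
    simp [hjs]

/-- Both circles are quotients of the same three intervals by the same relation `eq_iff`. The
induced homeomorphism of circles is extended over the disks by the cone construction. -/
theorem exists_homeomorph (hS : TriangleParam S l β) (hT : TriangleParam T l γ) :
    ∃ φ : S ≃ₜ T, ∀ j, ∀ s ∈ Icc 0 (l j), φ (β j s) = γ j s := by
  obtain ⟨e, f, hf, hfs, hfe⟩ := hS.exists_sphere_param
  obtain ⟨e', f', hf', hfs', hfe'⟩ := hT.exists_sphere_param
  have hiff : ∀ a b, f a = f b ↔ f' a = f' b := by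
    intro a b
    rw [Subtype.ext_iff, Subtype.ext_iff, hfe, hfe, hfe', hfe', ← Subtype.ext_iff,
      ← Subtype.ext_iff, e.injective.eq_iff, e'.injective.eq_iff, hS.eq_iff a.2.2 b.2.2,
      hT.eq_iff a.2.2 b.2.2]
  let τ₀ : Metric.sphere (0 : ℂ) 1 → Metric.sphere (0 : ℂ) 1 :=
    fun z => f' (Function.surjInv hfs z)
  have hτ₀ : ∀ a, τ₀ (f a) = f' a := fun a => (hiff _ _).1 (Function.surjInv_eq hfs _)
  have hcl : IsClosedMap f := hf.isClosedMap
  have hτ₀c : Continuous τ₀ := by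
    rw [(hcl.isQuotientMap hf hfs).continuous_iff]
    exact hf'.congr fun a => (hτ₀ a).symm
  have hτ₀b : Function.Bijective τ₀ := by
    constructor
    · intro z w hzw
      obtain ⟨a, rfl⟩ := hfs z
      obtain ⟨b, rfl⟩ := hfs w
      rw [hτ₀, hτ₀] at hzw
      exact (hiff a b).2 hzw
    · intro z
      obtain ⟨a, rfl⟩ := hfs' z
      exact ⟨f a, hτ₀ a⟩
  classical
  let τ : ℂ → ℂ := fun z => if hz : z ∈ Metric.sphere (0 : ℂ) 1 then τ₀ ⟨z, hz⟩ else 0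
  have hτ : ∀ z : Metric.sphere (0 : ℂ) 1, τ z = τ₀ z := fun z => dif_pos z.2
  obtain ⟨Θ, hΘc, hΘb, hΘτ⟩ := exists_radial_extension (τ := τ) (by
      rw [continuousOn_iff_continuous_domRestrict]
      exact (continuous_subtype_val.comp hτ₀c).congr fun z => (hτ z).symm) (by
      refine ⟨fun z hz => ?_, fun z hz w hw hzw => ?_, fun z hz => ?_⟩
      · rw [hτ ⟨z, hz⟩]; exact (τ₀ _).2
      · rw [hτ ⟨z, hz⟩, hτ ⟨w, hw⟩] at hzw
        exact congrArg Subtype.val (hτ₀b.1 (Subtype.ext hzw))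
      · obtain ⟨w, hw⟩ := hτ₀b.2 ⟨z, hz⟩
        exact ⟨w, w.2, by rw [hτ, hw]⟩)
  have hbij : Function.Bijective fun z : Metric.closedBall (0 : ℂ) 1 =>
      (⟨Θ z, hΘb.mapsTo z.2⟩ : Metric.closedBall (0 : ℂ) 1) := by
    constructor
    · intro z w hzw
      exact Subtype.ext (hΘb.injOn z.2 w.2 (congrArg Subtype.val hzw))
    · intro z
      obtain ⟨w, hw, hwz⟩ := hΘb.surjOn z.2
      exact ⟨⟨w, hw⟩, Subtype.ext hwz⟩
  have hcompact : CompactSpace (Metric.closedBall (0 : ℂ) 1) :=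
    isCompact_iff_compactSpace.1 (isCompact_closedBall _ _)
  let Ψ : Metric.closedBall (0 : ℂ) 1 ≃ₜ Metric.closedBall (0 : ℂ) 1 :=
    Continuous.homeoOfEquivCompactToT2 (f := Equiv.ofBijective _ hbij)
      (Continuous.subtype_mk (continuousOn_iff_continuous_domRestrict.1 hΘc) _)
  refine ⟨(e.trans Ψ).trans e'.symm, fun j s hs => ?_⟩
  have h1 : (Ψ (e (β j s)) : ℂ) = e' (γ j s) := by
    change Θ (e (β j s)) = _
    rw [← hfe ⟨j, s, hs⟩, hΘτ (f _).2, hτ, hτ₀, hfe']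
  simp only [Homeomorph.trans_apply]
  rw [Subtype.ext h1, e'.symm_apply_apply]

end TriangleParam

/-! ### Lengths of boundary paths -/

/-- Continuous induction. Distances are compared only with nearby points, so `edist (u x) (u y)` is
bounded by the variation of `v` on `[x, y]` through a minimal counterexample; summing over a
partition gives the claim. -/
theorem eVariationOn_le_of_eventually_edist_eq {α E F : Type*} [ConditionallyCompleteLinearOrder α]
    [TopologicalSpace α] [OrderTopology α] [DenselyOrdered α] [PseudoEMetricSpace E]
    [PseudoEMetricSpace F] {u : α → E} {v : α → F}
    (h : ∀ t, ∀ᶠ s in nhds t, edist (u s) (u t) = edist (v s) (v t)) :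
    eVariationOn u univ ≤ eVariationOn v univ := by
  have step : ∀ x y z, x ≤ y → y ≤ z → edist (u x) (u y) ≤ eVariationOn v (Icc x y) →
      edist (u y) (u z) = edist (v y) (v z) → edist (u x) (u z) ≤ eVariationOn v (Icc x z) := by
    intro x y z hxy hyz h1 h2
    have h3 := eVariationOn.Icc_add_Icc v (s := univ) hxy hyz (mem_univ y)
    simp only [univ_inter] at h3
    rw [← h3]
    refine (edist_triangle _ (u y) _).trans (add_le_add h1 ?_)
    rw [h2]
    exact eVariationOn.edist_le v (left_mem_Icc.2 hyz) (right_mem_Icc.2 hyz)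
  have key : ∀ x y, x ≤ y → edist (u x) (u y) ≤ eVariationOn v (Icc x y) := by
    intro x
    by_contra! hc
    -- The local comparison at `sInf B` is used twice: from the left it shows that the infimum is
    -- good, and from the right that good points persist beyond it.
    let B := {y | x ≤ y ∧ eVariationOn v (Icc x y) < edist (u x) (u y)}
    have hB : B.Nonempty := hc
    have hbd : BddBelow B := ⟨x, fun y hy => hy.1⟩
    have hxs : x ≤ sInf B := le_csInf hB fun y hy => hy.1
    have hgood : edist (u x) (u (sInf B)) ≤ eVariationOn v (Icc x (sInf B)) := by
      rcases eq_or_lt_of_le hxs with heq | hlt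
      · rw [← heq, edist_self]; exact zero_le
      · have : (nhdsWithin (sInf B) (Iio (sInf B))).NeBot := nhdsLT_neBot_of_exists_lt ⟨x, hlt⟩
        obtain ⟨z, hz, hz1, hz2⟩ := ((eventually_nhdsWithin_of_eventually_nhds (h (sInf B))).and
          (Ioo_mem_nhdsLT hlt)).exists
        refine step x z _ hz1.le hz2.le ?_ hz
        by_contra! hbad
        exact absurd (csInf_le hbd (⟨hz1.le, hbad⟩ : z ∈ B)) (not_le.2 hz2)
    obtain ⟨y, hyB, hy⟩ := (mem_closure_iff_frequently.1 (csInf_mem_closure hB hbd)).and_eventually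
      (h (sInf B)) |>.exists
    have := step x _ y hxs (csInf_le hbd hyB) hgood (by rw [edist_comm, hy, edist_comm])
    exact absurd hyB.2 (not_lt.2 this)
  refine iSup_le fun p => ?_
  obtain ⟨n, p, hp, -⟩ := p
  calc ∑ i ∈ Finset.range n, edist (u (p (i + 1))) (u (p i))
      ≤ ∑ i ∈ Finset.range n, eVariationOn v (Icc (p i) (p (i + 1))) :=
        Finset.sum_le_sum fun i _ => by
          rw [edist_comm]; exact key _ _ (hp (Nat.le_succ i))
    _ = eVariationOn v (Icc (p 0) (p n)) := by
        clear * - hp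
        induction n with
        | zero => simp
        | succ n ih =>
          rw [Finset.sum_range_succ, ih]
          have h3 := eVariationOn.Icc_add_Icc v (s := univ) (hp (Nat.zero_le n))
            (hp (Nat.le_succ n)) (mem_univ _)
          simpa only [univ_inter] using h3
    _ ≤ _ := eVariationOn.mono v (subset_univ _)

/-- A map which is isometric on each of finitely many closed sets preserves the lengths of paths
in their union. -/
theorem pathLength_comp_eq {S T : Type*} [MetricSpace S] [MetricSpace T] {ι : Type*} [Finite ι]
    (β : ι → Set S) (hβ : ∀ j, IsClosed (β j)) (φ : C(S, T))
    (hφ : ∀ j, ∀ x ∈ β j, ∀ y ∈ β j, dist (φ x) (φ y) = dist x y) (γ : C(unitInterval, S))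
    (hγ : ∀ t, γ t ∈ ⋃ j, β j) : pathLength (φ.comp γ) = pathLength γ := by
  have key : ∀ t, ∀ᶠ s in nhds t, edist ((φ.comp γ) s) ((φ.comp γ) t) = edist (γ s) (γ t) := by
    intro t
    -- Near `t` the path avoids this finite closed union, so each nearby value shares a piece with
    -- `γ t`, and there the map is isometric.
    have hcl : IsClosed (⋃ j ∈ {j | γ t ∉ β j}, β j) :=
      (Set.toFinite _).isClosed_biUnion fun j _ => hβ j
    have hnt : γ t ∈ (⋃ j ∈ {j | γ t ∉ β j}, β j)ᶜ := by
      intro hmem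
      obtain ⟨j, hj, hj'⟩ := mem_iUnion₂.1 hmem
      exact hj hj'
    filter_upwards [γ.continuous.continuousAt.preimage_mem_nhds (hcl.isOpen_compl.mem_nhds hnt)]
      with s hs
    obtain ⟨j, hj⟩ := mem_iUnion.1 (hγ s)
    have htj : γ t ∈ β j := by
      by_contra hc
      exact hs (mem_iUnion₂.2 ⟨j, hc, hj⟩)
    simp only [ContinuousMap.comp_apply]
    rw [edist_dist, edist_dist, hφ j _ hj _ htj]
  exact le_antisymm (eVariationOn_le_of_eventually_edist_eq key)
    (eVariationOn_le_of_eventually_edist_eq fun t => (key t).mono fun s hs => hs.symm)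

/-! ### Shelling a collar -/

namespace Shelling

variable {V : Type*} [DecidableEq V] {T : Finset (Finset V)}

theorem ear_at {p s : List V} {u v : V} (z : V) (h : Shelling T (p ++ u :: v :: s))
    (hz : ∀ t ∈ T, z ∉ t) : Shelling (insert {u, v, z} T) (p ++ u :: z :: v :: s) := by
  have h1 := Shelling.ear (l := s ++ p) z (by simpa using Shelling.rot p (u :: v :: s) h) hz
  simpa using Shelling.rot (u :: z :: v :: s) p (by simpa using h1)

theorem fill_at {p s : List V} {u v w : V} (h : Shelling T (p ++ u :: v :: w :: s))
    (hl : s ++ p ≠ []) (hT : ∀ t ∈ T, u ∈ t → w ∉ t) :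
    Shelling (insert {u, v, w} T) (p ++ u :: w :: s) := by
  have h1 := Shelling.fill (l := s ++ p) (by simpa using Shelling.rot p (u :: v :: w :: s) h) hl hT
  simpa using Shelling.rot (u :: w :: s) p (by simpa using h1)

variable {J : Type*} [DecidableEq J] (w v : J → V) (succ : J → J)

/-- First ring along an open chain of old edges: each edge gets an ear with a new tip, and the
boundary then alternates between `w` and `v`. -/
theorem collar_ears (hv : Function.Injective v) (hvw : ∀ a b, v a ≠ w b) (n : ℕ) :
    ∀ (T : Finset (Finset V)) (p : List V) (k : J),
      Shelling T (p ++ (List.iterate succ k n).map w ++ [w (succ^[n] k)]) →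
      (List.iterate succ (succ k) n).Nodup →
      (∀ a ∈ List.iterate succ (succ k) n, ∀ t ∈ T, v a ∉ t) →
      Shelling (T ∪ (List.iterate succ k n).toFinset.image
        fun a => {w a, w (succ a), v (succ a)})
        (p ++ (List.iterate succ k n).flatMap (fun a => [w a, v (succ a)]) ++
          [w (succ^[n] k)]) := by
  induction n with
  | zero => intro T p k h _ _; simpa using h
  | succ n ih =>
    intro T p k h hnd hf
    obtain ⟨r, hr⟩ : ∃ r, (List.iterate succ (succ k) n).map w ++ [w (succ^[n] (succ k))] =
        w (succ k) :: r := by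
      cases n with
      | zero => exact ⟨[], rfl⟩
      | succ n => exact ⟨_, rfl⟩
    have h1 : Shelling T (p ++ w k :: w (succ k) :: r) := by
      rw [← hr]; simpa [List.iterate] using h
    have hf' := hf (succ k) (by simp [List.iterate])
    have h2 := h1.ear_at (v (succ k)) hf'
    have hnd' : succ k ∉ List.iterate succ (succ (succ k)) n ∧
        (List.iterate succ (succ (succ k)) n).Nodup := List.nodup_cons.1 hnd
    have h3 := ih (insert {w k, w (succ k), v (succ k)} T) (p ++ [w k, v (succ k)]) (succ k) (by
        rw [List.append_assoc, hr]; simpa using h2) hnd'.2 (fun a ha t ht => by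
        rcases Finset.mem_insert.1 ht with rfl | ht
        · have : a ≠ succ k := fun h => hnd'.1 (h ▸ ha)
          simp [hvw, hv.eq_iff, this]
        · exact hf a (List.mem_cons_of_mem _ ha) t ht)
    have e : T ∪ (List.iterate succ k (n + 1)).toFinset.image
        (fun a => ({w a, w (succ a), v (succ a)} : Finset V)) =
        insert {w k, w (succ k), v (succ k)} T ∪ (List.iterate succ (succ k) n).toFinset.image
        fun a => {w a, w (succ a), v (succ a)} := by
      simp only [List.iterate, List.toFinset_cons, Finset.image_insert]
      ext t
      simp only [Finset.mem_union, Finset.mem_insert]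
      tauto
    rw [e]
    simpa [List.iterate] using h3

/-- Second ring: the notch at each `w a` between two consecutive tips is filled, leaving only
vertices `v` in this portion of the boundary. -/
theorem collar_fills (hv : Function.Injective v) (hvw : ∀ a b, v a ≠ w b) (n : ℕ) :
    ∀ (T : Finset (Finset V)) (p : List V) (k : J), p ≠ [] →
      Shelling T (p ++ v k :: (List.iterate succ k n).flatMap (fun a => [w a, v (succ a)])) →
      (List.iterate succ k n).Nodup →
      (∀ a ∈ List.iterate succ k n, succ a ≠ a ∧ succ (succ a) ≠ a) →
      (∀ a ∈ List.iterate succ k n, ∀ t ∈ T, v a ∈ t → v (succ a) ∉ t) →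
      Shelling (T ∪ (List.iterate succ k n).toFinset.image fun a => {v a, w a, v (succ a)})
        (p ++ v k :: (List.iterate succ k n).map (fun a => v (succ a))) := by
  induction n with
  | zero => intro T p k _ h _ _ _; simpa using h
  | succ n ih =>
    intro T p k hp h hnd hs hf
    have h1 : Shelling T (p ++ v k :: w k :: v (succ k) ::
        (List.iterate succ (succ k) n).flatMap (fun a => [w a, v (succ a)])) := by
      simpa [List.iterate] using h
    have h2 := h1.fill_at (by simp [hp]) (hf k (by simp [List.iterate]))
    have hnd' : k ∉ List.iterate succ (succ k) n ∧ (List.iterate succ (succ k) n).Nodup :=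
      List.nodup_cons.1 hnd
    have hk := hs k (by simp [List.iterate])
    have h3 := ih (insert {v k, w k, v (succ k)} T) (p ++ [v k]) (succ k) (by simp)
      (by simpa using h2) hnd'.2 (fun a ha => hs a (List.mem_cons_of_mem _ ha))
      (fun a ha t ht => by
        rcases Finset.mem_insert.1 ht with rfl | ht
        · have hak : a ≠ k := fun h => hnd'.1 (h ▸ ha)
          simp only [Finset.mem_insert, Finset.mem_singleton, hvw, hv.eq_iff, hak, false_or]
          rintro rfl
          exact not_or.2 ⟨hk.2, (hs _ (List.mem_cons_of_mem _ ha)).1⟩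
        · exact hf a (List.mem_cons_of_mem _ ha) t ht)
    have e : T ∪ (List.iterate succ k (n + 1)).toFinset.image
        (fun a => ({v a, w a, v (succ a)} : Finset V)) =
        insert {v k, w k, v (succ k)} T ∪ (List.iterate succ (succ k) n).toFinset.image
        fun a => {v a, w a, v (succ a)} := by
      simp only [List.iterate, List.toFinset_cons, Finset.image_insert]
      ext t
      simp only [Finset.mem_union, Finset.mem_insert]
      tauto
    rw [e]
    simpa [List.iterate] using h3

/-- A shelling can be extended by a collar of two rings of triangles. -/
theorem collar (hv : Function.Injective v) (hvw : ∀ a b, v a ≠ w b)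
    {n : ℕ} {k : J} (hn : 3 ≤ n) (hk : succ^[n] k = k)
    (h : Shelling T ((List.iterate succ k n).map w)) (hT : ∀ a, ∀ t ∈ T, v a ∉ t)
    (hs : ∀ a ∈ List.iterate succ k n, succ a ≠ a ∧ succ (succ a) ≠ a) :
    Shelling (T ∪ ((List.iterate succ k n).toFinset.image
        fun a => {w a, w (succ a), v (succ a)}) ∪
        ((List.iterate succ k n).toFinset.image fun a => {v a, w a, v (succ a)}))
      ((List.iterate succ k n).map v) := by
  have hnd : (List.iterate succ k n).Nodup := h.nodup_and_mem.1.of_map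
  -- The chain lemmas treat linear lists, so one edge of the cycle is kept back. A last ear and a
  -- last fill close the two rings.
  obtain ⟨m, rfl⟩ : ∃ m, n = m + 1 := ⟨n - 1, by omega⟩
  have hcyc : List.iterate succ (succ k) (m + 1) = List.iterate succ (succ k) m ++ [k] := by
    rw [List.iterate_add, ← Function.iterate_succ_apply, hk]; rfl
  have hperm : (List.iterate succ (succ k) (m + 1)).Perm (List.iterate succ k (m + 1)) := by
    rw [hcyc]
    exact List.perm_append_comm
  have hnd' : k ∉ List.iterate succ (succ k) m ∧ (List.iterate succ (succ k) m).Nodup :=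
    List.nodup_cons.1 hnd
  have h0 : Shelling T ([] ++ (List.iterate succ (succ k) m).map w ++ [w (succ^[m] (succ k))]) := by
    rw [← Function.iterate_succ_apply, hk]
    simpa using Shelling.rot [w k] ((List.iterate succ (succ k) m).map w)
      (by simpa [List.iterate] using h)
  have hsub : List.iterate succ (succ (succ k)) m ++ [succ k] =
      List.iterate succ (succ (succ k)) (m + 1) := by
    rw [List.iterate_add, ← Function.iterate_succ_apply, ← Function.iterate_succ_apply,
      Function.iterate_succ_apply' succ (m + 1), hk]
    rfl
  have hnds : (List.iterate succ (succ k) (m + 1)).Nodup := hperm.nodup_iff.2 hnd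
  have hnd2 : (List.iterate succ (succ (succ k)) m ++ [succ k]).Nodup :=
    (List.perm_append_comm (l₁ := List.iterate succ (succ (succ k)) m)
      (l₂ := [succ k])).nodup_iff.2 hnds
  have h1 := collar_ears w v succ hv hvw m T [] (succ k) h0
    (List.nodup_append.1 hnd2).1 fun a _ => hT a
  rw [← Function.iterate_succ_apply, hk] at h1
  obtain ⟨j, rfl⟩ : ∃ j, m = j + 1 := ⟨m - 1, by omega⟩
  generalize hT₂ : T ∪ (List.iterate succ (succ k) (j + 1)).toFinset.image
    (fun a => ({w a, w (succ a), v (succ a)} : Finset V)) = T₂ at h1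
  have h2 := Shelling.ear (u := w k) (v := w (succ k)) (l := v (succ (succ k)) ::
      (List.iterate succ (succ (succ k)) j).flatMap (fun a => [w a, v (succ a)])) (v (succ k))
    (by simpa [List.iterate] using Shelling.rot _ [w k] h1) (by
      intro t ht
      rw [← hT₂] at ht
      rcases Finset.mem_union.1 ht with ht | ht
      · exact hT _ t ht
      · obtain ⟨a, ha, rfl⟩ := Finset.mem_image.1 ht
        have : succ k ≠ succ a := by
          intro hka
          have hmem : succ a ∈ List.iterate succ (succ (succ k)) (j + 1) := by
            have := List.mem_map_of_mem (f := succ) (List.mem_toFinset.1 ha)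
            clear * - this
            generalize succ k = b at *
            generalize j + 1 = m at *
            induction m generalizing b with
            | zero => simp [List.iterate] at this
            | succ m ih =>
              simp only [List.iterate, List.map_cons, List.mem_cons] at this ⊢
              exact this.imp_right fun h => ih _ h
          exact (List.nodup_append.1 hnd2).2.2 _ hmem _ (List.mem_singleton.2 rfl) hka.symm
        simp [hvw, hv.eq_iff, this])
  generalize hT₁ : insert {w k, w (succ k), v (succ k)} T₂ = T₁ at h2
  have eT₁ : T₁ = T ∪ ((List.iterate succ k (j + 1 + 1)).toFinset.image
        fun a => {w a, w (succ a), v (succ a)}) := by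
    rw [← hT₁, ← hT₂]
    simp only [List.iterate, List.toFinset_cons, Finset.image_insert]
    ext t
    simp only [Finset.mem_union, Finset.mem_insert]
    tauto
  -- A triangle of the first ring has only one outer vertex; hence the outer edges created by the
  -- fills are new.
  have hone : ∀ a b, a ≠ b → ∀ t ∈ T₁, v a ∈ t → v b ∉ t := by
    intro a b hab t ht ha hb
    rw [eT₁] at ht
    rcases Finset.mem_union.1 ht with ht | ht
    · exact hT a t ht ha
    · obtain ⟨c, -, rfl⟩ := Finset.mem_image.1 ht
      simp only [Finset.mem_insert, Finset.mem_singleton, hvw, hv.eq_iff, false_or] at ha hb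
      exact hab (ha.trans hb.symm)
  have h3 : Shelling T₁ ([w k] ++ v (succ k) ::
      (List.iterate succ (succ k) (j + 1)).flatMap (fun a => [w a, v (succ a)])) := by
    simpa [List.iterate] using h2
  have hks := hs k (by simp [List.iterate])
  have h4 := collar_fills w v succ hv hvw (j + 1) T₁ [w k] (succ k) (by simp) h3 hnd'.2
    (fun a ha => hs a (List.mem_cons_of_mem _ ha)) (fun a ha t ht hat => hone a (succ a)
      (hs a (List.mem_cons_of_mem _ ha)).1.symm t ht hat)
  have hmap : (List.iterate succ (succ k) (j + 1)).map (fun a => v (succ a)) =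
      (List.iterate succ (succ (succ k)) j).map v ++ [v k] := by
    have e1 : ∀ (m : ℕ) (b : J), (List.iterate succ b m).map (fun a => v (succ a)) =
        (List.iterate succ (succ b) m).map v := by
      intro m
      induction m with
      | zero => intro b; rfl
      | succ m ih => intro b; simp [List.iterate, ih]
    rw [e1, List.iterate_add, ← Function.iterate_succ_apply, ← Function.iterate_succ_apply, hk]
    simp [List.iterate]
  rw [hmap] at h4
  generalize hT₃ : T₁ ∪ (List.iterate succ (succ k) (j + 1)).toFinset.image
    (fun a => ({v a, w a, v (succ a)} : Finset V)) = T₃ at h4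
  have h5 := Shelling.fill (u := v k) (v := w k) (w := v (succ k))
    (l := (List.iterate succ (succ (succ k)) j).map v) (by
      simpa using Shelling.rot (w k :: v (succ k) :: (List.iterate succ (succ (succ k)) j).map v)
        [v k] (by simpa using h4)) (by
      obtain ⟨i, rfl⟩ : ∃ i, j = i + 1 := ⟨j - 1, by omega⟩
      simp [List.iterate]) (by
      intro t ht
      rw [← hT₃] at ht
      rcases Finset.mem_union.1 ht with ht | ht
      · exact hone _ _ hks.1.symm t ht
      · obtain ⟨a, ha, rfl⟩ := Finset.mem_image.1 ht
        have ha' := List.mem_toFinset.1 ha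
        have hka : k ≠ a := fun h => hnd'.1 (h ▸ ha')
        simp only [Finset.mem_insert, Finset.mem_singleton, hvw, hv.eq_iff, hka, false_or]
        rintro rfl
        refine not_or.2 ⟨fun h => ?_, fun h => ?_⟩
        · exact (hs a (List.mem_cons_of_mem _ ha')).2 (by rw [h])
        · exact hks.1 h)
  have e : T ∪ ((List.iterate succ k (j + 1 + 1)).toFinset.image
        fun a => {w a, w (succ a), v (succ a)}) ∪
        ((List.iterate succ k (j + 1 + 1)).toFinset.image fun a => {v a, w a, v (succ a)}) =
      insert {v k, w k, v (succ k)} T₃ := by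
    rw [← eT₁, ← hT₃, show List.iterate succ k (j + 1 + 1) = k :: List.iterate succ (succ k) (j + 1) from rfl,
      List.toFinset_cons, Finset.image_insert, Finset.union_insert]
  rw [e]
  simpa [List.iterate] using h5

end Shelling

/-! ### The triangulation -/

/-- The vertices of the triangulation: an apex and two copies of the boundary indices `(i, t)`,
the points at (signed) distance `t` steps from the corner `i`. -/
inductive Vtx
  | apex
  | inn (k : Fin 3 × ℤ)
  | out (k : Fin 3 × ℤ)

namespace Vtx

/-- Any order will do: it only serves to list the vertices of a face and to orient edges. -/
instance : LinearOrder Vtx :=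
  have := Classical.decRel (WellOrderingRel (α := Vtx))
  linearOrderOfSTO WellOrderingRel

/-- The next boundary index. -/
def succ (N : Fin 3 → ℕ) (k : Fin 3 × ℤ) : Fin 3 × ℤ :=
  if k.2 < N k.1 then (k.1, k.2 + 1) else (k.1 + 1, -(N (k.1 + 1) : ℤ))

/-- The boundary indices in cyclic order. -/
def bdry (N : Fin 3 → ℕ) : List (Fin 3 × ℤ) :=
  List.iterate (succ N) (0, -(N 0 : ℤ)) ((2 * N 0 + 1) + (2 * N 1 + 1) + (2 * N 2 + 1))

/-- The cone over the central hexagon. `fanA` stands on the chord that cuts off corner `i`, `fanB`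
on the gap between the steps from corner `i` and those from corner `i + 1`. -/
def fanA (N : Fin 3 → ℕ) (i : Fin 3) : Finset Vtx :=
  {apex, inn (i, (N i : ℤ)), inn (i, -(N i : ℤ))}

def fanB (N : Fin 3 → ℕ) (i : Fin 3) : Finset Vtx :=
  {apex, inn (i + 1, -(N (i + 1) : ℤ)), inn (i, (N i : ℤ))}

/-- The ladder at corner `i`: the quadrilateral between rungs `t` and `t + 1` is cut by a diagonal
into `armA` and `armB`. For `t = 0` the inner rung is the corner itself and `armB` degenerates, so
`arms` starts it at `1`. -/
def armA (i : Fin 3) (t : ℕ) : Finset Vtx :=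
  {inn (i, -(t + 1 : ℤ)), inn (i, (t + 1 : ℤ)), inn (i, -(t : ℤ))}

def armB (i : Fin 3) (t : ℕ) : Finset Vtx :=
  {inn (i, -(t : ℤ)), inn (i, (t + 1 : ℤ)), inn (i, (t : ℤ))}

/-- `col` stands on an inner edge and `rim` on the corresponding outer edge; they share the diagonal
from `inn k` to `out (succ N k)`. -/
def col (N : Fin 3 → ℕ) (k : Fin 3 × ℤ) : Finset Vtx := {inn k, inn (succ N k), out (succ N k)}

def rim (N : Fin 3 → ℕ) (k : Fin 3 × ℤ) : Finset Vtx := {out k, inn k, out (succ N k)}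

def fans (N : Fin 3 → ℕ) : Finset (Finset Vtx) :=
  Finset.univ.image (fanA N) ∪ Finset.univ.image (fanB N)

def arms (i : Fin 3) (n : ℕ) : Finset (Finset Vtx) :=
  (Finset.range n).image (armA i) ∪ (Finset.Ico 1 n).image (armB i)

/-- The triangles of the triangulation. -/
def faces (N : Fin 3 → ℕ) : Finset (Finset Vtx) :=
  fans N ∪ arms 0 (N 0) ∪ arms 1 (N 1) ∪ arms 2 (N 2) ∪ (bdry N).toFinset.image (col N) ∪
    (bdry N).toFinset.image (rim N)

/-- The boundary indices near the corner `i`. -/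
def seg (i : Fin 3) (n : ℕ) : List (Fin 3 × ℤ) :=
  List.iterate (fun k => (k.1, k.2 + 1)) (i, -(n : ℤ)) (2 * n + 1)

theorem iterate_shift (m : ℕ) (i : Fin 3) (a : ℤ) :
    (fun k : Fin 3 × ℤ => (k.1, k.2 + 1))^[m] (i, a) = (i, a + m) := by
  induction m generalizing a with
  | zero => simp
  | succ m ih =>
    rw [Function.iterate_succ_apply, ih]
    simp only [Prod.mk.injEq, true_and]
    push_cast; ring

theorem seg_zero (i : Fin 3) : seg i 0 = [(i, 0)] := by simp [seg, List.iterate]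

theorem seg_succ (i : Fin 3) (n : ℕ) :
    seg i (n + 1) = (i, -(n + 1 : ℤ)) :: seg i n ++ [(i, (n + 1 : ℤ))] := by
  unfold seg
  rw [show 2 * (n + 1) + 1 = 1 + (2 * n + 1) + 1 by ring, List.iterate_add, List.iterate_add,
    iterate_shift, iterate_shift]
  simp only [List.iterate, List.singleton_append]
  push_cast
  rw [show -(n + 1 : ℤ) + 1 = -n by ring,
    show -(n + 1 : ℤ) + (1 + (2 * n + 1)) = n + 1 by ring]

theorem mem_seg {i : Fin 3} {n : ℕ} {k : Fin 3 × ℤ} : k ∈ seg i n ↔ k.1 = i ∧ |k.2| ≤ n := by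
  obtain ⟨j, t⟩ := k
  induction n with
  | zero => simp [seg_zero, Prod.ext_iff]
  | succ n ih =>
    rw [seg_succ]
    simp only [List.cons_append, List.mem_cons, List.mem_append, ih, List.not_mem_nil, or_false,
      Prod.mk.injEq, abs_le]
    push_cast
    constructor
    · rintro (⟨h, h'⟩ | ⟨h, h'⟩ | ⟨h, h'⟩) <;> exact ⟨h, by omega⟩
    · rintro ⟨h, h'⟩
      simp only [h, true_and]
      omega

theorem iterate_succ_eq_shift (N : Fin 3 → ℕ) (i : Fin 3) (m : ℕ) (a : ℤ) (h : a + m ≤ N i) :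
    (succ N)^[m] (i, a) = (i, a + m) := by
  induction m generalizing a with
  | zero => simp
  | succ m ih =>
    push_cast at h
    rw [Function.iterate_succ_apply, succ, if_pos (by simp only; omega), ih _ (by omega)]
    simp only [Prod.mk.injEq, true_and]
    push_cast; ring

theorem list_iterate_succ_eq_shift (N : Fin 3 → ℕ) (i : Fin 3) (m : ℕ) (a : ℤ)
    (h : a + m ≤ N i + 1) :
    List.iterate (succ N) (i, a) m = List.iterate (fun k => (k.1, k.2 + 1)) (i, a) m := by
  induction m generalizing a with
  | zero => rfl
  | succ m ih =>
    push_cast at h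
    cases m with
    | zero => rfl
    | succ m =>
      have h1 : succ N (i, a) = (i, a + 1) := by
        rw [succ, if_pos (by push_cast at h; simp only; omega)]
      rw [show List.iterate (succ N) (i, a) (m + 1 + 1) =
        (i, a) :: List.iterate (succ N) (succ N (i, a)) (m + 1) from rfl, h1, ih _ (by omega)]
      rfl

theorem iterate_succ_seg (N : Fin 3 → ℕ) (i : Fin 3) :
    (succ N)^[2 * N i + 1] (i, -(N i : ℤ)) = (i + 1, -(N (i + 1) : ℤ)) := by
  rw [Function.iterate_succ_apply', iterate_succ_eq_shift N i _ _ (by push_cast; omega), succ,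
    if_neg (by push_cast; omega)]

theorem bdry_eq (N : Fin 3 → ℕ) : bdry N = seg 0 (N 0) ++ seg 1 (N 1) ++ seg 2 (N 2) := by
  have key : ∀ i, List.iterate (succ N) (i, -(N i : ℤ)) (2 * N i + 1) = seg i (N i) := fun i =>
    list_iterate_succ_eq_shift N i _ _ (by push_cast; omega)
  have e0 := iterate_succ_seg N 0
  have e1 := iterate_succ_seg N 1
  rw [show (0 : Fin 3) + 1 = 1 from rfl] at e0
  rw [show (1 : Fin 3) + 1 = 2 from rfl] at e1
  rw [bdry, List.iterate_add, List.iterate_add, key, e0, key,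
    show 2 * N 0 + 1 + (2 * N 1 + 1) = (2 * N 1 + 1) + (2 * N 0 + 1) by ring,
    Function.iterate_add_apply, e0, e1, key]

theorem iterate_succ_bdry (N : Fin 3 → ℕ) :
    (succ N)^[(2 * N 0 + 1) + (2 * N 1 + 1) + (2 * N 2 + 1)] (0, -(N 0 : ℤ)) = (0, -(N 0 : ℤ)) := by
  have e0 := iterate_succ_seg N 0
  have e1 := iterate_succ_seg N 1
  have e2 := iterate_succ_seg N 2
  rw [show (0 : Fin 3) + 1 = 1 from rfl] at e0
  rw [show (1 : Fin 3) + 1 = 2 from rfl] at e1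
  rw [show (2 : Fin 3) + 1 = 0 from rfl] at e2
  rw [show (2 * N 0 + 1) + (2 * N 1 + 1) + (2 * N 2 + 1) =
    (2 * N 2 + 1) + ((2 * N 1 + 1) + (2 * N 0 + 1)) by ring,
    Function.iterate_add_apply _ (2 * N 2 + 1), Function.iterate_add_apply _ (2 * N 1 + 1),
    e0, e1, e2]

theorem mem_bdry {N : Fin 3 → ℕ} {k : Fin 3 × ℤ} : k ∈ bdry N ↔ |k.2| ≤ N k.1 := by
  rw [bdry_eq]
  simp only [List.mem_append, mem_seg]
  obtain ⟨j, t⟩ := k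
  fin_cases j <;> simp

theorem succ_mem_bdry {N : Fin 3 → ℕ} {k : Fin 3 × ℤ} (hk : k ∈ bdry N) : succ N k ∈ bdry N := by
  rw [mem_bdry, abs_le] at *
  unfold succ
  split_ifs <;> simp only <;> omega

theorem succ_ne {N : Fin 3 → ℕ} (k : Fin 3 × ℤ) : succ N k ≠ k := by
  intro h
  unfold succ at h
  split_ifs at h
  · have := congrArg Prod.snd h
    simp at this
  · exact (by decide : ∀ i : Fin 3, i + 1 ≠ i) k.1 (congrArg Prod.fst h)

theorem succ_succ_ne {N : Fin 3 → ℕ} (hN : ∀ i, 1 ≤ N i) (k : Fin 3 × ℤ) :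
    succ N (succ N k) ≠ k := by
  intro h
  by_cases h1 : k.2 < N k.1
  · have e1 : succ N k = (k.1, k.2 + 1) := if_pos h1
    rw [e1] at h
    unfold succ at h
    split_ifs at h
    · have := congrArg Prod.snd h
      simp at this
      omega
    · exact (by decide : ∀ i : Fin 3, i + 1 ≠ i) k.1 (congrArg Prod.fst h)
  · have e1 : succ N k = (k.1 + 1, -(N (k.1 + 1) : ℤ)) := if_neg h1
    have := hN (k.1 + 1)
    rw [e1, succ, if_pos (by simp only; omega)] at h
    exact (by decide : ∀ i : Fin 3, i + 1 ≠ i) k.1 (congrArg Prod.fst h)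

theorem succ_injOn {N : Fin 3 → ℕ} {j k : Fin 3 × ℤ} (hj : j ∈ bdry N) (hk : k ∈ bdry N)
    (h : succ N j = succ N k) : j = k := by
  rw [mem_bdry, abs_le] at hj hk
  obtain ⟨a, s⟩ := j
  obtain ⟨b, t⟩ := k
  simp only at hj hk
  unfold succ at h
  simp only at h
  split_ifs at h with h1 h2 h2
  · simpa using h
  · simp only [Prod.mk.injEq] at h
    obtain ⟨rfl, h⟩ := h
    omega
  · simp only [Prod.mk.injEq] at h
    obtain ⟨rfl, h⟩ := h
    omega
  · simp only [Prod.mk.injEq] at h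
    have hab : a = b := add_right_cancel h.1
    subst hab
    simp only [Prod.mk.injEq, true_and]
    omega

/-- After the base triangle, four ears each bring a new hexagon vertex. The sixth triangle closes up
around `o` and moves it into the interior. -/
theorem shelling_hexagon {V : Type*} [DecidableEq V] {o a b c d e f : V}
    (h : [o, a, b, c, d, e, f].Nodup) :
    Shelling {{o, b, a}, {o, d, c}, {o, f, e}, {o, c, b}, {o, e, d}, {o, a, f}}
      [a, b, c, d, e, f] := by
  simp only [List.nodup_cons, List.mem_cons, List.not_mem_nil, or_false, not_or, not_false_eq_true,
    List.nodup_nil, and_true] at h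
  obtain ⟨⟨oa, ob, oc, od, oe, of⟩, ⟨ab, ac, ad, ae, af⟩, ⟨bc, bd, be, bf⟩, ⟨cd, ce, cf⟩,
    ⟨de, df⟩, ef⟩ := h
  have h1 := Shelling.base (u := o) (v := e) (w := f) oe ef of
  have h2 := h1.ear d (by simp [Ne.symm od, de, df])
  have h3 := h2.ear c (by simp [Ne.symm oc, cd, ce, cf])
  have h4 := h3.ear b (by simp [Ne.symm ob, bc, bd, be, bf])
  have h5 := h4.ear a (by simp [Ne.symm oa, ab, ac, ad, ae, af])
  have h6 := Shelling.rot [o, a, b, c, d, e] [f] h5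
  have h7 := Shelling.fill (u := f) (v := o) (w := a) (l := [b, c, d, e]) h6 (by simp) (by
    simp [Ne.symm of, Ne.symm oa, ab, ac, ad, ae, Ne.symm af, Ne.symm bf, Ne.symm cf,
      Ne.symm df, Ne.symm ef, af])
  have h8 := Shelling.rot [f] [a, b, c, d, e] h7
  have e1 : ({f, o, a} : Finset V) = {o, a, f} := by
    rw [Finset.insert_comm, Finset.pair_comm]
  have e2 : ({o, e, f} : Finset V) = {o, f, e} := by
    rw [Finset.pair_comm]
  have e3 : ({{o, b, a}, {o, d, c}, {o, f, e}, {o, c, b}, {o, e, d}, {o, a, f}} :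
      Finset (Finset V)) = insert {f, o, a} (insert {o, b, a} (insert {o, c, b}
        (insert {o, d, c} (insert {o, e, d} {{o, e, f}})))) := by
    rw [e1, e2]
    ext t
    simp only [Finset.mem_insert, Finset.mem_singleton]
    generalize ({o, b, a} : Finset V) = x1, ({o, c, b} : Finset V) = x2,
      ({o, d, c} : Finset V) = x3, ({o, e, d} : Finset V) = x4, ({o, f, e} : Finset V) = x5,
      ({o, a, f} : Finset V) = x6
    clear * -
    grind
  rw [e3]
  exact h8

/-- The ladder is built from the hexagon towards the corner. One `armA` and one `armB`, both ears,
advance the exposed rung by one step; the final ear adds the corner. -/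
theorem shelling_arm (i : Fin 3) (n : ℕ) (hn : 1 ≤ n) :
    ∀ (T : Finset (Finset Vtx)) (p s : List Vtx),
      Shelling T (p ++ inn (i, -(n : ℤ)) :: inn (i, (n : ℤ)) :: s) →
      (∀ r : ℤ, |r| < n → ∀ t ∈ T, inn (i, r) ∉ t) →
      Shelling (T ∪ arms i n) (p ++ (seg i n).map inn ++ s) := by
  induction n, hn using Nat.le_induction with
  | base =>
    intro T p s h hf
    have h1 := h.ear_at (inn (i, 0)) (hf 0 (by simp))
    have e : T ∪ arms i 1 = insert {inn (i, -((1 : ℕ) : ℤ)), inn (i, ((1 : ℕ) : ℤ)), inn (i, 0)} T := by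
      rw [Finset.insert_eq, Finset.union_comm]
      simp [arms, armA]
    rw [e, seg_succ, seg_zero]
    simpa using h1
  | succ n hn ih =>
    intro T p s h hf
    have h1 := h.ear_at (inn (i, -(n : ℤ))) (hf _ (by
      rw [abs_neg, abs_of_nonneg (by positivity)]; push_cast; omega))
    have h2 : Shelling (insert {inn (i, -((n + 1 : ℕ) : ℤ)), inn (i, ((n + 1 : ℕ) : ℤ)),
        inn (i, -(n : ℤ))} T)
        ((p ++ [inn (i, -((n + 1 : ℕ) : ℤ))]) ++ inn (i, -(n : ℤ)) :: inn (i, ((n + 1 : ℕ) : ℤ)) :: s) := by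
      rw [List.append_assoc]
      exact h1
    have h3 := h2.ear_at (inn (i, (n : ℤ))) (by
      intro t ht
      rcases Finset.mem_insert.1 ht with rfl | ht
      · simp only [Finset.mem_insert, Finset.mem_singleton, inn.injEq, Prod.mk.injEq, true_and]
        push_cast
        omega
      · exact hf _ (by rw [abs_of_nonneg (by positivity)]; push_cast; omega) t ht)
    have h4 := ih _ _ _ h3 (by
      intro r hr t ht
      rw [abs_lt] at hr
      rcases Finset.mem_insert.1 ht with rfl | ht
      · simp only [Finset.mem_insert, Finset.mem_singleton, inn.injEq, Prod.mk.injEq, true_and]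
        push_cast
        omega
      rcases Finset.mem_insert.1 ht with rfl | ht
      · simp only [Finset.mem_insert, Finset.mem_singleton, inn.injEq, Prod.mk.injEq, true_and]
        push_cast
        omega
      · exact hf _ (by rw [abs_lt]; push_cast; omega) t ht)
    have e : T ∪ arms i (n + 1) = insert {inn (i, -(n : ℤ)), inn (i, ((n + 1 : ℕ) : ℤ)), inn (i, (n : ℤ))}
        (insert {inn (i, -((n + 1 : ℕ) : ℤ)), inn (i, ((n + 1 : ℕ) : ℤ)), inn (i, -(n : ℤ))} T) ∪
        arms i n := by
      have e1 : armA i n = {inn (i, -((n + 1 : ℕ) : ℤ)), inn (i, ((n + 1 : ℕ) : ℤ)), inn (i, -(n : ℤ))} := by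
        simp [armA]
      have e2 : armB i n = {inn (i, -(n : ℤ)), inn (i, ((n + 1 : ℕ) : ℤ)), inn (i, (n : ℤ))} := by
        simp [armB]
      rw [← e1, ← e2]
      have e3 : Finset.Ico 1 (n + 1) = insert n (Finset.Ico 1 n) := by
        ext x; simp only [Finset.mem_Ico, Finset.mem_insert]; omega
      simp only [arms, Finset.range_add_one, Finset.image_insert, e3]
      ext t
      simp only [Finset.mem_union, Finset.mem_insert]
      tauto
    rw [e, seg_succ]
    simpa using h4

theorem mem_fans {N : Fin 3 → ℕ} {t : Finset Vtx} :
    t ∈ fans N ↔ (∃ i, fanA N i = t) ∨ ∃ i, fanB N i = t := by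
  simp [fans]

theorem mem_arms {i : Fin 3} {n : ℕ} {t : Finset Vtx} :
    t ∈ arms i n ↔ (∃ m < n, armA i m = t) ∨ ∃ m, (1 ≤ m ∧ m < n) ∧ armB i m = t := by
  simp [arms]

theorem mem_faces {N : Fin 3 → ℕ} {t : Finset Vtx} :
    t ∈ faces N ↔ (∃ i, fanA N i = t) ∨ (∃ i, fanB N i = t) ∨ (∃ i, ∃ m < N i, armA i m = t) ∨
      (∃ i m, (1 ≤ m ∧ m < N i) ∧ armB i m = t) ∨ (∃ k ∈ bdry N, col N k = t) ∨
      ∃ k ∈ bdry N, rim N k = t := by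
  have h : ((t ∈ arms 0 (N 0) ∨ t ∈ arms 1 (N 1)) ∨ t ∈ arms 2 (N 2)) ↔ ∃ i, t ∈ arms i (N i) := by
    simp [Fin.exists_fin_succ, or_assoc]
  have h' : t ∈ faces N ↔ t ∈ fans N ∨ (∃ i, t ∈ arms i (N i)) ∨ (∃ k ∈ bdry N, col N k = t) ∨
      ∃ k ∈ bdry N, rim N k = t := by
    rw [← h]
    simp only [faces, Finset.mem_union, Finset.mem_image, List.mem_toFinset, or_assoc]
  simp only [h', mem_fans, mem_arms, exists_or, or_assoc]

theorem shelling_core {N : Fin 3 → ℕ} (hN : ∀ i, 1 ≤ N i) :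
    Shelling (fans N ∪ arms 0 (N 0) ∪ arms 1 (N 1) ∪ arms 2 (N 2)) ((bdry N).map inn) := by
  have h0 := hN 0
  have h1 := hN 1
  have h2 := hN 2
  have hhex : Shelling (fans N) [inn (0, -(N 0 : ℤ)), inn (0, (N 0 : ℤ)), inn (1, -(N 1 : ℤ)),
      inn (1, (N 1 : ℤ)), inn (2, -(N 2 : ℤ)), inn (2, (N 2 : ℤ))] := by
    have := shelling_hexagon (o := apex) (a := inn (0, -(N 0 : ℤ))) (b := inn (0, (N 0 : ℤ)))
      (c := inn (1, -(N 1 : ℤ))) (d := inn (1, (N 1 : ℤ))) (e := inn (2, -(N 2 : ℤ)))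
      (f := inn (2, (N 2 : ℤ))) (by
        simp only [List.nodup_cons, List.mem_cons, List.not_mem_nil, or_false,
          not_false_eq_true, List.nodup_nil, and_true, inn.injEq, Prod.mk.injEq, reduceCtorEq,
          Fin.reduceEq, false_and, true_and]
        omega)
    convert this using 1
    ext t
    rw [mem_fans]
    simp only [Fin.exists_fin_succ, Fin.exists_fin_zero, fanA, fanB, Finset.mem_insert,
      Finset.mem_singleton, Fin.succ_zero_eq_one, Fin.succ_one_eq_two, eq_comm (b := t),
      show (0 : Fin 3) + 1 = 1 from rfl, show (1 : Fin 3) + 1 = 2 from rfl,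
      show (2 : Fin 3) + 1 = 0 from rfl, or_false, or_assoc]
  have fans_not : ∀ i (r : ℤ), |r| < N i → ∀ t ∈ fans N, inn (i, r) ∉ t := by
    intro i r hr t ht
    rw [abs_lt] at hr
    rcases mem_fans.1 ht with ⟨j, rfl⟩ | ⟨j, rfl⟩
    · simp only [fanA, Finset.mem_insert, Finset.mem_singleton, inn.injEq, Prod.mk.injEq,
        reduceCtorEq, false_or]
      rintro (⟨rfl, h⟩ | ⟨rfl, h⟩) <;> omega
    · simp only [fanB, Finset.mem_insert, Finset.mem_singleton, inn.injEq, Prod.mk.injEq,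
        reduceCtorEq, false_or]
      rintro (⟨rfl, h⟩ | ⟨rfl, h⟩) <;> omega
  have arms_not : ∀ i j (r : ℤ) (n : ℕ), i ≠ j → ∀ t ∈ arms j n, inn (i, r) ∉ t := by
    intro i j r n hij t ht
    rcases mem_arms.1 ht with ⟨m, -, rfl⟩ | ⟨m, -, rfl⟩
    · simp [armA, hij]
    · simp [armB, hij]
  have s0 := shelling_arm 0 (N 0) h0 (fans N) [] _ hhex (fans_not 0)
  have s1 := shelling_arm 1 (N 1) h1 _ ((seg 0 (N 0)).map inn) [inn (2, -(N 2 : ℤ)), inn (2, (N 2 : ℤ))]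
    s0 (by
      intro r hr t ht
      rcases Finset.mem_union.1 ht with ht | ht
      · exact fans_not 1 r hr t ht
      · exact arms_not 1 0 r _ (by decide) t ht)
  have s2 := shelling_arm 2 (N 2) h2 _ ((seg 0 (N 0)).map inn ++ (seg 1 (N 1)).map inn) [] s1 (by
      intro r hr t ht
      rcases Finset.mem_union.1 ht with ht | ht
      · rcases Finset.mem_union.1 ht with ht | ht
        · exact fans_not 2 r hr t ht
        · exact arms_not 2 0 r _ (by decide) t ht
      · exact arms_not 2 1 r _ (by decide) t ht)
  rw [bdry_eq, List.map_append, List.map_append]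
  rwa [List.append_nil] at s2

theorem shelling_faces {N : Fin 3 → ℕ} (hN : ∀ i, 1 ≤ N i) :
    Shelling (faces N) ((bdry N).map out) := by
  refine Shelling.collar inn out (succ N) (fun a b h => out.inj h) (fun a b h => by simp at h)
    (by omega) (iterate_succ_bdry N) (shelling_core hN) ?_ fun a _ =>
      ⟨succ_ne a, succ_succ_ne hN a⟩
  intro a t ht
  simp only [Finset.mem_union, mem_fans, mem_arms] at ht
  rcases ht with (((⟨i, rfl⟩ | ⟨i, rfl⟩) | ⟨m, -, rfl⟩ | ⟨m, -, rfl⟩) | ⟨m, -, rfl⟩ | ⟨m, -, rfl⟩) |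
    ⟨m, -, rfl⟩ | ⟨m, -, rfl⟩ <;> simp [fanA, fanB, armA, armB]

end Vtx

/-! ### Estimates on surfaces of triangle complexes -/

theorem sum_triple_of_mem_simplexOf {V : Type*} [DecidableEq V] {a b c : V} (hab : a ≠ b)
    (hbc : b ≠ c) (hac : a ≠ c) {x : V → ℝ} (hx : x ∈ simplexOf {a, b, c}) :
    x a + x b + x c = 1 := by
  have := hx.2.2
  rw [Finset.sum_insert (by simp [hab, hac]), Finset.sum_pair hbc] at this
  linarith

namespace TriangleComplex

variable {V : Type} [LinearOrder V] (K : TriangleComplex V)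

theorem exists_coords_eq {t : Finset V} (ht : t ∈ K.faces) {x : V → ℝ} (hx : x ∈ simplexOf t) :
    ∃ p, K.coords p = x := by
  have : x ∈ range K.coords := by
    rw [range_coords]
    exact mem_iUnion₂.2 ⟨t, ht, hx⟩
  exact this

theorem exists_face (p : K.Surface) : ∃ t ∈ K.faces, K.coords p ∈ simplexOf t := by
  have : K.coords p ∈ range K.coords := mem_range_self p
  rw [range_coords] at this
  simpa using this

/-- In a triangle, the distance from a vertex is convex and so is largest at another vertex. -/
theorem dist_le_of_coords_eq_single {a b c : V} (ht : {a, b, c} ∈ K.faces) (hab : a ≠ b)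
    (hbc : b ≠ c) (hac : a ≠ c) {p q : K.Surface} (hp : K.coords p = Pi.single a 1)
    (hq : K.coords q ∈ simplexOf {a, b, c}) {E : ℝ} (hb : K.len a b ≤ E) (hc : K.len a c ≤ E) :
    dist p q ≤ E := by
  have h0b := K.len_pos_of_mem ht (a := a) (b := b) (by simp) (by simp) hab
  have h0c := K.len_pos_of_mem ht (a := a) (b := c) (by simp) (by simp) hac
  have hpm : K.coords p ∈ simplexOf {a, b, c} := by
    rw [hp]
    apply simplexOf_mono (s := {a}) (by simp)
    rw [simplexOf_singleton]; rfl
  have h1 := K.sq_dist_le_quadForm ht hab hbc hac hpm hq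
  have hs := sum_triple_of_mem_simplexOf hab hbc hac hq
  have hqa := hq.1 a
  have hqb := hq.1 b
  have hqc := hq.1 c
  refine abs_le_of_sq_le_sq' ?_ (h0b.le.trans hb) |>.2
  refine h1.trans ?_
  simp only [quadForm, hp, Pi.sub_apply, Pi.single_eq_same, Pi.single_eq_of_ne hab.symm,
    Pi.single_eq_of_ne hac.symm, zero_sub]
  have e1 : K.len a b ^ 2 ≤ E ^ 2 := pow_le_pow_left₀ h0b.le hb 2
  have e2 : K.len a c ^ 2 ≤ E ^ 2 := pow_le_pow_left₀ h0c.le hc 2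
  have e3 : 1 - K.coords q a = K.coords q b + K.coords q c := by linarith
  rw [e3]
  have e4 : (K.coords q b + K.coords q c) * (K.coords q b * K.len a b ^ 2) ≤
      (K.coords q b + K.coords q c) * (K.coords q b * E ^ 2) := by gcongr
  have e5 : (K.coords q b + K.coords q c) * (K.coords q c * K.len a c ^ 2) ≤
      (K.coords q b + K.coords q c) * (K.coords q c * E ^ 2) := by gcongr
  have e6 : 0 ≤ K.coords q b * K.coords q c * K.len b c ^ 2 := by positivity
  have e7 : (K.coords q b + K.coords q c) ^ 2 * E ^ 2 ≤ 1 * E ^ 2 := by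
    gcongr
    exact pow_le_one₀ (by positivity) (by linarith)
  nlinarith

theorem isDiskWithBoundary {B : Set (V → ℝ)} (h : IsDiskIn (⋃ t ∈ K.faces, simplexOf t) B) :
    IsDiskWithBoundary K.Surface (K.coords ⁻¹' B) := by
  obtain ⟨e, hc, hi, hA, hB⟩ := h
  rw [← range_coords] at hA
  have hcompact : CompactSpace (Metric.closedBall (0 : ℂ) 1) :=
    isCompact_iff_compactSpace.1 (isCompact_closedBall _ _)
  have hmem : ∀ z : Metric.closedBall (0 : ℂ) 1, e z ∈ range K.coords := fun z => by
    rw [← hA]; exact mem_image_of_mem _ z.2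
  have hbij : Function.Bijective fun z : Metric.closedBall (0 : ℂ) 1 =>
      (⟨e z, hmem z⟩ : range K.coords) := by
    constructor
    · intro z w hzw
      exact Subtype.ext (hi z.2 w.2 (congrArg Subtype.val hzw))
    · rintro ⟨x, hx⟩
      rw [← hA] at hx
      obtain ⟨z, hz, rfl⟩ := hx
      exact ⟨⟨z, hz⟩, rfl⟩
  let Ψ : Metric.closedBall (0 : ℂ) 1 ≃ₜ range K.coords :=
    Continuous.homeoOfEquivCompactToT2 (f := Equiv.ofBijective _ hbij)
      (Continuous.subtype_mk (continuousOn_iff_continuous_domRestrict.1 hc) _)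
  refine ⟨K.isEmbedding_coords.toHomeomorph.trans Ψ.symm, ?_⟩
  have key : ∀ x, e (Ψ.symm (K.isEmbedding_coords.toHomeomorph x)) = K.coords x := fun x =>
    congrArg Subtype.val (Ψ.apply_symm_apply (K.isEmbedding_coords.toHomeomorph x))
  ext x
  rw [mem_preimage, ← hB]
  set z := Ψ.symm (K.isEmbedding_coords.toHomeomorph x) with hz
  have hx : K.coords x = e z := (key x).symm
  change K.coords x ∈ _ ↔ ‖(z : ℂ)‖ = 1
  rw [hx]
  constructor
  · rintro ⟨w, hw, hwz⟩
    rw [← hi (Metric.sphere_subset_closedBall hw) z.2 hwz]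
    simpa using hw
  · intro h
    exact mem_image_of_mem _ (by simpa using h)

/-- Faces may be listed with repetitions: one index is chosen for each face and the others only
increase the bound. -/
theorem hausdorffTwo_le_of_image {I : Type*} (s : Finset I) (f : I → Finset V) (B : I → ℝ)
    (hs : ∀ t ∈ K.faces, ∃ i ∈ s, f i = t) (hB : ∀ i ∈ s, 0 ≤ B i)
    (h : ∀ i ∈ s, ∃ a b c, f i = {a, b, c} ∧ a ≠ b ∧ b ≠ c ∧ a ≠ c ∧
      K.len a b * K.len a c ≤ B i) :
    hausdorffTwo K.Surface ≤ ENNReal.ofReal (4 * ∑ i ∈ s, B i) := by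
  classical
  have : Nonempty I := by
    obtain ⟨t, ht⟩ := K.nonempty
    exact ⟨(hs t ht).choose⟩
  choose! g hg hfg using hs
  refine (K.hausdorffTwo_le (fun t => B (g t)) fun t ht => ?_).trans ?_
  · obtain ⟨a, b, c, h1, h2⟩ := h _ (hg t ht)
    exact ⟨a, b, c, by rw [← h1, hfg t ht], h2⟩
  · refine ENNReal.ofReal_le_ofReal (mul_le_mul_of_nonneg_left ?_ (by norm_num))
    have hinj : Set.InjOn g K.faces := fun t ht t' ht' h => by
      rw [← hfg t ht, ← hfg t' ht', h]
    rw [← Finset.sum_image (f := B) hinj]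
    refine Finset.sum_le_sum_of_subset_of_nonneg (fun i hi => ?_) fun i hi _ => hB i hi
    obtain ⟨t, ht, rfl⟩ := Finset.mem_image.1 hi
    exact hg t ht

/-- A sufficient condition for an increment to be dominated by the Euclidean distance: the
triangle has an angle which is not too close to `0` or `π`. -/
theorem sq_le_quadForm {a b c : V} {δ : V → ℝ} (hδ : δ a + δ b + δ c = 0)
    (hb : 0 ≤ K.len a b) (hc : 0 ≤ K.len a c)
    (h : |K.len a b ^ 2 + K.len a c ^ 2 - K.len b c ^ 2| ≤ 3 / 2 * (K.len a b * K.len a c)) {u : ℝ}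
    (hu : |u| ≤ (K.len a b * |δ b| + K.len a c * |δ c|) / 3) : u ^ 2 ≤ K.quadForm a b c δ := by
  -- The law of cosines at `a`. With `X` and `Y` the two side lengths times the weights, the form is
  -- at least `X² + Y² - (3/2) X Y`, and this dominates `((X + Y) / 3)²`.
  have e : K.quadForm a b c δ = (K.len a b * |δ b|) ^ 2 + (K.len a c * |δ c|) ^ 2 +
      (K.len a b ^ 2 + K.len a c ^ 2 - K.len b c ^ 2) * (δ b * δ c) := by
    have : δ a = -δ b - δ c := by linarith
    rw [quadForm, this, mul_pow, mul_pow, sq_abs, sq_abs]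
    ring
  have h1 : -(3 / 2 * (K.len a b * |δ b|) * (K.len a c * |δ c|)) ≤
      (K.len a b ^ 2 + K.len a c ^ 2 - K.len b c ^ 2) * (δ b * δ c) := by
    have h2 : |(K.len a b ^ 2 + K.len a c ^ 2 - K.len b c ^ 2) * (δ b * δ c)| ≤
        3 / 2 * (K.len a b * K.len a c) * (|δ b| * |δ c|) := by
      rw [abs_mul, abs_mul]
      gcongr
    have := neg_le_of_abs_le h2
    nlinarith
  have hx : 0 ≤ K.len a b * |δ b| := by positivity
  have hy : 0 ≤ K.len a c * |δ c| := by positivity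
  have h3 : u ^ 2 ≤ ((K.len a b * |δ b| + K.len a c * |δ c|) / 3) ^ 2 := by
    rw [← sq_abs u]
    exact pow_le_pow_left₀ (abs_nonneg u) hu 2
  rw [e]
  generalize K.len a b * |δ b| = X at *
  generalize K.len a c * |δ c| = Y at *
  nlinarith [sq_nonneg (X - Y)]

end TriangleComplex

/-! ### The triangulated surface of a boundary mesh -/

/-- A mesh on the boundary of a triangular disk: points `m k`, consecutive ones joined by geodesics
`bd k` of length `dl k` comparable to the mesh size `κ`. -/
structure Mesh (T : Type*) [MetricSpace T] where
  N : Fin 3 → ℕ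
  N_pos : ∀ i, 1 ≤ N i
  κ : ℝ
  κ_pos : 0 < κ
  m : Fin 3 × ℤ → T
  bd : Fin 3 × ℤ → ℝ → T
  dl : Fin 3 × ℤ → ℝ
  dl_pos : ∀ k ∈ Vtx.bdry N, 0 < dl k
  dl_le : ∀ k ∈ Vtx.bdry N, dl k ≤ 4 * κ
  dl_eq : ∀ k ∈ Vtx.bdry N, k.2 < N k.1 → dl k = κ
  bd_zero : ∀ k ∈ Vtx.bdry N, bd k 0 = m k
  bd_dl : ∀ k ∈ Vtx.bdry N, bd k (dl k) = m (Vtx.succ N k)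
  bd_dist : ∀ k ∈ Vtx.bdry N, ∀ s ∈ Icc 0 (dl k), ∀ t ∈ Icc 0 (dl k),
    dist (bd k s) (bd k t) = |s - t|
  R : ℝ
  R_nonneg : 0 ≤ R
  dist_le_R : ∀ a b : Fin 3 × ℤ, |a.2| = (N a.1 : ℤ) → |b.2| = (N b.1 : ℤ) → dist (m a) (m b) ≤ R

namespace Mesh

open Vtx

variable {T : Type*} [MetricSpace T] (M : Mesh T)

/-- The lengths of the edges of the triangulation. -/
def len : Vtx → Vtx → ℝ
  -- The factor `3` matches the slack in `sq_le_quadForm`, and `100 * κ` keeps triangles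
  -- nondegenerate when points are close or equal. The edges from `inn` to `out` are hypotenuses
  -- over outer edges, giving right angles in the rim, while outer edges keep their true length.
  | inn a, inn b => 100 * M.κ + 3 * dist (M.m a) (M.m b)
  | apex, inn _ => 100 * M.κ + 3 * M.R
  | inn _, apex => 100 * M.κ + 3 * M.R
  | inn a, out b => √((100 * M.κ) ^ 2 + dist (M.m a) (M.m b) ^ 2)
  | out a, inn b => √((100 * M.κ) ^ 2 + dist (M.m a) (M.m b) ^ 2)
  | out a, out b => dist (M.m a) (M.m b)
  -- Default values: no face contains the apex together with an outer vertex.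
  | apex, apex => 0
  | apex, out _ => 0
  | out _, apex => 0

theorem len_comm (a b : Vtx) : M.len a b = M.len b a := by
  cases a <;> cases b <;> simp [len, dist_comm]

theorem dist_succ {k : Fin 3 × ℤ} (hk : k ∈ bdry M.N) : dist (M.m k) (M.m (succ M.N k)) = M.dl k := by
  have := M.dl_pos k hk
  rw [← M.bd_zero k hk, ← M.bd_dl k hk, M.bd_dist k hk _ ⟨le_rfl, this.le⟩ _ ⟨this.le, le_rfl⟩,
    zero_sub, abs_neg, abs_of_pos this]

theorem dist_inner {i : Fin 3} {t : ℤ} (h : -(M.N i : ℤ) ≤ t) (h' : t < M.N i) :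
    dist (M.m (i, t)) (M.m (i, t + 1)) = M.κ := by
  have hk : (i, t) ∈ bdry M.N := mem_bdry.2 (abs_le.2 ⟨h, h'.le⟩)
  have := M.dist_succ hk
  rwa [M.dl_eq _ hk h', succ, if_pos h'] at this

theorem dist_armA {i : Fin 3} {t : ℕ} (h : t < M.N i) :
    dist (M.m (i, -(t + 1 : ℤ))) (M.m (i, -(t : ℤ))) = M.κ := by
  have := M.dist_inner (i := i) (t := -(t + 1 : ℤ)) (by omega) (by omega)
  rwa [show -(t + 1 : ℤ) + 1 = -t by ring] at this

theorem dist_armB {i : Fin 3} {t : ℕ} (h : t < M.N i) :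
    dist (M.m (i, (t : ℤ))) (M.m (i, (t + 1 : ℤ))) = M.κ :=
  M.dist_inner (by omega) (by exact_mod_cast h)

theorem dist_fanA (i : Fin 3) : dist (M.m (i, (M.N i : ℤ))) (M.m (i, -(M.N i : ℤ))) ≤ M.R :=
  M.dist_le_R _ _ (by simp) (by simp)

theorem dist_fanB (i : Fin 3) :
    dist (M.m (i + 1, -(M.N (i + 1) : ℤ))) (M.m (i, (M.N i : ℤ))) ≤ M.R :=
  M.dist_le_R _ _ (by simp) (by simp)

theorem len_lt_of_triple {u v w : Vtx} (h1 : M.len u v < M.len u w + M.len w v)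
    (h2 : M.len v w < M.len v u + M.len u w) (h3 : M.len u w < M.len u v + M.len v w) :
    ∀ a ∈ ({u, v, w} : Finset Vtx), ∀ b ∈ ({u, v, w} : Finset Vtx), ∀ c ∈ ({u, v, w} : Finset Vtx),
      a ≠ b → b ≠ c → a ≠ c → M.len a b < M.len a c + M.len c b := by
  have c1 := M.len_comm u v
  have c2 := M.len_comm u w
  have c3 := M.len_comm v w
  simp only [Finset.mem_insert, Finset.mem_singleton]
  rintro a (ha | ha | ha) b (hb | hb | hb) c (hc | hc | hc) hab hbc hac <;>
    rw [ha, hb] at hab <;> rw [hb, hc] at hbc <;> rw [ha, hc] at hac <;> rw [ha, hb, hc] <;>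
    first
    | exact absurd rfl hab
    | exact absurd rfl hbc
    | exact absurd rfl hac
    | linarith

theorem len_inn_triple (a b c : Fin 3 × ℤ) :
    M.len (inn a) (inn b) < M.len (inn a) (inn c) + M.len (inn c) (inn b) := by
  have := M.κ_pos
  have := dist_triangle (M.m a) (M.m c) (M.m b)
  simp only [len]
  linarith

theorem len_lt_fan {a b : Fin 3 × ℤ} (hab : dist (M.m a) (M.m b) ≤ M.R) :
    ∀ x ∈ ({apex, inn a, inn b} : Finset Vtx), ∀ y ∈ ({apex, inn a, inn b} : Finset Vtx),
      ∀ z ∈ ({apex, inn a, inn b} : Finset Vtx),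
      x ≠ y → y ≠ z → x ≠ z → M.len x y < M.len x z + M.len z y := by
  have := M.κ_pos
  have := M.R_nonneg
  have h0 : 0 ≤ dist (M.m a) (M.m b) := dist_nonneg
  have h1 : dist (M.m b) (M.m a) = dist (M.m a) (M.m b) := dist_comm _ _
  refine M.len_lt_of_triple ?_ ?_ ?_ <;> simp only [len] <;> linarith

theorem sqrt_lt_aux {D d : ℝ} (hD : 0 < D) (hd : 0 < d) :
    D < √(D ^ 2 + d ^ 2) ∧ √(D ^ 2 + d ^ 2) < D + d := by
  constructor
  · exact Real.lt_sqrt_of_sq_lt (by nlinarith)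
  · rw [Real.sqrt_lt' (by positivity)]
    nlinarith

theorem len_inn_out_self (k : Fin 3 × ℤ) : M.len (inn k) (out k) = 100 * M.κ := by
  have := M.κ_pos
  simp only [len, dist_self]
  rw [zero_pow two_ne_zero, add_zero, Real.sqrt_sq (by positivity)]

theorem len_inn_out_succ {k : Fin 3 × ℤ} (hk : k ∈ bdry M.N) :
    M.len (inn k) (out (succ M.N k)) = √((100 * M.κ) ^ 2 + M.dl k ^ 2) := by
  simp only [len, M.dist_succ hk]

theorem len_out_out_succ {k : Fin 3 × ℤ} (hk : k ∈ bdry M.N) :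
    M.len (out k) (out (succ M.N k)) = M.dl k := M.dist_succ hk

theorem len_inn_inn_succ {k : Fin 3 × ℤ} (hk : k ∈ bdry M.N) :
    M.len (inn k) (inn (succ M.N k)) = 100 * M.κ + 3 * M.dl k := by
  simp only [len, M.dist_succ hk]

theorem len_lt_col {k : Fin 3 × ℤ} (hk : k ∈ bdry M.N) :
    ∀ x ∈ col M.N k, ∀ y ∈ col M.N k, ∀ z ∈ col M.N k,
      x ≠ y → y ≠ z → x ≠ z → M.len x y < M.len x z + M.len z y := by
  have hκ := M.κ_pos
  have h1 := M.dl_pos k hk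
  have h2 := M.dl_le k hk
  obtain ⟨h3, h4⟩ := sqrt_lt_aux (show 0 < 100 * M.κ by positivity) h1
  have e1 := M.len_comm (inn (succ M.N k)) (inn k)
  have e2 := M.len_comm (out (succ M.N k)) (inn (succ M.N k))
  have e3 := M.len_inn_out_self (succ M.N k)
  have e4 := M.len_inn_out_succ hk
  have e5 := M.len_inn_inn_succ hk
  refine M.len_lt_of_triple ?_ ?_ ?_ <;> linarith

theorem len_lt_rim {k : Fin 3 × ℤ} (hk : k ∈ bdry M.N) :
    ∀ x ∈ rim M.N k, ∀ y ∈ rim M.N k, ∀ z ∈ rim M.N k,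
      x ≠ y → y ≠ z → x ≠ z → M.len x y < M.len x z + M.len z y := by
  have hκ := M.κ_pos
  have h1 := M.dl_pos k hk
  have h2 := M.dl_le k hk
  obtain ⟨h3, h4⟩ := sqrt_lt_aux (show 0 < 100 * M.κ by positivity) h1
  have e1 := M.len_comm (out (succ M.N k)) (inn k)
  have e2 := M.len_comm (out k) (inn k)
  have e3 := M.len_inn_out_self k
  have e4 := M.len_inn_out_succ hk
  have e5 := M.len_out_out_succ hk
  refine M.len_lt_of_triple ?_ ?_ ?_ <;> linarith

/-- The triangulated surface spanned by a mesh. -/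
def complex : TriangleComplex Vtx where
  faces := faces M.N
  card_face := (shelling_faces M.N_pos).card_eq_three
  nonempty := (shelling_faces M.N_pos).nonempty
  len := M.len
  len_comm := M.len_comm
  len_lt := by
    intro t ht
    rcases mem_faces.1 ht with ⟨i, rfl⟩ | ⟨i, rfl⟩ | ⟨i, n, hn, rfl⟩ | ⟨i, n, hn, rfl⟩ |
      ⟨k, hk, rfl⟩ | ⟨k, hk, rfl⟩
    · exact M.len_lt_fan (M.dist_fanA i)
    · exact M.len_lt_fan (M.dist_fanB i)
    · exact M.len_lt_of_triple (M.len_inn_triple _ _ _) (M.len_inn_triple _ _ _)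
        (M.len_inn_triple _ _ _)
    · exact M.len_lt_of_triple (M.len_inn_triple _ _ _) (M.len_inn_triple _ _ _)
        (M.len_inn_triple _ _ _)
    · exact M.len_lt_col hk
    · exact M.len_lt_rim hk
  connected := (shelling_faces M.N_pos).connected

/-- The surface spanned by a mesh. -/
abbrev Surf : Type := M.complex.Surface

theorem col_mem_faces {k : Fin 3 × ℤ} (hk : k ∈ bdry M.N) : col M.N k ∈ faces M.N :=
  mem_faces.2 (Or.inr (Or.inr (Or.inr (Or.inr (Or.inl ⟨k, hk, rfl⟩)))))

theorem rim_mem_faces {k : Fin 3 × ℤ} (hk : k ∈ bdry M.N) : rim M.N k ∈ faces M.N :=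
  mem_faces.2 (Or.inr (Or.inr (Or.inr (Or.inr (Or.inr ⟨k, hk, rfl⟩)))))

theorem complex_len : M.complex.len = M.len := rfl

/-! ### Lipschitz functions -/

/-- The values at the vertices of the comparison function for the point `q`. -/
def vval (q : T) : Vtx → ℝ
  | inn k => dist q (M.m k)
  | out k => dist q (M.m k)
  -- The hexagon vertices are pairwise within `R`, so any of them could supply the value at the
  -- apex.
  | apex => dist q (M.m (0, (M.N 0 : ℤ)))

/-- The deviation of the distance to `q` from linear interpolation along a boundary edge. -/
def dev (q : T) (k : Fin 3 × ℤ) (τ : ℝ) : ℝ :=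
  dist q (M.bd k (τ * M.dl k)) - ((1 - τ) * dist q (M.m k) + τ * dist q (M.m (succ M.N k)))

/-- The truncation of `dev` in the collar. -/
def bump (q : T) (k : Fin 3 × ℤ) (x : Vtx → ℝ) : ℝ :=
  -- On the triangle `col`, this bound vanishes on the two edges at `inn (succ N k)`, where
  -- neighbouring faces expect affine values. On the diagonal shared with `rim` it is large enough
  -- to leave `dev` untouched.
  let c := 2 * M.dl k * min (x (out (succ M.N k))) (x (inn k) + x (out k))
  max (-c) (min (M.dev q k (x (out (succ M.N k)))) c)

/-- A function on the surface which restricts to the distance to `q` on the boundary. -/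
def distFun (q : T) (x : Vtx → ℝ) : ℝ :=
  ∑ v ∈ (faces M.N).biUnion id, x v * M.vval q v +
    ∑ k ∈ (bdry M.N).toFinset, M.bump q k x

theorem bump_eq_zero (q : T) (k : Fin 3 × ℤ) (x : Vtx → ℝ)
    (h : min (x (out (succ M.N k))) (x (inn k) + x (out k)) = 0) : M.bump q k x = 0 := by
  simp only [bump, h, mul_zero, neg_zero]
  exact max_eq_left (min_le_right _ _)

theorem bump_eq_zero_of_out (q : T) (k : Fin 3 × ℤ) {x : Vtx → ℝ} (hx : ∀ v, 0 ≤ x v)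
    (h : x (out (succ M.N k)) = 0) : M.bump q k x = 0 :=
  M.bump_eq_zero q k x (by
    rw [h]; exact min_eq_left (add_nonneg (hx _) (hx _)))

theorem sum_vval {t : Finset Vtx} (ht : t ∈ faces M.N) {x : Vtx → ℝ} (hx : x ∈ simplexOf t) (q : T) :
    ∑ v ∈ (faces M.N).biUnion id, x v * M.vval q v = ∑ v ∈ t, x v * M.vval q v := by
  symm
  apply Finset.sum_subset
  · intro v hv
    exact Finset.mem_biUnion.2 ⟨t, ht, hv⟩
  · intro v _ hv
    rw [hx.2.1 v hv, zero_mul]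

theorem distFun_of_no_out {t : Finset Vtx} (ht : t ∈ faces M.N) (hout : ∀ k, out k ∉ t)
    {x : Vtx → ℝ} (hx : x ∈ simplexOf t) (q : T) : M.distFun q x = ∑ v ∈ t, x v * M.vval q v := by
  have h0 : ∑ k ∈ (bdry M.N).toFinset, M.bump q k x = 0 := Finset.sum_eq_zero fun k _ =>
    M.bump_eq_zero_of_out q k hx.1 (hx.2.1 _ (hout _))
  rw [distFun, M.sum_vval ht hx, h0, add_zero]

theorem sum_triple {u v w : Vtx} (huv : u ≠ v) (hvw : v ≠ w) (huw : u ≠ w) (f : Vtx → ℝ) :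
    ∑ z ∈ {u, v, w}, f z = f u + f v + f w := by
  rw [Finset.sum_insert (by simp [huv, huw]), Finset.sum_pair hvw]
  ring

theorem distFun_col {k : Fin 3 × ℤ} (hk : k ∈ bdry M.N) {x : Vtx → ℝ} (hx : x ∈ simplexOf (col M.N k))
    (q : T) : M.distFun q x = ∑ v ∈ col M.N k, x v * M.vval q v + M.bump q k x := by
  rw [distFun, M.sum_vval (M.col_mem_faces hk) hx]
  congr 1
  refine Finset.sum_eq_single k (fun j hj hjk => ?_) fun h => absurd (List.mem_toFinset.2 hk) h
  refine M.bump_eq_zero_of_out q j hx.1 (hx.2.1 _ ?_)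
  have : succ M.N j ≠ succ M.N k := fun h => hjk (succ_injOn (List.mem_toFinset.1 hj) hk h)
  simp [col, this]

/-- A `1`-Lipschitz function on a segment of length `dl k` deviates from its linear interpolation by
at most `2 * dl k * min τ (1 - τ)`. So the truncation is inactive and the correction restores the
distance exactly. -/
theorem distFun_rim {k : Fin 3 × ℤ} (hk : k ∈ bdry M.N) {x : Vtx → ℝ} (hx : x ∈ simplexOf (rim M.N k))
    (q : T) : M.distFun q x = dist q (M.bd k (x (out (succ M.N k)) * M.dl k)) := by
  have hne := succ_ne (N := M.N) k
  rw [distFun, M.sum_vval (M.rim_mem_faces hk) hx]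
  have hb : ∑ j ∈ (bdry M.N).toFinset, M.bump q j x = M.bump q k x := by
    refine Finset.sum_eq_single k (fun j hj hjk => ?_) fun h => absurd (List.mem_toFinset.2 hk) h
    have h1 : succ M.N j ≠ succ M.N k := fun h => hjk (succ_injOn (List.mem_toFinset.1 hj) hk h)
    -- The preceding edge shares the vertex `out k`, so its first factor need not vanish; its second
    -- factor does.
    by_cases h2 : succ M.N j = k
    · apply M.bump_eq_zero
      have h3 : j ≠ succ M.N k := by
        rintro rfl
        exact succ_succ_ne M.N_pos k h2
      rw [hx.2.1 (inn j) (by simp [rim, hjk]), hx.2.1 (out j) (by simp [rim, hjk, h3]), add_zero]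
      exact min_eq_right (hx.1 _)
    · exact M.bump_eq_zero_of_out q j hx.1 (hx.2.1 _ (by simp [rim, h1, h2]))
  have hd1 : out k ≠ inn k := by simp
  have hd2 : inn k ≠ out (succ M.N k) := by simp
  have hd3 : out k ≠ out (succ M.N k) := by simpa using hne.symm
  have hs := sum_triple_of_mem_simplexOf hd1 hd2 hd3 hx
  rw [hb, rim, sum_triple hd1 hd2 hd3]
  set τ := x (out (succ M.N k)) with hτ
  have h1 : x (inn k) + x (out k) = 1 - τ := by linarith
  have hτ0 : 0 ≤ τ := hx.1 _
  have hτ1 : 0 ≤ 1 - τ := by rw [← h1]; exact add_nonneg (hx.1 _) (hx.1 _)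
  have hdl := M.dl_pos k hk
  have hm : τ * M.dl k ∈ Icc 0 (M.dl k) := ⟨by positivity, by nlinarith⟩
  have d1 : |dist q (M.bd k (τ * M.dl k)) - dist q (M.m k)| ≤ τ * M.dl k := by
    have := abs_dist_sub_le (M.bd k (τ * M.dl k)) (M.m k) q
    rw [← M.bd_zero k hk, M.bd_dist k hk _ hm _ ⟨le_rfl, hdl.le⟩, sub_zero,
      abs_of_nonneg hm.1] at this
    rwa [dist_comm q, dist_comm q, ← M.bd_zero k hk]
  have d2 : |dist q (M.bd k (τ * M.dl k)) - dist q (M.m (succ M.N k))| ≤ (1 - τ) * M.dl k := by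
    have := abs_dist_sub_le (M.bd k (τ * M.dl k)) (M.m (succ M.N k)) q
    rw [← M.bd_dl k hk, M.bd_dist k hk _ hm _ ⟨hdl.le, le_rfl⟩,
      abs_of_nonpos (show τ * M.dl k - M.dl k ≤ 0 by linarith [hm.2])] at this
    rw [dist_comm q, dist_comm q, ← M.bd_dl k hk]
    linarith
  have d3 : |dist q (M.m k) - dist q (M.m (succ M.N k))| ≤ M.dl k := by
    have := abs_dist_sub_le (M.m k) (M.m (succ M.N k)) q
    rwa [M.dist_succ hk, dist_comm _ q, dist_comm _ q] at this
  rw [abs_le] at d1 d2 d3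
  have hdev : |M.dev q k τ| ≤ 2 * M.dl k * min τ (1 - τ) := by
    rw [dev]
    rcases le_total τ (1 - τ) with h | h
    · rw [min_eq_left h, abs_le]
      constructor <;> nlinarith
    · rw [min_eq_right h, abs_le]
      constructor <;> nlinarith
  have hbump : M.bump q k x = M.dev q k τ := by
    simp only [bump, h1, ← hτ]
    rw [abs_le] at hdev
    rw [min_eq_left hdev.2, max_eq_right hdev.1]
  rw [hbump, dev]
  simp only [vval]
  have : x (out k) = 1 - τ - x (inn k) := by linarith
  rw [this]
  ring

theorem abs_clip_sub_le {a a' c c' e : ℝ} (ha : |a - a'| ≤ e) (hc : |c - c'| ≤ e) :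
    |max (-c) (min a c) - max (-c') (min a' c')| ≤ e := by
  refine (abs_max_sub_max_le_max _ _ _ _).trans (max_le ?_ ?_)
  · rwa [neg_sub_neg, abs_sub_comm]
  · exact (abs_min_sub_min_le_max _ _ _ _).trans (max_le ha hc)

/-- Clipping does not increase differences. The clipped function is `2 * dl k`-Lipschitz in the
outer coordinate, and the clipping level has the same constant in each coordinate involved. -/
theorem abs_bump_sub_le {k : Fin 3 × ℤ} (hk : k ∈ bdry M.N) {x y : Vtx → ℝ}
    (hx : x ∈ simplexOf (col M.N k)) (hy : y ∈ simplexOf (col M.N k)) (q : T) :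
    |M.bump q k x - M.bump q k y| ≤ 2 * M.dl k *
      (|x (out (succ M.N k)) - y (out (succ M.N k))| + |x (inn k) - y (inn k)|) := by
  have hne := succ_ne (N := M.N) k
  have ho : out k ∉ col M.N k := by simp [col, hne.symm]
  have hdl := M.dl_pos k hk
  have hd2 : inn k ≠ out (succ M.N k) := by simp
  have hle : ∀ z ∈ simplexOf (col M.N k), z (out (succ M.N k)) ∈ Icc (0 : ℝ) 1 := by
    intro z hz
    have hs := sum_triple_of_mem_simplexOf (a := inn k) (b := inn (succ M.N k))
      (c := out (succ M.N k)) (by simpa using hne.symm) (by simp) (by simp) hz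
    have h1 := hz.1 (inn k)
    have h2 := hz.1 (inn (succ M.N k))
    exact ⟨hz.1 _, by linarith⟩
  have hs := hle x hx
  have ht := hle y hy
  simp only [bump, hx.2.1 _ ho, hy.2.1 _ ho, add_zero]
  set s := x (out (succ M.N k))
  set t := y (out (succ M.N k))
  apply abs_clip_sub_le
  · have hm : ∀ r ∈ Icc (0 : ℝ) 1, r * M.dl k ∈ Icc 0 (M.dl k) := fun r hr =>
      ⟨mul_nonneg hr.1 hdl.le, by nlinarith [hr.2]⟩
    have d1 := abs_dist_sub_le (M.bd k (s * M.dl k)) (M.bd k (t * M.dl k)) q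
    rw [M.bd_dist k hk _ (hm s hs) _ (hm t ht), ← sub_mul, abs_mul, abs_of_pos hdl,
      dist_comm _ q, dist_comm _ q] at d1
    have d3 := abs_dist_sub_le (M.m k) (M.m (succ M.N k)) q
    rw [M.dist_succ hk, dist_comm _ q, dist_comm _ q] at d3
    have e : M.dev q k s - M.dev q k t = (dist q (M.bd k (s * M.dl k)) - dist q (M.bd k (t * M.dl k))) +
        (s - t) * (dist q (M.m k) - dist q (M.m (succ M.N k))) := by
      simp only [dev]; ring
    rw [e]
    refine (abs_add_le _ _).trans ?_
    rw [abs_mul]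
    have : |s - t| * |dist q (M.m k) - dist q (M.m (succ M.N k))| ≤ |s - t| * M.dl k := by gcongr
    have := mul_nonneg hdl.le (abs_nonneg (x (inn k) - y (inn k)))
    linarith
  · rw [← mul_sub, abs_mul, abs_of_pos (by positivity)]
    refine mul_le_mul_of_nonneg_left ?_ (by positivity)
    refine (abs_min_sub_min_le_max _ _ _ _).trans (max_le ?_ ?_)
    · linarith [abs_nonneg (x (inn k) - y (inn k))]
    · linarith [abs_nonneg (s - t)]

theorem abs_dist_sub_le' (q a b : T) : |dist q a - dist q b| ≤ dist a b := by
  have := abs_dist_sub_le a b q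
  rwa [dist_comm _ q, dist_comm _ q] at this

/-- The comparison function is `1`-Lipschitz on an affine face whose edges at the vertex `u` are
long compared to its variation. -/
theorem lipschitz_affine {u v w : Vtx} (ht : {u, v, w} ∈ faces M.N) (huv : u ≠ v) (hvw : v ≠ w)
    (huw : u ≠ w) (hout : ∀ k, out k ∉ ({u, v, w} : Finset Vtx)) (q : T)
    (h : |M.len u v ^ 2 + M.len u w ^ 2 - M.len v w ^ 2| ≤ 3 / 2 * (M.len u v * M.len u w))
    (hv : |M.vval q v - M.vval q u| ≤ M.len u v / 3)
    (hw : |M.vval q w - M.vval q u| ≤ M.len u w / 3) :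
    ∃ a b c, ({u, v, w} : Finset Vtx) = {a, b, c} ∧ a ≠ b ∧ b ≠ c ∧ a ≠ c ∧
      ∀ x ∈ simplexOf {u, v, w}, ∀ y ∈ simplexOf {u, v, w},
        (M.distFun q x - M.distFun q y) ^ 2 ≤ M.complex.quadForm a b c (x - y) := by
  refine ⟨u, v, w, rfl, huv, hvw, huw, fun x hx y hy => ?_⟩
  have hsx := sum_triple_of_mem_simplexOf huv hvw huw hx
  have hsy := sum_triple_of_mem_simplexOf huv hvw huw hy
  have h1 : 0 ≤ M.len u v := by linarith [abs_nonneg (M.vval q v - M.vval q u)]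
  have h2 : 0 ≤ M.len u w := by linarith [abs_nonneg (M.vval q w - M.vval q u)]
  refine M.complex.sq_le_quadForm (by simp only [Pi.sub_apply]; linarith) h1 h2 h ?_
  rw [M.distFun_of_no_out ht hout hx, M.distFun_of_no_out ht hout hy, sum_triple huv hvw huw,
    sum_triple huv hvw huw]
  have e : x u * M.vval q u + x v * M.vval q v + x w * M.vval q w -
      (y u * M.vval q u + y v * M.vval q v + y w * M.vval q w) =
      (M.vval q v - M.vval q u) * (x v - y v) + (M.vval q w - M.vval q u) * (x w - y w) := by
    have a1 : x u = 1 - x v - x w := by linarith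
    have a2 : y u = 1 - y v - y w := by linarith
    rw [a1, a2]; ring
  rw [e]
  refine (abs_add_le _ _).trans ?_
  rw [abs_mul, abs_mul]
  simp only [Pi.sub_apply, complex_len]
  have b1 : |M.vval q v - M.vval q u| * |x v - y v| ≤ M.len u v / 3 * |x v - y v| := by gcongr
  have b2 : |M.vval q w - M.vval q u| * |x w - y w| ≤ M.len u w / 3 * |x w - y w| := by gcongr
  linarith

theorem abs_vval_fan {j : Fin 3 × ℤ} (hj : |j.2| = (M.N j.1 : ℤ)) (q : T) :
    |M.vval q apex - M.vval q (inn j)| ≤ M.R :=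
  (abs_dist_sub_le' q _ _).trans (M.dist_le_R _ _ (by simp) hj)

theorem lipschitz_fan {a b : Fin 3 × ℤ} (ht : {apex, inn a, inn b} ∈ faces M.N) (hne : a ≠ b)
    (ha : |a.2| = (M.N a.1 : ℤ)) (hb : |b.2| = (M.N b.1 : ℤ)) (q : T) :
    ∃ u v w, ({apex, inn a, inn b} : Finset Vtx) = {u, v, w} ∧ u ≠ v ∧ v ≠ w ∧ u ≠ w ∧
      ∀ x ∈ simplexOf {apex, inn a, inn b}, ∀ y ∈ simplexOf {apex, inn a, inn b},
        (M.distFun q x - M.distFun q y) ^ 2 ≤ M.complex.quadForm u v w (x - y) := by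
  -- The angle at the apex may be arbitrarily small. The triangle is isosceles with base no longer
  -- than its legs, so at a base vertex the cosine lies between `0` and `1 / 2`; that vertex is
  -- used.
  rw [Finset.insert_comm] at ht ⊢
  have hκ := M.κ_pos
  have hR := M.R_nonneg
  have hd := M.dist_le_R a b ha hb
  have h0 : 0 ≤ dist (M.m a) (M.m b) := dist_nonneg
  refine M.lipschitz_affine ht (by simp) (by simp) (by simpa using hne) (by simp) q ?_ ?_ ?_
  · simp only [len]
    rw [abs_of_nonneg (by nlinarith)]
    nlinarith
  · refine (M.abs_vval_fan ha q).trans ?_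
    simp only [len]; linarith
  · refine (abs_dist_sub_le' q (M.m b) (M.m a)).trans ?_
    simp only [len]
    rw [dist_comm]; linarith

/-- The side from `a` to `b` is `103 * κ`, while the other two sides are at least `100 * κ` and
differ by at most `3 * κ`. This bounds the angle at `a` away from `0` and `π`, however wide the
ladder is. -/
theorem lipschitz_arm {a b c : Fin 3 × ℤ} (ht : {inn a, inn b, inn c} ∈ faces M.N) (hab : a ≠ b)
    (hbc : b ≠ c) (hac : a ≠ c) (hd : dist (M.m a) (M.m b) = M.κ) (q : T) :
    ∃ u v w, ({inn a, inn b, inn c} : Finset Vtx) = {u, v, w} ∧ u ≠ v ∧ v ≠ w ∧ u ≠ w ∧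
      ∀ x ∈ simplexOf {inn a, inn b, inn c}, ∀ y ∈ simplexOf {inn a, inn b, inn c},
        (M.distFun q x - M.distFun q y) ^ 2 ≤ M.complex.quadForm u v w (x - y) := by
  have hκ := M.κ_pos
  have t1 := dist_triangle (M.m a) (M.m b) (M.m c)
  have t2 := dist_triangle_left (M.m b) (M.m c) (M.m a)
  rw [hd] at t1 t2
  have h0 : 0 ≤ dist (M.m a) (M.m c) := dist_nonneg
  refine M.lipschitz_affine ht (by simpa using hab) (by simpa using hbc) (by simpa using hac)
    (by simp) q ?_ ?_ ?_
  · simp only [len, hd]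
    rw [abs_le]
    constructor <;> nlinarith
  · refine (abs_dist_sub_le' q (M.m b) (M.m a)).trans ?_
    simp only [len]
    rw [dist_comm]; linarith
  · refine (abs_dist_sub_le' q (M.m c) (M.m a)).trans ?_
    simp only [len]
    rw [dist_comm]; linarith

/-- At `inn (succ N k)` the angle is controlled and both sides are at least `100 * κ`. Interpolation
and correction together have coefficients at most `12 * κ` and `8 * κ`, below a third of these
sides. -/
theorem lipschitz_col {k : Fin 3 × ℤ} (hk : k ∈ bdry M.N) (q : T) :
    ∃ u v w, col M.N k = {u, v, w} ∧ u ≠ v ∧ v ≠ w ∧ u ≠ w ∧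
      ∀ x ∈ simplexOf (col M.N k), ∀ y ∈ simplexOf (col M.N k),
        (M.distFun q x - M.distFun q y) ^ 2 ≤ M.complex.quadForm u v w (x - y) := by
  have hne := succ_ne (N := M.N) k
  have hκ := M.κ_pos
  have hdl := M.dl_pos k hk
  have hdl' := M.dl_le k hk
  have h1 : inn k ≠ inn (succ M.N k) := by simpa using hne.symm
  have h2 : inn (succ M.N k) ≠ out (succ M.N k) := by simp
  have h3 : inn k ≠ out (succ M.N k) := by simp
  refine ⟨inn (succ M.N k), inn k, out (succ M.N k), ?_, h1.symm, h3, h2, fun x hx y hy => ?_⟩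
  · rw [col, Finset.insert_comm]
  have hsx := sum_triple_of_mem_simplexOf h1 h2 h3 hx
  have hsy := sum_triple_of_mem_simplexOf h1 h2 h3 hy
  have e1 : M.len (inn (succ M.N k)) (inn k) = 100 * M.κ + 3 * M.dl k := by
    rw [M.len_comm, M.len_inn_inn_succ hk]
  have e2 := M.len_inn_out_self (succ M.N k)
  have e3 : M.len (inn k) (out (succ M.N k)) ^ 2 = (100 * M.κ) ^ 2 + M.dl k ^ 2 := by
    rw [M.len_inn_out_succ hk, Real.sq_sqrt (by positivity)]
  refine M.complex.sq_le_quadForm (by simp only [Pi.sub_apply]; linarith)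
    (by rw [complex_len, e1]; positivity) (by rw [complex_len, e2]; positivity) ?_ ?_
  · rw [complex_len, e1, e2, e3, abs_le]
    constructor <;> nlinarith
  · rw [complex_len, e1, e2, M.distFun_col hk hx, M.distFun_col hk hy]
    simp only [Pi.sub_apply]
    rw [col, sum_triple h1 h2 h3, sum_triple h1 h2 h3]
    have hb := M.abs_bump_sub_le hk hx hy q
    have d3 := abs_dist_sub_le' q (M.m k) (M.m (succ M.N k))
    rw [M.dist_succ hk] at d3
    have e : x (inn k) * M.vval q (inn k) + x (inn (succ M.N k)) * M.vval q (inn (succ M.N k)) +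
        x (out (succ M.N k)) * M.vval q (out (succ M.N k)) + M.bump q k x -
        (y (inn k) * M.vval q (inn k) + y (inn (succ M.N k)) * M.vval q (inn (succ M.N k)) +
        y (out (succ M.N k)) * M.vval q (out (succ M.N k)) + M.bump q k y) =
        (dist q (M.m k) - dist q (M.m (succ M.N k))) * (x (inn k) - y (inn k)) +
          (M.bump q k x - M.bump q k y) := by
      simp only [vval]
      have a1 : x (out (succ M.N k)) = 1 - x (inn k) - x (inn (succ M.N k)) := by linarith
      have a2 : y (out (succ M.N k)) = 1 - y (inn k) - y (inn (succ M.N k)) := by linarith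
      rw [a1, a2]; ring
    rw [e]
    refine (abs_add_le _ _).trans ?_
    rw [abs_mul]
    set A := |x (inn k) - y (inn k)|
    set B := |x (out (succ M.N k)) - y (out (succ M.N k))|
    have hA : 0 ≤ A := abs_nonneg _
    have hB : 0 ≤ B := abs_nonneg _
    have b1 : |dist q (M.m k) - dist q (M.m (succ M.N k))| * A ≤ M.dl k * A := by gcongr
    have b2 : M.dl k * A ≤ 4 * M.κ * A := by gcongr
    have b3 : M.dl k * B ≤ 4 * M.κ * B := by gcongr
    have b4 : 0 ≤ M.dl k * A := by positivity
    have b5 : 0 ≤ M.κ * A := by positivity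
    have b6 : 0 ≤ M.κ * B := by positivity
    linarith

/-- The angle at `out k` is right, so the outer coordinate times `dl k` is the orthogonal projection
onto the outer edge. The function depends only on this projection, through a unit speed path in `T`.
-/
theorem lipschitz_rim {k : Fin 3 × ℤ} (hk : k ∈ bdry M.N) (q : T) :
    ∃ u v w, rim M.N k = {u, v, w} ∧ u ≠ v ∧ v ≠ w ∧ u ≠ w ∧
      ∀ x ∈ simplexOf (rim M.N k), ∀ y ∈ simplexOf (rim M.N k),
        (M.distFun q x - M.distFun q y) ^ 2 ≤ M.complex.quadForm u v w (x - y) := by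
  have hne := succ_ne (N := M.N) k
  have hκ := M.κ_pos
  have hdl := M.dl_pos k hk
  have h1 : out k ≠ inn k := by simp
  have h2 : inn k ≠ out (succ M.N k) := by simp
  have h3 : out k ≠ out (succ M.N k) := by simpa using hne.symm
  refine ⟨out k, inn k, out (succ M.N k), rfl, h1, h2, h3, fun x hx y hy => ?_⟩
  have hsx := sum_triple_of_mem_simplexOf h1 h2 h3 hx
  have hsy := sum_triple_of_mem_simplexOf h1 h2 h3 hy
  have hm : ∀ z ∈ simplexOf (rim M.N k), z (out k) + z (inn k) + z (out (succ M.N k)) = 1 →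
      z (out (succ M.N k)) * M.dl k ∈ Icc 0 (M.dl k) := by
    intro z hz hs
    have a1 := hz.1 (out k)
    have a2 := hz.1 (inn k)
    exact ⟨mul_nonneg (hz.1 _) hdl.le, by nlinarith⟩
  rw [M.distFun_rim hk hx, M.distFun_rim hk hy]
  have d := abs_dist_sub_le' q (M.bd k (x (out (succ M.N k)) * M.dl k))
    (M.bd k (y (out (succ M.N k)) * M.dl k))
  rw [M.bd_dist k hk _ (hm x hx hsx) _ (hm y hy hsy), ← sub_mul] at d
  rw [← sq_abs]
  refine (pow_le_pow_left₀ (abs_nonneg _) d 2).trans ?_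
  rw [sq_abs]
  have e1 : M.len (out k) (inn k) = 100 * M.κ := by rw [M.len_comm, M.len_inn_out_self]
  have e2 := M.len_out_out_succ hk
  have e3 : M.len (inn k) (out (succ M.N k)) ^ 2 = (100 * M.κ) ^ 2 + M.dl k ^ 2 := by
    rw [M.len_inn_out_succ hk, Real.sq_sqrt (by positivity)]
  simp only [TriangleComplex.quadForm, complex_len, e1, e2, e3, Pi.sub_apply]
  have a1 : x (out k) - y (out k) = -(x (inn k) - y (inn k)) -
      (x (out (succ M.N k)) - y (out (succ M.N k))) := by linarith
  rw [a1]
  generalize x (inn k) - y (inn k) = A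
  generalize x (out (succ M.N k)) - y (out (succ M.N k)) = B
  nlinarith [sq_nonneg (M.κ * A)]

theorem abs_distFun_sub_le (q : T) (p p' : M.Surf) :
    |M.distFun q (M.complex.coords p) - M.distFun q (M.complex.coords p')| ≤ dist p p' := by
  refine M.complex.abs_sub_le_dist (M.distFun q) (fun t ht => ?_) p p'
  have ht' := ht
  have hN := M.N_pos
  rcases mem_faces.1 ht with ⟨i, rfl⟩ | ⟨i, rfl⟩ | ⟨i, n, hn, rfl⟩ | ⟨i, n, hn, rfl⟩ |
    ⟨k, hk, rfl⟩ | ⟨k, hk, rfl⟩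
  · have := hN i
    exact M.lipschitz_fan ht (by simp only [ne_eq, Prod.mk.injEq, true_and]; omega) (by simp)
      (by simp) q
  · exact M.lipschitz_fan ht (fun h => (by decide : ∀ i : Fin 3, i + 1 ≠ i) i
      (congrArg Prod.fst h)) (by simp) (by simp) q
  · have e : armA i n = {inn (i, -(n + 1 : ℤ)), inn (i, -(n : ℤ)), inn (i, (n + 1 : ℤ))} := by
      rw [armA, Finset.pair_comm]
    rw [e] at ht ⊢
    exact M.lipschitz_arm ht (by simp) (by simp only [ne_eq, Prod.mk.injEq, true_and]; omega)
      (by simp only [ne_eq, Prod.mk.injEq, true_and]; omega) (M.dist_armA hn) q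
  · have e : armB i n = {inn (i, (n : ℤ)), inn (i, (n + 1 : ℤ)), inn (i, -(n : ℤ))} := by
      rw [armB, Finset.insert_comm, Finset.pair_comm, Finset.insert_comm]
    rw [e] at ht ⊢
    exact M.lipschitz_arm ht (by simp) (by simp only [ne_eq, Prod.mk.injEq, true_and]; omega)
      (by simp only [ne_eq, Prod.mk.injEq, true_and]; omega) (M.dist_armB hn.2) q
  · exact M.lipschitz_col hk q
  · exact M.lipschitz_rim hk q

end Mesh

theorem pathSet_iterate {V J : Type*} [DecidableEq V] (v : J → V) (f : J → J) (n : ℕ) (k : J) :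
    pathSet ((List.iterate f k (n + 2)).map v) =
      ⋃ a ∈ List.iterate f k (n + 1), simplexOf {v a, v (f a)} := by
  induction n generalizing k with
  | zero =>
    have : pathSet [v k, v (f k)] = simplexOf {v k, v (f k)} := by
      rw [pathSet_cons_cons, union_eq_left]
      exact simplexOf_mono (by simp)
    simpa [List.iterate] using this
  | succ n ih =>
    have h1 : List.iterate f k (n + 1 + 2) = k :: List.iterate f (f k) (n + 2) := rfl
    have h2 : List.iterate f k (n + 1 + 1) = k :: List.iterate f (f k) (n + 1) := rfl
    have h3 : pathSet ((List.iterate f k (n + 1 + 2)).map v) =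
        simplexOf {v k, v (f k)} ∪ pathSet ((List.iterate f (f k) (n + 2)).map v) := rfl
    rw [h3, ih, h2]
    simp only [List.mem_cons, iUnion_iUnion_eq_or_left]

namespace Mesh

open Vtx

variable {T : Type*} [MetricSpace T] (M : Mesh T)

/-! ### The boundary of the surface -/

theorem cycleSet_bdry : cycleSet ((bdry M.N).map out) =
    ⋃ k ∈ bdry M.N, simplexOf {out k, out (succ M.N k)} := by
  have h := iterate_succ_bdry M.N
  unfold bdry
  obtain ⟨n, hn⟩ : ∃ n, 2 * M.N 0 + 1 + (2 * M.N 1 + 1) + (2 * M.N 2 + 1) = n + 1 :=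
    ⟨_, (Nat.succ_pred_eq_of_pos (by omega)).symm⟩
  rw [hn] at h ⊢
  have e : List.iterate (succ M.N) (0, -(M.N 0 : ℤ)) (n + 2) =
      List.iterate (succ M.N) (0, -(M.N 0 : ℤ)) (n + 1) ++ [(0, -(M.N 0 : ℤ))] := by
    rw [show n + 2 = (n + 1) + 1 from rfl, List.iterate_add _ _ (n + 1) 1, h]
    rfl
  rw [← pathSet_iterate, e, List.map_append]
  rfl

theorem isDiskWithBoundary :
    IsDiskWithBoundary M.Surf {p | ∃ k ∈ bdry M.N,
      M.complex.coords p ∈ simplexOf {out k, out (succ M.N k)}} := by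
  have := M.complex.isDiskWithBoundary (shelling_faces M.N_pos).isDiskIn
  convert this using 1
  rw [M.cycleSet_bdry]
  ext p
  simp

/-- Arc length parametrizations of the boundary edges. -/
theorem exists_rim : ∃ b : Fin 3 × ℤ → ℝ → M.Surf, ∀ k ∈ bdry M.N, ∀ s ∈ Icc 0 (M.dl k),
    M.complex.coords (b k s) =
      (1 - s / M.dl k) • Pi.single (out k) (1 : ℝ) +
        (s / M.dl k) • Pi.single (out (succ M.N k)) (1 : ℝ) := by
  have h : ∀ (k : Fin 3 × ℤ) (s : ℝ), ∃ p : M.Surf, k ∈ bdry M.N → s ∈ Icc 0 (M.dl k) →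
      M.complex.coords p = (1 - s / M.dl k) • Pi.single (out k) (1 : ℝ) +
        (s / M.dl k) • Pi.single (out (succ M.N k)) (1 : ℝ) := by
    intro k s
    by_cases hks : k ∈ bdry M.N ∧ s ∈ Icc 0 (M.dl k)
    · obtain ⟨hk, hs⟩ := hks
      have hdl := M.dl_pos k hk
      have hne : out k ≠ out (succ M.N k) := by simpa using (succ_ne (N := M.N) k).symm
      have h0 : 0 ≤ s / M.dl k := div_nonneg hs.1 hdl.le
      have h1 : s / M.dl k ≤ 1 := div_le_one_of_le₀ hs.2 hdl.le
      obtain ⟨p, hp⟩ := M.complex.exists_coords_eq (M.rim_mem_faces hk)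
        (x := (1 - s / M.dl k) • Pi.single (out k) (1 : ℝ) +
          (s / M.dl k) • Pi.single (out (succ M.N k)) (1 : ℝ))
        (simplexOf_mono (s := {out k, out (succ M.N k)}) (by
          intro v; simp only [rim, Finset.mem_insert, Finset.mem_singleton]; tauto) (by
          refine ⟨fun v => ?_, fun v hv => ?_, ?_⟩
          · have e (w : Vtx) : (0 : ℝ) ≤ (Pi.single w (1 : ℝ) : Vtx → ℝ) v := by
              have h : (0 : Vtx → ℝ) ≤ Pi.single w (1 : ℝ) := Pi.single_nonneg.2 zero_le_one
              exact h v
            have e1 := e (out k)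
            have e2 := e (out (succ M.N k))
            simp only [Pi.add_apply, Pi.smul_apply, smul_eq_mul]
            have := sub_nonneg.2 h1
            positivity
          · simp only [Finset.mem_insert, Finset.mem_singleton, not_or] at hv
            simp [Pi.single_eq_of_ne hv.1, Pi.single_eq_of_ne hv.2]
          · rw [Finset.sum_pair hne]
            simp [Pi.single_eq_of_ne hne, Pi.single_eq_of_ne hne.symm]))
      exact ⟨p, fun _ _ => hp⟩
    · obtain ⟨t, ht⟩ := M.complex.nonempty
      exact ⟨M.complex.toSurface ⟨t, ht⟩ ⟨M.complex.basis ⟨t, ht⟩ 0,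
        subset_convexHull ℝ _ (mem_range_self 0)⟩, fun hk hs => absurd ⟨hk, hs⟩ hks⟩
  choose b hb using h
  exact ⟨b, fun k hk s hs => hb k s hk hs⟩

/-- The arc length parametrization of the boundary edge `k`. -/
def rimPoint : Fin 3 × ℤ → ℝ → M.Surf := M.exists_rim.choose

theorem coords_rimPoint {k : Fin 3 × ℤ} (hk : k ∈ bdry M.N) {s : ℝ} (hs : s ∈ Icc 0 (M.dl k)) :
    M.complex.coords (M.rimPoint k s) = (1 - s / M.dl k) • Pi.single (out k) (1 : ℝ) +
        (s / M.dl k) • Pi.single (out (succ M.N k)) (1 : ℝ) := M.exists_rim.choose_spec k hk s hs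

theorem coords_rimPoint_values {k : Fin 3 × ℤ} (hk : k ∈ bdry M.N) {s : ℝ}
    (hs : s ∈ Icc 0 (M.dl k)) :
    M.complex.coords (M.rimPoint k s) (out k) = 1 - s / M.dl k ∧
    M.complex.coords (M.rimPoint k s) (out (succ M.N k)) = s / M.dl k ∧
    ∀ v, v ≠ out k → v ≠ out (succ M.N k) → M.complex.coords (M.rimPoint k s) v = 0 := by
  have hne : out k ≠ out (succ M.N k) := by simpa using (succ_ne (N := M.N) k).symm
  rw [M.coords_rimPoint hk hs]
  refine ⟨by simp [Pi.single_eq_of_ne hne], by simp [Pi.single_eq_of_ne hne.symm],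
    fun v h1 h2 => by simp [Pi.single_eq_of_ne h1, Pi.single_eq_of_ne h2]⟩

theorem coords_rimPoint_mem {k : Fin 3 × ℤ} (hk : k ∈ bdry M.N) {s : ℝ}
    (hs : s ∈ Icc 0 (M.dl k)) :
    M.complex.coords (M.rimPoint k s) ∈ simplexOf {out k, out (succ M.N k)} := by
  have hne : out k ≠ out (succ M.N k) := by simpa using (succ_ne (N := M.N) k).symm
  obtain ⟨h1, h2, h3⟩ := M.coords_rimPoint_values hk hs
  have hdl := M.dl_pos k hk
  refine ⟨fun v => ?_, fun v hv => ?_, ?_⟩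
  · by_cases hv1 : v = out k
    · rw [hv1, h1]; exact sub_nonneg.2 (div_le_one_of_le₀ hs.2 hdl.le)
    by_cases hv2 : v = out (succ M.N k)
    · rw [hv2, h2]; exact div_nonneg hs.1 hdl.le
    rw [h3 v hv1 hv2]
  · simp only [Finset.mem_insert, Finset.mem_singleton, not_or] at hv
    exact h3 v hv.1 hv.2
  · rw [Finset.sum_pair hne, h1, h2]; ring

theorem coords_rimPoint_mem_rim {k : Fin 3 × ℤ} (hk : k ∈ bdry M.N) {s : ℝ}
    (hs : s ∈ Icc 0 (M.dl k)) : M.complex.coords (M.rimPoint k s) ∈ simplexOf (rim M.N k) :=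
  simplexOf_mono (by
    intro v; simp only [rim, Finset.mem_insert, Finset.mem_singleton]; tauto)
    (M.coords_rimPoint_mem hk hs)

theorem rimPoint_dl {k : Fin 3 × ℤ} (hk : k ∈ bdry M.N) :
    M.rimPoint k (M.dl k) = M.rimPoint (succ M.N k) 0 := by
  have hdl := M.dl_pos k hk
  have hk' := succ_mem_bdry hk
  apply M.complex.coords_injective
  rw [M.coords_rimPoint hk ⟨hdl.le, le_rfl⟩, M.coords_rimPoint hk' ⟨le_rfl, (M.dl_pos _ hk').le⟩,
    div_self hdl.ne']
  simp

theorem dist_rimPoint_le {k : Fin 3 × ℤ} (hk : k ∈ bdry M.N) {s t : ℝ} (hs : s ∈ Icc 0 (M.dl k))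
    (ht : t ∈ Icc 0 (M.dl k)) : dist (M.rimPoint k s) (M.rimPoint k t) ≤ |s - t| := by
  have hne : out k ≠ out (succ M.N k) := by simpa using (succ_ne (N := M.N) k).symm
  have hdl := M.dl_pos k hk
  have h := M.complex.sq_dist_le_quadForm (a := out k) (b := inn k) (c := out (succ M.N k))
    (M.rim_mem_faces hk) (by simp) (by simp) hne (M.coords_rimPoint_mem_rim hk hs)
    (M.coords_rimPoint_mem_rim hk ht)
  obtain ⟨a1, a2, a3⟩ := M.coords_rimPoint_values hk hs
  obtain ⟨b1, b2, b3⟩ := M.coords_rimPoint_values hk ht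
  have e : M.complex.quadForm (out k) (inn k) (out (succ M.N k))
      (M.complex.coords (M.rimPoint k s) - M.complex.coords (M.rimPoint k t)) = (s - t) ^ 2 := by
    simp only [TriangleComplex.quadForm, Pi.sub_apply, a1, a2, b1, b2,
      a3 (inn k) (by simp) (by simp), b3 (inn k) (by simp) (by simp), complex_len,
      M.len_out_out_succ hk]
    field_simp
    ring
  rw [e] at h
  exact abs_le_of_sq_le_sq' (by rwa [sq_abs]) (abs_nonneg _) |>.2

theorem distFun_rimPoint {k : Fin 3 × ℤ} (hk : k ∈ bdry M.N) {s : ℝ} (hs : s ∈ Icc 0 (M.dl k))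
    (q : T) : M.distFun q (M.complex.coords (M.rimPoint k s)) = dist q (M.bd k s) := by
  rw [M.distFun_rim hk (M.coords_rimPoint_mem_rim hk hs), (M.coords_rimPoint_values hk hs).2.1,
    div_mul_cancel₀ _ (M.dl_pos k hk).ne']

/-- The `1`-Lipschitz extension of the distance to `q = bd j s` takes the value `0` at one rim point
and `dist q (bd k t)` at the other. -/
theorem dist_bd_le {j k : Fin 3 × ℤ} (hj : j ∈ bdry M.N) (hk : k ∈ bdry M.N) {s t : ℝ}
    (hs : s ∈ Icc 0 (M.dl j)) (ht : t ∈ Icc 0 (M.dl k)) :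
    dist (M.bd j s) (M.bd k t) ≤ dist (M.rimPoint j s) (M.rimPoint k t) := by
  have := M.abs_distFun_sub_le (M.bd j s) (M.rimPoint j s) (M.rimPoint k t)
  rw [M.distFun_rimPoint hj hs, M.distFun_rimPoint hk ht, dist_self, zero_sub, abs_neg,
    abs_of_nonneg dist_nonneg] at this
  exact this

theorem exists_rimPoint_eq {k : Fin 3 × ℤ} (hk : k ∈ bdry M.N) {p : M.Surf}
    (hp : M.complex.coords p ∈ simplexOf {out k, out (succ M.N k)}) :
    ∃ s ∈ Icc 0 (M.dl k), M.rimPoint k s = p := by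
  have hne : out k ≠ out (succ M.N k) := by simpa using (succ_ne (N := M.N) k).symm
  have hdl := M.dl_pos k hk
  have hsum := hp.2.2
  rw [Finset.sum_pair hne] at hsum
  have h0 := hp.1 (out k)
  have h1 := hp.1 (out (succ M.N k))
  have hs : M.complex.coords p (out (succ M.N k)) * M.dl k ∈ Icc 0 (M.dl k) :=
    ⟨by positivity, by nlinarith⟩
  refine ⟨_, hs, M.complex.coords_injective (funext fun v => ?_)⟩
  obtain ⟨a1, a2, a3⟩ := M.coords_rimPoint_values hk hs
  rw [mul_div_cancel_right₀ _ hdl.ne'] at a1 a2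
  by_cases hv1 : v = out k
  · rw [hv1, a1]; linarith
  by_cases hv2 : v = out (succ M.N k)
  · rw [hv2, a2]
  rw [a3 v hv1 hv2, hp.2.1 v (by simp [hv1, hv2])]

theorem boundary_eq : {p : M.Surf | ∃ k ∈ bdry M.N,
      M.complex.coords p ∈ simplexOf {out k, out (succ M.N k)}} =
    {p | ∃ k ∈ bdry M.N, ∃ s ∈ Icc 0 (M.dl k), M.rimPoint k s = p} := by
  ext p
  constructor
  · rintro ⟨k, hk, hp⟩
    exact ⟨k, hk, M.exists_rimPoint_eq hk hp⟩
  · rintro ⟨k, hk, s, hs, rfl⟩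
    exact ⟨k, hk, M.coords_rimPoint_mem hk hs⟩

/-! ### Diameter -/

theorem exists_vertex {t : Finset Vtx} (ht : t ∈ faces M.N) {v : Vtx} (hv : v ∈ t) :
    ∃ p : M.Surf, M.complex.coords p = Pi.single v (1 : ℝ) :=
  M.complex.exists_coords_eq ht (simplexOf_mono (s := {v}) (by simpa using hv) (by
    rw [simplexOf_singleton]; rfl))

theorem exists_inner (k : Fin 3 × ℤ) (hk : k ∈ bdry M.N) :
    ∃ p : M.Surf, M.complex.coords p = Pi.single (inn k) (1 : ℝ) :=
  M.exists_vertex (M.rim_mem_faces hk) (by simp [rim])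

theorem exists_apex : ∃ p : M.Surf, M.complex.coords p = Pi.single apex (1 : ℝ) :=
  M.exists_vertex (t := fanA M.N 0) (mem_faces.2 (Or.inl ⟨0, rfl⟩)) (by simp [fanA])

theorem single_mem_simplexOf {t : Finset Vtx} {v : Vtx} (hv : v ∈ t) :
    (Pi.single v (1 : ℝ) : Vtx → ℝ) ∈ simplexOf t :=
  simplexOf_mono (s := {v}) (by simpa using hv) (by rw [simplexOf_singleton]; rfl)

theorem dist_inner_succ_le {k : Fin 3 × ℤ} (hk : k ∈ bdry M.N) {p p' : M.Surf}
    (hp : M.complex.coords p = Pi.single (inn k) (1 : ℝ))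
    (hp' : M.complex.coords p' = Pi.single (inn (succ M.N k)) (1 : ℝ)) :
    dist p p' ≤ 112 * M.κ := by
  have hκ := M.κ_pos
  have hdl := M.dl_le k hk
  have hdl0 := M.dl_pos k hk
  have h4 := (sqrt_lt_aux (show 0 < 100 * M.κ by positivity) hdl0).2
  refine M.complex.dist_le_of_coords_eq_single (a := inn k) (b := inn (succ M.N k))
    (c := out (succ M.N k)) (M.col_mem_faces hk) (by simpa using (succ_ne (N := M.N) k).symm)
    (by simp) (by simp) hp ?_ ?_ ?_
  · rw [hp']; exact single_mem_simplexOf (by simp)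
  · rw [complex_len, M.len_inn_inn_succ hk]; linarith
  · rw [complex_len, M.len_inn_out_succ hk]; linarith

theorem dist_inner_le (i : Fin 3) (n : ℕ) (a : ℤ) (h : -(M.N i : ℤ) ≤ a) (h' : a + n ≤ M.N i)
    {p p' : M.Surf} (hp : M.complex.coords p = Pi.single (inn (i, a)) (1 : ℝ))
    (hp' : M.complex.coords p' = Pi.single (inn (i, a + n)) (1 : ℝ)) :
    dist p p' ≤ 112 * M.κ * n := by
  induction n generalizing p' with
  | zero =>
    have : p = p' := M.complex.coords_injective (by rw [hp, hp']; simp)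
    rw [this]; simp
  | succ n ih =>
    push_cast at h'
    have hk : (i, a + n) ∈ bdry M.N := mem_bdry.2 (abs_le.2 ⟨by simp only; omega, by simp only; omega⟩)
    obtain ⟨r, hr⟩ := M.exists_inner _ hk
    have h1 := ih (by omega) hr
    have h2 := M.dist_inner_succ_le hk hr (p' := p') (by
      rw [hp', succ, if_pos (by simp only; omega)]
      push_cast
      rw [add_assoc])
    have := dist_triangle p r p'
    push_cast
    linarith

theorem dist_apex_le {p o : M.Surf} {a b : Fin 3 × ℤ} (ht : {apex, inn a, inn b} ∈ faces M.N)
    (hab : a ≠ b) (ho : M.complex.coords o = Pi.single apex (1 : ℝ))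
    (hp : M.complex.coords p ∈ simplexOf {apex, inn a, inn b}) :
    dist p o ≤ 100 * M.κ + 3 * M.R := by
  rw [dist_comm]
  exact M.complex.dist_le_of_coords_eq_single ht (by simp) (by simpa using hab) (by simp) ho hp
    (by simp [complex_len, len]) (by simp [complex_len, len])

theorem fanA_mem (i : Fin 3) : {apex, inn (i, (M.N i : ℤ)), inn (i, -(M.N i : ℤ))} ∈ faces M.N :=
  mem_faces.2 (Or.inl ⟨i, rfl⟩)

/-- Walk along inner edges to the hexagon vertex on the same side of the corner, then along one fan
edge to the apex. -/
theorem dist_inner_apex_le {k : Fin 3 × ℤ} (hk : k ∈ bdry M.N) {p o : M.Surf}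
    (hp : M.complex.coords p = Pi.single (inn k) (1 : ℝ))
    (ho : M.complex.coords o = Pi.single apex (1 : ℝ)) :
    dist p o ≤ 112 * M.κ * M.N k.1 + (100 * M.κ + 3 * M.R) := by
  obtain ⟨i, t⟩ := k
  have hκ := M.κ_pos
  have hN := M.N_pos i
  have hk' := abs_le.1 (mem_bdry.1 hk)
  simp only at hk' ⊢
  have hne : ((i, (M.N i : ℤ)) : Fin 3 × ℤ) ≠ (i, -(M.N i : ℤ)) := by
    simp only [ne_eq, Prod.mk.injEq, true_and]; omega
  have hbound : ∀ n : ℕ, n ≤ M.N i → 112 * M.κ * n ≤ 112 * M.κ * M.N i := fun n hn => by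
    have : (n : ℝ) ≤ M.N i := by exact_mod_cast hn
    gcongr
  rcases le_total 0 t with h0 | h0
  · obtain ⟨r, hr⟩ := M.exists_vertex (M.fanA_mem i) (v := inn (i, (M.N i : ℤ))) (by simp)
    have h1 := M.dist_apex_le (M.fanA_mem i) hne ho (p := r) (by
      rw [hr]; exact single_mem_simplexOf (by simp))
    have h2 := M.dist_inner_le i (M.N i - t).toNat t hk'.1 (by omega) hp (p' := r) (by
      rw [hr, Int.toNat_of_nonneg (by omega)]; simp)
    have h3 := hbound (M.N i - t).toNat (by omega)
    linarith [dist_triangle p r o]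
  · obtain ⟨r, hr⟩ := M.exists_vertex (M.fanA_mem i) (v := inn (i, -(M.N i : ℤ))) (by simp)
    have h1 := M.dist_apex_le (M.fanA_mem i) hne ho (p := r) (by
      rw [hr]; exact single_mem_simplexOf (by simp))
    have h2 := M.dist_inner_le i (t + M.N i).toNat (-(M.N i : ℤ)) le_rfl (by omega) hr (p' := p) (by
      rw [hp, Int.toNat_of_nonneg (by omega)]; simp)
    have h3 := hbound (t + M.N i).toNat (by omega)
    rw [dist_comm] at h2
    linarith [dist_triangle p r o]

theorem dist_inner_of_mem_face {p : M.Surf} {t : Finset Vtx} (ht : t ∈ faces M.N)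
    (hp : M.complex.coords p ∈ simplexOf t) {E : ℝ} (hE : 112 * M.κ ≤ E)
    (hE' : ∀ a b, 100 * M.κ + 3 * dist (M.m a) (M.m b) ≤ E) {o : M.Surf}
    (ho : M.complex.coords o = Pi.single apex (1 : ℝ)) :
    dist p o ≤ 100 * M.κ + 3 * M.R ∨
      ∃ k ∈ bdry M.N, ∃ r, M.complex.coords r = Pi.single (inn k) (1 : ℝ) ∧ dist p r ≤ E := by
  have hκ := M.κ_pos
  have inner : ∀ a b c : Fin 3 × ℤ, {inn a, inn b, inn c} = t → a ≠ b → b ≠ c → a ≠ c →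
      a ∈ bdry M.N → ∃ k ∈ bdry M.N, ∃ r, M.complex.coords r = Pi.single (inn k) (1 : ℝ) ∧
        dist p r ≤ E := by
    rintro a b c rfl hab hbc hac ha
    obtain ⟨r, hr⟩ := M.exists_inner a ha
    refine ⟨a, ha, r, hr, ?_⟩
    rw [dist_comm]
    exact M.complex.dist_le_of_coords_eq_single ht (by simpa using hab) (by simpa using hbc)
      (by simpa using hac) hr hp (hE' _ _) (hE' _ _)
  rcases mem_faces.1 ht with ⟨i, rfl⟩ | ⟨i, rfl⟩ | ⟨i, n, hn, rfl⟩ | ⟨i, n, hn, rfl⟩ |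
    ⟨k, hk, rfl⟩ | ⟨k, hk, rfl⟩
  · have := M.N_pos i
    exact Or.inl (M.dist_apex_le ht (by simp only [ne_eq, Prod.mk.injEq, true_and]; omega) ho hp)
  · exact Or.inl (M.dist_apex_le ht (fun h => (by decide : ∀ i : Fin 3, i + 1 ≠ i) i
      (congrArg Prod.fst h)) ho hp)
  · refine Or.inr (inner _ _ _ rfl ?_ ?_ ?_ ?_)
    · simp only [ne_eq, Prod.mk.injEq, true_and]; omega
    · simp only [ne_eq, Prod.mk.injEq, true_and]; omega
    · simp only [ne_eq, Prod.mk.injEq, true_and]; omega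
    · rw [mem_bdry, abs_le]; constructor <;> simp only <;> omega
  · refine Or.inr (inner _ _ _ rfl ?_ ?_ ?_ ?_)
    · simp only [ne_eq, Prod.mk.injEq, true_and]; omega
    · simp only [ne_eq, Prod.mk.injEq, true_and]; omega
    · simp only [ne_eq, Prod.mk.injEq, true_and]; omega
    · rw [mem_bdry, abs_le]; constructor <;> simp only <;> omega
  · obtain ⟨r, hr⟩ := M.exists_inner k hk
    refine Or.inr ⟨k, hk, r, hr, ?_⟩
    have hdl := M.dl_le k hk
    have h4 := (sqrt_lt_aux (show 0 < 100 * M.κ by positivity) (M.dl_pos k hk)).2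
    rw [dist_comm]
    refine M.complex.dist_le_of_coords_eq_single ht (by simpa using (succ_ne (N := M.N) k).symm)
      (by simp) (by simp) hr hp ?_ ?_
    · rw [complex_len, M.len_inn_inn_succ hk]; linarith
    · rw [complex_len, M.len_inn_out_succ hk]; linarith
  · obtain ⟨r, hr⟩ := M.exists_inner k hk
    refine Or.inr ⟨k, hk, r, hr, ?_⟩
    have hdl := M.dl_le k hk
    have h4 := (sqrt_lt_aux (show 0 < 100 * M.κ by positivity) (M.dl_pos k hk)).2
    rw [dist_comm]
    have e : rim M.N k = {inn k, out k, out (succ M.N k)} := by rw [rim, Finset.insert_comm]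
    rw [e] at ht hp
    refine M.complex.dist_le_of_coords_eq_single ht (by simp)
      (by simpa using (succ_ne (N := M.N) k).symm) (by simp) hr hp ?_ ?_
    · rw [complex_len, M.len_inn_out_self]; linarith
    · rw [complex_len, M.len_inn_out_succ hk]; linarith

theorem diam_le {Δ : ℝ} (hκ : M.κ ≤ Δ) (hN : ∀ i, M.κ * M.N i ≤ Δ)
    (hm : ∀ a b, dist (M.m a) (M.m b) ≤ Δ) (hR : M.R ≤ 30 * Δ) :
    Metric.diam (univ : Set M.Surf) ≤ 1000 * Δ := by
  have hκ0 := M.κ_pos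
  obtain ⟨o, ho⟩ := M.exists_apex
  -- At most `115 * Δ` to an inner vertex, `112 * Δ` along a ladder, and `100 * Δ + 90 * Δ` to the
  -- apex.
  have key : ∀ p : M.Surf, dist p o ≤ 500 * Δ := by
    intro p
    obtain ⟨t, ht, hp⟩ := M.complex.exists_face p
    rcases M.dist_inner_of_mem_face ht hp (E := 115 * Δ) (by linarith)
      (fun a b => by linarith [hm a b]) ho with h | ⟨k, hk, r, hr, h⟩
    · linarith
    · have h1 := M.dist_inner_apex_le hk hr ho
      have h2 := hN k.1
      linarith [dist_triangle p r o]
  refine Metric.diam_le_of_forall_dist_le (by linarith) fun p _ p' _ => ?_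
  linarith [dist_triangle_right p p' o, key p, key p']

/-! ### Area -/

/-- In each face two convenient sides are multiplied: the long fan edges, a short ladder edge of
`103 * κ` with a rung, or two collar edges with product at most `12000 * κ ^ 2`. The prefactor `4`
comes from `hausdorffMeasure_triangle_le`. -/
theorem hausdorffTwo_le :
    hausdorffTwo M.Surf ≤ ENNReal.ofReal (4 * (6 * (100 * M.κ + 3 * M.R) ^ 2 +
      2 * (∑ i, ∑ t ∈ Finset.range (M.N i),
        103 * M.κ * (103 * M.κ + 3 * dist (M.m (i, (t : ℤ))) (M.m (i, -(t : ℤ))))) +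
      24000 * M.κ ^ 2 * ∑ i, (2 * M.N i + 1))) := by
  have hκ := M.κ_pos
  let B := Finset.univ.sigma fun i => Finset.range (M.N i)
  let B' := Finset.univ.sigma fun i => Finset.Ico 1 (M.N i)
  let C := (bdry M.N).toFinset
  let W : (Σ _ : Fin 3, ℕ) → ℝ := fun a =>
    103 * M.κ * (103 * M.κ + 3 * dist (M.m (a.1, (a.2 : ℤ))) (M.m (a.1, -(a.2 : ℤ))))
  let F : Fin 3 ⊕ Fin 3 ⊕ (Σ _ : Fin 3, ℕ) ⊕ (Σ _ : Fin 3, ℕ) ⊕ (Fin 3 × ℤ) ⊕ (Fin 3 × ℤ) → Finset Vtx :=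
    Sum.elim (fanA M.N) (Sum.elim (fanB M.N) (Sum.elim (fun a => armA a.1 a.2)
      (Sum.elim (fun a => armB a.1 a.2) (Sum.elim (col M.N) (rim M.N)))))
  let A : Fin 3 ⊕ Fin 3 ⊕ (Σ _ : Fin 3, ℕ) ⊕ (Σ _ : Fin 3, ℕ) ⊕ (Fin 3 × ℤ) ⊕ (Fin 3 × ℤ) → ℝ :=
    Sum.elim (fun _ => (100 * M.κ + 3 * M.R) ^ 2) (Sum.elim (fun _ => (100 * M.κ + 3 * M.R) ^ 2)
      (Sum.elim W (Sum.elim W (Sum.elim (fun _ => 12000 * M.κ ^ 2) (fun _ => 12000 * M.κ ^ 2)))))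
  let I := (Finset.univ : Finset (Fin 3)).disjSum ((Finset.univ : Finset (Fin 3)).disjSum
    (B.disjSum (B'.disjSum (C.disjSum C))))
  have hW : ∀ a, 0 ≤ W a := fun a => by positivity
  have hlen := M.complex.hausdorffTwo_le_of_image I F A ?_ ?_ ?_
  · refine hlen.trans (ENNReal.ofReal_le_ofReal (mul_le_mul_of_nonneg_left ?_ (by norm_num)))
    have hC : (C.card : ℝ) ≤ ∑ i, (2 * M.N i + 1 : ℝ) := by
      have : C.card ≤ 2 * M.N 0 + 1 + (2 * M.N 1 + 1) + (2 * M.N 2 + 1) := by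
        refine (List.toFinset_card_le _).trans (le_of_eq ?_)
        simp [bdry, add_assoc]
      rw [Fin.sum_univ_three]
      exact_mod_cast this
    have hB : ∑ a ∈ B, W a = ∑ i, ∑ t ∈ Finset.range (M.N i),
        103 * M.κ * (103 * M.κ + 3 * dist (M.m (i, (t : ℤ))) (M.m (i, -(t : ℤ)))) :=
      Finset.sum_sigma _ _ _
    have hB' : ∑ a ∈ B', W a ≤ ∑ a ∈ B, W a :=
      Finset.sum_le_sum_of_subset_of_nonneg (by
        intro a ha
        simp only [B, B', Finset.mem_sigma, Finset.mem_Ico, Finset.mem_range] at ha ⊢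
        exact ⟨ha.1, ha.2.2⟩) fun a _ _ => hW a
    have hCκ : 12000 * M.κ ^ 2 * C.card ≤ 12000 * M.κ ^ 2 * ∑ i, (2 * M.N i + 1 : ℝ) := by gcongr
    simp only [I, A, Finset.sum_disjSum, Sum.elim_inl, Sum.elim_inr, Finset.sum_const,
      Finset.card_univ, Fintype.card_fin, nsmul_eq_mul]
    rw [← hB]
    push_cast at hCκ ⊢
    linarith
  · intro t ht
    rcases mem_faces.1 ht with ⟨i, rfl⟩ | ⟨i, rfl⟩ | ⟨i, n, hn, rfl⟩ | ⟨i, n, hn, rfl⟩ |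
      ⟨k, hk, rfl⟩ | ⟨k, hk, rfl⟩
    · exact ⟨.inl i, by simp [I], rfl⟩
    · exact ⟨.inr (.inl i), by simp [I], rfl⟩
    · exact ⟨.inr (.inr (.inl ⟨i, n⟩)), by simp [I, B, hn], rfl⟩
    · exact ⟨.inr (.inr (.inr (.inl ⟨i, n⟩))), by simp [I, B', hn], rfl⟩
    · exact ⟨.inr (.inr (.inr (.inr (.inl k)))), by simp [I, C, hk], rfl⟩
    · exact ⟨.inr (.inr (.inr (.inr (.inr k)))), by simp [I, C, hk], rfl⟩
  · rintro (i | i | a | a | k | k) - <;> simp only [A, Sum.elim_inl, Sum.elim_inr]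
    · positivity
    · positivity
    · exact hW a
    · exact hW a
    · positivity
    · positivity
  · rintro (i | i | ⟨i, n⟩ | ⟨i, n⟩ | k | k) hI
    · have := M.N_pos i
      refine ⟨_, _, _, rfl, by simp, ?_, by simp, ?_⟩
      · simp only [ne_eq, inn.injEq, Prod.mk.injEq, true_and]; omega
      · simp only [complex_len, len, A, Sum.elim_inl]
        rw [sq]
    · refine ⟨_, _, _, rfl, by simp, ?_, by simp, ?_⟩
      · exact fun h => (by decide : ∀ i : Fin 3, i + 1 ≠ i) i (congrArg Prod.fst (inn.inj h))
      · simp only [complex_len, len, A, Sum.elim_inl, Sum.elim_inr]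
        rw [sq]
    · have hn : n < M.N i := by simpa [I, B] using hI
      refine ⟨inn (i, -(n : ℤ)), inn (i, -(n + 1 : ℤ)), inn (i, (n + 1 : ℤ)), ?_, ?_, ?_, ?_, ?_⟩
      · simp only [F, Sum.elim_inl, Sum.elim_inr, armA]
        rw [Finset.pair_comm, Finset.insert_comm]
      · simp only [ne_eq, inn.injEq, Prod.mk.injEq, true_and]; omega
      · simp only [ne_eq, inn.injEq, Prod.mk.injEq, true_and]; omega
      · simp only [ne_eq, inn.injEq, Prod.mk.injEq, true_and]; omega
      · have d1 := M.dist_armA hn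
        have d2 := M.dist_armB hn
        have d3 := dist_triangle (M.m (i, -(n : ℤ))) (M.m (i, (n : ℤ))) (M.m (i, (n + 1 : ℤ)))
        rw [dist_comm] at d1
        rw [dist_comm (M.m (i, -(n : ℤ))) (M.m (i, (n : ℤ))), d2] at d3
        simp only [complex_len, len, A, W, Sum.elim_inl, Sum.elim_inr, d1]
        have h0 : 0 ≤ dist (M.m (i, -(n : ℤ))) (M.m (i, (n + 1 : ℤ))) := dist_nonneg
        gcongr ?_ * ?_
        · linarith
        · linarith
    · have hn : 1 ≤ n ∧ n < M.N i := by simpa [I, B'] using hI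
      refine ⟨inn (i, (n : ℤ)), inn (i, (n + 1 : ℤ)), inn (i, -(n : ℤ)), ?_, ?_, ?_, ?_, ?_⟩
      · simp only [F, Sum.elim_inl, Sum.elim_inr, armB]
        rw [Finset.insert_comm, Finset.pair_comm, Finset.insert_comm]
      · simp only [ne_eq, inn.injEq, Prod.mk.injEq, true_and]; omega
      · simp only [ne_eq, inn.injEq, Prod.mk.injEq, true_and]; omega
      · simp only [ne_eq, inn.injEq, Prod.mk.injEq, true_and]; omega
      · have d2 := M.dist_armB hn.2
        simp only [complex_len, len, A, W, Sum.elim_inl, Sum.elim_inr, d2]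
        gcongr ?_ * ?_
        · linarith
        · linarith
    · have hk : k ∈ bdry M.N := by simpa [I, C] using hI
      refine ⟨inn (succ M.N k), inn k, out (succ M.N k), ?_,
        by simpa using succ_ne (N := M.N) k, by simp, by simp, ?_⟩
      · simp only [F, Sum.elim_inl, Sum.elim_inr, col]
        rw [Finset.insert_comm]
      · have hdl := M.dl_le k hk
        rw [complex_len, M.len_comm, M.len_inn_inn_succ hk, M.len_inn_out_self]
        simp only [A, Sum.elim_inl, Sum.elim_inr]
        nlinarith
    · have hk : k ∈ bdry M.N := by simpa [I, C] using hI
      refine ⟨out k, inn k, out (succ M.N k), rfl, by simp, by simp,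
        by simpa using (succ_ne (N := M.N) k).symm, ?_⟩
      have hdl := M.dl_le k hk
      rw [complex_len, M.len_comm, M.len_inn_out_self, M.len_out_out_succ hk]
      simp only [A, Sum.elim_inr]
      nlinarith

end Mesh

/-! ### Meshes on the boundary of a triangular disk -/

/-- Numbers `N i` of steps of length `κ` taken from the corner `i` in both directions such that
a gap of length at most `4 κ` remains on each side. -/
structure IsSubdivision (l : Fin 3 → ℝ) (κ : ℝ) (N : Fin 3 → ℕ) : Prop where
  κ_pos : 0 < κ
  N_pos : ∀ i, 1 ≤ N i
  lt : ∀ i, ((N i : ℝ) + N (i + 1)) * κ < l i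
  le : ∀ i, l i ≤ ((N i : ℝ) + N (i + 1)) * κ + 4 * κ

namespace IsSubdivision

open Vtx

/-- The side that contains the boundary edge which starts at the index `k`. -/
def side (k : Fin 3 × ℤ) : Fin 3 := if 0 ≤ k.2 then k.1 else k.1 + 2

/-- The position of the index `k` on its side. -/
def pos (l : Fin 3 → ℝ) (κ : ℝ) (k : Fin 3 × ℤ) : ℝ :=
  if 0 ≤ k.2 then k.2 * κ else l (k.1 + 2) + k.2 * κ

/-- The length of the boundary edge which starts at the index `k`. -/
def gap (l : Fin 3 → ℝ) (κ : ℝ) (N : Fin 3 → ℕ) (k : Fin 3 × ℤ) : ℝ :=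
  if k.2 < N k.1 then κ else l k.1 - ((N k.1 : ℝ) + N (k.1 + 1)) * κ

variable {l : Fin 3 → ℝ} {κ : ℝ} {N : Fin 3 → ℕ}

theorem gap_pos (h : IsSubdivision l κ N) (k : Fin 3 × ℤ) : 0 < gap l κ N k := by
  unfold gap
  split_ifs
  · exact h.κ_pos
  · linarith [h.lt k.1]

theorem gap_le (h : IsSubdivision l κ N) (k : Fin 3 × ℤ) : gap l κ N k ≤ 4 * κ := by
  unfold gap
  have := h.κ_pos
  split_ifs
  · linarith
  · linarith [h.le k.1]

theorem lt_prev (h : IsSubdivision l κ N) (i : Fin 3) :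
    ((N (i + 2) : ℝ) + N i) * κ < l (i + 2) := by
  have := h.lt (i + 2)
  rwa [(by decide : ∀ i : Fin 3, i + 2 + 1 = i) i] at this

theorem pos_nonneg (h : IsSubdivision l κ N) {k : Fin 3 × ℤ} (hk : k ∈ bdry N) :
    0 ≤ pos l κ k := by
  have hκ := h.κ_pos
  have hk' := abs_le.1 (mem_bdry.1 hk)
  unfold pos
  split_ifs with h0
  · have : (0 : ℝ) ≤ k.2 := by exact_mod_cast h0
    positivity
  · have h1 : -(N k.1 : ℝ) ≤ k.2 := by exact_mod_cast hk'.1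
    have h2 := h.lt_prev k.1
    have h3 : (0 : ℝ) ≤ N (k.1 + 2) * κ := by positivity
    nlinarith

theorem pos_add_gap_le (h : IsSubdivision l κ N) {k : Fin 3 × ℤ} (hk : k ∈ bdry N) :
    pos l κ k + gap l κ N k ≤ l (side k) := by
  have hκ := h.κ_pos
  have hk' := abs_le.1 (mem_bdry.1 hk)
  have hN := h.N_pos k.1
  have h4 : (0 : ℝ) ≤ N (k.1 + 1) * κ := by positivity
  unfold pos gap side
  have h5 := h.lt k.1
  split_ifs with h0 h1 h1
  · have h1 : (k.2 : ℝ) + 1 ≤ N k.1 := by exact_mod_cast h1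
    nlinarith
  · have h1 : (k.2 : ℝ) = N k.1 := by exact_mod_cast le_antisymm hk'.2 (not_lt.1 h1)
    rw [h1]; linarith
  · have h1 : (k.2 : ℝ) + 1 ≤ 0 := by exact_mod_cast (by omega : k.2 + 1 ≤ 0)
    nlinarith
  · omega

theorem add_mem (h : IsSubdivision l κ N) {k : Fin 3 × ℤ} (hk : k ∈ bdry N) {s : ℝ}
    (hs : s ∈ Icc 0 (gap l κ N k)) : pos l κ k + s ∈ Icc 0 (l (side k)) :=
  ⟨add_nonneg (h.pos_nonneg hk) hs.1, by linarith [h.pos_add_gap_le hk, hs.2]⟩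

variable {T : Type*} [MetricSpace T] {γ : Fin 3 → ℝ → T}

/-- The step leaving `t = -1` ends at the corner, where the parametrization passes to the next side;
the step leaving `t = N i` crosses the gap. All other steps move by `κ` on one side. -/
theorem bd_gap (h : IsSubdivision l κ N) (hT : TriangleParam T l γ) {k : Fin 3 × ℤ}
    (hk : k ∈ bdry N) :
    γ (side k) (pos l κ k + gap l κ N k) = γ (side (succ N k)) (pos l κ (succ N k)) := by
  obtain ⟨i, t⟩ := k
  have hk' := abs_le.1 (mem_bdry.1 hk)
  have hN := h.N_pos i
  have hN' := h.N_pos (i + 1)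
  by_cases h1 : t < N i
  · by_cases h0 : 0 ≤ t
    · simp only [side, pos, gap, succ, if_pos h1, if_pos h0, if_pos (show 0 ≤ t + 1 by omega)]
      push_cast
      ring_nf
    by_cases h2 : t = -1
    · subst h2
      have := hT.glue' i
      simpa [side, pos, gap, succ, h1] using this
    · simp only [side, pos, gap, succ, if_pos h1, if_neg h0, if_neg (show ¬ 0 ≤ t + 1 by omega)]
      push_cast
      ring_nf
  · have ht : t = N i := le_antisymm hk'.2 (not_lt.1 h1)
    subst ht
    have e : i + 1 + 2 = i := (by decide : ∀ i : Fin 3, i + 1 + 2 = i) i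
    have h2 : ¬ (0 : ℤ) ≤ -(N (i + 1) : ℤ) := by omega
    simp only [side, pos, gap, succ, lt_irrefl, if_false, if_neg h2, e,
      if_pos (show (0 : ℤ) ≤ N i by omega)]
    push_cast
    ring_nf

theorem dist_gap (h : IsSubdivision l κ N) (hT : TriangleParam T l γ) {k : Fin 3 × ℤ}
    (hk : k ∈ bdry N) {s t : ℝ} (hs : s ∈ Icc 0 (gap l κ N k)) (ht : t ∈ Icc 0 (gap l κ N k)) :
    dist (γ (side k) (pos l κ k + s)) (γ (side k) (pos l κ k + t)) = |s - t| := by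
  rw [hT.dist_eq _ _ (h.add_mem hk hs) _ (h.add_mem hk ht), add_sub_add_left_eq_sub]

/-- The distance of the two mesh points at `t` steps from the corner `i`. -/
def width (l : Fin 3 → ℝ) (κ : ℝ) (γ : Fin 3 → ℝ → T) (i : Fin 3) (t : ℕ) : ℝ :=
  dist (γ i (t * κ)) (γ (i + 2) (l (i + 2) - t * κ))

theorem dist_eq_width (hT : TriangleParam T l γ) (i : Fin 3) (t : ℕ) :
    dist (γ (side (i, (t : ℤ))) (pos l κ (i, (t : ℤ))))
      (γ (side (i, -(t : ℤ))) (pos l κ (i, -(t : ℤ)))) = width l κ γ i t := by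
  rcases t.eq_zero_or_pos with rfl | ht
  · simp [side, pos, width, hT.glue' i]
  · have h1 : ¬ (0 : ℤ) ≤ -(t : ℤ) := by omega
    simp only [side, pos, width, if_neg h1, if_pos (Int.natCast_nonneg t)]
    push_cast
    ring_nf

/-- Walking round the hexagon from a fixed vertex meets each of the three chords at most once,
together with gaps of length at most `4 * κ`. -/
theorem dist_hexagon_le (h : IsSubdivision l κ N) (hT : TriangleParam T l γ) (a : Fin 3 × ℤ)
    (ha : |a.2| = (N a.1 : ℤ)) :
    dist (γ (side a) (pos l κ a)) (γ (side (0, -(N 0 : ℤ))) (pos l κ (0, -(N 0 : ℤ)))) ≤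
      ∑ i, width l κ γ i (N i) + 12 * κ := by
  have hκ := h.κ_pos
  let m : Fin 3 × ℤ → T := fun k => γ (side k) (pos l κ k)
  have h1 : ∀ i : Fin 3, dist (m (i, (N i : ℤ))) (m (i, -(N i : ℤ))) = width l κ γ i (N i) :=
    fun i => dist_eq_width hT i _
  have h2 : ∀ i : Fin 3, dist (m (i, (N i : ℤ))) (m (i + 1, -(N (i + 1) : ℤ))) ≤ 4 * κ := by
    intro i
    have hk : (i, (N i : ℤ)) ∈ bdry N := mem_bdry.2 (by simp)
    have hg := h.gap_pos (i, (N i : ℤ))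
    have h3 := h.dist_gap hT hk (s := 0) (t := gap l κ N (i, (N i : ℤ))) ⟨le_rfl, hg.le⟩
      ⟨hg.le, le_rfl⟩
    rw [h.bd_gap hT hk, add_zero, zero_sub, abs_neg, abs_of_pos hg] at h3
    simp only [succ, lt_irrefl, if_false] at h3
    exact h3.le.trans (h.gap_le _)
  have h3 : ∀ i : Fin 3, 0 ≤ width l κ γ i (N i) := fun i => dist_nonneg
  rw [Fin.sum_univ_three]
  have a0 := h1 0
  have a1 := h1 1
  have a2 := h1 2
  have b0 := h2 0
  have b1 := h2 1
  have n0 := h3 0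
  have n1 := h3 1
  have n2 := h3 2
  rw [show (0 : Fin 3) + 1 = 1 from rfl] at b0
  rw [show (1 : Fin 3) + 1 = 2 from rfl] at b1
  have c0 := dist_triangle_left (m (1, -(N 1 : ℤ))) (m (0, -(N 0 : ℤ))) (m (0, (N 0 : ℤ)))
  have c1 := dist_triangle (m (1, (N 1 : ℤ))) (m (1, -(N 1 : ℤ))) (m (0, -(N 0 : ℤ)))
  have c2 := dist_triangle_left (m (2, -(N 2 : ℤ))) (m (0, -(N 0 : ℤ))) (m (1, (N 1 : ℤ)))
  have c3 := dist_triangle (m (2, (N 2 : ℤ))) (m (2, -(N 2 : ℤ))) (m (0, -(N 0 : ℤ)))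
  have c4 := dist_self (m (0, -(N 0 : ℤ)))
  obtain ⟨i, t⟩ := a
  change dist (m (i, t)) (m (0, -(N 0 : ℤ))) ≤ _
  rcases eq_or_eq_neg_of_abs_eq ha with hx | hx <;> dsimp only at hx <;> subst hx <;>
    fin_cases i <;> dsimp only [Fin.zero_eta, Fin.mk_one, Fin.reduceFinMk] <;> linarith

/-- The boundary mesh given by a subdivision. -/
@[simps κ m bd dl R]
def mesh (h : IsSubdivision l κ N) (hT : TriangleParam T l γ) : Mesh T where
  N := N
  N_pos := h.N_pos
  κ := κ
  κ_pos := h.κ_pos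
  m k := γ (side k) (pos l κ k)
  bd k s := γ (side k) (pos l κ k + s)
  dl := gap l κ N
  dl_pos k _ := h.gap_pos k
  dl_le k _ := h.gap_le k
  dl_eq k _ hk := if_pos hk
  bd_zero k _ := by simp
  bd_dl k hk := h.bd_gap hT hk
  bd_dist k hk _ hs _ ht := h.dist_gap hT hk hs ht
  -- Two hexagon vertices are compared through the reference vertex of `dist_hexagon_le`, hence the
  -- factor `2`.
  R := 2 * (∑ i, width l κ γ i (N i) + 12 * κ)
  R_nonneg := by
    have hκ := h.κ_pos
    have h3 : 0 ≤ ∑ i, width l κ γ i (N i) := Finset.sum_nonneg fun _ _ => dist_nonneg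
    positivity
  dist_le_R a b ha hb := by
    have h1 := h.dist_hexagon_le hT a ha
    have h2 := h.dist_hexagon_le hT b hb
    refine (dist_triangle_right _ _ _).trans ((add_le_add h1 h2).trans ?_)
    linarith

@[simp]
theorem mesh_N (h : IsSubdivision l κ N) (hT : TriangleParam T l γ) : (h.mesh hT).N = N := rfl

end IsSubdivision

/-- Paths of speed at most one that are defined on consecutive intervals can be concatenated. -/
theorem exists_concat {S : Type*} [PseudoMetricSpace S] (b : ℕ → ℝ) (c : ℕ → ℝ → S) (n : ℕ)
    (hb : ∀ u ≤ n, b u ≤ b (u + 1))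
    (hc : ∀ u ≤ n, ∀ s ∈ Icc (b u) (b (u + 1)), ∀ t ∈ Icc (b u) (b (u + 1)),
      dist (c u s) (c u t) ≤ |s - t|)
    (hm : ∀ u < n, c u (b (u + 1)) = c (u + 1) (b (u + 1))) :
    b 0 ≤ b (n + 1) ∧ ∃ β : ℝ → S, (∀ u ≤ n, ∀ s ∈ Icc (b u) (b (u + 1)), β s = c u s) ∧
      ∀ s ∈ Icc (b 0) (b (n + 1)), ∀ t ∈ Icc (b 0) (b (n + 1)), dist (β s) (β t) ≤ |s - t| := by
  induction n with
  | zero =>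
    refine ⟨hb 0 le_rfl, c 0, fun u hu s _ => ?_, hc 0 le_rfl⟩
    rw [Nat.le_zero.1 hu]
  | succ n ih =>
    obtain ⟨hle, β, h1, h2⟩ := ih (fun u hu => hb u (hu.trans n.le_succ))
      (fun u hu => hc u (hu.trans n.le_succ)) (fun u hu => hm u (hu.trans n.lt_succ_self))
    have hbn := hb (n + 1) le_rfl
    have hcn := hc (n + 1) le_rfl
    have hmono : ∀ u, u ≤ n + 1 → b u ≤ b (n + 1) := fun u hu => by
      refine Nat.decreasingInduction' (P := fun k => b k ≤ b (n + 1)) (fun k hk _ ih => ?_) hu le_rfl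
      exact (hb k (by omega)).trans ih
    have hjoin : β (b (n + 1)) = c (n + 1) (b (n + 1)) := by
      rw [h1 n le_rfl _ ⟨hmono n n.le_succ, le_rfl⟩, hm n n.lt_succ_self]
    let β' : ℝ → S := fun s => if s ≤ b (n + 1) then β s else c (n + 1) s
    have e1 : ∀ s ≤ b (n + 1), β' s = β s := fun s hs => if_pos hs
    have e2 : ∀ s, b (n + 1) ≤ s → β' s = c (n + 1) s := fun s hs => by
      rcases hs.eq_or_lt with rfl | hs
      · rw [e1 _ le_rfl, hjoin]
      · exact if_neg hs.not_ge
    refine ⟨hle.trans hbn, β', fun u hu s hs => ?_, ?_⟩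
    · rcases hu.eq_or_lt with rfl | hu
      · exact e2 s hs.1
      · rw [e1 s (hs.2.trans (hmono _ hu)), h1 u (Nat.lt_succ_iff.1 hu) s hs]
    · have key : ∀ s ∈ Icc (b 0) (b (n + 1 + 1)), ∀ t ∈ Icc (b 0) (b (n + 1 + 1)), s ≤ t →
          dist (β' s) (β' t) ≤ |s - t| := by
        intro s hs t ht hst
        rcases le_total t (b (n + 1)) with h | h
        · rw [e1 s (hst.trans h), e1 t h]
          exact h2 s ⟨hs.1, hst.trans h⟩ t ⟨ht.1, h⟩
        rcases le_total (b (n + 1)) s with h' | h'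
        · rw [e2 s h', e2 t h]
          exact hcn s ⟨h', hs.2⟩ t ⟨h, ht.2⟩
        · have d1 := h2 s ⟨hs.1, h'⟩ _ ⟨hle, le_rfl⟩
          have d2 := hcn _ ⟨le_rfl, hbn⟩ t ⟨h, ht.2⟩
          rw [← e1 s h', ← e1 _ le_rfl] at d1
          rw [← e2 t h, ← e2 _ le_rfl] at d2
          refine (dist_triangle _ _ _).trans ((add_le_add d1 d2).trans (le_of_eq ?_))
          rw [abs_of_nonpos (sub_nonpos.2 h'), abs_of_nonpos (sub_nonpos.2 h),
            abs_of_nonpos (sub_nonpos.2 hst)]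
          ring
      intro s hs t ht
      rcases le_total s t with h | h
      · exact key s hs t ht h
      · rw [dist_comm, abs_sub_comm]
        exact key t ht s hs h

/-! ### The boundary of the surface parametrized by the three sides -/

namespace IsSubdivision

open Vtx

/-- The `u`-th boundary index on the side `j`. -/
def sideIdx (N : Fin 3 → ℕ) (j : Fin 3) (u : ℕ) : Fin 3 × ℤ :=
  if u ≤ N j then (j, (u : ℤ)) else (j + 1, (u : ℤ) - (N j + 1 + N (j + 1)))

/-- The position of the `u`-th boundary index on the side `j`. -/
def bp (l : Fin 3 → ℝ) (κ : ℝ) (N : Fin 3 → ℕ) (j : Fin 3) (u : ℕ) : ℝ :=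
  if u ≤ N j then u * κ else l j + (u - (N j + 1 + N (j + 1))) * κ

variable {l : Fin 3 → ℝ} {κ : ℝ} {N : Fin 3 → ℕ} {j : Fin 3} {u : ℕ}

theorem sideIdx_mem (hu : u ≤ N j + N (j + 1)) : sideIdx N j u ∈ bdry N := by
  rw [mem_bdry]
  unfold sideIdx
  split_ifs with h <;> dsimp only <;> rw [abs_le] <;> omega

theorem side_sideIdx (hu : u ≤ N j + N (j + 1)) : side (sideIdx N j u) = j := by
  unfold sideIdx side
  split_ifs with h h' h'
  · rfl
  · omega
  · dsimp only at h'; omega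
  · exact (by decide : ∀ i : Fin 3, i + 1 + 2 = i) j

theorem pos_sideIdx (hu : u ≤ N j + N (j + 1)) : pos l κ (sideIdx N j u) = bp l κ N j u := by
  unfold sideIdx pos bp
  split_ifs with h h' h'
  · simp
  · omega
  · dsimp only at h'; omega
  · dsimp only
    rw [(by decide : ∀ i : Fin 3, i + 1 + 2 = i) j]
    push_cast
    ring

theorem succ_sideIdx (hu : u ≤ N j + N (j + 1)) :
    succ N (sideIdx N j u) = sideIdx N j (u + 1) := by
  rcases lt_trichotomy u (N j) with h | rfl | h
  · have h' : (u : ℤ) < N j := by exact_mod_cast h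
    simp only [sideIdx, if_pos h.le, if_pos (Nat.succ_le_of_lt h), succ, if_pos h']
    push_cast
    rfl
  · simp [sideIdx, succ]
  · have h' : (u : ℤ) - (N j + 1 + N (j + 1)) < N (j + 1) := by omega
    simp only [sideIdx, if_neg h.not_ge, if_neg (show ¬ u + 1 ≤ N j by omega), succ, if_pos h',
      Prod.mk.injEq, true_and]
    push_cast
    ring

theorem bp_succ (hu : u ≤ N j + N (j + 1)) :
    bp l κ N j (u + 1) = bp l κ N j u + gap l κ N (sideIdx N j u) := by
  unfold sideIdx bp gap
  split_ifs with h1 h2 h3 h3 h2 h3 h3 <;> dsimp only at * <;> try omega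
  · push_cast; ring
  · have : u = N j := by omega
    subst this
    push_cast; ring
  · push_cast; ring

theorem bp_zero : bp l κ N j 0 = 0 := by simp [bp]

theorem bp_last : bp l κ N j (N j + N (j + 1) + 1) = l j := by
  unfold bp
  rw [if_neg (by omega)]
  push_cast
  ring

theorem sideIdx_zero : sideIdx N j 0 = (j, 0) := by simp [sideIdx]

theorem sideIdx_last : sideIdx N j (N j + N (j + 1) + 1) = (j + 1, 0) := by
  unfold sideIdx
  rw [if_neg (by omega)]
  simp only [Prod.mk.injEq, true_and]
  push_cast
  ring

theorem exists_sideIdx {k : Fin 3 × ℤ} (hk : k ∈ bdry N) :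
    ∃ j u, u ≤ N j + N (j + 1) ∧ sideIdx N j u = k := by
  obtain ⟨i, t⟩ := k
  have hk' := abs_le.1 (mem_bdry.1 hk)
  dsimp only at hk'
  by_cases h : 0 ≤ t
  · lift t to ℕ using h
    exact ⟨i, t, by omega, if_pos (by omega)⟩
  · have e : i + 2 + 1 = i := (by decide : ∀ i : Fin 3, i + 2 + 1 = i) i
    refine ⟨i + 2, (t + (N (i + 2) + 1 + N i)).toNat, by rw [e]; omega, ?_⟩
    unfold sideIdx
    rw [if_neg (by omega), e]
    simp only [Prod.mk.injEq, true_and]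
    omega

variable {T : Type*} [MetricSpace T] {γ : Fin 3 → ℝ → T}

theorem exists_mem_piece (j : Fin 3) {s : ℝ} (hs : s ∈ Icc 0 (l j)) :
    ∃ u ≤ N j + N (j + 1), s ∈ Icc (bp l κ N j u) (bp l κ N j (u + 1)) := by
  have key : ∀ n, s ≤ bp l κ N j (n + 1) →
      ∃ u ≤ n, s ∈ Icc (bp l κ N j u) (bp l κ N j (u + 1)) := by
    intro n
    induction n with
    | zero => exact fun hn => ⟨0, le_rfl, by rw [bp_zero]; exact hs.1, hn⟩
    | succ n ih =>
      intro hn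
      rcases le_total s (bp l κ N j (n + 1)) with h' | h'
      · obtain ⟨u, hu, hus⟩ := ih h'
        exact ⟨u, hu.trans n.le_succ, hus⟩
      · exact ⟨n + 1, le_rfl, h', hn⟩
  exact key _ (by rw [bp_last]; exact hs.2)

theorem exists_param (h : IsSubdivision l κ N) (hT : TriangleParam T l γ) (j : Fin 3) :
    ∃ β : ℝ → (h.mesh hT).Surf,
      (∀ u ≤ N j + N (j + 1), ∀ s ∈ Icc (bp l κ N j u) (bp l κ N j (u + 1)),
        β s = (h.mesh hT).rimPoint (sideIdx N j u) (s - bp l κ N j u)) ∧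
      ∀ s ∈ Icc 0 (l j), ∀ t ∈ Icc 0 (l j), dist (β s) (β t) ≤ |s - t| := by
  have hmem : ∀ u ≤ N j + N (j + 1), ∀ s ∈ Icc (bp l κ N j u) (bp l κ N j (u + 1)),
      s - bp l κ N j u ∈ Icc 0 ((h.mesh hT).dl (sideIdx N j u)) := fun u hu s hs =>
    ⟨sub_nonneg.2 hs.1, by rw [sub_le_iff_le_add', h.mesh_dl, ← bp_succ hu]; exact hs.2⟩
  obtain ⟨-, β, h1, h2⟩ := exists_concat (bp l κ N j)
    (fun u s => (h.mesh hT).rimPoint (sideIdx N j u) (s - bp l κ N j u)) (N j + N (j + 1))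
    (fun u hu => by rw [bp_succ hu]; linarith [h.gap_pos (sideIdx N j u)])
    (fun u hu s hs t ht => by
      have := (h.mesh hT).dist_rimPoint_le (sideIdx_mem hu) (hmem u hu s hs) (hmem u hu t ht)
      rwa [sub_sub_sub_cancel_right] at this)
    (fun u hu => by
      have := (h.mesh hT).rimPoint_dl (sideIdx_mem hu.le)
      rw [mesh_N, succ_sideIdx hu.le, h.mesh_dl] at this
      simp only [sub_self]
      rw [← this, bp_succ hu.le, add_sub_cancel_left])
  rw [bp_zero, bp_last] at h2
  exact ⟨β, h1, h2⟩

/-- The surface of a subdivision is a triangular disk with the same side lengths, and its boundary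
distances dominate those of the given disk. -/
theorem exists_triangleParam (h : IsSubdivision l κ N) (hT : TriangleParam T l γ) :
    ∃ β, TriangleParam (h.mesh hT).Surf l β ∧
      ∀ j, ∀ s ∈ Icc 0 (l j), ∀ k, ∀ t ∈ Icc 0 (l k),
        dist (γ j s) (γ k t) ≤ dist (β j s) (β k t) := by
  choose β h1 h2 using h.exists_param hT
  have hmem : ∀ j, ∀ u ≤ N j + N (j + 1), ∀ s ∈ Icc (bp l κ N j u) (bp l κ N j (u + 1)),
      s - bp l κ N j u ∈ Icc 0 ((h.mesh hT).dl (sideIdx N j u)) := fun j u hu s hs =>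
    ⟨sub_nonneg.2 hs.1, by rw [sub_le_iff_le_add', h.mesh_dl, ← bp_succ hu]; exact hs.2⟩
  have hbd : ∀ j, ∀ s ∈ Icc 0 (l j), ∃ k ∈ bdry N, ∃ s' ∈ Icc 0 ((h.mesh hT).dl k),
      γ j s = (h.mesh hT).bd k s' ∧ β j s = (h.mesh hT).rimPoint k s' := by
    intro j s hs
    obtain ⟨u, hu, hus⟩ := exists_mem_piece (κ := κ) (N := N) j hs
    refine ⟨_, sideIdx_mem hu, _, hmem j u hu s hus, ?_, h1 j u hu s hus⟩
    rw [mesh_bd, side_sideIdx hu, pos_sideIdx hu, add_sub_cancel]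
  have hle : ∀ j, ∀ s ∈ Icc 0 (l j), ∀ k, ∀ t ∈ Icc 0 (l k),
      dist (γ j s) (γ k t) ≤ dist (β j s) (β k t) := by
    intro j s hs k t ht
    obtain ⟨a, ha, s', hs', e1, e2⟩ := hbd j s hs
    obtain ⟨b, hb, t', ht', e3, e4⟩ := hbd k t ht
    rw [e1, e2, e3, e4]
    exact (h.mesh hT).dist_bd_le ha hb hs' ht'
  -- Each side is a geodesic: the concatenated rim edges have speed at most one, and domination by
  -- the geodesic of `T` gives the reverse inequality. Disjointness of the open sides is inherited
  -- from `T` in the same way.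
  refine ⟨β, ⟨?_, hT.pos, fun j s hs t ht => (h2 j s hs t ht).antisymm ?_, fun j => ?_, ?_⟩, hle⟩
  · have hd := (h.mesh hT).isDiskWithBoundary
    rw [(h.mesh hT).boundary_eq] at hd
    convert hd using 1
    ext p
    simp only [mem_iUnion, mem_image]
    constructor
    · rintro ⟨j, s, hs, rfl⟩
      obtain ⟨k, hk, s', hs', -, e⟩ := hbd j s hs
      exact ⟨k, hk, s', hs', e.symm⟩
    · rintro ⟨k, hk, s, hs, rfl⟩
      obtain ⟨j, u, hu, rfl⟩ := exists_sideIdx (N := N) hk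
      have hpos := h.pos_nonneg (sideIdx_mem hu)
      have hend := h.pos_add_gap_le (sideIdx_mem hu)
      rw [pos_sideIdx hu] at hpos hend
      rw [side_sideIdx hu] at hend
      rw [h.mesh_dl] at hs
      refine ⟨j, bp l κ N j u + s, ⟨add_nonneg hpos hs.1, by linarith [hs.2]⟩, ?_⟩
      rw [h1 j u hu _ ⟨by linarith [hs.1], by rw [bp_succ hu]; linarith [hs.2]⟩,
        add_sub_cancel_left]
  · rw [← hT.dist_eq j s hs t ht]
    exact hle j s hs j t ht
  · have hg := (h.gap_pos (sideIdx N j (N j + N (j + 1)))).le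
    have hg' := (h.gap_pos (sideIdx N (j + 1) 0)).le
    have e := (h.mesh hT).rimPoint_dl (sideIdx_mem (N := N) (j := j) (le_refl (N j + N (j + 1))))
    rw [mesh_N, succ_sideIdx le_rfl, sideIdx_last, h.mesh_dl] at e
    have hb := bp_succ (l := l) (κ := κ) (N := N) (j := j) (le_refl (N j + N (j + 1)))
    have hb' := bp_succ (l := l) (κ := κ) (N := N) (j := j + 1) (Nat.zero_le _)
    have e1 := h1 j _ le_rfl (l j) ⟨by rw [← bp_last (l := l) (κ := κ) (N := N)]; linarith,
      bp_last.ge⟩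
    rw [← bp_last (l := l) (κ := κ) (N := N) (j := j), hb, add_sub_cancel_left, e] at e1
    rw [← bp_last (l := l) (κ := κ) (N := N) (j := j), hb, e1,
      h1 (j + 1) 0 (Nat.zero_le _) 0 ⟨bp_zero.le, by rw [hb', bp_zero]; linarith⟩, bp_zero,
      sub_self, sideIdx_zero]
  · intro j k hjk s hs t ht heq
    have := hle j s (Ioo_subset_Icc_self hs) k t (Ioo_subset_Icc_self ht)
    rw [heq, dist_self] at this
    exact hT.disjoint j k hjk s hs t ht (dist_le_zero.1 this)

end IsSubdivision

/-! ### Choice of the subdivision and final estimates -/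

theorem exists_isSubdivision {l : Fin 3 → ℝ} {κ : ℝ} (hκ : 0 < κ) (hl : ∀ i, 10 * κ ≤ l i)
    (h0 : ∀ i, 0 ≤ gromov l i) :
    ∃ N : Fin 3 → ℕ, IsSubdivision l κ N ∧ ∀ i, N i = 1 ∨ N i * κ ≤ gromov l i := by
  -- Except when the maximum forces `N i = 1`, the last step ends between `κ` and `2 * κ` short of
  -- the Gromov product. The two shortfalls on an edge add up to a positive gap of at most `4 * κ`;
  -- the forced single steps fit because edges are at least `10 * κ` long.
  let N : Fin 3 → ℕ := fun i => max 1 (⌈gromov l i / κ⌉₊ - 2)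
  have h1 : ∀ i, gromov l i ≤ N i * κ + 2 * κ ∧
      ((N i = 1 ∧ gromov l i ≤ 3 * κ) ∨ N i * κ < gromov l i - κ) := by
    intro i
    have c1 : gromov l i / κ ≤ ⌈gromov l i / κ⌉₊ := Nat.le_ceil _
    rw [div_le_iff₀ hκ] at c1
    rcases le_or_gt ⌈gromov l i / κ⌉₊ 3 with h | h
    · have hN : N i = 1 := by simp only [N]; omega
      have h' : (⌈gromov l i / κ⌉₊ : ℝ) ≤ 3 := by exact_mod_cast h
      have h3 : gromov l i ≤ 3 * κ := c1.trans (by gcongr)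
      refine ⟨?_, Or.inl ⟨hN, h3⟩⟩
      rw [hN]; push_cast; linarith
    · have hN : N i + 2 = ⌈gromov l i / κ⌉₊ := by simp only [N]; omega
      rw [← hN] at c1
      have hpos : 0 ≤ gromov l i / κ := by
        by_contra hc
        rw [Nat.ceil_eq_zero.2 (not_le.1 hc).le] at h
        omega
      have c2 := Nat.ceil_lt_add_one hpos
      rw [← hN, ← sub_lt_iff_lt_add, lt_div_iff₀ hκ] at c2
      push_cast at c1 c2
      exact ⟨by linarith, Or.inr (by linarith)⟩
  refine ⟨N, ⟨hκ, fun i => le_max_left _ _, fun i => ?_, fun i => ?_⟩, fun i => ?_⟩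
  · have hi := hl i
    have g1 := h0 i
    have g2 := h0 (i + 1)
    have hg := gromov_add l i
    obtain ⟨-, ⟨a, b⟩ | a⟩ := h1 i <;> obtain ⟨-, ⟨c, d⟩ | c⟩ := h1 (i + 1)
    · linarith
    · rw [a]; push_cast; nlinarith
    · rw [c]; push_cast; nlinarith
    · linarith
  · have hg := gromov_add l i
    linarith [(h1 i).1, (h1 (i + 1)).1]
  · rcases (h1 i).2 with ⟨a, -⟩ | a
    · exact Or.inl a
    · exact Or.inr (by linarith)

namespace IsSubdivision

variable {l : Fin 3 → ℝ} {κ : ℝ} {N : Fin 3 → ℕ}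
  {T : Type*} [MetricSpace T] {γ : Fin 3 → ℝ → T}

theorem width_zero (hT : TriangleParam T l γ) (i : Fin 3) : width l κ γ i 0 = 0 := by
  simp [width, hT.glue' i]

theorem width_nonneg (i : Fin 3) (t : ℕ) : 0 ≤ width l κ γ i t := dist_nonneg

theorem mul_le (h : IsSubdivision l κ N) (i : Fin 3) : N i * κ ≤ l i ∧ N i * κ ≤ l (i + 2) := by
  have hκ := h.κ_pos
  have h1 := h.lt i
  have h2 := h.lt_prev i
  have h3 : (0 : ℝ) ≤ N (i + 1) * κ := by positivity
  have h4 : (0 : ℝ) ≤ N (i + 2) * κ := by positivity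
  constructor <;> linarith

theorem width_succ_le (h : IsSubdivision l κ N) (hT : TriangleParam T l γ) (i : Fin 3) {t : ℕ}
    (ht : t < N i) : width l κ γ i (t + 1) ≤ width l κ γ i t + 2 * κ := by
  have hκ := h.κ_pos
  obtain ⟨h1, h2⟩ := h.mul_le i
  have h0 : (0 : ℝ) ≤ t * κ := by positivity
  have h3 : (t + 1 : ℝ) * κ ≤ N i * κ := by
    have : (t : ℝ) + 1 ≤ N i := by exact_mod_cast ht
    gcongr
  have d1 : dist (γ i (t * κ)) (γ i ((t + 1 : ℕ) * κ)) = κ := by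
    push_cast
    rw [hT.dist_eq i _ ⟨h0, by linarith⟩ _ ⟨by linarith, by linarith⟩, abs_sub_comm,
      abs_of_nonneg (by linarith)]
    ring
  have d2 : dist (γ (i + 2) (l (i + 2) - t * κ)) (γ (i + 2) (l (i + 2) - (t + 1 : ℕ) * κ)) = κ := by
    push_cast
    rw [hT.dist_eq (i + 2) _ ⟨by linarith, by linarith⟩ _ ⟨by linarith, by linarith⟩,
      abs_of_nonneg (by linarith)]
    ring
  have := dist_triangle4_left (γ i (t * κ)) (γ (i + 2) (l (i + 2) - t * κ))
    (γ i ((t + 1 : ℕ) * κ)) (γ (i + 2) (l (i + 2) - (t + 1 : ℕ) * κ))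
  unfold width
  linarith

/-- A discrete version of integrating the derivative of `w²`: as `w` grows by at most `2 * κ` per
step, `w²` grows by at most `4 * κ * w + 4 * κ²`. So the cone over the hexagon is paid for by the
ladders. -/
theorem sq_width_le (h : IsSubdivision l κ N) (hT : TriangleParam T l γ) (i : Fin 3) :
    width l κ γ i (N i) ^ 2 ≤
      4 * (κ * ∑ t ∈ Finset.range (N i), width l κ γ i t) + 4 * (κ * (N i * κ)) := by
  have hκ := h.κ_pos
  have key : ∀ n ≤ N i, width l κ γ i n ^ 2 ≤
      4 * (κ * ∑ t ∈ Finset.range n, width l κ γ i t) + 4 * (κ * (n * κ)) := by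
    intro n
    induction n with
    | zero => intro _; simp [width_zero hT]
    | succ n ih =>
      intro hn
      have h1 := ih (by omega)
      have h2 := h.width_succ_le hT i (t := n) (by omega)
      have h3 : 0 ≤ width l κ γ i (n + 1) := width_nonneg _ _
      rw [Finset.sum_range_succ]
      push_cast
      nlinarith [pow_le_pow_left₀ h3 h2 2]
  exact key _ le_rfl

/-- The rectangles below the graph of widths are summed; the factor `4` combines their halved
heights with `π / 4 ≥ 1 / 2`. If `N i = 1`, the only term is the width at the corner, which is zero.
-/
theorem sum_width_le (h : IsSubdivision l κ N) (hT : TriangleParam T l γ) (i : Fin 3)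
    (hN : N i = 1 ∨ N i * κ ≤ gromov l i) (hfin : hausdorffTwo T ≠ ⊤) :
    κ * ∑ t ∈ Finset.range (N i), width l κ γ i t ≤
      4 * (hausdorffTwo T).toReal + 2 * (κ * (N i * κ)) := by
  have hκ := h.κ_pos
  rcases hN with hN | hN
  · rw [hN]
    simp only [Finset.range_one, Finset.sum_singleton, width_zero hT, mul_zero]
    positivity
  let : MeasurableSpace T := borel T
  have : BorelSpace T := ⟨rfl⟩
  have h1 := hT.sum_corner_le i hκ (N i) hN
  have hpi : (1 : ℝ) / 2 ≤ Real.pi / 4 := by linarith [Real.pi_gt_three]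
  have h2 : ENNReal.ofReal (1 / 2) * Measure.hausdorffMeasure 2 (univ : Set T) ≤ hausdorffTwo T :=
    mul_le_mul_left (ENNReal.ofReal_le_ofReal hpi) _
  have h3 : ENNReal.ofReal (1 / 2 * ∑ t ∈ Finset.range (N i), κ * (width l κ γ i t / 2 - κ)) ≤
      hausdorffTwo T := by
    rw [ENNReal.ofReal_mul (by norm_num)]
    refine le_trans (mul_le_mul_right (le_trans ?_ h1) _) h2
    exact Finset.le_sum_of_subadditive _ ENNReal.ofReal_zero.le (fun _ _ => ENNReal.ofReal_add_le) _ _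
  have h4 := (ENNReal.ofReal_le_iff_le_toReal hfin).1 h3
  have h5 : ∑ t ∈ Finset.range (N i), κ * (width l κ γ i t / 2 - κ) =
      κ * (∑ t ∈ Finset.range (N i), width l κ γ i t) / 2 - κ * (N i * κ) := by
    rw [← Finset.mul_sum, Finset.sum_sub_distrib, ← Finset.sum_div]
    simp
    ring
  rw [h5] at h4
  linarith

theorem sum_mul_le (h : IsSubdivision l κ N) : ∑ i, N i * κ ≤ ∑ i, l i :=
  Finset.sum_le_sum fun i _ => (h.mul_le i).1

/-- The area of the surface is bounded by the area of the disk, if the mesh is fine. -/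
theorem hausdorffTwo_le (h : IsSubdivision l κ N) (hT : TriangleParam T l γ)
    (hl : ∀ i, κ ≤ l i) (hN : ∀ i, N i = 1 ∨ N i * κ ≤ gromov l i) (hfin : hausdorffTwo T ≠ ⊤)
    (hκA : κ * ∑ i, l i ≤ (hausdorffTwo T).toReal) :
    hausdorffTwo (h.mesh hT).Surf ≤ ENNReal.ofReal (10 ^ 7) * hausdorffTwo T := by
  have hκ := h.κ_pos
  set A := (hausdorffTwo T).toReal with hA
  have hA0 : 0 ≤ A := ENNReal.toReal_nonneg
  refine (h.mesh hT).hausdorffTwo_le.trans ?_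
  rw [← ENNReal.ofReal_toReal hfin, ← hA, ← ENNReal.ofReal_mul (by norm_num)]
  apply ENNReal.ofReal_le_ofReal
  simp only [mesh_N, mesh_κ, mesh_m, mesh_R, dist_eq_width hT]
  have hs := fun i => h.sum_width_le hT i (hN i) hfin
  have hq := fun i => h.sq_width_le hT i
  have hn := h.sum_mul_le
  -- The error terms, multiples of `κ ^ 2` and of `κ` times the total number of steps times `κ`, are
  -- each bounded by the area through the smallness condition on `κ`.
  have hκκ : κ * κ ≤ A := by
    refine le_trans ?_ hκA
    rw [Fin.sum_univ_three]
    have := hT.pos 1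
    have := hT.pos 2
    have := hl 0
    gcongr
    linarith
  have hκN : κ * ∑ i, N i * κ ≤ A := (mul_le_mul_of_nonneg_left hn hκ.le).trans hκA
  have hsum : ∀ i, ∑ t ∈ Finset.range (N i), 103 * κ * (103 * κ + 3 * width l κ γ i t) =
      10609 * (κ * (N i * κ)) + 309 * (κ * ∑ t ∈ Finset.range (N i), width l κ γ i t) := by
    intro i
    rw [← Finset.mul_sum, Finset.sum_add_distrib, Finset.sum_const, Finset.card_range,
      nsmul_eq_mul, ← Finset.mul_sum]
    ring
  simp only [hsum]
  have s0 := hs 0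
  have s1 := hs 1
  have s2 := hs 2
  have q0 := hq 0
  have q1 := hq 1
  have q2 := hq 2
  have w0 : 0 ≤ width l κ γ 0 (N 0) := width_nonneg _ _
  have w1 : 0 ≤ width l κ γ 1 (N 1) := width_nonneg _ _
  have w2 : 0 ≤ width l κ γ 2 (N 2) := width_nonneg _ _
  rw [Fin.sum_univ_three] at hκN
  rw [Fin.sum_univ_three, Fin.sum_univ_three, Fin.sum_univ_three]
  generalize (∑ t ∈ Finset.range (N 0), width l κ γ 0 t) = S0 at *
  generalize (∑ t ∈ Finset.range (N 1), width l κ γ 1 t) = S1 at *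
  generalize (∑ t ∈ Finset.range (N 2), width l κ γ 2 t) = S2 at *
  generalize width l κ γ 0 (N 0) = g0 at *
  generalize width l κ γ 1 (N 1) = g1 at *
  generalize width l κ γ 2 (N 2) = g2 at *
  -- Here `100 + 72 = 172`. Then `(a + b)² ≤ 2 a² + 2 b²`, and the Cauchy–Schwarz inequality for
  -- three terms gives `2 * 36 * 3 = 216`.
  have hsq : (100 * κ + 3 * (2 * (g0 + g1 + g2 + 12 * κ))) ^ 2 ≤
      60000 * (κ * κ) + 216 * (g0 ^ 2 + g1 ^ 2 + g2 ^ 2) := by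
    nlinarith [sq_nonneg (172 * κ - 6 * (g0 + g1 + g2)), sq_nonneg (g0 - g1),
      sq_nonneg (g0 - g2), sq_nonneg (g1 - g2), mul_pos hκ hκ]
  have hκsq : κ ^ 2 * (2 * (N 0 : ℝ) + 1 + (2 * (N 1 : ℝ) + 1) + (2 * (N 2 : ℝ) + 1)) =
      2 * (κ * (N 0 * κ + N 1 * κ + N 2 * κ)) + 3 * (κ * κ) := by ring
  rw [mul_assoc 24000]
  push_cast
  rw [hκsq]
  linarith

/-- The diameter of the surface is bounded by the diameter of the disk. -/
theorem diam_le (h : IsSubdivision l κ N) (hT : TriangleParam T l γ) (hl : ∀ i, κ ≤ l i) :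
    Metric.diam (univ : Set (h.mesh hT).Surf) ≤ 1000 * Metric.diam (univ : Set T) := by
  have hb : Bornology.IsBounded (univ : Set T) := by
    obtain ⟨e, -⟩ := hT.disk
    have : CompactSpace T := e.symm.compactSpace
    exact isCompact_univ.isBounded
  have hd : ∀ x y : T, dist x y ≤ Metric.diam (univ : Set T) := fun x y =>
    Metric.dist_le_diam_of_mem hb (mem_univ x) (mem_univ y)
  have hld : ∀ i, l i ≤ Metric.diam (univ : Set T) := fun i => by
    rw [← hT.dist_corner i]
    exact hd _ _
  refine (h.mesh hT).diam_le ((hl 0).trans (hld 0)) (fun i => ?_) (fun a b => hd _ _) ?_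
  · rw [mul_comm]
    exact (h.mul_le i).1.trans (hld i)
  · have h1 : ∀ i, width l κ γ i (N i) ≤ Metric.diam (univ : Set T) := fun i => hd _ _
    rw [mesh_R, Fin.sum_univ_three]
    linarith [h1 0, h1 1, h1 2, hl 0, hld 0]

end IsSubdivision

/-! ### The theorem -/

theorem theorem4p2 :
    ∃ L : ℝ, 0 < L ∧
      ∀ (T : Type*) [MetricSpace T] (α : Fin 3 → Set T), IsTriangularDisk T α →
        ∃ (S : Type) (_ : MetricSpace S) (β : Fin 3 → Set S) (φ : S ≃ₜ T),
          IsPolyhedralSurface S ∧ IsTriangularDisk S β ∧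
          Metric.diam (Set.univ : Set S) ≤ L * Metric.diam (Set.univ : Set T) ∧
          hausdorffTwo S ≤ ENNReal.ofReal L * hausdorffTwo T ∧
          (∀ j, φ '' β j = α j ∧ ∀ x ∈ β j, ∀ y ∈ β j, dist (φ x) (φ y) = dist x y) ∧
          (∀ γ : C(unitInterval, S), (∀ t, γ t ∈ ⋃ j, β j) →
            pathLength ((φ : C(S, T)).comp γ) = pathLength γ) ∧
          (∀ x ∈ ⋃ j, β j, ∀ y ∈ ⋃ j, β j, dist (φ x) (φ y) ≤ dist x y) := by
  -- The constant is dictated by the area estimate; the diameter estimate needs only `1000`.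
  refine ⟨10 ^ 7, by norm_num, fun T _ α hα => ?_⟩
  obtain ⟨l, γ, hT, hαγ⟩ := hα.exists_param
  have hlpos : 0 < ∑ i, l i := Finset.sum_pos (fun i _ => hT.pos i) Finset.univ_nonempty
  -- A step `κ ≤ a` makes `κ` times the perimeter at most the area. Positivity of the measure of `T`
  -- is essential here; for infinite measure any `a` will do.
  obtain ⟨a, ha0, ha⟩ : ∃ a : ℝ, 0 < a ∧
      (hausdorffTwo T ≠ ⊤ → a * ∑ i, l i ≤ (hausdorffTwo T).toReal) := by
    by_cases hfin : hausdorffTwo T = ⊤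
    · exact ⟨1, one_pos, fun h => absurd hfin h⟩
    · exact ⟨(hausdorffTwo T).toReal / ∑ i, l i,
        div_pos (ENNReal.toReal_pos hT.hausdorffTwo_pos.ne' hfin) hlpos,
        fun _ => (div_mul_cancel₀ _ hlpos.ne').le⟩
  obtain ⟨κ, hκ, hκa, hκl⟩ : ∃ κ : ℝ, 0 < κ ∧ κ ≤ a ∧ ∀ i, 10 * κ ≤ l i := by
    refine ⟨min a (min (l 0) (min (l 1) (l 2)) / 10), ?_, min_le_left _ _, fun i => ?_⟩
    · have := hT.pos 0
      have := hT.pos 1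
      have := hT.pos 2
      positivity
    · have h1 : min a (min (l 0) (min (l 1) (l 2)) / 10) ≤ _ := min_le_right _ _
      have h2 : min (l 0) (min (l 1) (l 2)) ≤ l i := by fin_cases i <;> simp
      linarith
  have hκl' : ∀ i, κ ≤ l i := fun i => by linarith [hκl i]
  obtain ⟨N, hN, hNr⟩ := exists_isSubdivision hκ hκl hT.gromov_nonneg
  obtain ⟨β, hS, hle⟩ := hN.exists_triangleParam hT
  obtain ⟨φ, hφ⟩ := hS.exists_homeomorph hT
  have hiso : ∀ j, ∀ x ∈ β j '' Icc 0 (l j), ∀ y ∈ β j '' Icc 0 (l j),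
      dist (φ x) (φ y) = dist x y := by
    rintro j _ ⟨s, hs, rfl⟩ _ ⟨t, ht, rfl⟩
    rw [hφ j s hs, hφ j t ht, hT.dist_eq j s hs t ht, hS.dist_eq j s hs t ht]
  refine ⟨(hN.mesh hT).Surf, inferInstance, fun j => β j '' Icc 0 (l j), φ,
    ⟨(hN.mesh hT).complex.isPolyhedralSpace, inferInstance, ?_⟩, hS.isTriangularDisk, ?_, ?_,
    fun j => ⟨?_, hiso j⟩, ?_, ?_⟩
  · obtain ⟨e, -⟩ := hS.disk
    exact nonempty_chartedSpace_of_homeomorph e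
  · refine (hN.diam_le hT hκl').trans ?_
    have : 0 ≤ Metric.diam (univ : Set T) := Metric.diam_nonneg
    linarith
  · by_cases hfin : hausdorffTwo T = ⊤
    · rw [hfin, ENNReal.mul_top (by simp)]
      exact le_top
    · exact hN.hausdorffTwo_le hT hκl' hNr hfin ((by gcongr : κ * ∑ i, l i ≤ a * ∑ i, l i).trans
        (ha hfin))
  · rw [image_image, hαγ j]
    exact image_congr fun s hs => hφ j s hs
  · intro c hc
    exact pathLength_comp_eq (fun j => β j '' Icc 0 (l j))
      (fun j => (isCompact_Icc.image_of_continuousOn (hS.continuousOn j)).isClosed) _ hiso c hc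
  · intro x hx y hy
    obtain ⟨j, s, hs, rfl⟩ := mem_iUnion.1 hx
    obtain ⟨k, t, ht, rfl⟩ := mem_iUnion.1 hy
    rw [hφ j s hs, hφ k t ht]
    exact hle j s hs k t ht

end
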